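/- **Conventions.** Throughout $\mathbb N=\{1,2,\dots\}$, $r$ denotes a prime, $p$ denotes a prime, $P(n)$ is the largest prime divisor of $n$ (with $P(1)=1$), $\mu$ is the Möbius function and $\lambda$ the Liouville function. Let $\mathbb E_\chi=\frac1{r-1}\sum_\chi$ be the average over all Dirichlet characters $\chi$ mod $r$, and for $r>2$ let $\mathbb E_{\chi\ne\chi_0}=\frac1{r-2}\sum_{\chi\ne\chi_0}$. Let $\mathbb E_f$ be the average over Steinhaus random completely multiplicative functions $f$ (the values $f(p)$ are independent and uniform on the unit circle). Put $f^\ast(n)=f(n)\mathbf 1_{\gcd(n,r)=1}$ and let $L^\ast(s,f)=\sum_{n\ge1}f^\ast(n)n^{-s}$ formally, so that $1/L^\ast(s,f)=\sum_{n\ge1}\mu(n)f^\ast(n)n^{-s}$. For $\Re(s_1),\Re(s_2)>\frac12$ define $$\mathbb E_f\frac{f^\ast(m_1)\overline{f^\ast}(m_2)}{L^\ast(s_1,f)L^\ast(s_2,\overline f)}:=\sum_{n_1,n_2\ge1}\frac{\mu(n_1)\mu(n_2)\,\mathbb E_f\big[f^\ast(m_1)\overline{f^\ast}(m_2)f^\ast(n_1)\overline{f^\ast}(n_2)\big]}{n_1^{s_1}n_2^{s_2}}.$$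 **Hypotheses.** Assume the following two statements. 1. (GRH) For every prime $r$ and every Dirichlet character $\chi$ mod $r$, including the principal one, all zeros of $L(s,\chi)$ with $0<\Re(s)<1$ satisfy $\Re(s)=\frac12$. 2. (Twisted Ratios Conjecture) There is an absolute constant $\omega'\in(0,\frac12]$ such that for all sufficiently small $\varepsilon,\hbar>0$, uniformly over primes $r>2$, integers $1\le m_1,m_2\le r^{\hbar}$, and $s_1,s_2\in\mathbb C$ with $\Re(s_1)=\Re(s_2)=\frac12+\varepsilon$, where $T=\max(|\Im s_1|,|\Im s_2|)$, $$\mathbb E_{\chi\ne\chi_0}\frac{\chi(m_1)\overline\chi(m_2)}{L(s_1,\chi)L(s_2,\overline\chi)}=\mathbb E_f\frac{f^\ast(m_1)\overline{f^\ast}(m_2)}{L^\ast(s_1,f)L^\ast(s_2,\overline f)}+O_\varepsilon\big((1+T)^\varepsilon r^{-\omega'}\big).$$ **Proposition 2.8.** Under these hypotheses there is a constant $K>0$ such that for every $A>0$ there is $\varepsilon_0=\varepsilon_0(A)>0$ such that the following holds for all $0<\varepsilon\le\varepsilon_0$. Let $r$ be a prime, let $x,P,\delta>0$ be real, and let $N,Y\in\mathbb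 N$, with $x,P,N,\delta^{-1}\ge K$ and $x\le r^A$. Let $1\le Q\le e^{(\log x)^{1/3}}$ and $c\in\{\mu,\lambda\}$. Assume $$\max(P,\delta^{-1},N)^{400(Y/\delta)^2\log(N\log P)}\le r^\varepsilon,\qquad 20Y\log(N\log P)\le(\log x)^{1/2}.$$ Let $g,g_{N+1}\colon\mathbb R\to\mathbb R$ be functions, with $g$ smooth, and put $g_j(y)=g(y-j)$ for integers $|j|\le N$. Suppose that - (i) $\sum_{|j|\le N}g_j(y)+g_{N+1}(y)=1$ for all $y\in\mathbb R$; - (ii) $g\ge0$ everywhere, and $g(y)\le\delta$ whenever $|y|>1$; - (iii) $g_{N+1}\ge0$ everywhere, and $g_{N+1}(y)\le\delta$ whenever $|y|\le N$; - (iv) $|g^{(\ell)}(y)|\le\frac1{\pi(\ell+1)}\big(\frac{2\pi}\delta\big)^{\ell+1}$ for all $\ell\in\mathbb N$ and $y\in\mathbb R$. Let $j(1),\dots,j(Y)\in\{-N,\dots,N+1\}$. For $1\le i\le Y$ and each prime $p$, let $a_i(p),a_i(p^2)\in\mathbb C$ have absolute value at most $1$. For completely multiplicative $f$ put $$G_{f,\boldsymbol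 j}(\boldsymbol a)=\prod_{1\le i\le Y}g_{j(i)}\Big(\Re\sum_{p\le P}\Big(\frac{a_i(p)f(p)}{p^{1/2}}+\frac{a_i(p^2)f(p^2)}{p}\Big)\Big).$$ Then $$\mathbb E_\chi\,G_{\chi,\boldsymbol j}(\boldsymbol a)\Big|\sum_{n\le x}c(n)\chi(n)\Big|^2=\mathbb E_f\,G_{f,\boldsymbol j}(\boldsymbol a)\Big|\sum_{\substack{n\le x\\P(n)>Q}}c(n)f(n)\Big|^2+O\Big(\frac{x}{(N\log P)^{10Y}}\Big),$$ where the implied constant depends only on $A$. -/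

import Mathlib

open MeasureTheory
open scoped ContDiff

noncomputable section

namespace TwistedRatios

/-! ### Dirichlet characters -/

/-- The Generalized Riemann Hypothesis for the family of all Dirichlet characters mod `r`
(the principal one included): every zero of `L(s, χ)` in the open critical strip lies on the
critical line. -/
def GRH (r : ℕ) [NeZero r] : Prop :=
  ∀ χ : DirichletCharacter ℂ r, ∀ s : ℂ, 0 < s.re → s.re < 1 →
    DirichletCharacter.LFunction χ s = 0 → s.re = 1 / 2

/-- The average `(1 / (r - 1)) ∑_χ F χ` over all Dirichlet characters modulo a prime `r`. -/
def charAvg (r : ℕ) [NeZero r] (F : DirichletCharacter ℂ r → ℝ) : ℝ :=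
  (∑ χ : DirichletCharacter ℂ r, F χ) / ((r : ℝ) - 1)

open Classical in
/-- The average `(1 / (r - 2)) ∑_{χ ≠ χ₀} F χ` over the nonprincipal Dirichlet characters modulo
an odd prime `r`. -/
def nonprincipalAvg (r : ℕ) [NeZero r] (F : DirichletCharacter ℂ r → ℂ) : ℂ :=
  (∑ χ ∈ (Finset.univ : Finset (DirichletCharacter ℂ r)).erase 1, F χ) / ((r : ℂ) - 2)

/-! ### Steinhaus random multiplicative functions -/

/-- The law of a family of independent uniform angles (points of `ℝ/ℤ`) indexed by the primes. -/
def steinhausMeasure : Measure (Nat.Primes → UnitAddCircle) :=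
  Measure.infinitePi fun _ => AddCircle.haarAddCircle

/-- The completely multiplicative function `f` with `f(p) = exp(2πi θ_p)` at every prime `p`.
(The value at `0` plays no role.) -/
def steinhaus (θ : Nat.Primes → UnitAddCircle) (n : ℕ) : ℂ :=
  n.factorization.prod fun p k =>
    if hp : p.Prime then (AddCircle.toCircle (θ ⟨p, hp⟩) : ℂ) ^ k else 1

/-- `f*(n) = f(n) 1_{gcd(n, r) = 1}`. -/
def coprimePart (r : ℕ) (f : ℕ → ℂ) (n : ℕ) : ℂ :=
  if n.Coprime r then f n else 0

/-- The Steinhaus average `𝔼_f [f*(m₁) conj(f*(m₂)) / (L*(s₁, f) L*(s₂, conj f))]`: since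
`1 / L*(s, f) = ∑_n μ(n) f*(n) n^{-s}`, expand formally as a Dirichlet series in `n₁, n₂ ≥ 1`
and average every coefficient over `f`. (The terms with `n₁ n₂ = 0` vanish, as `μ(0) = 0`.) -/
def steinhausTwist (r m₁ m₂ : ℕ) (s₁ s₂ : ℂ) : ℂ :=
  ∑' n : ℕ × ℕ,
    (∫ θ, coprimePart r (steinhaus θ) m₁ * star (coprimePart r (steinhaus θ) m₂) *
        ((ArithmeticFunction.moebius n.1 : ℂ) * coprimePart r (steinhaus θ) n.1) *
        star ((ArithmeticFunction.moebius n.2 : ℂ) * coprimePart r (steinhaus θ) n.2)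
      ∂steinhausMeasure) / ((n.1 : ℂ) ^ s₁ * (n.2 : ℂ) ^ s₂)

/-! ### The twisted Ratios Conjecture -/

/-- The twisted Ratios Conjecture: there is an absolute `ω' ∈ (0, 1/2]` such that, for all
sufficiently small `ε, ℏ > 0`, uniformly over odd primes `r`, integers `1 ≤ m₁, m₂ ≤ r^ℏ` and
`s₁, s₂` with real part `1/2 + ε`, with `T = max(|Im s₁|, |Im s₂|)`,
`𝔼_{χ ≠ χ₀} χ(m₁) conj(χ(m₂)) / (L(s₁, χ) L(s₂, conj χ))
  = 𝔼_f f*(m₁) conj(f*(m₂)) / (L*(s₁, f) L*(s₂, conj f)) + O_ε((1 + T)^ε r^{-ω'})`. -/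
def TwistedRatiosConjecture : Prop :=
  ∃ ω' : ℝ, 0 < ω' ∧ ω' ≤ 1 / 2 ∧
  ∃ ε₀ : ℝ, 0 < ε₀ ∧ ∃ h₀ : ℝ, 0 < h₀ ∧
  ∀ ε : ℝ, 0 < ε → ε ≤ ε₀ →
  ∃ C : ℝ, ∀ h : ℝ, 0 < h → h ≤ h₀ →
  ∀ (r : ℕ) [Fact r.Prime], r ≠ 2 →
  ∀ m₁ m₂ : ℕ, 1 ≤ m₁ → (m₁ : ℝ) ≤ (r : ℝ) ^ h → 1 ≤ m₂ → (m₂ : ℝ) ≤ (r : ℝ) ^ h →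
  ∀ s₁ s₂ : ℂ, s₁.re = 1 / 2 + ε → s₂.re = 1 / 2 + ε →
    ‖nonprincipalAvg r (fun χ => χ m₁ * star (χ m₂) /
          (DirichletCharacter.LFunction χ s₁ * DirichletCharacter.LFunction (star χ) s₂))
        - steinhausTwist r m₁ m₂ s₁ s₂‖
      ≤ C * (1 + max |s₁.im| |s₂.im|) ^ ε * (r : ℝ) ^ (-ω')

/-! ### The smooth partition of unity and the weight `G` -/

/-- The functions `g_j = g(· - j)`, `|j| ≤ N`, together with `g_{N+1} = gTail`, form a smooth
partition of unity of precision `δ`. -/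
structure IsPartition (N : ℕ) (δ : ℝ) (g gTail : ℝ → ℝ) : Prop where
  smooth : ContDiff ℝ ∞ g
  sum_eq_one : ∀ x : ℝ, ∑ j ∈ Finset.Icc (-(N : ℤ)) N, g (x - j) + gTail x = 1
  nonneg : ∀ x : ℝ, 0 ≤ g x
  le_of_one_lt : ∀ x : ℝ, 1 < |x| → g x ≤ δ
  tail_nonneg : ∀ x : ℝ, 0 ≤ gTail x
  tail_le : ∀ x : ℝ, |x| ≤ N → gTail x ≤ δ
  deriv_bound : ∀ l : ℕ, 1 ≤ l → ∀ x : ℝ,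
    |iteratedDeriv l g x| ≤ 1 / (Real.pi * (l + 1)) * (2 * Real.pi / δ) ^ (l + 1)

/-- The function `g_j` for an index `j ∈ [-N, N + 1]`. -/
def partFn (N : ℕ) (g gTail : ℝ → ℝ) (j : ℤ) (x : ℝ) : ℝ :=
  if j = N + 1 then gTail x else g (x - j)

/-- `Re ∑_{p ≤ P} (b(p) f(p) / p^{1/2} + b(p²) f(p²) / p)`, the sum being over primes. -/
def primeSum (P : ℝ) (b f : ℕ → ℂ) : ℝ :=
  (∑ p ∈ (Finset.Icc 1 ⌊P⌋₊).filter Nat.Prime,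
    (b p * f p / (√(p : ℝ) : ℂ) + b (p ^ 2) * f (p ^ 2) / (p : ℂ))).re

/-- `G_{f, j}(a) = ∏_i g_{j(i)} (Re ∑_{p ≤ P} (a_i(p) f(p) / p^{1/2} + a_i(p²) f(p²) / p))`. -/
def weightG (N : ℕ) (g gTail : ℝ → ℝ) (P : ℝ) {Y : ℕ} (j : Fin Y → ℤ) (a : Fin Y → ℕ → ℂ)
    (f : ℕ → ℂ) : ℝ :=
  ∏ i : Fin Y, partFn N g gTail (j i) (primeSum P (a i) f)

/-! ### The partial sums -/

/-- The largest prime divisor of `n`, and `0` if there is none. -/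
def maxPrimeDivisor (n : ℕ) : ℕ := n.primeFactors.sup id

/-- `∑_{n ≤ x} c(n) f(n)`. -/
def partialSum (c : ℕ → ℤ) (f : ℕ → ℂ) (x : ℝ) : ℂ :=
  ∑ n ∈ Finset.Icc 1 ⌊x⌋₊, (c n : ℂ) * f n

/-- `∑_{n ≤ x, P(n) > Q} c(n) f(n)`, where `P(n)` is the largest prime divisor of `n`. -/
def roughPartialSum (c : ℕ → ℤ) (f : ℕ → ℂ) (x Q : ℝ) : ℂ :=
  ∑ n ∈ (Finset.Icc 1 ⌊x⌋₊).filter (fun n => Q < (maxPrimeDivisor n : ℝ)), (c n : ℂ) * f n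

end TwistedRatios

end

/-!
Averages over the Dirichlet characters mod `r` are compared with Steinhaus averages in three stages.

*Twisted second moments.* Under GRH, the Littlewood argument (`exists_littlewood_bound`: Borel–
Carathéodory for `log L`, then Hadamard's three circles) bounds `1 / L(s, χ)` and `L(s, χ)` by any
power of `r (1 + |t|)` to the right of the critical line. With a smoothed form of Perron's formula
(`sum_eq_perron`, whose kernel is of order `|s|⁻²`) the Ratios Conjecture may be integrated over both
variables on `Re s = 1/2 + ε`, which evaluates the average of `χ(m₁) conj(χ(m₂)) |∑ c(n) χ(n)|²`
for `c = μ`. Since `λ(n) = ∑_{d² m = n} μ(m)`, the case `c = λ` follows for the part `d ≤ D` by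
absorbing `d₁², d₂²` into the twists. The cut-off is chosen piecewise linear, with the tail weighted
by `min(1, d/D)`. The tail has generating function `B(2s, χ²) / L(s, χ)`, where `B(s, ψ)` is the
series `∑ ψ(d) min(1, d/D) d^{-s}`: it is small when `ψ ≠ 1`, and there are at most two characters
with `χ² = 1`. The outcome is `exists_twisted_second_moment_bound`, with
a saving of a power of `r`.

*From the weight to trigonometric polynomials.* Each factor of `G` is a smooth function of a prime
sum `S`, and is replaced by its Taylor polynomial at the origin, of degree `L` about
`4·10⁵ Y δ⁻² log (N log P)`. The resulting product is a combination of `f(m₁) conj(f(m₂))` with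
`P`-smooth `m₁, m₂`, and the growth hypothesis makes the `mᵢ` and the sum of the absolute values of
the coefficients at most a small power of `r`, so the twisted second moments apply. The Taylor
remainder is dominated by another trigonometric polynomial `D` (`exists_trigPoly_approx`), so its
average over characters is transferred to the Steinhaus model in the same way, and only needs to be
bounded there. By Hoeffding's lemma `S` is subgaussian with variance proxy `O(log (N log P))`, so
`𝔼 D²` is smaller than any fixed power of `(N log P)^{-Y}`. To combine this with the partial sum,
`IsTrigPoly.integral_mul_norm_sq_le` uses that integers with different `P`-rough parts are
orthogonal even against a weight depending on smooth numbers only, and that the fourth moments of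
the sums over a fixed rough part lose no more than a power of `log P`.

*Smooth numbers.* The Steinhaus model still contains the condition `gcd(n, r) = 1` and lacks
`P(n) > Q`. By orthogonality the change costs the number of `n ≤ x` that are divisible by `r` or
`Q`-smooth, and Rankin's trick (`card_smooth_le_exp`) gives `x exp(-(log x)^{1/2})` for the latter;
`20 Y log (N log P) ≤ (log x)^{1/2}` makes this `O(x (N log P)^{-20Y})`, which leaves
`x (N log P)^{-10Y}` after the Cauchy–Schwarz inequality.
-/


open MeasureTheory
open scoped ContDiff

noncomputable section

namespace TwistedRatios

/-! ### Littlewood's bound for zero-free analytic functions -/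

/-- A zero-free analytic function on a disc has an analytic logarithm there, normalised to vanish
at the centre. -/
lemma exists_log_on_ball {h : ℂ → ℂ} {z₀ : ℂ} {R : ℝ} (hR : 0 < R)
    (hd : DifferentiableOn ℂ h (Metric.ball z₀ R)) (hne : ∀ z ∈ Metric.ball z₀ R, h z ≠ 0) :
    ∃ H : ℂ → ℂ, DifferentiableOn ℂ H (Metric.ball z₀ R) ∧ H z₀ = 0 ∧
      ∀ z ∈ Metric.ball z₀ R, h z = h z₀ * Complex.exp (H z) := by
  have h1 : DifferentiableOn ℂ (fun z => deriv h z / h z) (Metric.ball z₀ R) :=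
    (hd.deriv Metric.isOpen_ball).div hd hne
  obtain ⟨H, hH0, hH⟩ := Complex.IsExactOn.with_val_at h1.isExactOn_ball z₀ 0
  refine ⟨H, fun z hz => (hH z hz).differentiableAt.differentiableWithinAt, hH0, ?_⟩
  have hz0 : z₀ ∈ Metric.ball z₀ R := Metric.mem_ball_self hR
  have key : ∀ z ∈ Metric.ball z₀ R,
      HasDerivAt (fun z => h z * Complex.exp (-H z)) 0 z := by
    intro z hz
    have hh : HasDerivAt h (deriv h z) z :=
      (hd.differentiableAt (Metric.isOpen_ball.mem_nhds hz)).hasDerivAt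
    have := hh.mul ((hH z hz).neg.cexp)
    refine this.congr_deriv ?_
    have := hne z hz
    field_simp
    ring
  intro z hz
  have hconst := (convex_ball z₀ R).is_const_of_fderivWithin_eq_zero (𝕜 := ℂ)
    (f := fun z => h z * Complex.exp (-H z))
    (fun z hz => (key z hz).differentiableAt.differentiableWithinAt)
    (fun w hw => by
      rw [fderivWithin_of_isOpen Metric.isOpen_ball hw]
      have := (key w hw).hasFDerivAt.fderiv
      rw [this]; ext; simp) hz0 hz
  simp only [hH0, neg_zero, Complex.exp_zero, mul_one] at hconst
  rw [hconst, mul_assoc, ← Complex.exp_add]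
  simp

/-- Sublinear powers: `y ^ τ ≤ c y + O(1)` when `τ < 1`. -/
lemma exists_rpow_le_linear {τ c : ℝ} (hτ0 : 0 ≤ τ) (hτ : τ < 1) (hc : 0 < c) :
    ∃ C : ℝ, 0 ≤ C ∧ ∀ y : ℝ, 0 ≤ y → y ^ τ ≤ c * y + C := by
  refine ⟨(c⁻¹ ^ (1 / (1 - τ))) ^ τ, by positivity, fun y hy => ?_⟩
  rcases le_total y (c⁻¹ ^ (1 / (1 - τ))) with h | h
  · have := Real.rpow_le_rpow hy h hτ0
    nlinarith [mul_nonneg hc.le hy]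
  · have hy0 : 0 < y := lt_of_lt_of_le (by positivity) h
    have h1 : c⁻¹ ≤ y ^ (1 - τ) := by
      have := Real.rpow_le_rpow (by positivity) h (by linarith : 0 ≤ 1 - τ)
      rwa [← Real.rpow_mul (by positivity), one_div_mul_cancel (by linarith), Real.rpow_one] at this
    have h2 : y = y ^ τ * y ^ (1 - τ) := by
      rw [← Real.rpow_add hy0]; simp
    have h3 : y ^ τ * c⁻¹ ≤ y := by
      conv_rhs => rw [h2]
      gcongr
    have h4 : y ^ τ ≤ c * y := by
      calc y ^ τ = c * (y ^ τ * c⁻¹) := by field_simp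
        _ ≤ c * y := by gcongr
    have : 0 ≤ (c⁻¹ ^ (1 / (1 - τ))) ^ τ := by positivity
    linarith

/-- Hadamard's three circles theorem, in the form of a bound at a single point. -/
lemma three_circles {H : ℂ → ℂ} {z₀ s : ℂ} {R r₁ r₃ a b : ℝ} (hr₁ : 0 < r₁) (hr₁₃ : r₁ < r₃)
    (hr₃ : r₃ < R) (hd : DifferentiableOn ℂ H (Metric.ball z₀ R))
    (ha : ∀ z, ‖z - z₀‖ ≤ r₁ → ‖H z‖ ≤ a) (hb : ∀ z, ‖z - z₀‖ ≤ r₃ → ‖H z‖ ≤ b)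
    (hs₁ : r₁ ≤ ‖s - z₀‖) (hs₃ : ‖s - z₀‖ ≤ r₃) :
    ‖H s‖ ≤ a ^ (1 - (Real.log ‖s - z₀‖ - Real.log r₁) / (Real.log r₃ - Real.log r₁)) *
      b ^ ((Real.log ‖s - z₀‖ - Real.log r₁) / (Real.log r₃ - Real.log r₁)) := by
  have hr₃0 : 0 < r₃ := hr₁.trans hr₁₃
  have hlog : Real.log r₁ < Real.log r₃ := Real.log_lt_log hr₁ hr₁₃
  have hpos : 0 < ‖s - z₀‖ := hr₁.trans_le hs₁
  have hne : s - z₀ ≠ 0 := norm_pos_iff.1 hpos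
  have hnorm : ∀ w : ℂ, w.re ≤ Real.log r₃ → ‖Complex.exp w‖ ≤ r₃ := by
    intro w hw
    rw [Complex.norm_exp, ← Real.exp_log hr₃0]
    exact Real.exp_le_exp.2 (by simpa using hw)
  have hclos : closure (Complex.HadamardThreeLines.verticalStrip (Real.log r₁) (Real.log r₃)) ⊆
      Complex.HadamardThreeLines.verticalClosedStrip (Real.log r₁) (Real.log r₃) :=
    closure_minimal (fun z hz => ⟨le_of_lt hz.1, le_of_lt hz.2⟩)
      (isClosed_Icc.preimage Complex.continuous_re)
  have hdiff : DifferentiableOn ℂ (fun w => H (z₀ + Complex.exp w))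
      (closure (Complex.HadamardThreeLines.verticalStrip (Real.log r₁) (Real.log r₃))) := by
    refine hd.comp (by fun_prop) (fun w hw => ?_)
    have := hnorm w (hclos hw).2
    simp only [Metric.mem_ball, dist_eq_norm, add_sub_cancel_left]
    linarith
  have := Complex.HadamardThreeLines.norm_le_interp_of_mem_verticalClosedStrip'
    (f := fun w => H (z₀ + Complex.exp w)) (z := Complex.log (s - z₀)) (a := a) (b := b) hlog
    (by
      constructor
      · rw [Complex.log_re]; exact Real.log_le_log hr₁ hs₁
      · rw [Complex.log_re]; exact Real.log_le_log hpos hs₃)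
    hdiff.diffContOnCl
    ⟨b, by
      rintro _ ⟨w, hw, rfl⟩
      exact hb _ (by simpa using hnorm w hw.2)⟩
    (fun w hw => ha _ (by
      have hw' : w.re = Real.log r₁ := hw
      simp [Complex.norm_exp, hw', Real.exp_log hr₁]))
    (fun w hw => hb _ (by
      have hw' : w.re = Real.log r₃ := hw
      simpa using hnorm w hw'.le))
  simpa [Complex.exp_log hne, Complex.log_re] using this

/-- Littlewood's argument: an analytic function without zeros in `Re s > 1/2`, of polynomial growth
there and bounded above and below for `Re s ≥ 5/4`, is bounded, together with its inverse, by an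
arbitrarily small power of `Q (1 + |Im s|)` in `Re s ≥ 1/2 + η`. Borel–Carathéodory bounds the
logarithm by `O(log (Q (1 + |Im s|)))`, and three circles improve this to a power of that quantity
with exponent less than one. -/
theorem exists_littlewood_bound_aux {B C₀ η : ℝ} (hB : 0 < B) (hC₀ : 1 ≤ C₀) (hη : 0 < η)
    (hη' : η ≤ 1 / 4) :
    ∃ C : ℝ, 0 < C ∧ ∀ (Q : ℝ) (h : ℂ → ℂ), 1 ≤ Q →
      DifferentiableOn ℂ h {s | 1 / 2 < s.re} →
      (∀ s : ℂ, 1 / 2 < s.re → h s ≠ 0) →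
      (∀ s : ℂ, 1 / 2 < s.re → ‖h s‖ ≤ (Q * (2 + ‖s‖)) ^ B) →
      (∀ s : ℂ, 5 / 4 ≤ s.re → C₀⁻¹ ≤ ‖h s‖ ∧ ‖h s‖ ≤ C₀) →
      ∀ s : ℂ, 1 / 2 + η ≤ s.re →
        ‖h s‖ ≤ C * (Q * (1 + |s.im|)) ^ η ∧ ‖h s‖⁻¹ ≤ C * (Q * (1 + |s.im|)) ^ η := by
  set r₃ : ℝ := 3 / 2 - η / 2 with hr₃
  set D : ℝ := Real.log r₃ - Real.log (1 / 2) with hD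
  have hDpos : 0 < D := sub_pos.2 (Real.log_lt_log (by norm_num) (by rw [hr₃]; linarith))
  set τ : ℝ := (Real.log (3 / 2 - η) - Real.log (1 / 2)) / D with hτ
  have hτ1 : τ < 1 := by
    rw [hτ, div_lt_one hDpos, hD]
    have := Real.log_lt_log (by linarith : (0:ℝ) < 3 / 2 - η) (by rw [hr₃]; linarith : _ < r₃)
    linarith
  have hτ0 : 0 ≤ τ := by
    rw [hτ]
    have := Real.log_lt_log (by norm_num) (by linarith : (1:ℝ) / 2 < 3 / 2 - η)
    exact div_nonneg (by linarith) hDpos.le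
  have hlogC : 0 ≤ Real.log C₀ := Real.log_nonneg hC₀
  set M₁ : ℝ := 2 * Real.log C₀ + 1 with hM₁
  -- the slope is chosen so that the final exponent is `η`
  obtain ⟨C₁, hC₁, hlin⟩ := exists_rpow_le_linear hτ0 hτ1
    (c := η / (4 * M₁ * (6 * B / η))) (by positivity)
  set E : ℝ := η / B * (B * Real.log 6 + Real.log C₀ + 1) + 4 * M₁ * C₁ with hE
  have hlog6 : 0 ≤ Real.log 6 := Real.log_nonneg (by norm_num)
  have hE0 : 0 ≤ E := by positivity
  refine ⟨C₀ * Real.exp E, by positivity, fun Q h hQ hd hne hgr hbd s hs => ?_⟩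
  have hbase : 1 ≤ Q * (1 + |s.im|) := by nlinarith [abs_nonneg s.im]
  have hpow1 : 1 ≤ (Q * (1 + |s.im|)) ^ η := Real.one_le_rpow hbase hη.le
  have hexpE : 1 ≤ Real.exp E := Real.one_le_exp hE0
  rcases le_total (5 / 4) s.re with h54 | h54
  · obtain ⟨h1, h2⟩ := hbd s h54
    have h3 : C₀ ≤ C₀ * Real.exp E * (Q * (1 + |s.im|)) ^ η := by
      rw [mul_assoc]
      exact le_mul_of_one_le_right (by linarith) (one_le_mul_of_one_le_of_one_le hexpE hpow1)
    exact ⟨h2.trans h3, (inv_le_of_inv_le₀ (by linarith) h1).trans h3⟩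
  set z₀ : ℂ := ⟨2, s.im⟩ with hz₀
  have hre : ∀ z : ℂ, ∀ R : ℝ, ‖z - z₀‖ ≤ R → 2 - R ≤ z.re := by
    intro z R hz
    have := (Complex.abs_re_le_norm (z - z₀)).trans hz
    have := (abs_le.1 this).1
    simp only [Complex.sub_re, hz₀] at this
    linarith
  have hball : ∀ z ∈ Metric.ball z₀ (3 / 2), 1 / 2 < z.re := by
    intro z hz
    rw [Metric.mem_ball, dist_eq_norm] at hz
    have := hre z _ le_rfl
    linarith
  obtain ⟨H, hHd, hH0, hH⟩ := exists_log_on_ball (z₀ := z₀) (R := 3 / 2) (by norm_num)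
    (hd.mono hball) (fun z hz => hne z (hball z hz))
  obtain ⟨hz1, hz2⟩ := hbd z₀ (by norm_num [hz₀])
  have hhz0 : 0 < ‖h z₀‖ := lt_of_lt_of_le (by positivity) hz1
  have hlz : -Real.log C₀ ≤ Real.log ‖h z₀‖ := by
    rw [← Real.log_inv]; exact Real.log_le_log (by positivity) hz1
  have hlz' : Real.log ‖h z₀‖ ≤ Real.log C₀ := Real.log_le_log hhz0 hz2
  have hReH : ∀ z ∈ Metric.ball z₀ (3 / 2), (H z).re = Real.log ‖h z‖ - Real.log ‖h z₀‖ := by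
    intro z hz
    rw [hH z hz, norm_mul, Real.log_mul hhz0.ne' (by simp), Complex.norm_exp, Real.log_exp]
    ring
  set l : ℝ := Real.log (Q * (1 + |s.im|)) with hl
  have hl0 : 0 ≤ l := Real.log_nonneg hbase
  set M : ℝ := B * (l + Real.log 6) + Real.log C₀ + 1 with hM
  have hMpos : 0 < M := by positivity
  have hbc : ∀ z, ‖z - z₀‖ ≤ r₃ → ‖H z‖ ≤ 6 * M / η := by
    intro z hz
    have hzR : z - z₀ ∈ Metric.ball (0:ℂ) (3 / 2) := by
      rw [mem_ball_zero_iff]; linarith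
    have := Complex.borelCaratheodory_zero (f := fun w => H (z₀ + w)) (M := M) (R := 3 / 2) hMpos
      (hHd.comp (by fun_prop) (fun w hw => by simpa using hw))
      (fun w hw => by
        have hw' : z₀ + w ∈ Metric.ball z₀ (3 / 2) := by simpa using hw
        simp only [Set.mem_ofPred_eq]
        rw [hReH _ hw']
        have h1 := hgr _ (hball _ hw')
        have h2 : ‖z₀ + w‖ ≤ 4 + |s.im| := by
          have h3 : ‖z₀‖ ≤ 2 + |s.im| := by
            simpa [hz₀] using Complex.norm_le_abs_re_add_abs_im z₀
          have h4 : ‖w‖ < 3 / 2 := by simpa using hw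
          linarith [norm_add_le z₀ w]
        have h5 : Real.log ‖h (z₀ + w)‖ ≤ B * (l + Real.log 6) := by
          calc Real.log ‖h (z₀ + w)‖ ≤ Real.log ((Q * (2 + ‖z₀ + w‖)) ^ B) :=
                Real.log_le_log (norm_pos_iff.2 (hne _ (hball _ hw'))) h1
            _ = B * Real.log (Q * (2 + ‖z₀ + w‖)) := Real.log_rpow (by positivity) _
            _ ≤ B * Real.log (Q * (1 + |s.im|) * 6) := by
                have : Q * (2 + ‖z₀ + w‖) ≤ Q * (6 + 6 * |s.im|) :=
                  mul_le_mul_of_nonneg_left (by linarith [abs_nonneg s.im]) (by linarith)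
                refine mul_le_mul_of_nonneg_left (Real.log_le_log (by positivity) ?_) hB.le
                linarith
            _ = B * (l + Real.log 6) := by
                rw [Real.log_mul (by positivity) (by norm_num)]
        linarith) (by norm_num) hzR (by simp [hH0])
    simp only [add_sub_cancel] at this
    refine this.trans ?_
    have hz' : η / 2 ≤ 3 / 2 - ‖z - z₀‖ := by linarith
    calc 2 * M * ‖z - z₀‖ / (3 / 2 - ‖z - z₀‖) ≤ 2 * M * (3 / 2) / (η / 2) := by
          gcongr; linarith
      _ = 6 * M / η := by field_simp; ring
  have hbc1 : ∀ z, ‖z - z₀‖ ≤ 1 / 2 → ‖H z‖ ≤ 4 * M₁ := by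
    intro z hz
    have hzR : z - z₀ ∈ Metric.ball (0:ℂ) (3 / 4) := by
      rw [mem_ball_zero_iff]; linarith
    have := Complex.borelCaratheodory_zero (f := fun w => H (z₀ + w)) (M := M₁) (R := 3 / 4)
      (by positivity)
      (hHd.comp (by fun_prop) (fun w hw => by
        rw [mem_ball_zero_iff] at hw
        simp; linarith))
      (fun w hw => by
        rw [mem_ball_zero_iff] at hw
        have hw' : z₀ + w ∈ Metric.ball z₀ (3 / 2) := by simp; linarith
        simp only [Set.mem_ofPred_eq]
        rw [hReH _ hw']
        have h1 := hbd (z₀ + w) (by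
          have := hre (z₀ + w) (3 / 4) (by simpa using hw.le)
          linarith)
        have := Real.log_le_log (norm_pos_iff.2 (hne _ (hball _ hw'))) h1.2
        linarith) (by norm_num) hzR (by simp [hH0])
    simp only [add_sub_cancel] at this
    refine this.trans ?_
    have hz' : 1 / 4 ≤ 3 / 4 - ‖z - z₀‖ := by linarith
    calc 2 * M₁ * ‖z - z₀‖ / (3 / 4 - ‖z - z₀‖) ≤ 2 * M₁ * (1 / 2) / (1 / 4) := by
          gcongr
      _ = 4 * M₁ := by ring
  have hsz : ‖s - z₀‖ = 2 - s.re := by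
    have : s - z₀ = ((s.re - 2 : ℝ) : ℂ) := by
      apply Complex.ext <;> simp [hz₀]
    rw [this, Complex.norm_real, Real.norm_eq_abs, abs_of_nonpos (by linarith)]; ring
  have h3c := three_circles (H := H) (s := s) (r₁ := 1 / 2) (r₃ := r₃) (by norm_num)
    (by linarith) (by linarith : r₃ < 3 / 2) hHd hbc1 hbc (by rw [hsz]; linarith)
    (by rw [hsz]; linarith)
  have hM1' : 1 ≤ 4 * M₁ := by rw [hM₁]; linarith
  have hM' : 1 ≤ 6 * M / η := by
    rw [le_div_iff₀ hη, hM]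
    have : 0 ≤ B * (l + Real.log 6) := by positivity
    linarith
  set τ' : ℝ := (Real.log ‖s - z₀‖ - Real.log (1 / 2)) / (Real.log r₃ - Real.log (1 / 2)) with hτ'
  have hτ'τ : τ' ≤ τ := by
    rw [hτ', hτ, hsz, ← hD]
    refine div_le_div_of_nonneg_right ?_ hDpos.le
    have := Real.log_le_log (by linarith : 0 < 2 - s.re) (by linarith : 2 - s.re ≤ 3 / 2 - η)
    linarith
  have hτ'0 : 0 ≤ τ' := by
    rw [hτ', hsz, ← hD]
    have := Real.log_le_log (by norm_num) (by linarith : (1:ℝ) / 2 ≤ 2 - s.re)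
    exact div_nonneg (by linarith) hDpos.le
  have hHs : ‖H s‖ ≤ η * l + E := by
    calc ‖H s‖ ≤ (4 * M₁) ^ (1 - τ') * (6 * M / η) ^ τ' := h3c
      _ ≤ (4 * M₁) ^ (1 : ℝ) * (6 * M / η) ^ τ := by
          have h1 := Real.rpow_le_rpow_of_exponent_le hM1' (by linarith : 1 - τ' ≤ 1)
          have h2 := Real.rpow_le_rpow_of_exponent_le hM' hτ'τ
          gcongr
      _ ≤ 4 * M₁ * (η / (4 * M₁ * (6 * B / η)) * (6 * M / η) + C₁) := by
          rw [Real.rpow_one]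
          have := hlin (6 * M / η) (by positivity)
          gcongr
      _ = η * l + E := by
          have : (0:ℝ) < M₁ := by linarith
          rw [hE, hM]
          field_simp
          ring
  have hsb : s ∈ Metric.ball z₀ (3 / 2) := by
    rw [Metric.mem_ball, dist_eq_norm, hsz]; linarith
  have hexp : Real.exp (η * l + E) = Real.exp E * (Q * (1 + |s.im|)) ^ η := by
    rw [Real.exp_add, mul_comm, Real.rpow_def_of_pos (by positivity), ← hl, mul_comm l]
  constructor
  · rw [hH s hsb, norm_mul, Complex.norm_exp, mul_assoc, ← hexp]
    gcongr
    exact (Complex.re_le_norm _).trans hHs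
  · rw [hH s hsb, norm_mul, Complex.norm_exp, mul_assoc, ← hexp, mul_inv, ← Real.exp_neg]
    have : ‖h z₀‖⁻¹ ≤ C₀ := inv_le_of_inv_le₀ (by linarith) hz1
    gcongr
    exact (neg_le_abs _).trans ((Complex.abs_re_le_norm _).trans hHs)

theorem exists_littlewood_bound {B C₀ η : ℝ} (hB : 0 < B) (hC₀ : 1 ≤ C₀) (hη : 0 < η) :
    ∃ C : ℝ, 0 < C ∧ ∀ (Q : ℝ) (h : ℂ → ℂ), 1 ≤ Q →
      DifferentiableOn ℂ h {s | 1 / 2 < s.re} →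
      (∀ s : ℂ, 1 / 2 < s.re → h s ≠ 0) →
      (∀ s : ℂ, 1 / 2 < s.re → ‖h s‖ ≤ (Q * (2 + ‖s‖)) ^ B) →
      (∀ s : ℂ, 5 / 4 ≤ s.re → C₀⁻¹ ≤ ‖h s‖ ∧ ‖h s‖ ≤ C₀) →
      ∀ s : ℂ, 1 / 2 + η ≤ s.re →
        ‖h s‖ ≤ C * (Q * (1 + |s.im|)) ^ η ∧ ‖h s‖⁻¹ ≤ C * (Q * (1 + |s.im|)) ^ η := by
  obtain ⟨C, hC, H⟩ := exists_littlewood_bound_aux (η := min η (1 / 4)) hB hC₀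
    (by positivity) (min_le_right _ _)
  refine ⟨C, hC, fun Q h hQ hd hne hgr hbd s hs => ?_⟩
  have hbase : 1 ≤ Q * (1 + |s.im|) := by nlinarith [abs_nonneg s.im]
  have hpow : (Q * (1 + |s.im|)) ^ min η (1 / 4) ≤ (Q * (1 + |s.im|)) ^ η :=
    Real.rpow_le_rpow_of_exponent_le hbase (min_le_left _ _)
  obtain ⟨h1, h2⟩ := H Q h hQ hd hne hgr hbd s (by linarith [min_le_left η (1 / 4)])
  exact ⟨h1.trans (by gcongr), h2.trans (by gcongr)⟩

/-! ### Growth of Dirichlet `L`-functions -/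

/-- Analytic continuation by partial summation: if the partial sums of `a` are `c N + O(B)`, then
its Dirichlet series is `c s / (s - 1) + J s` with `J` analytic and of linear growth in
`Re s > 0`. -/
lemma exists_abel_continuation {a : ℕ → ℂ} {c : ℂ} {B : ℝ} (ha : ∀ n, ‖a n‖ ≤ 1)
    (hB : ∀ N : ℕ, ‖∑ n ∈ Finset.Icc 1 N, a n - c * N‖ ≤ B) :
    ∃ J : ℂ → ℂ, DifferentiableOn ℂ J {s | 0 < s.re} ∧
      (∀ s : ℂ, 0 < s.re → ‖J s‖ ≤ ‖s‖ * ((B + ‖c‖) / s.re)) ∧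
      ∀ s : ℂ, 1 < s.re → LSeries a s = c * s / (s - 1) + J s := by
  set E : ℝ → ℂ := fun t => ∑ n ∈ Finset.Icc 1 ⌊t⌋₊, a n - c * t with hE
  have hEm : Measurable E := by
    have h1 : Measurable (fun N : ℕ => ∑ n ∈ Finset.Icc 1 N, a n) := measurable_from_nat
    have h2 := h1.comp (Nat.measurable_floor (R := ℝ))
    exact h2.sub (by fun_prop)
  have hEb : ∀ t : ℝ, 0 ≤ t → ‖E t‖ ≤ B + ‖c‖ := by
    intro t ht
    have h1 : E t = (∑ n ∈ Finset.Icc 1 ⌊t⌋₊, a n - c * (⌊t⌋₊ : ℂ)) - c * ((t - ⌊t⌋₊ : ℝ) : ℂ) := by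
      rw [hE]; push_cast; ring
    rw [h1]
    refine (norm_sub_le _ _).trans (add_le_add (hB _) ?_)
    rw [norm_mul, Complex.norm_real, Real.norm_eq_abs]
    refine mul_le_of_le_one_right (norm_nonneg _) (abs_le.2 ⟨?_, ?_⟩)
    · linarith [Nat.floor_le ht]
    · linarith [Nat.lt_floor_add_one t]
  have hB0 : 0 ≤ B + ‖c‖ := (norm_nonneg _).trans (hEb 0 le_rfl)
  set f : ℝ → ℂ := (Set.Ioi (1:ℝ)).indicator E with hf
  have hfm : Measurable f := hEm.indicator measurableSet_Ioi
  have hfb : ∀ t, ‖f t‖ ≤ B + ‖c‖ := by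
    intro t
    rw [hf, Set.indicator_apply]
    split_ifs with h
    · exact hEb t (by have : (1:ℝ) < t := h; linarith)
    · simpa using hB0
  have hloc : LocallyIntegrableOn f (Set.Ioi 0) := by
    refine LocallyIntegrable.locallyIntegrableOn ?_ _
    exact (locallyIntegrable_const (B + ‖c‖)).mono hfm.aestronglyMeasurable
      (Filter.Eventually.of_forall fun t => (hfb t).trans (le_abs_self _))
  have hmel : ∀ s : ℂ, mellin f (-s) = ∫ t in Set.Ioi (1:ℝ), E t * (t : ℂ) ^ (-(s + 1)) := by
    intro s
    have h1 : ∀ t : ℝ, (t : ℂ) ^ (-s - 1) • f t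
        = (Set.Ioi (1:ℝ)).indicator (fun t : ℝ => E t * (t : ℂ) ^ (-(s + 1))) t := by
      intro t
      rw [hf, Set.indicator_apply, Set.indicator_apply]
      split_ifs
      · rw [smul_eq_mul, mul_comm, show -s - 1 = -(s + 1) by ring]
      · simp
    rw [mellin]
    simp_rw [h1]
    rw [setIntegral_indicator measurableSet_Ioi,
      Set.inter_eq_right.2 (Set.Ioi_subset_Ioi zero_le_one)]
  have hint : ∀ s : ℂ, 0 < s.re →
      IntegrableOn (fun t : ℝ => E t * (t : ℂ) ^ (-(s + 1))) (Set.Ioi 1) := by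
    intro s hs
    have h1 : IntegrableOn (fun t : ℝ => (B + ‖c‖) * t ^ (-(s.re + 1))) (Set.Ioi 1) :=
      (integrableOn_Ioi_rpow_of_lt (by linarith) one_pos).const_mul _
    refine h1.mono' ?_ ?_
    · exact (hEm.mul (by fun_prop)).aestronglyMeasurable
    · refine (ae_restrict_iff' measurableSet_Ioi).2 (Filter.Eventually.of_forall fun t ht => ?_)
      have ht' : (0:ℝ) < t := lt_trans one_pos ht
      rw [norm_mul, Complex.norm_cpow_eq_rpow_re_of_pos ht']
      simp only [Complex.neg_re, Complex.add_re, Complex.one_re]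
      gcongr
      exact hEb t ht'.le
  refine ⟨fun s => s * mellin f (-s), ?_, ?_, ?_⟩
  · intro s hs
    have hs' : 0 < s.re := hs
    have h1 : DifferentiableAt ℂ (mellin f) (-s) := by
      refine mellin_differentiableAt_of_isBigO_rpow (a := 0) (b := (-s).re - 1) hloc ?_
        (by simpa using hs') ?_ (by linarith)
      · simp only [neg_zero, Real.rpow_zero]
        exact Asymptotics.IsBigO.of_bound (B + ‖c‖)
          (Filter.Eventually.of_forall fun t => by simpa using hfb t)
      · have : f =ᶠ[nhdsWithin 0 (Set.Ioi 0)] fun _ => 0 := by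
          have h2 : Set.Iio (1:ℝ) ∈ nhdsWithin (0:ℝ) (Set.Ioi 0) :=
            mem_nhdsWithin_of_mem_nhds (Iio_mem_nhds one_pos)
          filter_upwards [h2] with t ht
          rw [hf, Set.indicator_of_notMem]
          exact not_lt.2 (le_of_lt (Set.mem_Iio.1 ht))
        exact this.trans_isBigO (Asymptotics.isBigO_zero _ _)
    have h2 : DifferentiableAt ℂ (fun s => mellin f (-s)) s :=
      DifferentiableAt.comp (g := mellin f) s h1 (by fun_prop)
    exact (differentiableAt_id.mul h2).differentiableWithinAt
  · intro s hs
    rw [norm_mul]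
    refine mul_le_mul_of_nonneg_left ?_ (norm_nonneg _)
    rw [hmel]
    have h1 : IntegrableOn (fun t : ℝ => (B + ‖c‖) * t ^ (-(s.re + 1))) (Set.Ioi 1) :=
      (integrableOn_Ioi_rpow_of_lt (by linarith) one_pos).const_mul _
    refine (norm_integral_le_of_norm_le h1 ?_).trans ?_
    · refine (ae_restrict_iff' measurableSet_Ioi).2 (Filter.Eventually.of_forall fun t ht => ?_)
      have ht' : (0:ℝ) < t := lt_trans one_pos ht
      rw [norm_mul, Complex.norm_cpow_eq_rpow_re_of_pos ht']
      simp only [Complex.neg_re, Complex.add_re, Complex.one_re]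
      gcongr
      exact hEb t ht'.le
    · rw [integral_const_mul, integral_Ioi_rpow_of_lt (by linarith) one_pos]
      simp only [Real.one_rpow]
      rw [show -(s.re + 1) + 1 = -s.re by ring, neg_div_neg_eq, mul_one_div]
  · intro s hs
    have hO : (fun n ↦ ∑ k ∈ Finset.Icc 1 n, ‖a k‖) =O[Filter.atTop] fun n ↦ (n : ℝ) ^ (1:ℝ) := by
      refine Asymptotics.IsBigO.of_bound 1 (Filter.Eventually.of_forall fun n => ?_)
      rw [Real.norm_of_nonneg (Finset.sum_nonneg fun _ _ => norm_nonneg _)]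
      refine (Finset.sum_le_sum fun k _ => ha k).trans ?_
      simp
    rw [LSeries_eq_mul_integral' a zero_le_one (by simpa using hs) hO]
    have h0 : s ≠ 0 := by rintro rfl; simp at hs; linarith
    have h01 : s - 1 ≠ 0 := by
      intro h; rw [sub_eq_zero] at h; simp [h] at hs
    have h1 : ∀ t ∈ Set.Ioi (1:ℝ), (∑ k ∈ Finset.Icc 1 ⌊t⌋₊, a k) * (t:ℂ) ^ (-(s + 1))
        = E t * (t:ℂ) ^ (-(s + 1)) + c * (t:ℂ) ^ (-s) := by
      intro t ht
      have ht' : (t:ℂ) ≠ 0 := by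
        have : (1:ℝ) < t := ht
        exact_mod_cast (by linarith : t ≠ 0)
      have h2 : (t:ℂ) ^ (-s) = t * (t:ℂ) ^ (-(s + 1)) := by
        rw [show -s = 1 + (-(s+1)) by ring, Complex.cpow_add _ _ ht', Complex.cpow_one]
      rw [h2, hE]; ring
    rw [setIntegral_congr_fun measurableSet_Ioi h1, integral_add (hint s (by linarith))
      ((integrableOn_Ioi_cpow_of_lt (by simpa using hs) one_pos).const_mul _),
      integral_const_mul, integral_Ioi_cpow_of_lt (by simpa using hs) one_pos, ← hmel]
    simp only [Complex.ofReal_one, Complex.one_cpow]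
    have h3 : -s + 1 ≠ 0 := by
      intro h; apply h01; linear_combination -h
    field_simp
    ring

/-- The partial sums of a Dirichlet character grow linearly, with slope its mean value, up to an
error bounded by twice the modulus. -/
lemma norm_sum_character_sub_le {r : ℕ} [NeZero r] (χ : DirichletCharacter ℂ r) (N : ℕ) :
    ‖∑ n ∈ Finset.Icc 1 N, χ (n : ZMod r) - ((∑ a : ZMod r, χ a) / r) * N‖ ≤ 2 * r := by
  have hr : (0:ℝ) < r := by exact_mod_cast NeZero.pos r
  have hrc : (r:ℂ) ≠ 0 := by exact_mod_cast NeZero.ne r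
  set f : ℕ → ℂ := fun n => χ (n : ZMod r) with hf
  have hfr : ∀ n, f (n + r) = f n := by intro n; simp [hf]
  have hbase : ∑ n ∈ Finset.Icc 1 r, f n = ∑ a : ZMod r, χ a := by
    have h1 : ∑ n ∈ Finset.range r, f n = ∑ a : ZMod r, χ a := by
      refine Finset.sum_nbij' (fun n => (n : ZMod r)) ZMod.val (by simp)
        (fun a _ => Finset.mem_range.2 (ZMod.val_lt a)) ?_ (by simp) (by simp [hf])
      intro n hn
      exact ZMod.val_cast_of_lt (Finset.mem_range.1 hn)
    rw [← h1]
    have h2 := Finset.sum_range_succ f r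
    have h3 := Finset.sum_range_succ' f r
    have h4 : ∑ n ∈ Finset.Icc 1 r, f n = ∑ k ∈ Finset.range r, f (k + 1) := by
      rw [Finset.range_eq_Ico, Finset.sum_Ico_add' f 0 r 1]
      rfl
    have h5 : f r = f 0 := by simpa using hfr 0
    rw [h4]
    rw [h2, h5] at h3
    exact (add_right_cancel h3).symm
  have hshift : ∀ N, ∑ n ∈ Finset.Icc 1 (N + r), f n
      = ∑ n ∈ Finset.Icc 1 N, f n + ∑ a : ZMod r, χ a := by
    intro N
    induction N with
    | zero => simpa using hbase
    | succ N ih =>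
      rw [Finset.sum_Icc_succ_top (by omega), show N + 1 + r = N + r + 1 by ring,
        Finset.sum_Icc_succ_top (by omega), ih, show N + r + 1 = N + 1 + r by ring, hfr]
      ring
  have hA : ‖∑ a : ZMod r, χ a‖ ≤ r := by
    refine (norm_sum_le _ _).trans ((Finset.sum_le_sum fun a _ => χ.norm_le_one a).trans ?_)
    simp [ZMod.card]
  induction N using Nat.strong_induction_on with
  | _ N ih =>
    rcases lt_or_ge N r with h | h
    · have hN : (N:ℝ) ≤ r := by exact_mod_cast h.le
      have h1 : ‖∑ n ∈ Finset.Icc 1 N, f n‖ ≤ N := by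
        refine (norm_sum_le _ _).trans ((Finset.sum_le_sum fun a _ => χ.norm_le_one _).trans ?_)
        simp
      have h2 : ‖(∑ a : ZMod r, χ a) / r * N‖ ≤ r := by
        rw [norm_mul, norm_div, Complex.norm_natCast, Complex.norm_natCast]
        have : ‖∑ a : ZMod r, χ a‖ / r ≤ 1 := (div_le_one hr).2 hA
        nlinarith [(Nat.cast_nonneg N : (0:ℝ) ≤ N)]
      linarith [norm_sub_le (∑ n ∈ Finset.Icc 1 N, f n) ((∑ a : ZMod r, χ a) / r * N)]
    · obtain ⟨M, rfl⟩ := Nat.exists_eq_add_of_le' h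
      have := ih M (by have := NeZero.pos r; omega)
      rw [hshift]
      convert this using 2
      push_cast
      field_simp
      ring

/-- The `L`-function of `χ`, with the pole of the principal character cancelled by the factor
`(s - 1) / (s + 1)`. -/
def regL {r : ℕ} [NeZero r] (χ : DirichletCharacter ℂ r) (s : ℂ) : ℂ :=
  open Classical in
  if χ = 1 then DirichletCharacter.LFunctionTrivChar₁ r s / (s + 1)
  else DirichletCharacter.LFunction χ s

/-- The analytic continuation of `1 / L(s, χ)`, with value `0` at the pole of the principal
`L`-function. -/
def recipL {r : ℕ} [NeZero r] (χ : DirichletCharacter ℂ r) (s : ℂ) : ℂ :=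
  open Classical in
  if χ = 1 then (s - 1) / DirichletCharacter.LFunctionTrivChar₁ r s
  else (DirichletCharacter.LFunction χ s)⁻¹

lemma norm_regL_le {r : ℕ} [NeZero r] (χ : DirichletCharacter ℂ r) {s : ℂ} (hs : 1 / 2 < s.re) :
    ‖regL χ s‖ ≤ ((r : ℝ) * (2 + ‖s‖)) ^ (5 : ℝ) := by
  have hr : (1:ℝ) ≤ r := by exact_mod_cast NeZero.pos r
  set c : ℂ := (∑ a : ZMod r, χ a) / r with hc
  have hc1 : ‖c‖ ≤ 1 := by
    rw [hc, norm_div, Complex.norm_natCast, div_le_one (by linarith)]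
    refine (norm_sum_le _ _).trans ((Finset.sum_le_sum fun a _ => χ.norm_le_one a).trans ?_)
    simp [ZMod.card]
  obtain ⟨J, hJd, hJb, hJ⟩ := exists_abel_continuation (a := fun n => χ (n : ZMod r)) (c := c)
    (B := 2 * r) (fun n => χ.norm_le_one _) (norm_sum_character_sub_le χ)
  have hopen : IsOpen {s : ℂ | 0 < s.re} := isOpen_lt continuous_const Complex.continuous_re
  have hconn : IsPreconnected {s : ℂ | 0 < s.re} := (convex_halfSpace_re_gt 0).isPreconnected
  have h2 : (2:ℂ) ∈ {s : ℂ | 0 < s.re} := by simp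
  have hev : ∀ᶠ z : ℂ in nhds 2, 1 < z.re :=
    (isOpen_lt continuous_const Complex.continuous_re).mem_nhds (by simp)
  have hsig : (2 * r + ‖c‖) / s.re ≤ 6 * r := by
    rw [div_le_iff₀ (by linarith)]; nlinarith
  have hJs : ‖J s‖ ≤ ‖s‖ * (6 * r) :=
    (hJb s (by linarith)).trans (mul_le_mul_of_nonneg_left hsig (norm_nonneg _))
  have hn := norm_nonneg s
  have hbig : ‖s‖ + (1 + ‖s‖) * (‖s‖ * (6 * r)) ≤ ((r : ℝ) * (2 + ‖s‖)) ^ (5 : ℝ) := by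
    have h5 : ((r : ℝ) * (2 + ‖s‖)) ^ (5 : ℝ) = ((r : ℝ) * (2 + ‖s‖)) ^ (5 : ℕ) := by
      exact_mod_cast Real.rpow_natCast _ 5
    rw [h5]
    have h6 : 2 ≤ (r : ℝ) * (2 + ‖s‖) := by nlinarith
    have h7 : (r : ℝ) * (2 + ‖s‖) ^ 2 ≤ ((r : ℝ) * (2 + ‖s‖)) ^ 2 := by
      rw [mul_pow]; gcongr; nlinarith
    have h8 : (2:ℝ) ^ 3 ≤ ((r : ℝ) * (2 + ‖s‖)) ^ 3 := by gcongr
    calc ‖s‖ + (1 + ‖s‖) * (‖s‖ * (6 * r)) ≤ 2 ^ 3 * ((r : ℝ) * (2 + ‖s‖) ^ 2) := by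
          nlinarith [mul_nonneg hn hn, mul_nonneg (by linarith : (0:ℝ) ≤ r) (mul_nonneg hn hn), mul_nonneg (by linarith : (0:ℝ) ≤ r) hn, mul_nonneg (by linarith : (0:ℝ) ≤ r - 1) hn]
      _ ≤ ((r : ℝ) * (2 + ‖s‖)) ^ 3 * ((r : ℝ) * (2 + ‖s‖)) ^ 2 := by gcongr
      _ = _ := by ring
  unfold regL
  split_ifs with hχ
  · have hF : DifferentiableOn ℂ (DirichletCharacter.LFunctionTrivChar₁ r) {s | 0 < s.re} :=
      (DirichletCharacter.differentiable_LFunctionTrivChar₁ r).differentiableOn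
    have hG : DifferentiableOn ℂ (fun s => c * s + (s - 1) * J s) {s | 0 < s.re} := by
      fun_prop
    have heq := (hF.analyticOnNhd hopen).eqOn_of_preconnected_of_eventuallyEq
      (hG.analyticOnNhd hopen) hconn h2 (by
        filter_upwards [hev] with z hz
        have hz1 : z ≠ 1 := by rintro rfl; simp at hz
        have hz2 : z - 1 ≠ 0 := sub_ne_zero.2 hz1
        rw [DirichletCharacter.LFunctionTrivChar₁, Function.update_of_ne hz1,
          DirichletCharacter.LFunctionTrivChar, ← hχ, DirichletCharacter.LFunction_eq_LSeries _ hz,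
          hJ z hz]
        field_simp)
    rw [heq (show (0:ℝ) < s.re by linarith), norm_div]
    have h1 : 1 ≤ ‖s + 1‖ := by
      have := Complex.re_le_norm (s + 1)
      simp at this; linarith
    refine (div_le_self (norm_nonneg _) h1).trans (le_trans ?_ hbig)
    refine (norm_add_le _ _).trans ?_
    rw [norm_mul, norm_mul]
    have h3 : ‖s - 1‖ ≤ 1 + ‖s‖ := by
      have := norm_sub_le s 1; simp at this; linarith
    gcongr
    exact mul_le_of_le_one_left hn hc1
  · have hF : DifferentiableOn ℂ (DirichletCharacter.LFunction χ) {s | 0 < s.re} :=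
      (DirichletCharacter.differentiable_LFunction hχ).differentiableOn
    have hc0 : c = 0 := by rw [hc, χ.sum_eq_zero_of_ne_one hχ, zero_div]
    have heq := (hF.analyticOnNhd hopen).eqOn_of_preconnected_of_eventuallyEq
      (hJd.analyticOnNhd hopen) hconn h2 (by
        filter_upwards [hev] with z hz
        rw [DirichletCharacter.LFunction_eq_LSeries _ hz, hJ z hz, hc0]; simp)
    rw [heq (show (0:ℝ) < s.re by linarith)]
    refine hJs.trans (le_trans ?_ hbig)
    have : 0 ≤ ‖s‖ * (6 * r) := by positivity
    nlinarith

lemma differentiableOn_regL {r : ℕ} [NeZero r] (χ : DirichletCharacter ℂ r) :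
    DifferentiableOn ℂ (regL χ) {s | 1 / 2 < s.re} := by
  unfold regL
  split_ifs with hχ
  · refine ((DirichletCharacter.differentiable_LFunctionTrivChar₁ r).differentiableOn).div
      (by fun_prop) (fun s hs h => ?_)
    have hs' : 1 / 2 < s.re := hs
    have := congrArg Complex.re h
    simp at this; linarith
  · exact (DirichletCharacter.differentiable_LFunction hχ).differentiableOn

lemma LFunctionTrivChar₁_ne_zero {r : ℕ} [NeZero r] (hG : GRH r) {s : ℂ} (hs : 1 / 2 < s.re) :
    DirichletCharacter.LFunctionTrivChar₁ r s ≠ 0 := by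
  rcases eq_or_ne s 1 with rfl | h1
  · exact DirichletCharacter.LFunctionTrivChar₁_apply_one_ne_zero r
  · rw [DirichletCharacter.LFunctionTrivChar₁, Function.update_of_ne h1]
    refine mul_ne_zero (sub_ne_zero.2 h1) (fun h0 => ?_)
    rcases lt_or_ge s.re 1 with h | h
    · have := hG 1 s (by linarith) h h0
      linarith
    · exact DirichletCharacter.LFunction_ne_zero_of_one_le_re _ (Or.inr h1) h h0

lemma LFunction_ne_zero_of_GRH {r : ℕ} [NeZero r] (hG : GRH r) {χ : DirichletCharacter ℂ r}
    (hχ : χ ≠ 1) {s : ℂ} (hs : 1 / 2 < s.re) : DirichletCharacter.LFunction χ s ≠ 0 := by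
  intro h0
  rcases lt_or_ge s.re 1 with h | h
  · have := hG χ s (by linarith) h h0
    linarith
  · exact DirichletCharacter.LFunction_ne_zero_of_one_le_re _ (Or.inl hχ) h h0

lemma regL_ne_zero {r : ℕ} [NeZero r] (hG : GRH r) (χ : DirichletCharacter ℂ r) {s : ℂ}
    (hs : 1 / 2 < s.re) : regL χ s ≠ 0 := by
  unfold regL
  split_ifs with hχ
  · refine div_ne_zero (LFunctionTrivChar₁_ne_zero hG hs) (fun h => ?_)
    have := congrArg Complex.re h
    simp at this; linarith
  · exact LFunction_ne_zero_of_GRH hG hχ hs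

/-- A Dirichlet series with coefficients bounded by one is bounded by `ζ(σ)` for `Re s ≥ σ > 1`. -/
lemma norm_LSeries_le {a : ℕ → ℂ} (ha : ∀ n, ‖a n‖ ≤ 1) {σ : ℝ} (hσ : 1 < σ) {s : ℂ}
    (hs : σ ≤ s.re) : ‖LSeries a s‖ ≤ ∑' n : ℕ, 1 / (n : ℝ) ^ σ := by
  refine tsum_of_norm_bounded (Real.summable_one_div_nat_rpow.2 hσ).hasSum (fun n => ?_)
  rcases eq_or_ne n 0 with rfl | hn
  · simp [Real.zero_rpow (by linarith : σ ≠ 0)]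
  · have hn1 : (1:ℝ) ≤ n := by exact_mod_cast Nat.one_le_iff_ne_zero.2 hn
    rw [LSeries.norm_term_eq, if_neg hn]
    gcongr
    · exact ha n

lemma one_le_zetaSum {σ : ℝ} (hσ : 1 < σ) : 1 ≤ ∑' n : ℕ, 1 / (n : ℝ) ^ σ := by
  have := (Real.summable_one_div_nat_rpow.2 hσ).le_tsum 1 (fun n _ => by positivity)
  simpa using this

lemma norm_LFunction_bounds {r : ℕ} [NeZero r] (χ : DirichletCharacter ℂ r) {s : ℂ}
    (hs : 5 / 4 ≤ s.re) :
    (∑' n : ℕ, 1 / (n : ℝ) ^ (5 / 4 : ℝ))⁻¹ ≤ ‖DirichletCharacter.LFunction χ s‖ ∧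
      ‖DirichletCharacter.LFunction χ s‖ ≤ ∑' n : ℕ, 1 / (n : ℝ) ^ (5 / 4 : ℝ) := by
  have hs1 : 1 < s.re := by linarith
  rw [DirichletCharacter.LFunction_eq_LSeries _ hs1]
  refine ⟨?_, norm_LSeries_le (fun n => χ.norm_le_one _) (by norm_num) hs⟩
  have h1 := congrArg norm (DirichletCharacter.LSeries.mul_mu_eq_one χ hs1)
  rw [norm_mul, norm_one] at h1
  have h2 := norm_LSeries_le 
    (a := (fun n : ℕ => χ (n : ZMod r)) * fun n : ℕ => (ArithmeticFunction.moebius n : ℂ))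
    (σ := 5 / 4) (fun n => by
      rw [Pi.mul_apply, norm_mul]
      refine mul_le_one₀ (χ.norm_le_one _) (norm_nonneg _) ?_
      have := ArithmeticFunction.abs_moebius_le_one (n := n)
      rw [Complex.norm_intCast]; exact_mod_cast this) (by norm_num) hs
  rw [inv_le_iff_one_le_mul₀ (lt_of_lt_of_le one_pos (one_le_zetaSum (by norm_num)))]
  refine h1.symm.le.trans ?_
  exact mul_le_mul_of_nonneg_left h2 (norm_nonneg _)

/-- Under the Generalized Riemann Hypothesis, `L(s, χ)` and its inverse are at most an arbitrarily
small power of `r (1 + |Im s|)` to the right of the critical line. -/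
theorem exists_regL_bound (hGRH : ∀ (r : ℕ) [Fact r.Prime], GRH r) {η : ℝ} (hη : 0 < η) :
    ∃ C : ℝ, 0 < C ∧ ∀ (r : ℕ) [Fact r.Prime] (χ : DirichletCharacter ℂ r) (s : ℂ),
      1 / 2 + η ≤ s.re →
        ‖regL χ s‖ ≤ C * (r * (1 + |s.im|)) ^ η ∧ ‖regL χ s‖⁻¹ ≤ C * (r * (1 + |s.im|)) ^ η := by
  set Z : ℝ := ∑' n : ℕ, 1 / (n : ℝ) ^ (5 / 4 : ℝ) with hZ
  have hZ1 : 1 ≤ Z := one_le_zetaSum (by norm_num)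
  obtain ⟨C, hC, H⟩ := exists_littlewood_bound (B := 5) (C₀ := 9 * Z) (by norm_num) (by linarith) hη
  refine ⟨C, hC, fun r _ χ s hs => H r (regL χ) ?_ (differentiableOn_regL χ)
    (fun s hs => regL_ne_zero (hGRH r) χ hs) (fun s hs => norm_regL_le χ hs) ?_ s hs⟩
  · exact_mod_cast (Fact.out : r.Prime).one_lt.le
  intro s hs
  obtain ⟨h1, h2⟩ := norm_LFunction_bounds χ hs
  rw [← hZ] at h1 h2
  unfold regL
  split_ifs with hχ
  · have hs1 : s ≠ 1 := by rintro rfl; norm_num at hs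
    rw [DirichletCharacter.LFunctionTrivChar₁, Function.update_of_ne hs1,
      DirichletCharacter.LFunctionTrivChar, ← hχ, mul_div_right_comm, norm_mul, norm_div]
    have hsq1 : ‖s - 1‖ ^ 2 = (s.re - 1) ^ 2 + s.im ^ 2 := by
      rw [Complex.sq_norm, Complex.normSq_apply]; simp; ring
    have hsq2 : ‖s + 1‖ ^ 2 = (s.re + 1) ^ 2 + s.im ^ 2 := by
      rw [Complex.sq_norm, Complex.normSq_apply]; simp; ring
    have hle : ‖s - 1‖ ≤ ‖s + 1‖ :=
      abs_le_of_sq_le_sq' (by nlinarith) (norm_nonneg _) |>.2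
    have hle' : ‖s + 1‖ ≤ 9 * ‖s - 1‖ :=
      abs_le_of_sq_le_sq' (by nlinarith [sq_nonneg s.im]) (by positivity) |>.2
    have hpos : 0 < ‖s + 1‖ := by
      rw [norm_pos_iff]; intro h
      have := congrArg Complex.re h
      simp at this; linarith
    have hq1 : ‖s - 1‖ / ‖s + 1‖ ≤ 1 := (div_le_one hpos).2 hle
    have hq2 : 9⁻¹ ≤ ‖s - 1‖ / ‖s + 1‖ := by
      rw [le_div_iff₀ hpos]; linarith
    constructor
    · rw [mul_inv]; gcongr
    · calc _ ≤ 1 * Z := by gcongr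
        _ ≤ 9 * Z := by linarith
  · exact ⟨(inv_anti₀ (by linarith) (by linarith)).trans h1, by linarith⟩

lemma norm_recipL_le {r : ℕ} [NeZero r] (χ : DirichletCharacter ℂ r) {s : ℂ} (hs : 1 / 2 < s.re) :
    ‖recipL χ s‖ ≤ ‖regL χ s‖⁻¹ := by
  unfold recipL regL
  split_ifs with hχ
  · rw [norm_div, norm_div, inv_div]
    refine div_le_div_of_nonneg_right ?_ (norm_nonneg _)
    have hsq1 : ‖s - 1‖ ^ 2 = (s.re - 1) ^ 2 + s.im ^ 2 := by
      rw [Complex.sq_norm, Complex.normSq_apply]; simp; ring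
    have hsq2 : ‖s + 1‖ ^ 2 = (s.re + 1) ^ 2 + s.im ^ 2 := by
      rw [Complex.sq_norm, Complex.normSq_apply]; simp; ring
    exact abs_le_of_sq_le_sq' (by nlinarith) (norm_nonneg _) |>.2
  · rw [norm_inv]

lemma differentiableOn_recipL {r : ℕ} [NeZero r] (hG : GRH r) (χ : DirichletCharacter ℂ r) :
    DifferentiableOn ℂ (recipL χ) {s | 1 / 2 < s.re} := by
  unfold recipL
  split_ifs with hχ
  · exact DifferentiableOn.div (by fun_prop)
      ((DirichletCharacter.differentiable_LFunctionTrivChar₁ r).differentiableOn)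
      (fun s hs => LFunctionTrivChar₁_ne_zero hG hs)
  · exact ((DirichletCharacter.differentiable_LFunction hχ).differentiableOn).inv
      (fun s hs => LFunction_ne_zero_of_GRH hG hχ hs)

lemma recipL_eq_LSeries {r : ℕ} [NeZero r] (χ : DirichletCharacter ℂ r) {s : ℂ} (hs : 1 < s.re) :
    recipL χ s = LSeries (fun n => χ (n : ZMod r) * (ArithmeticFunction.moebius n : ℂ)) s := by
  have h1 := DirichletCharacter.LSeries.mul_mu_eq_one χ hs
  have h2 : LSeries (fun n => χ (n : ZMod r)) s ≠ 0 :=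
    DirichletCharacter.LSeries_ne_zero_of_one_lt_re χ hs
  have h3 : LSeries (fun n => χ (n : ZMod r) * (ArithmeticFunction.moebius n : ℂ)) s
      = (LSeries (fun n => χ (n : ZMod r)) s)⁻¹ := by
    exact eq_inv_of_mul_eq_one_right h1
  rw [h3]
  unfold recipL
  split_ifs with hχ
  · have hs1 : s ≠ 1 := by rintro rfl; simp at hs
    rw [DirichletCharacter.LFunctionTrivChar₁, Function.update_of_ne hs1,
      DirichletCharacter.LFunctionTrivChar, ← hχ, DirichletCharacter.LFunction_eq_LSeries _ hs]
    have : s - 1 ≠ 0 := sub_ne_zero.2 hs1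
    field_simp
  · rw [DirichletCharacter.LFunction_eq_LSeries _ hs]

/-! ### Contour shifts and Perron's formula -/

/-- The integral of `(1 + |t|) ^ (-(1 + θ))` over the real line. -/
def tailIntegral (θ : ℝ) : ℝ := ∫ t : ℝ, (1 + |t|) ^ (-(1 + θ))

lemma integrable_one_add_abs {θ : ℝ} (hθ : 0 < θ) :
    Integrable (fun t : ℝ => (1 + |t|) ^ (-(1 + θ))) := by
  have := integrable_one_add_norm (E := ℝ) (μ := volume) (r := 1 + θ) (by simp; linarith)
  simpa using this

lemma tailIntegral_nonneg (θ : ℝ) : 0 ≤ tailIntegral θ :=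
  integral_nonneg fun _ => by positivity

lemma integrable_vertical {F : ℂ → ℂ} {σ C θ : ℝ} (hθ : 0 < θ)
    (hc : Continuous fun t : ℝ => F (σ + t * Complex.I))
    (hb : ∀ t : ℝ, ‖F (σ + t * Complex.I)‖ ≤ C * (1 + |t|) ^ (-(1 + θ))) :
    Integrable fun t : ℝ => F (σ + t * Complex.I) :=
  ((integrable_one_add_abs hθ).const_mul C).mono' hc.aestronglyMeasurable
    (Filter.Eventually.of_forall hb)

lemma continuous_vertical {F : ℂ → ℂ} {S : Set ℂ} (hF : ContinuousOn F S) {σ : ℝ}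
    (hσ : ∀ t : ℝ, (σ + t * Complex.I : ℂ) ∈ S) :
    Continuous fun t : ℝ => F (σ + t * Complex.I) :=
  hF.comp_continuous (by fun_prop) hσ

/-- Moving a vertical line of integration across a strip of analyticity. -/
lemma integral_vertical_shift {F : ℂ → ℂ} {σ₁ σ₂ C θ : ℝ} (hσ : σ₁ ≤ σ₂) (hθ : 0 < θ)
    (hd : DifferentiableOn ℂ F {s | σ₁ ≤ s.re ∧ s.re ≤ σ₂})
    (hb : ∀ s : ℂ, σ₁ ≤ s.re → s.re ≤ σ₂ → ‖F s‖ ≤ C * (1 + |s.im|) ^ (-(1 + θ))) :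
    ∫ t : ℝ, F (σ₁ + t * Complex.I) = ∫ t : ℝ, F (σ₂ + t * Complex.I) := by
  have hi : ∀ σ : ℝ, σ₁ ≤ σ → σ ≤ σ₂ → Integrable fun t : ℝ => F (σ + t * Complex.I) := by
    intro σ h1 h2
    refine integrable_vertical (C := C) hθ (continuous_vertical hd.continuousOn (fun t => by simp [h1, h2]))
      (fun t => ?_)
    simpa using hb (σ + t * Complex.I) (by simpa using h1) (by simpa using h2)
  have hlim : ∀ σ : ℝ, σ₁ ≤ σ → σ ≤ σ₂ → Filter.Tendsto
      (fun T : ℝ => ∫ t in (-T)..T, F (σ + t * Complex.I)) Filter.atTop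
      (nhds (∫ t : ℝ, F (σ + t * Complex.I))) := fun σ h1 h2 =>
    intervalIntegral_tendsto_integral (hi σ h1 h2) Filter.tendsto_neg_atTop_atBot Filter.tendsto_id
  have hrect : ∀ T : ℝ, 0 ≤ T →
      ‖(∫ t in (-T)..T, F (σ₂ + t * Complex.I)) - ∫ t in (-T)..T, F (σ₁ + t * Complex.I)‖
        ≤ 2 * (C * (1 + T) ^ (-(1 + θ)) * |σ₂ - σ₁|) := by
    intro T hT
    have h := Complex.integral_boundary_rect_eq_zero_of_differentiableOn F ⟨σ₁, -T⟩ ⟨σ₂, T⟩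
      (hd.mono (fun s hs => by
        have := hs.1
        simp only [Set.mem_preimage, Set.uIcc_of_le hσ] at this
        exact this))
    simp only at h
    have hhor : ∀ y : ℝ, |y| = T → ‖∫ x in σ₁..σ₂, F (x + y * Complex.I)‖
        ≤ C * (1 + T) ^ (-(1 + θ)) * |σ₂ - σ₁| := by
      intro y hy
      refine intervalIntegral.norm_integral_le_of_norm_le_const (fun x hx => ?_)
      rw [Set.uIoc_of_le hσ] at hx
      have := hb (x + y * Complex.I) (by simpa using hx.1.le) (by simpa using hx.2)
      simpa [hy] using this
    have h1 := hhor (-T) (by simp [abs_of_nonneg hT])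
    have h2 := hhor T (abs_of_nonneg hT)
    have h3 : Complex.I • (∫ t in (-T)..T, F (σ₂ + t * Complex.I)) -
        Complex.I • (∫ t in (-T)..T, F (σ₁ + t * Complex.I))
        = (∫ x in σ₁..σ₂, F (x + T * Complex.I)) - ∫ x in σ₁..σ₂, F (x + (-T : ℝ) * Complex.I) := by
      linear_combination h
    calc _ = ‖Complex.I • ((∫ t in (-T)..T, F (σ₂ + t * Complex.I)) -
          ∫ t in (-T)..T, F (σ₁ + t * Complex.I))‖ := by rw [norm_smul, Complex.norm_I, one_mul]
      _ ≤ _ := by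
        rw [smul_sub, h3]
        exact (norm_sub_le _ _).trans (by linarith)
  have hz : Filter.Tendsto (fun T : ℝ => 2 * (C * (1 + T) ^ (-(1 + θ)) * |σ₂ - σ₁|)) Filter.atTop
      (nhds 0) := by
    have h1 : Filter.Tendsto (fun T : ℝ => (1 + T) ^ (-(1 + θ))) Filter.atTop (nhds 0) :=
      (tendsto_rpow_neg_atTop (by linarith)).comp
        (Filter.tendsto_atTop_add_const_left _ 1 Filter.tendsto_id)
    have := ((h1.const_mul C).mul_const |σ₂ - σ₁|).const_mul 2
    simpa using this
  have hdiff := (hlim σ₂ hσ le_rfl).sub (hlim σ₁ le_rfl hσ)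
  have h0 := squeeze_zero_norm' (Filter.eventually_atTop.2 ⟨0, fun T hT => hrect T hT⟩) hz
  exact (sub_eq_zero.1 (tendsto_nhds_unique hdiff h0)).symm

/-- Termwise integration of a Dirichlet series against an integrable kernel on a vertical line of
absolute convergence. -/
lemma integral_mul_LSeries {a : ℕ → ℂ} {s₀ : ℂ} (hs : LSeriesSummable a s₀) {K : ℝ → ℂ}
    (hK : Integrable K) :
    ∫ t : ℝ, K t * LSeries a (s₀ + t * Complex.I)
      = ∑' n, ∫ t : ℝ, K t * LSeries.term a (s₀ + t * Complex.I) n := by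
  have hnorm : ∀ n, ∀ t : ℝ, ‖LSeries.term a (s₀ + t * Complex.I) n‖ = ‖LSeries.term a s₀ n‖ := by
    intro n t
    rw [LSeries.norm_term_eq, LSeries.norm_term_eq]
    simp
  have hcont : ∀ n, Continuous fun t : ℝ => LSeries.term a (s₀ + t * Complex.I) n := by
    intro n
    rcases eq_or_ne n 0 with rfl | hn
    · simpa using continuous_const
    · have hn' : (n : ℂ) ≠ 0 := by exact_mod_cast hn
      simp only [LSeries.term_of_ne_zero hn]
      refine continuous_const.div ?_ (fun t => by simp [Complex.cpow_eq_zero_iff, hn'])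
      exact Continuous.const_cpow (by fun_prop) (Or.inl hn')
  have hint : ∀ n, Integrable fun t : ℝ => K t * LSeries.term a (s₀ + t * Complex.I) n := by
    intro n
    exact hK.mul_bdd (c := ‖LSeries.term a s₀ n‖) (hcont n).aestronglyMeasurable
      (Filter.Eventually.of_forall fun t => (hnorm n t).le)
  have hsum : Summable fun n => ∫ t : ℝ, ‖K t * LSeries.term a (s₀ + t * Complex.I) n‖ := by
    have : ∀ n, ∫ t : ℝ, ‖K t * LSeries.term a (s₀ + t * Complex.I) n‖
        = (∫ t : ℝ, ‖K t‖) * ‖LSeries.term a s₀ n‖ := by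
      intro n
      simp_rw [norm_mul, hnorm]
      rw [integral_mul_const]
    simp_rw [this]
    exact hs.norm.mul_left _
  refine Eq.trans ?_ (integral_tsum_of_summable_integral_norm hint hsum).symm
  congr 1
  ext t
  rw [LSeries, tsum_mul_left]

/-- The Mellin transform of `max (1 - u) 0` is `1 / (s (s + 1))`. -/
lemma hasMellin_max_one_sub {s : ℂ} (hs : 0 < s.re) :
    HasMellin (fun u : ℝ => ((max (1 - u) 0 : ℝ) : ℂ)) s (1 / (s * (s + 1))) := by
  have h1 := hasMellin_one_Ioc hs
  have h2 := hasMellin_cpow_Ioc 1 (s := s) (by simp; linarith)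
  have h3 := hasMellin_sub h1.1 h2.1
  rw [h1.2, h2.2] at h3
  have h0 : s ≠ 0 := by rintro rfl; simp at hs
  have h01 : s + 1 ≠ 0 := by
    intro h; have := congrArg Complex.re h; simp at this; linarith
  have h4 : 1 / s - 1 / (s + 1) = 1 / (s * (s + 1)) := by field_simp; ring
  rw [h4] at h3
  have h5 : ∀ u ∈ Set.Ioi (0:ℝ), ((Set.Ioc (0:ℝ) 1).indicator (fun _ => (1:ℂ)) u -
      (Set.Ioc (0:ℝ) 1).indicator (fun t : ℝ => (t:ℂ) ^ (1:ℂ)) u) = ((max (1 - u) 0 : ℝ) : ℂ) := by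
    intro u hu
    have hu' : (0:ℝ) < u := hu
    rcases le_or_gt u 1 with h | h
    · rw [Set.indicator_of_mem (show u ∈ Set.Ioc (0:ℝ) 1 from ⟨hu', h⟩),
        Set.indicator_of_mem (show u ∈ Set.Ioc (0:ℝ) 1 from ⟨hu', h⟩),
        max_eq_left (by linarith)]
      simp
    · rw [Set.indicator_of_notMem (fun h' => absurd h'.2 (not_le.2 h)),
        Set.indicator_of_notMem (fun h' => absurd h'.2 (not_le.2 h)), max_eq_right (by linarith)]
      simp
  refine ⟨?_, ?_⟩
  · exact h3.1.congr_fun (fun u hu => by simp only [h5 u hu]) measurableSet_Ioi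
  · rw [← h3.2]
    exact setIntegral_congr_fun measurableSet_Ioi (fun u hu => by simp only [h5 u hu])

/-- The Mellin transform of `min 1 u` in `-1 < Re s < 0` is `-1 / (s (s + 1))`. -/
lemma hasMellin_min_one {s : ℂ} (hs : s.re < 0) (hs' : -1 < s.re) :
    HasMellin (fun u : ℝ => ((min 1 u : ℝ) : ℂ)) s (-1 / (s * (s + 1))) := by
  have h0 : s ≠ 0 := by rintro rfl; simp at hs
  have h01 : s + 1 ≠ 0 := by
    intro h; have := congrArg Complex.re h; simp at this; linarith
  have h2 := hasMellin_cpow_Ioc 1 (s := s) (by simp; linarith)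
  have h1 : HasMellin ((Set.Ioi (1:ℝ)).indicator (fun _ => (1:ℂ))) s (-1 / s) := by
    have h5 : ∀ t : ℝ, (t : ℂ) ^ (s - 1) • (Set.Ioi (1:ℝ)).indicator (fun _ => (1:ℂ)) t
        = (Set.Ioi (1:ℝ)).indicator (fun t : ℝ => (t:ℂ) ^ (s - 1)) t := by
      intro t
      by_cases h : t ∈ Set.Ioi (1:ℝ) <;> simp [h]
    have hre : (s - 1).re < -1 := by simp; linarith
    constructor
    · rw [MellinConvergent]
      simp_rw [h5]
      exact ((integrableOn_Ioi_cpow_of_lt hre one_pos).integrable_indicator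
        measurableSet_Ioi).integrableOn
    · rw [mellin]
      simp_rw [h5]
      rw [setIntegral_indicator measurableSet_Ioi,
        Set.inter_eq_right.2 (Set.Ioi_subset_Ioi zero_le_one),
        integral_Ioi_cpow_of_lt hre one_pos]
      simp
  have h3 := hasMellin_add h1.1 h2.1
  rw [h1.2, h2.2] at h3
  have h4 : -1 / s + 1 / (s + 1) = -1 / (s * (s + 1)) := by field_simp; ring
  rw [h4] at h3
  have h5 : ∀ u ∈ Set.Ioi (0:ℝ), ((Set.Ioi (1:ℝ)).indicator (fun _ => (1:ℂ)) u +
      (Set.Ioc (0:ℝ) 1).indicator (fun t : ℝ => (t:ℂ) ^ (1:ℂ)) u) = ((min 1 u : ℝ) : ℂ) := by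
    intro u hu
    have hu' : (0:ℝ) < u := hu
    rcases le_or_gt u 1 with h | h
    · rw [Set.indicator_of_mem (show u ∈ Set.Ioc (0:ℝ) 1 from ⟨hu', h⟩),
        Set.indicator_of_notMem (s := Set.Ioi (1:ℝ)) (fun h' => absurd h (not_le.2 (Set.mem_Ioi.1 h'))),
        min_eq_right h]
      simp
    · rw [Set.indicator_of_notMem (s := Set.Ioc (0:ℝ) 1) (fun h' => absurd h'.2 (not_le.2 h)),
        Set.indicator_of_mem (show u ∈ Set.Ioi (1:ℝ) from h), min_eq_left h.le]
      simp
  refine ⟨?_, ?_⟩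
  · exact h3.1.congr_fun (fun u hu => by simp only [h5 u hu]) measurableSet_Ioi
  · rw [← h3.2]
    exact setIntegral_congr_fun measurableSet_Ioi (fun u hu => by simp only [h5 u hu])

lemma one_add_abs_im_le_norm {s : ℂ} {c : ℝ} (hc : 0 < c) (hc1 : c ≤ 1) (hs : c ≤ |s.re|) :
    c / 2 * (1 + |s.im|) ≤ ‖s‖ := by
  have h1 := Complex.abs_re_le_norm s
  have h2 := Complex.abs_im_le_norm s
  nlinarith [abs_nonneg s.im]

/-- The decay of the kernel `1 / (s (s + 1))` on vertical lines away from its poles. -/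
lemma norm_inv_mul_add_one_le {s : ℂ} {c : ℝ} (hc : 0 < c) (hc1 : c ≤ 1) (hs : c ≤ |s.re|)
    (hs' : c ≤ |s.re + 1|) :
    ‖1 / (s * (s + 1))‖ ≤ 4 / c ^ 2 * (1 + |s.im|) ^ (-(1 + 1) : ℝ) := by
  have h1 := one_add_abs_im_le_norm hc hc1 hs
  have h2 := one_add_abs_im_le_norm (s := s + 1) hc hc1 (by simpa using hs')
  simp only [Complex.add_im, Complex.one_im, add_zero] at h2
  have h3 : 0 < 1 + |s.im| := by positivity
  rw [norm_div, norm_one, norm_mul, Real.rpow_neg h3.le,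
    show ((1:ℝ) + 1) = ((2:ℕ):ℝ) by norm_num, Real.rpow_natCast]
  calc 1 / (‖s‖ * ‖s + 1‖) ≤ 1 / ((c / 2 * (1 + |s.im|)) * (c / 2 * (1 + |s.im|))) := by
        gcongr
    _ = _ := by field_simp; norm_num

lemma continuous_inv_mul_add_one {σ : ℝ} (h0 : σ ≠ 0) (h1 : σ + 1 ≠ 0) :
    Continuous fun t : ℝ => 1 / ((σ + t * Complex.I : ℂ) * (σ + t * Complex.I + 1)) := by
  refine continuous_const.div (by fun_prop) (fun t h => ?_)
  rcases mul_eq_zero.1 h with h | h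
  · have := congrArg Complex.re h; simp at this; exact h0 this
  · have := congrArg Complex.re h; simp at this; exact h1 this

lemma verticalIntegrable_inv {σ : ℝ} (h0 : σ ≠ 0) (h1 : σ + 1 ≠ 0) :
    Integrable fun t : ℝ => 1 / ((σ + t * Complex.I : ℂ) * (σ + t * Complex.I + 1)) := by
  set c : ℝ := min 1 (min |σ| |σ + 1|) with hc
  have hc0 : 0 < c := by
    rw [hc]; exact lt_min one_pos (lt_min (abs_pos.2 h0) (abs_pos.2 h1))
  refine integrable_vertical (F := fun s => 1 / (s * (s + 1))) (C := 4 / c ^ 2) one_pos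
    (continuous_inv_mul_add_one h0 h1) (fun t => ?_)
  have := norm_inv_mul_add_one_le (s := σ + t * Complex.I) hc0 (min_le_left _ _)
    (by simp [hc]) (by simp [hc])
  simpa using this

/-- Mellin inversion for `max (1 - u) 0`. -/
lemma integral_cpow_max_one_sub {σ y : ℝ} (hσ : 0 < σ) (hy : 0 < y) :
    ∫ t : ℝ, (y : ℂ) ^ (-(σ + t * Complex.I)) *
      (1 / ((σ + t * Complex.I : ℂ) * (σ + t * Complex.I + 1))) = 2 * Real.pi * (max (1 - y) 0 : ℝ) := by
  have hm : ∀ t : ℝ, mellin (fun u : ℝ => ((max (1 - u) 0 : ℝ) : ℂ)) (σ + t * Complex.I)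
      = 1 / ((σ + t * Complex.I : ℂ) * (σ + t * Complex.I + 1)) :=
    fun t => (hasMellin_max_one_sub (by simpa using hσ)).2
  have h := mellinInv_mellin_eq σ (fun u : ℝ => ((max (1 - u) 0 : ℝ) : ℂ)) hy
    (hasMellin_max_one_sub (by simpa using hσ)).1
    (by
      rw [Complex.VerticalIntegrable]
      simp_rw [hm]
      exact verticalIntegrable_inv hσ.ne' (by linarith))
    (by fun_prop)
  rw [mellinInv] at h
  simp_rw [hm, smul_eq_mul] at h
  rw [← h, Complex.real_smul]
  push_cast
  rw [← mul_assoc, mul_one_div_cancel (by simp), one_mul]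

/-- Mellin inversion for `min 1 u`. -/
lemma integral_cpow_min_one {σ y : ℝ} (hσ : σ < 0) (hσ' : -1 < σ) (hy : 0 < y) :
    ∫ t : ℝ, (y : ℂ) ^ (-(σ + t * Complex.I)) *
      (1 / ((σ + t * Complex.I : ℂ) * (σ + t * Complex.I + 1))) = -(2 * Real.pi * (min 1 y : ℝ)) := by
  have hm : ∀ t : ℝ, mellin (fun u : ℝ => ((min 1 u : ℝ) : ℂ)) (σ + t * Complex.I)
      = -(1 / ((σ + t * Complex.I : ℂ) * (σ + t * Complex.I + 1))) :=
    fun t => by rw [(hasMellin_min_one (by simpa using hσ) (by simpa using hσ')).2, neg_div]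
  have h := mellinInv_mellin_eq σ (fun u : ℝ => ((min 1 u : ℝ) : ℂ)) hy
    (hasMellin_min_one (by simpa using hσ) (by simpa using hσ')).1
    (by
      rw [Complex.VerticalIntegrable]
      simp_rw [hm]
      exact (verticalIntegrable_inv hσ.ne (by linarith)).neg)
    (by fun_prop)
  rw [mellinInv] at h
  simp_rw [hm, smul_eq_mul, mul_neg] at h
  rw [← h, Complex.real_smul, integral_neg]
  push_cast
  rw [← mul_assoc, mul_one_div_cancel (by simp), one_mul, neg_neg]

/-- The kernel `∫_X^{X+1} u^s du / s`: it represents the summation condition `n ≤ X` as a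
difference of two Cesàro means, so that its vertical integrals converge absolutely. -/
def perronKernel (X : ℕ) (s : ℂ) : ℂ :=
  (((X + 1 : ℕ) : ℂ) ^ (s + 1) - (X : ℂ) ^ (s + 1)) / (s * (s + 1))

lemma norm_perronKernel_le {X : ℕ} {s : ℂ} {θ : ℝ} (hs : 1 / 2 ≤ s.re) (hθ : 0 ≤ θ) (hθ1 : θ ≤ 1) :
    ‖perronKernel X s‖ ≤ 32 * ((X : ℝ) + 1) ^ (s.re + θ) * (1 + |s.im|) ^ (-(1 + θ)) := by
  have hX : (0:ℝ) < (X:ℝ) + 1 := by positivity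
  have hn := one_add_abs_im_le_norm (s := s) (c := 1 / 2) (by norm_num) (by norm_num)
    (by rw [abs_of_nonneg (by linarith)]; exact hs)
  have hT : 0 < 1 + |s.im| := by positivity
  have hspos : 0 < ‖s‖ := lt_of_lt_of_le (by positivity) hn
  have hs1 : ‖s‖ ≤ ‖s + 1‖ := by
    have e1 : ‖s‖ ^ 2 = s.re ^ 2 + s.im ^ 2 := by
      rw [Complex.sq_norm, Complex.normSq_apply]; ring
    have e2 : ‖s + 1‖ ^ 2 = (s.re + 1) ^ 2 + s.im ^ 2 := by
      rw [Complex.sq_norm, Complex.normSq_apply]; simp; ring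
    exact abs_le_of_sq_le_sq' (by nlinarith) (norm_nonneg _) |>.2
  have hs1pos : 0 < ‖s + 1‖ := hspos.trans_le hs1
  have hs1ne : s + 1 ≠ 0 := norm_pos_iff.1 hs1pos
  have hnum1 : ‖((X + 1 : ℕ) : ℂ) ^ (s + 1) - (X : ℂ) ^ (s + 1)‖ ≤
      ‖s + 1‖ * ((X:ℝ) + 1) ^ s.re := by
    rcases Nat.eq_zero_or_pos X with rfl | hXpos
    · have : (1:ℝ) ≤ ‖s + 1‖ := by
        have := Complex.re_le_norm (s + 1); simp at this; linarith
      simpa [Complex.zero_cpow hs1ne] using this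
    · have hXpos' : (0:ℝ) < X := by exact_mod_cast hXpos
      have := (convex_Icc (X:ℝ) (X + 1)).norm_image_sub_le_of_norm_hasDerivWithin_le
        (f := fun u : ℝ => (u : ℂ) ^ (s + 1)) (f' := fun u : ℝ => (s + 1) * (u:ℂ) ^ s)
        (C := ‖s + 1‖ * ((X:ℝ) + 1) ^ s.re)
        (fun u hu => by
          have hu0 : u ≠ 0 := by linarith [hu.1]
          have := hasDerivAt_ofReal_cpow_const' (x := u) (r := s) hu0 (by
            intro h; rw [h] at hs1ne; simp at hs1ne)
          have h2 := this.const_mul (s + 1)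
          refine (h2.congr_of_eventuallyEq
            (Filter.Eventually.of_forall fun v => ?_)).hasDerivWithinAt
          field_simp)
        (fun u hu => by
          have hu0 : 0 < u := by linarith [hu.1]
          rw [norm_mul, Complex.norm_cpow_eq_rpow_re_of_pos hu0]
          gcongr
          · exact hu.2)
        (show (X:ℝ) ∈ Set.Icc (X:ℝ) (X + 1) by simp) (show (X:ℝ) + 1 ∈ Set.Icc (X:ℝ) (X + 1) by simp)
      simpa using this
  have hnum2 : ‖((X + 1 : ℕ) : ℂ) ^ (s + 1) - (X : ℂ) ^ (s + 1)‖ ≤ 2 * ((X:ℝ) + 1) ^ (s.re + 1) := by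
    refine (norm_sub_le _ _).trans ?_
    rw [Complex.norm_natCast_cpow_of_re_ne_zero _ (by simp; linarith),
      Complex.norm_natCast_cpow_of_re_ne_zero _ (by simp; linarith)]
    simp only [Complex.add_re, Complex.one_re]
    have : (X:ℝ) ^ (s.re + 1) ≤ ((X:ℝ) + 1) ^ (s.re + 1) := by gcongr; linarith
    push_cast
    linarith
  have hk1 : ‖perronKernel X s‖ ≤ ((X:ℝ) + 1) ^ s.re / ‖s‖ := by
    rw [perronKernel, norm_div, norm_mul, div_le_div_iff₀ (by positivity) hspos]
    calc _ ≤ ‖s + 1‖ * ((X:ℝ) + 1) ^ s.re * ‖s‖ := by gcongr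
      _ = _ := by ring
  have hk2 : ‖perronKernel X s‖ ≤ 2 * ((X:ℝ) + 1) ^ (s.re + 1) / ‖s‖ ^ 2 := by
    rw [perronKernel, norm_div, norm_mul, sq]
    gcongr
  have hinterp : ‖perronKernel X s‖ ≤ (((X:ℝ) + 1) ^ s.re / ‖s‖) ^ (1 - θ) *
      (2 * ((X:ℝ) + 1) ^ (s.re + 1) / ‖s‖ ^ 2) ^ θ := by
    rcases eq_or_lt_of_le (norm_nonneg (perronKernel X s)) with h0 | h0
    · rw [← h0]; positivity
    calc ‖perronKernel X s‖ = ‖perronKernel X s‖ ^ (1 - θ) * ‖perronKernel X s‖ ^ θ := by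
          rw [← Real.rpow_add h0]; simp
      _ ≤ _ := by gcongr
  refine hinterp.trans ?_
  have hA : 0 < ((X:ℝ) + 1) ^ s.re := by positivity
  have e1 : (((X:ℝ) + 1) ^ s.re / ‖s‖) ^ (1 - θ) *
      (2 * ((X:ℝ) + 1) ^ (s.re + 1) / ‖s‖ ^ 2) ^ θ
      = 2 ^ θ * ((X:ℝ) + 1) ^ (s.re + θ) * ‖s‖ ^ (-(1 + θ)) := by
    rw [Real.div_rpow hA.le hspos.le, Real.div_rpow (by positivity) (by positivity),
      Real.mul_rpow (by norm_num) (by positivity), ← Real.rpow_mul hX.le, ← Real.rpow_mul hX.le,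
      ← Real.rpow_natCast, ← Real.rpow_mul hspos.le, Real.rpow_neg hspos.le]
    have e2 : s.re + θ = s.re * (1 - θ) + (s.re + 1) * θ := by ring
    have e3 : 1 + θ = (1 - θ) + ((2:ℕ):ℝ) * θ := by push_cast; ring
    rw [e2, e3, Real.rpow_add hX, Real.rpow_add hspos]
    field_simp
  rw [e1]
  have h2θ : (2:ℝ) ^ θ ≤ 2 := by
    calc (2:ℝ) ^ θ ≤ 2 ^ (1:ℝ) := Real.rpow_le_rpow_of_exponent_le (by norm_num) hθ1
      _ = 2 := by norm_num
  have h3 : ‖s‖ ^ (-(1 + θ)) ≤ 16 * (1 + |s.im|) ^ (-(1 + θ)) := by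
    calc ‖s‖ ^ (-(1 + θ)) ≤ (1 / 2 / 2 * (1 + |s.im|)) ^ (-(1 + θ)) :=
          Real.rpow_le_rpow_of_nonpos (by positivity) hn (by linarith)
      _ = (1 / 4) ^ (-(1 + θ)) * (1 + |s.im|) ^ (-(1 + θ)) := by
          rw [Real.mul_rpow (by norm_num) hT.le]; norm_num
      _ ≤ 16 * (1 + |s.im|) ^ (-(1 + θ)) := by
          gcongr
          rw [show (1/4:ℝ) = 4⁻¹ by norm_num, Real.inv_rpow (by norm_num), ← Real.rpow_neg (by norm_num), neg_neg]
          calc (4:ℝ) ^ (1 + θ) ≤ 4 ^ (2:ℝ) :=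
                Real.rpow_le_rpow_of_exponent_le (by norm_num) (by linarith)
            _ = 16 := by norm_num
  calc 2 ^ θ * ((X:ℝ) + 1) ^ (s.re + θ) * ‖s‖ ^ (-(1 + θ))
      ≤ 2 * ((X:ℝ) + 1) ^ (s.re + θ) * (16 * (1 + |s.im|) ^ (-(1 + θ))) := by gcongr
    _ = _ := by ring

lemma differentiableOn_perronKernel (X : ℕ) :
    DifferentiableOn ℂ (perronKernel X) {s | 0 < s.re} := by
  intro s hs
  have hs' : 0 < s.re := hs
  have h0 : s ≠ 0 := by rintro rfl; simp at hs'
  have h01 : s + 1 ≠ 0 := by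
    intro h; have := congrArg Complex.re h; simp at this; linarith
  refine DifferentiableAt.differentiableWithinAt ?_
  unfold perronKernel
  refine DifferentiableAt.div (DifferentiableAt.sub ?_ ?_) (by fun_prop) (mul_ne_zero h0 h01)
  · exact DifferentiableAt.const_cpow (by fun_prop) (Or.inr h01)
  · exact DifferentiableAt.const_cpow (by fun_prop) (Or.inr h01)

lemma continuous_perronKernel (X : ℕ) {σ : ℝ} (hσ : 0 < σ) :
    Continuous fun t : ℝ => perronKernel X (σ + t * Complex.I) :=
  continuous_vertical (differentiableOn_perronKernel X).continuousOn (fun t => by simpa using hσ)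

lemma integrable_perronKernel (X : ℕ) {σ : ℝ} (hσ : 1 / 2 ≤ σ) :
    Integrable fun t : ℝ => perronKernel X (σ + t * Complex.I) := by
  refine integrable_vertical (C := 32 * ((X : ℝ) + 1) ^ (σ + 1)) one_pos
    (continuous_perronKernel X (by linarith)) (fun t => ?_)
  simpa using norm_perronKernel_le (X := X) (s := σ + t * Complex.I) (θ := 1) (by simpa using hσ)
    zero_le_one le_rfl

/-- Perron's formula for a single term. -/
lemma integral_perronKernel_mul {X n : ℕ} (hn : n ≠ 0) {σ : ℝ} (hσ : 0 < σ) :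
    ∫ t : ℝ, perronKernel X (σ + t * Complex.I) * (1 / (n : ℂ) ^ (σ + t * Complex.I : ℂ))
      = 2 * Real.pi * (if n ≤ X then 1 else 0) := by
  have hn0 : (0:ℝ) < n := by exact_mod_cast Nat.pos_of_ne_zero hn
  set κ : ℝ → ℂ := fun t => 1 / ((σ + t * Complex.I : ℂ) * (σ + t * Complex.I + 1)) with hκ
  have hκi : Integrable κ := verticalIntegrable_inv hσ.ne' (by linarith)
  have hZ : ∀ Z : ℕ, (∫ t : ℝ, (Z:ℂ) ^ (σ + t * Complex.I + 1 : ℂ) *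
      (1 / (n : ℂ) ^ (σ + t * Complex.I : ℂ)) * κ t) = 2 * Real.pi * (max ((Z:ℝ) - n) 0 : ℝ) ∧
      Integrable fun t : ℝ => (Z:ℂ) ^ (σ + t * Complex.I + 1 : ℂ) *
      (1 / (n : ℂ) ^ (σ + t * Complex.I : ℂ)) * κ t := by
    intro Z
    rcases Nat.eq_zero_or_pos Z with rfl | hZ
    · have h0 : ∀ t : ℝ, ((0:ℕ):ℂ) ^ (σ + t * Complex.I + 1 : ℂ) = 0 := by
        intro t
        rw [Nat.cast_zero, Complex.zero_cpow]
        intro h; have := congrArg Complex.re h; simp at this; linarith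
      simp only [h0, zero_mul]
      refine ⟨?_, integrable_zero _ _ _⟩
      rw [max_eq_right (by simp)]
      simp
    · have hZ0 : (0:ℝ) < Z := by exact_mod_cast hZ
      have hZc : (Z:ℂ) ≠ 0 := by exact_mod_cast hZ0.ne'
      have h1 : ∀ t : ℝ, (Z:ℂ) ^ (σ + t * Complex.I + 1 : ℂ) *
          (1 / (n : ℂ) ^ (σ + t * Complex.I : ℂ)) * κ t
          = Z * (((n / Z : ℝ) : ℂ) ^ (-(σ + t * Complex.I)) * κ t) := by
        intro t
        rw [Complex.cpow_add _ _ hZc, Complex.cpow_one, Complex.cpow_neg]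
        have : (((n / Z : ℝ)) : ℂ) ^ (σ + t * Complex.I : ℂ)
            = (n:ℂ) ^ (σ + t * Complex.I : ℂ) / (Z:ℂ) ^ (σ + t * Complex.I : ℂ) := by
          have := Complex.mul_cpow_ofReal_nonneg (a := n / Z) (b := Z) (by positivity) hZ0.le
            (σ + t * Complex.I)
          rw [eq_div_iff (by simp [Complex.cpow_eq_zero_iff, hZc])]
          rw [← Complex.ofReal_natCast Z, ← this, ← Complex.ofReal_mul, div_mul_cancel₀ _ hZ0.ne']
          simp
        rw [this]
        have h2 : (Z:ℂ) ^ (σ + t * Complex.I : ℂ) ≠ 0 := by simp [Complex.cpow_eq_zero_iff, hZc]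
        have h3 : (n:ℂ) ^ (σ + t * Complex.I : ℂ) ≠ 0 := by simp [Complex.cpow_eq_zero_iff, hn]
        field_simp
      simp_rw [h1]
      constructor
      · rw [integral_const_mul, hκ, integral_cpow_max_one_sub hσ (by positivity)]
        have : max ((Z:ℝ) - n) 0 = Z * max (1 - (n:ℝ) / Z) 0 := by
          rw [mul_max_of_nonneg _ _ hZ0.le]
          congr 1
          · field_simp
          · simp
        rw [this]; push_cast; ring
      · refine Integrable.const_mul ?_ _
        refine hκi.bdd_mul (c := ((n:ℝ) / Z) ^ (-σ)) ?_ (Filter.Eventually.of_forall fun t => ?_)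
        · refine Continuous.aestronglyMeasurable ?_
          refine Continuous.const_cpow (by fun_prop) (Or.inl ?_)
          exact_mod_cast (by positivity : (n:ℝ) / Z ≠ 0)
        · rw [Complex.norm_cpow_eq_rpow_re_of_pos (by positivity)]; simp
  have hsplit : ∀ t : ℝ, perronKernel X (σ + t * Complex.I) * (1 / (n : ℂ) ^ (σ + t * Complex.I : ℂ))
      = ((X + 1 : ℕ):ℂ) ^ (σ + t * Complex.I + 1 : ℂ) * (1 / (n : ℂ) ^ (σ + t * Complex.I : ℂ)) * κ t
      - (X:ℂ) ^ (σ + t * Complex.I + 1 : ℂ) * (1 / (n : ℂ) ^ (σ + t * Complex.I : ℂ)) * κ t := by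
    intro t
    rw [perronKernel, hκ]; ring
  simp_rw [hsplit]
  rw [integral_sub (hZ _).2 (hZ _).2, (hZ _).1, (hZ _).1]
  split_ifs with h
  · have h1 : (n:ℝ) ≤ X := by exact_mod_cast h
    rw [max_eq_left (by push_cast; linarith), max_eq_left (by linarith)]
    push_cast; ring
  · have h1 : (X:ℝ) + 1 ≤ n := by exact_mod_cast Nat.lt_of_not_le h
    rw [max_eq_right (by push_cast; linarith), max_eq_right (by linarith)]
    simp

/-- Perron's formula on a line of absolute convergence. -/
lemma integral_perronKernel_mul_LSeries {a : ℕ → ℂ} {σ : ℝ} (hσ : 1 / 2 ≤ σ)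
    (hs : LSeriesSummable a σ) (X : ℕ) :
    ∫ t : ℝ, perronKernel X (σ + t * Complex.I) * LSeries a (σ + t * Complex.I)
      = 2 * Real.pi * ∑ n ∈ Finset.Icc 1 X, a n := by
  rw [integral_mul_LSeries hs (integrable_perronKernel X hσ), tsum_eq_sum (s := Finset.Icc 1 X),
    Finset.mul_sum]
  · refine Finset.sum_congr rfl fun n hn => ?_
    have hn' := Finset.mem_Icc.1 hn
    have hn0 : n ≠ 0 := by omega
    have := integral_perronKernel_mul (X := X) hn0 (σ := σ) (by linarith)
    rw [if_pos hn'.2] at this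
    simp_rw [LSeries.term_of_ne_zero hn0]
    have h2 : ∀ t : ℝ, perronKernel X (σ + t * Complex.I) * (a n / (n : ℂ) ^ (σ + t * Complex.I : ℂ))
        = a n * (perronKernel X (σ + t * Complex.I) * (1 / (n : ℂ) ^ (σ + t * Complex.I : ℂ))) := by
      intro t; ring
    simp_rw [h2]
    rw [integral_const_mul, this]; ring
  · intro n hn
    rcases eq_or_ne n 0 with rfl | hn0
    · simp
    · have hnX : ¬ n ≤ X := fun h => hn (Finset.mem_Icc.2 ⟨Nat.one_le_iff_ne_zero.2 hn0, h⟩)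
      have := integral_perronKernel_mul (X := X) hn0 (σ := σ) (by linarith)
      rw [if_neg hnX, mul_zero] at this
      simp_rw [LSeries.term_of_ne_zero hn0]
      have h2 : ∀ t : ℝ, perronKernel X (σ + t * Complex.I) * (a n / (n : ℂ) ^ (σ + t * Complex.I : ℂ))
          = a n * (perronKernel X (σ + t * Complex.I) * (1 / (n : ℂ) ^ (σ + t * Complex.I : ℂ))) := by
        intro t; ring
      simp_rw [h2]
      rw [integral_const_mul, this, mul_zero]

/-- Perron's formula after moving the line of integration to the left, for a Dirichlet series with
analytic continuation of subpolynomial growth. -/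
theorem sum_eq_perron {a : ℕ → ℂ} (ha : ∀ n, ‖a n‖ ≤ 1) {F : ℂ → ℂ} {σ C θ : ℝ} (hσ : 1 / 2 ≤ σ)
    (hσ2 : σ ≤ 2) (hθ1 : θ < 1)
    (hd : DifferentiableOn ℂ F {s | σ ≤ s.re})
    (hb : ∀ s : ℂ, σ ≤ s.re → ‖F s‖ ≤ C * (1 + |s.im|) ^ θ)
    (hF : ∀ s : ℂ, s.re = 2 → F s = LSeries a s) (X : ℕ) :
    2 * Real.pi * ∑ n ∈ Finset.Icc 1 X, a n
      = ∫ t : ℝ, perronKernel X (σ + t * Complex.I) * F (σ + t * Complex.I) := by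
  have hC : 0 ≤ C := by
    by_contra h
    have := (norm_nonneg _).trans (hb σ (by simp))
    simp at this; exact h this
  have hshift := integral_vertical_shift (F := fun s => perronKernel X s * F s) (σ₁ := σ) (σ₂ := 2)
    (C := 32 * ((X : ℝ) + 1) ^ (3 : ℝ) * C) (θ := 1 - θ) hσ2 (by linarith)
    (((differentiableOn_perronKernel X).mono (fun s hs => by
        have : σ ≤ s.re := hs.1
        show 0 < s.re; linarith)).mul (hd.mono (fun s hs => hs.1)))
    (fun s h1 h2 => by
      rw [norm_mul]
      have hk := norm_perronKernel_le (X := X) (s := s) (θ := 1) (by linarith) zero_le_one le_rfl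
      have hX : (1:ℝ) ≤ (X:ℝ) + 1 := by linarith [(Nat.cast_nonneg X : (0:ℝ) ≤ X)]
      have hp : ((X : ℝ) + 1) ^ (s.re + 1) ≤ ((X : ℝ) + 1) ^ (3:ℝ) :=
        Real.rpow_le_rpow_of_exponent_le hX (by linarith)
      have hT : 0 < 1 + |s.im| := by positivity
      calc ‖perronKernel X s‖ * ‖F s‖
          ≤ (32 * ((X : ℝ) + 1) ^ (3:ℝ) * (1 + |s.im|) ^ (-(1 + 1) : ℝ)) * (C * (1 + |s.im|) ^ θ) := by
            have := hb s h1
            gcongr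
            exact hk.trans (by gcongr)
        _ = 32 * ((X : ℝ) + 1) ^ (3:ℝ) * C * ((1 + |s.im|) ^ (-(1 + 1) : ℝ) * (1 + |s.im|) ^ θ) := by
            ring
        _ = _ := by
            rw [← Real.rpow_add hT]; congr 2; ring)
  rw [hshift]
  have hs2 : LSeriesSummable a ((2:ℝ):ℂ) :=
    LSeriesSummable_of_bounded_of_one_lt_re (m := 1) (fun n _ => ha n) (by simp)
  have := integral_perronKernel_mul_LSeries (by norm_num) hs2 X
  rw [← this]
  congr 1; ext t
  rw [hF _ (by simp)]

/-- The bound for partial sums that Perron's formula provides. -/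
theorem norm_sum_le_of_perron {a : ℕ → ℂ} (ha : ∀ n, ‖a n‖ ≤ 1) {F : ℂ → ℂ} {σ C C' θ : ℝ}
    (hσ : 1 / 2 ≤ σ) (hσ2 : σ ≤ 2) (hθ0 : 0 < θ) (hθ1 : θ ≤ 1 / 2)
    (hd : DifferentiableOn ℂ F {s | σ ≤ s.re})
    (hb : ∀ s : ℂ, σ ≤ s.re → ‖F s‖ ≤ C * (1 + |s.im|) ^ θ)
    (hb' : ∀ s : ℂ, s.re = σ → ‖F s‖ ≤ C' * (1 + |s.im|) ^ θ)
    (hF : ∀ s : ℂ, s.re = 2 → F s = LSeries a s) (X : ℕ) :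
    ‖∑ n ∈ Finset.Icc 1 X, a n‖ ≤ 32 * tailIntegral θ * C' * ((X : ℝ) + 1) ^ (σ + 2 * θ) := by
  have hC' : 0 ≤ C' := by
    have := (norm_nonneg _).trans (hb' σ (by simp))
    simpa using this
  have h := sum_eq_perron ha hσ hσ2 (by linarith) hd hb hF X
  have hbound : ‖∫ t : ℝ, perronKernel X (σ + t * Complex.I) * F (σ + t * Complex.I)‖
      ≤ 32 * ((X : ℝ) + 1) ^ (σ + 2 * θ) * C' * tailIntegral θ := by
    rw [tailIntegral, ← integral_const_mul]
    refine norm_integral_le_of_norm_le ((integrable_one_add_abs hθ0).const_mul _)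
      (Filter.Eventually.of_forall fun t => ?_)
    have hk := norm_perronKernel_le (X := X) (s := σ + t * Complex.I) (θ := 2 * θ)
      (by simpa using hσ) (by linarith) (by linarith)
    have hf := hb' (σ + t * Complex.I) (by simp)
    have hre : (σ + t * Complex.I : ℂ).re = σ := by simp
    have him : (σ + t * Complex.I : ℂ).im = t := by simp
    rw [hre, him] at hk
    rw [him] at hf
    have hT : 0 < 1 + |t| := by positivity
    rw [norm_mul]
    calc _ ≤ (32 * ((X : ℝ) + 1) ^ (σ + 2 * θ) * (1 + |t|) ^ (-(1 + 2 * θ))) *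
          (C' * (1 + |t|) ^ θ) := by gcongr
      _ = 32 * ((X : ℝ) + 1) ^ (σ + 2 * θ) * C' * ((1 + |t|) ^ (-(1 + 2 * θ)) * (1 + |t|) ^ θ) := by
          ring
      _ = _ := by rw [← Real.rpow_add hT]; congr 2; ring
  rw [← h, norm_mul] at hbound
  have h2 : (1:ℝ) ≤ ‖(2 * Real.pi : ℂ)‖ := by
    rw [norm_mul, Complex.norm_real, Real.norm_of_nonneg Real.pi_pos.le]
    norm_num
    linarith [Real.pi_gt_three]
  calc _ ≤ ‖(2 * Real.pi : ℂ)‖ * ‖∑ n ∈ Finset.Icc 1 X, a n‖ :=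
        le_mul_of_one_le_left (norm_nonneg _) h2
    _ ≤ _ := hbound
    _ = _ := by ring

/-! ### The Möbius and Liouville functions as convolutions over squares -/

/-- The arithmetic function equal to `κ d` at `d ^ 2` and to zero off the squares. -/
def sqLift (κ : ℕ → ℝ) (n : ℕ) : ℂ := if n.sqrt ^ 2 = n then (κ n.sqrt : ℂ) else 0

/-- The convolution `∑_{d² m = n} κ(d) μ(m)`. It interpolates between `μ` (for `κ` the indicator
of `1`) and `λ` (for `κ = 1`). -/
def sqConv (κ : ℕ → ℝ) (n : ℕ) : ℂ :=
  ∑ p ∈ n.divisorsAntidiagonal, sqLift κ p.1 * (ArithmeticFunction.moebius p.2 : ℂ)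

lemma sqLift_sq (κ : ℕ → ℝ) (d : ℕ) : sqLift κ (d ^ 2) = κ d := by
  simp [sqLift, Nat.sqrt_eq']

lemma eq_of_sq_mul_squarefree {d e m b : ℕ} (hd : d ≠ 0) (he : e ≠ 0) (hm : Squarefree m)
    (hb : Squarefree b) (h : e ^ 2 * b = d ^ 2 * m) : e = d := by
  refine Nat.eq_of_factorization_eq he hd (fun p => ?_)
  have h1 := congrArg (fun n => n.factorization p) h
  simp only [Nat.factorization_mul (pow_ne_zero 2 he) hb.ne_zero,
    Nat.factorization_mul (pow_ne_zero 2 hd) hm.ne_zero, Nat.factorization_pow,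
    Finsupp.add_apply, Finsupp.smul_apply, smul_eq_mul] at h1
  have h2 := hm.natFactorization_le_one p
  have h3 := hb.natFactorization_le_one p
  omega

lemma sqConv_apply (κ : ℕ → ℝ) {d m : ℕ} (hd : d ≠ 0) (hm : Squarefree m) :
    sqConv κ (d ^ 2 * m) = κ d * (ArithmeticFunction.moebius m : ℂ) := by
  have hm0 := hm.ne_zero
  rw [sqConv, Finset.sum_eq_single (d ^ 2, m)]
  · rw [sqLift_sq]
  · rintro ⟨a, b⟩ hab hne
    rw [Nat.mem_divisorsAntidiagonal] at hab
    by_contra hcon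
    rw [mul_eq_zero, not_or] at hcon
    have hb : Squarefree b := by
      rw [← ArithmeticFunction.moebius_ne_zero_iff_squarefree]
      exact_mod_cast hcon.2
    have ha : a.sqrt ^ 2 = a := by
      by_contra h; exact hcon.1 (by simp [sqLift, h])
    have ha0 : a ≠ 0 := by rintro rfl; simp at hab; tauto
    have hs : a.sqrt ≠ 0 := by
      intro h; rw [h] at ha; simp at ha; exact ha0 ha.symm
    have hab' : a * b = d ^ 2 * m := hab.1
    have : a.sqrt = d := eq_of_sq_mul_squarefree hd hs hm hb (by rw [ha]; exact hab')
    have ha2 : a = d ^ 2 := by rw [← ha, this]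
    apply hne
    rw [ha2] at hab'
    exact Prod.ext ha2 (Nat.eq_of_mul_eq_mul_left (by positivity) hab')
  · intro h
    exact absurd (Nat.mem_divisorsAntidiagonal.2 ⟨rfl, mul_ne_zero (pow_ne_zero 2 hd) hm0⟩) h

lemma exists_sq_mul_squarefree {n : ℕ} (hn : n ≠ 0) :
    ∃ d m : ℕ, d ≠ 0 ∧ Squarefree m ∧ n = d ^ 2 * m := by
  obtain ⟨m, d, hm, hd, h, hsq⟩ := Nat.sq_mul_squarefree_of_pos (Nat.pos_of_ne_zero hn)
  exact ⟨d, m, hd.ne', hsq, h.symm⟩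

lemma norm_moebius_le_one (n : ℕ) : ‖(ArithmeticFunction.moebius n : ℂ)‖ ≤ 1 := by
  rw [Complex.norm_intCast]
  exact_mod_cast ArithmeticFunction.abs_moebius_le_one (n := n)

lemma norm_sqConv_le {κ : ℕ → ℝ} (hκ : ∀ d, |κ d| ≤ 1) (n : ℕ) : ‖sqConv κ n‖ ≤ 1 := by
  rcases eq_or_ne n 0 with rfl | hn
  · simp [sqConv]
  · obtain ⟨d, m, hd, hm, rfl⟩ := exists_sq_mul_squarefree hn
    rw [sqConv_apply κ hd hm, norm_mul, Complex.norm_real]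
    exact mul_le_one₀ (hκ d) (norm_nonneg _) (norm_moebius_le_one m)

lemma liouville_eq_sqConv {n : ℕ} (hn : n ≠ 0) :
    (ArithmeticFunction.liouville n : ℂ) = sqConv (fun _ => 1) n := by
  obtain ⟨d, m, hd, hm, rfl⟩ := exists_sq_mul_squarefree hn
  rw [sqConv_apply _ hd hm, ArithmeticFunction.liouville_apply_mul, sq,
    ArithmeticFunction.liouville_apply_mul, ArithmeticFunction.liouville_apply hd,
    ArithmeticFunction.liouville_apply hm.ne_zero,
    ArithmeticFunction.moebius_apply_of_squarefree hm]
  have : ((-1 : ℤ) ^ ArithmeticFunction.cardFactors d) * (-1) ^ ArithmeticFunction.cardFactors d = 1 := by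
    rw [← mul_pow]; simp
  rw [this]; simp

lemma moebius_eq_sqConv {n : ℕ} (hn : n ≠ 0) :
    (ArithmeticFunction.moebius n : ℂ) = sqConv (fun d => if d = 1 then 1 else 0) n := by
  obtain ⟨d, m, hd, hm, rfl⟩ := exists_sq_mul_squarefree hn
  rw [sqConv_apply _ hd hm]
  rcases eq_or_ne d 1 with rfl | h1
  · simp
  · have : ¬ Squarefree (d ^ 2 * m) := by
      intro h
      have := h d ⟨m, by ring⟩
      exact h1 (Nat.isUnit_iff.1 this)
    rw [ArithmeticFunction.moebius_eq_zero_of_not_squarefree this]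
    simp [h1]

lemma sqConv_add (κ κ' : ℕ → ℝ) (n : ℕ) :
    sqConv (fun d => κ d + κ' d) n = sqConv κ n + sqConv κ' n := by
  rw [sqConv, sqConv, sqConv, ← Finset.sum_add_distrib]
  refine Finset.sum_congr rfl fun p _ => ?_
  unfold sqLift
  split_ifs
  · push_cast; ring
  · ring

/-- Partial sums of `sqConv κ` against a completely multiplicative function, in terms of partial
sums of the Möbius function. -/
lemma sum_sqConv_mul {f : ℕ → ℂ} (hf : ∀ m n : ℕ, m ≠ 0 → n ≠ 0 → f (m * n) = f m * f n)
    (κ : ℕ → ℝ) (X : ℕ) :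
    ∑ n ∈ Finset.Icc 1 X, sqConv κ n * f n
      = ∑ d ∈ Finset.Icc 1 X, κ d * f (d ^ 2) *
          ∑ m ∈ Finset.Icc 1 (X / d ^ 2), (ArithmeticFunction.moebius m : ℂ) * f m := by
  simp_rw [sqConv, Finset.sum_mul, Finset.mul_sum]
  rw [Finset.sum_sigma', Finset.sum_sigma']
  symm
  refine Finset.sum_of_injOn (fun x => ⟨x.1 ^ 2 * x.2, (x.1 ^ 2, x.2)⟩) ?_ ?_ ?_ ?_
  · rintro ⟨d, m⟩ h1 ⟨e, k⟩ h2 h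
    simp only [Sigma.mk.injEq, heq_eq_eq, Prod.mk.injEq] at h
    have hde : d = e := Nat.pow_left_injective (n := 2) (by norm_num) h.2.1
    subst hde
    simp [h.2.2]
  · rintro ⟨d, m⟩ h
    simp only [Finset.coe_sigma, Set.mem_sigma_iff, Finset.mem_coe, Finset.mem_Icc] at h ⊢
    have hd2 : 0 < d ^ 2 := pow_pos h.1.1 2
    refine ⟨⟨Nat.mul_pos hd2 h.2.1, ?_⟩, ?_⟩
    · rw [mul_comm]; exact (Nat.le_div_iff_mul_le hd2).1 h.2.2
    · rw [Nat.mem_divisorsAntidiagonal]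
      exact ⟨rfl, (Nat.mul_pos hd2 h.2.1).ne'⟩
  · rintro ⟨n, a, b⟩ h hn
    simp only [Finset.mem_sigma, Finset.mem_Icc, Nat.mem_divisorsAntidiagonal] at h
    obtain ⟨⟨hn1, hnX⟩, hab, -⟩ := h
    simp only
    by_cases ha : a.sqrt ^ 2 = a
    · exfalso
      apply hn
      have ha0 : 0 < a := Nat.pos_of_ne_zero (by rintro rfl; simp at hab; omega)
      have hb0 : 0 < b := Nat.pos_of_ne_zero (by rintro rfl; simp at hab; omega)
      have hs0 : 0 < a.sqrt := Nat.sqrt_pos.2 ha0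
      refine ⟨⟨a.sqrt, b⟩, ?_, ?_⟩
      · simp only [Finset.coe_sigma, Set.mem_sigma_iff, Finset.mem_coe, Finset.mem_Icc]
        refine ⟨⟨hs0, ?_⟩, hb0, ?_⟩
        · calc a.sqrt ≤ a := Nat.sqrt_le_self a
            _ ≤ a * b := Nat.le_mul_of_pos_right a hb0
            _ ≤ X := by rw [hab]; exact hnX
        · rw [ha, Nat.le_div_iff_mul_le ha0, mul_comm, hab]; exact hnX
      · simp only [ha, hab]
    · simp [sqLift, ha]
  · rintro ⟨d, m⟩ h
    simp only [Finset.mem_sigma, Finset.mem_Icc] at h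
    simp only
    rw [sqLift_sq, hf _ _ (pow_pos h.1.1 2).ne' (by omega)]
    ring

lemma LSeriesSummable_of_norm_le_one {a : ℕ → ℂ} (ha : ∀ n, ‖a n‖ ≤ 1) {s : ℂ} (hs : 1 < s.re) :
    LSeriesSummable a s :=
  LSeriesSummable_of_bounded_of_one_lt_re (m := 1) (fun n _ => ha n) hs

lemma norm_sqLift_le {κ : ℕ → ℝ} (hκ : ∀ d, |κ d| ≤ 1) (n : ℕ) : ‖sqLift κ n‖ ≤ 1 := by
  unfold sqLift
  split_ifs
  · rw [Complex.norm_real]; exact hκ _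
  · simp

lemma norm_char_mul_le {r : ℕ} [NeZero r] (χ : DirichletCharacter ℂ r) {a : ℕ → ℂ}
    (ha : ∀ n, ‖a n‖ ≤ 1) (n : ℕ) : ‖χ (n : ZMod r) * a n‖ ≤ 1 := by
  rw [norm_mul]
  exact mul_le_one₀ (χ.norm_le_one _) (norm_nonneg _) (ha n)

lemma LSeries_char_mul_sqLift {r : ℕ} [NeZero r] (χ : DirichletCharacter ℂ r) (κ : ℕ → ℝ)
    (s : ℂ) :
    LSeries (fun n => χ (n : ZMod r) * sqLift κ n) s
      = LSeries (fun d => (χ ^ 2) (d : ZMod r) * (κ d : ℂ)) (2 * s) := by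
  have hinj : Function.Injective (fun d : ℕ => d ^ 2) := Nat.pow_left_injective (by norm_num)
  rw [LSeries, LSeries, ← hinj.tsum_eq]
  · refine tsum_congr fun d => ?_
    rcases eq_or_ne d 0 with rfl | hd
    · simp
    · rw [LSeries.term_of_ne_zero (pow_ne_zero 2 hd), LSeries.term_of_ne_zero hd, sqLift_sq,
        MulChar.pow_apply' χ two_ne_zero]
      have hdc : (d:ℂ) ≠ 0 := by exact_mod_cast hd
      push_cast
      rw [map_pow, sq (d:ℂ), Complex.natCast_mul_natCast_cpow, two_mul, Complex.cpow_add _ _ hdc]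
  · intro n hn
    by_contra h
    apply hn
    have : ¬ n.sqrt ^ 2 = n := fun h' => h ⟨n.sqrt, h'⟩
    rcases eq_or_ne n 0 with rfl | hn0
    · simp
    · rw [LSeries.term_of_ne_zero hn0]; simp [sqLift, this]

lemma LSeries_char_mul_sqConv {r : ℕ} [NeZero r] (χ : DirichletCharacter ℂ r) {κ : ℕ → ℝ}
    (hκ : ∀ d, |κ d| ≤ 1) {s : ℂ} (hs : 1 < s.re) :
    LSeries (fun n => χ (n : ZMod r) * sqConv κ n) s
      = LSeries (fun d => (χ ^ 2) (d : ZMod r) * (κ d : ℂ)) (2 * s) * recipL χ s := by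
  have h1 := LSeriesSummable_of_norm_le_one (norm_char_mul_le χ (norm_sqLift_le hκ)) hs
  have h2 := LSeriesSummable_of_norm_le_one (norm_char_mul_le χ norm_moebius_le_one) hs
  rw [← LSeries_char_mul_sqLift, recipL_eq_LSeries χ hs, ← LSeries_convolution' h1 h2]
  congr 1
  rw [LSeries.convolution_def]
  ext n
  rw [sqConv, Finset.mul_sum]
  refine Finset.sum_congr rfl fun p hp => ?_
  rw [Nat.mem_divisorsAntidiagonal] at hp
  rw [← hp.1]
  push_cast
  rw [map_mul]
  ring

lemma differentiableOn_LSeries_of_norm_le_one {a : ℕ → ℂ} (ha : ∀ n, ‖a n‖ ≤ 1) :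
    DifferentiableOn ℂ (LSeries a) {s | 1 < s.re} := by
  refine (LSeries_differentiableOn a).mono (fun s hs => ?_)
  have hs' : 1 < s.re := hs
  have : LSeries.abscissaOfAbsConv a ≤ 1 :=
    LSeries.abscissaOfAbsConv_le_of_le_const ⟨1, fun n _ => ha n⟩
  show LSeries.abscissaOfAbsConv a < s.re
  exact lt_of_le_of_lt this (by exact_mod_cast hs')

theorem exists_recipL_bound (hGRH : ∀ (r : ℕ) [Fact r.Prime], GRH r) {η : ℝ} (hη : 0 < η) :
    ∃ C : ℝ, 0 < C ∧ ∀ (r : ℕ) [Fact r.Prime] (χ : DirichletCharacter ℂ r) (s : ℂ),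
      1 / 2 + η ≤ s.re → ‖recipL χ s‖ ≤ C * (r * (1 + |s.im|)) ^ η := by
  obtain ⟨C, hC, H⟩ := exists_regL_bound hGRH hη
  exact ⟨C, hC, fun r _ χ s hs =>
    (norm_recipL_le χ (by linarith)).trans (H r χ s hs).2⟩

/-- On the Riemann Hypothesis, cancellation in the Dirichlet series with coefficients
`ψ(d) min(1, d / D)`, just to the right of the line of absolute convergence: the weight
`min(1, d / D)` is a vertical integral of `(D / d) ^ w / (w (w + 1))`, and the line of integration
moves to `Re w = -1/2` without meeting a pole. -/
theorem exists_weighted_series_bound (hGRH : ∀ (r : ℕ) [Fact r.Prime], GRH r) {ε : ℝ}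
    (hε : 0 < ε) (hε' : ε ≤ 1 / 4) :
    ∃ C : ℝ, 0 < C ∧ ∀ (r : ℕ) [Fact r.Prime] (ψ : DirichletCharacter ℂ r), ψ ≠ 1 →
      ∀ D : ℝ, 1 ≤ D → ∀ s : ℂ, s.re = 1 + 2 * ε →
        ‖LSeries (fun d => ψ (d : ZMod r) * ((min 1 ((d : ℝ) / D) : ℝ) : ℂ)) s‖
          ≤ C * D ^ (-(1 / 2) : ℝ) * (r * (1 + |s.im|)) ^ ε := by
  obtain ⟨C, hC, H⟩ := exists_regL_bound hGRH hε
  refine ⟨4 / ε ^ 2 * C * tailIntegral (1 - ε) + 1, by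
    have := tailIntegral_nonneg (1 - ε); positivity, ?_⟩
  intro r _ ψ hψ D hD s hs
  have hD0 : 0 < D := by linarith
  have hr1 : (1:ℝ) ≤ r := by exact_mod_cast (Fact.out : r.Prime).one_lt.le
  set G : ℂ → ℂ := fun w => (D:ℂ) ^ w * (1 / (w * (w + 1))) * DirichletCharacter.LFunction ψ (s + w)
    with hG
  have hGb : ∀ w : ℂ, -(1/2) ≤ w.re → w.re ≤ -ε →
      ‖G w‖ ≤ D ^ w.re * (4 / ε ^ 2 * C * (r * (1 + |s.im|)) ^ ε) * (1 + |w.im|) ^ (-(1 + (1 - ε))) := by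
    intro w h1 h2
    have hk := norm_inv_mul_add_one_le (s := w) (c := ε) hε (by linarith)
      (by rw [abs_of_nonpos (by linarith)]; linarith) (by rw [abs_of_nonneg (by linarith)]; linarith)
    have hl := (H r ψ (s + w) (by simp [hs]; linarith)).1
    rw [regL, if_neg hψ] at hl
    have hT : 0 < 1 + |w.im| := by positivity
    have him : r * (1 + |(s + w).im|) ≤ r * (1 + |s.im|) * (1 + |w.im|) := by
      rw [mul_assoc]
      refine mul_le_mul_of_nonneg_left ?_ (by linarith)
      have := abs_add_le s.im w.im
      rw [Complex.add_im]
      nlinarith [mul_nonneg (abs_nonneg s.im) (abs_nonneg w.im)]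
    rw [hG]
    simp only [norm_mul]
    rw [Complex.norm_cpow_eq_rpow_re_of_pos hD0]
    calc _ ≤ D ^ w.re * (4 / ε ^ 2 * (1 + |w.im|) ^ (-(1 + 1) : ℝ)) *
          (C * (r * (1 + |s.im|) * (1 + |w.im|)) ^ ε) := by
          refine mul_le_mul (mul_le_mul_of_nonneg_left hk (by positivity)) (hl.trans ?_)
            (norm_nonneg _) (by positivity)
          gcongr
      _ = D ^ w.re * (4 / ε ^ 2 * C * (r * (1 + |s.im|)) ^ ε) *
          ((1 + |w.im|) ^ (-(1 + 1) : ℝ) * (1 + |w.im|) ^ ε) := by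
          rw [Real.mul_rpow (by positivity) hT.le]; ring
      _ = _ := by rw [← Real.rpow_add hT]; congr 2; ring
  have hGd : DifferentiableOn ℂ G {w | -(1/2) ≤ w.re ∧ w.re ≤ -ε} := by
    intro w hw
    have hw0 : w ≠ 0 := by rintro rfl; have := hw.2; simp at this; linarith
    have hw1 : w + 1 ≠ 0 := by
      intro h; have := congrArg Complex.re h; simp at this; have := hw.1; linarith
    refine DifferentiableAt.differentiableWithinAt ?_
    refine DifferentiableAt.mul (DifferentiableAt.mul ?_ ?_) ?_
    · exact DifferentiableAt.const_cpow differentiableAt_id (Or.inl (by exact_mod_cast hD0.ne'))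
    · exact (differentiableAt_const _).div (by fun_prop) (mul_ne_zero hw0 hw1)
    · exact ((DirichletCharacter.differentiable_LFunction hψ).differentiableAt).comp w (by fun_prop)
  have hbase : 0 ≤ 4 / ε ^ 2 * C * (r * (1 + |s.im|)) ^ ε := by positivity
  have hshift := integral_vertical_shift (F := G) (σ₁ := -(1/2)) (σ₂ := -ε)
    (C := 4 / ε ^ 2 * C * (r * (1 + |s.im|)) ^ ε) (θ := 1 - ε) (by linarith) (by linarith) hGd
    (fun w h1 h2 => (hGb w h1 h2).trans (by
      have : D ^ w.re ≤ 1 := Real.rpow_le_one_of_one_le_of_nonpos hD (by linarith)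
      exact mul_le_mul_of_nonneg_right (mul_le_of_le_one_left hbase this) (by positivity)))
  have hmain : ∫ t : ℝ, G (((-ε : ℝ) : ℂ) + t * Complex.I) = -(2 * Real.pi *
      LSeries (fun d => ψ (d : ZMod r) * ((min 1 ((d : ℝ) / D) : ℝ) : ℂ)) s) := by
    have hre : 1 < (s + ((-ε : ℝ) : ℂ)).re := by simp [hs]; linarith
    have hsum : LSeriesSummable (fun d => ψ (d : ZMod r)) (s + ((-ε : ℝ) : ℂ)) :=
      ψ.LSeriesSummable_of_one_lt_re hre
    have hK : Integrable fun t : ℝ => (D:ℂ) ^ (((-ε : ℝ) : ℂ) + t * Complex.I) *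
        (1 / ((((-ε : ℝ) : ℂ) + t * Complex.I) * (((-ε : ℝ) : ℂ) + t * Complex.I + 1))) := by
      refine (verticalIntegrable_inv (σ := -ε) (by linarith) (by linarith)).bdd_mul
        (c := D ^ (-ε)) ?_ (Filter.Eventually.of_forall fun t => ?_)
      · refine Continuous.aestronglyMeasurable ?_
        exact Continuous.const_cpow (by fun_prop) (Or.inl (by exact_mod_cast hD0.ne'))
      · rw [Complex.norm_cpow_eq_rpow_re_of_pos hD0]; simp
    have h1 := integral_mul_LSeries hsum hK
    have h2 : ∀ t : ℝ, G (((-ε : ℝ) : ℂ) + t * Complex.I) =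
        (D:ℂ) ^ (((-ε : ℝ) : ℂ) + t * Complex.I) *
        (1 / ((((-ε : ℝ) : ℂ) + t * Complex.I) * (((-ε : ℝ) : ℂ) + t * Complex.I + 1))) *
        LSeries (fun d => ψ (d : ZMod r)) (s + ((-ε : ℝ) : ℂ) + t * Complex.I) := by
      intro t
      rw [hG]
      simp only
      rw [← add_assoc, DirichletCharacter.LFunction_eq_LSeries _ (by simpa using hre)]
    simp_rw [h2]
    rw [h1, LSeries, ← tsum_mul_left, ← tsum_neg]
    refine tsum_congr fun n => ?_
    rcases eq_or_ne n 0 with rfl | hn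
    · simp
    · have hn0 : (0:ℝ) < n := by exact_mod_cast Nat.pos_of_ne_zero hn
      have hnc : (n:ℂ) ≠ 0 := by exact_mod_cast hn
      have hDc : (D:ℂ) ≠ 0 := by exact_mod_cast hD0.ne'
      simp_rw [LSeries.term_of_ne_zero hn]
      have h3 : ∀ t : ℝ, (D:ℂ) ^ (((-ε : ℝ) : ℂ) + t * Complex.I) *
          (1 / ((((-ε : ℝ) : ℂ) + t * Complex.I) * (((-ε : ℝ) : ℂ) + t * Complex.I + 1))) *
          (ψ (n : ZMod r) / (n:ℂ) ^ (s + ((-ε : ℝ) : ℂ) + t * Complex.I))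
          = ψ (n : ZMod r) / (n:ℂ) ^ s * ((((n / D : ℝ)) : ℂ) ^ (-(((-ε : ℝ) : ℂ) + t * Complex.I)) *
          (1 / ((((-ε : ℝ) : ℂ) + t * Complex.I) * (((-ε : ℝ) : ℂ) + t * Complex.I + 1)))) := by
        intro t
        set w : ℂ := ((-ε : ℝ) : ℂ) + t * Complex.I with hw
        have e1 : (((n / D : ℝ)) : ℂ) ^ (-w) = (D:ℂ) ^ w / (n:ℂ) ^ w := by
          have e2 := Complex.mul_cpow_ofReal_nonneg (a := n / D) (b := D) (by positivity) hD0.le w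
          rw [← Complex.ofReal_mul, div_mul_cancel₀ _ hD0.ne', Complex.ofReal_natCast] at e2
          rw [Complex.cpow_neg, e2]
          have : (((n / D : ℝ)) : ℂ) ^ w ≠ 0 := by
            rw [Complex.cpow_ne_zero_iff]; left; exact_mod_cast (by positivity : (n:ℝ) / D ≠ 0)
          have : (D:ℂ) ^ w ≠ 0 := by rw [Complex.cpow_ne_zero_iff]; left; exact hDc
          field_simp
        rw [e1, add_assoc s, ← hw, Complex.cpow_add _ _ hnc]
        ring
      simp_rw [h3]
      rw [integral_const_mul, integral_cpow_min_one (by linarith) (by linarith) (by positivity)]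
      ring
  have hle : ‖∫ t : ℝ, G (((-(1/2) : ℝ) : ℂ) + t * Complex.I)‖ ≤
      D ^ (-(1/2) : ℝ) * (4 / ε ^ 2 * C * (r * (1 + |s.im|)) ^ ε) * tailIntegral (1 - ε) := by
    rw [tailIntegral, ← integral_const_mul]
    refine norm_integral_le_of_norm_le ((integrable_one_add_abs (by linarith)).const_mul _)
      (Filter.Eventually.of_forall fun t => ?_)
    have := hGb (((-(1/2) : ℝ) : ℂ) + t * Complex.I) (by simp) (by simp; linarith)
    simpa using this
  rw [hshift, hmain, norm_neg, norm_mul] at hle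
  have h2 : (1:ℝ) ≤ ‖(2 * Real.pi : ℂ)‖ := by
    rw [norm_mul, Complex.norm_real, Real.norm_of_nonneg Real.pi_pos.le]
    norm_num
    linarith [Real.pi_gt_three]
  have h3 : 0 ≤ D ^ (-(1/2) : ℝ) * (r * (1 + |s.im|)) ^ ε := by positivity
  calc _ ≤ _ := le_mul_of_one_le_left (norm_nonneg _) h2
    _ ≤ _ := hle
    _ ≤ _ := by linarith

/-- On the Riemann Hypothesis, square-root cancellation in the partial sums of `χ` twisted by a
convolution over squares. -/
theorem exists_sqConv_sum_bound (hGRH : ∀ (r : ℕ) [Fact r.Prime], GRH r) {ε : ℝ} (hε : 0 < ε)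
    (hε' : ε ≤ 1 / 4) :
    ∃ C : ℝ, 0 < C ∧ ∀ (r : ℕ) [Fact r.Prime] (χ : DirichletCharacter ℂ r) (κ : ℕ → ℝ),
      (∀ d, |κ d| ≤ 1) → ∀ X : ℕ,
        ‖∑ n ∈ Finset.Icc 1 X, χ (n : ZMod r) * sqConv κ n‖
          ≤ C * (r : ℝ) ^ ε * ((X : ℝ) + 1) ^ (1 / 2 + 3 * ε) := by
  obtain ⟨C, hC, H⟩ := exists_recipL_bound hGRH hε
  set Z : ℝ := ∑' n : ℕ, 1 / (n : ℝ) ^ (1 + 2 * ε) with hZ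
  have hZ1 : 1 ≤ Z := one_le_zetaSum (by linarith)
  refine ⟨32 * tailIntegral ε * (Z * C) + 1, by
    have := tailIntegral_nonneg ε; positivity, fun r _ χ κ hκ X => ?_⟩
  have hκ' : ∀ d, ‖(κ d : ℂ)‖ ≤ 1 := fun d => by rw [Complex.norm_real]; exact hκ d
  have hbound : ∀ s : ℂ, 1 / 2 + ε ≤ s.re →
      ‖LSeries (fun d => (χ ^ 2) (d : ZMod r) * (κ d : ℂ)) (2 * s) * recipL χ s‖
        ≤ Z * C * (r : ℝ) ^ ε * (1 + |s.im|) ^ ε := by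
    intro s hs
    rw [norm_mul]
    have h1 := norm_LSeries_le (norm_char_mul_le (χ ^ 2) hκ') (σ := 1 + 2 * ε) (s := 2 * s)
      (by linarith) (by simp; linarith)
    have h2 := H r χ s hs
    rw [Real.mul_rpow (by positivity) (by positivity)] at h2
    calc _ ≤ Z * (C * ((r : ℝ) ^ ε * (1 + |s.im|) ^ ε)) := by gcongr
      _ = _ := by ring
  have := norm_sum_le_of_perron (a := fun n => χ (n : ZMod r) * sqConv κ n)
    (norm_char_mul_le χ (norm_sqConv_le hκ))
    (F := fun s => LSeries (fun d => (χ ^ 2) (d : ZMod r) * (κ d : ℂ)) (2 * s) * recipL χ s)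
    (σ := 1 / 2 + ε) (C := Z * C * (r : ℝ) ^ ε) (C' := Z * C * (r : ℝ) ^ ε) (θ := ε)
    (by linarith) (by linarith) hε (by linarith)
    (by
      refine DifferentiableOn.mul ?_ ((differentiableOn_recipL (hGRH r) χ).mono (fun s hs => ?_))
      · refine (differentiableOn_LSeries_of_norm_le_one (norm_char_mul_le (χ ^ 2) hκ')).comp
          (by fun_prop) (fun s hs => ?_)
        have : 1 / 2 + ε ≤ s.re := hs
        show 1 < (2 * s).re
        simp; linarith
      · have : 1 / 2 + ε ≤ s.re := hs
        show 1 / 2 < s.re; linarith)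
    hbound (fun s hs => hbound s hs.ge)
    (fun s hs => (LSeries_char_mul_sqConv χ hκ (by rw [hs]; norm_num)).symm) X
  refine this.trans ?_
  rw [show 1 / 2 + ε + 2 * ε = 1 / 2 + 3 * ε by ring]
  have h0 : 0 ≤ (r : ℝ) ^ ε * ((X : ℝ) + 1) ^ (1 / 2 + 3 * ε) := by positivity
  nlinarith

/-- The contribution of large squares is small, for characters whose square is nonprincipal. -/
theorem exists_sqConv_tail_bound (hGRH : ∀ (r : ℕ) [Fact r.Prime], GRH r) {ε : ℝ} (hε : 0 < ε)
    (hε' : ε ≤ 1 / 4) :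
    ∃ C : ℝ, 0 < C ∧ ∀ (r : ℕ) [Fact r.Prime] (χ : DirichletCharacter ℂ r), χ ^ 2 ≠ 1 →
      ∀ D : ℝ, 1 ≤ D → ∀ X : ℕ,
        ‖∑ n ∈ Finset.Icc 1 X, χ (n : ZMod r) * sqConv (fun d => min 1 ((d : ℝ) / D)) n‖
          ≤ C * D ^ (-(1 / 2) : ℝ) * (r : ℝ) ^ (2 * ε) * ((X : ℝ) + 1) ^ (1 / 2 + 5 * ε) := by
  obtain ⟨C, hC, H⟩ := exists_recipL_bound hGRH hε
  obtain ⟨B, hB, HB⟩ := exists_weighted_series_bound hGRH hε hε'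
  set Z : ℝ := ∑' n : ℕ, 1 / (n : ℝ) ^ (1 + 2 * ε) with hZ
  have hZ1 : 1 ≤ Z := one_le_zetaSum (by linarith)
  refine ⟨32 * tailIntegral (2 * ε) * (2 * B * C) + 1, by
    have := tailIntegral_nonneg (2 * ε); positivity, fun r _ χ hχ D hD X => ?_⟩
  have hD0 : 0 < D := by linarith
  set κ : ℕ → ℝ := fun d => min 1 ((d : ℝ) / D) with hκdef
  have hκ : ∀ d, |κ d| ≤ 1 := fun d => by
    rw [hκdef, abs_of_nonneg (by positivity)]; exact min_le_left _ _
  have hκ' : ∀ d, ‖(κ d : ℂ)‖ ≤ 1 := fun d => by rw [Complex.norm_real]; exact hκ d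
  have hbound : ∀ s : ℂ, 1 / 2 + ε ≤ s.re →
      ‖LSeries (fun d => (χ ^ 2) (d : ZMod r) * (κ d : ℂ)) (2 * s) * recipL χ s‖
        ≤ Z * C * (r : ℝ) ^ ε * (1 + |s.im|) ^ (2 * ε) := by
    intro s hs
    rw [norm_mul]
    have h1 := norm_LSeries_le (norm_char_mul_le (χ ^ 2) hκ') (σ := 1 + 2 * ε) (s := 2 * s)
      (by linarith) (by simp; linarith)
    have h2 := H r χ s hs
    rw [Real.mul_rpow (by positivity) (by positivity)] at h2
    have h3 : (1 + |s.im|) ^ ε ≤ (1 + |s.im|) ^ (2 * ε) :=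
      Real.rpow_le_rpow_of_exponent_le (by linarith [abs_nonneg s.im]) (by linarith)
    calc _ ≤ Z * (C * ((r : ℝ) ^ ε * (1 + |s.im|) ^ (2 * ε))) := by
          gcongr
          exact h2.trans (by gcongr)
      _ = _ := by ring
  have hline : ∀ s : ℂ, s.re = 1 / 2 + ε →
      ‖LSeries (fun d => (χ ^ 2) (d : ZMod r) * (κ d : ℂ)) (2 * s) * recipL χ s‖
        ≤ 2 * B * C * D ^ (-(1 / 2) : ℝ) * (r : ℝ) ^ (2 * ε) * (1 + |s.im|) ^ (2 * ε) := by
    intro s hs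
    rw [norm_mul]
    have h1 := HB r (χ ^ 2) hχ D hD (2 * s) (by simp [hs]; ring)
    have h2 := H r χ s hs.ge
    have hT : 0 < 1 + |s.im| := by positivity
    have h3 : ((r:ℝ) * (1 + |(2 * s).im|)) ^ ε ≤ 2 * ((r:ℝ) * (1 + |s.im|)) ^ ε := by
      calc ((r:ℝ) * (1 + |(2 * s).im|)) ^ ε ≤ (2 * ((r:ℝ) * (1 + |s.im|))) ^ ε := by
            refine Real.rpow_le_rpow (by positivity) ?_ hε.le
            have : |(2 * s).im| = 2 * |s.im| := by simp [abs_mul]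
            rw [this, mul_left_comm]
            gcongr
            linarith
        _ = 2 ^ ε * ((r:ℝ) * (1 + |s.im|)) ^ ε := Real.mul_rpow (by norm_num) (by positivity)
        _ ≤ 2 * ((r:ℝ) * (1 + |s.im|)) ^ ε := by
            gcongr
            calc (2:ℝ) ^ ε ≤ 2 ^ (1:ℝ) :=
                  Real.rpow_le_rpow_of_exponent_le (by norm_num) (by linarith)
              _ = 2 := by norm_num
    calc _ ≤ (B * D ^ (-(1 / 2) : ℝ) * (2 * ((r:ℝ) * (1 + |s.im|)) ^ ε)) *
          (C * ((r:ℝ) * (1 + |s.im|)) ^ ε) := by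
          gcongr
          exact h1.trans (by gcongr)
      _ = 2 * B * C * D ^ (-(1 / 2) : ℝ) *
          (((r:ℝ) * (1 + |s.im|)) ^ ε * ((r:ℝ) * (1 + |s.im|)) ^ ε) := by ring
      _ = _ := by
          have hr0 : (0:ℝ) < r := by exact_mod_cast (Fact.out : r.Prime).pos
          rw [← Real.rpow_add (by positivity), ← two_mul, Real.mul_rpow hr0.le hT.le]; ring
  have := norm_sum_le_of_perron (a := fun n => χ (n : ZMod r) * sqConv κ n)
    (norm_char_mul_le χ (norm_sqConv_le hκ))
    (F := fun s => LSeries (fun d => (χ ^ 2) (d : ZMod r) * (κ d : ℂ)) (2 * s) * recipL χ s)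
    (σ := 1 / 2 + ε) (C := Z * C * (r : ℝ) ^ ε)
    (C' := 2 * B * C * D ^ (-(1 / 2) : ℝ) * (r : ℝ) ^ (2 * ε)) (θ := 2 * ε)
    (by linarith) (by linarith) (by linarith) (by linarith)
    (by
      refine DifferentiableOn.mul ?_ ((differentiableOn_recipL (hGRH r) χ).mono (fun s hs => ?_))
      · refine (differentiableOn_LSeries_of_norm_le_one (norm_char_mul_le (χ ^ 2) hκ')).comp
          (by fun_prop) (fun s hs => ?_)
        have : 1 / 2 + ε ≤ s.re := hs
        show 1 < (2 * s).re
        simp; linarith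
      · have : 1 / 2 + ε ≤ s.re := hs
        show 1 / 2 < s.re; linarith)
    hbound hline
    (fun s hs => (LSeries_char_mul_sqConv χ hκ (by rw [hs]; norm_num)).symm) X
  refine this.trans ?_
  rw [show 1 / 2 + ε + 2 * (2 * ε) = 1 / 2 + 5 * ε by ring]
  have h0 : 0 ≤ D ^ (-(1 / 2) : ℝ) * (r : ℝ) ^ (2 * ε) * ((X : ℝ) + 1) ^ (1 / 2 + 5 * ε) := by
    positivity
  nlinarith

/-! ### Steinhaus random multiplicative functions -/

instance : IsProbabilityMeasure steinhausMeasure := by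
  unfold steinhausMeasure; infer_instance

lemma steinhaus_eq_prod (θ : Nat.Primes → UnitAddCircle) {n N : ℕ} (hn : n ≤ N) :
    steinhaus θ n = ∏ p ∈ (Finset.range (N + 1)).subtype Nat.Prime,
      (AddCircle.toCircle (θ p) : ℂ) ^ (n.factorization p) := by
  unfold steinhaus
  rw [Finsupp.prod_of_support_subset (s := Finset.range (N + 1))]
  · rw [← Finset.prod_subset (Finset.filter_subset Nat.Prime (Finset.range (N + 1)))]
    · rw [← Finset.prod_subtype_eq_prod_filter]
      refine Finset.prod_congr rfl fun p _ => ?_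
      rw [dif_pos p.2]
    · intro p hp hp'
      have : ¬ p.Prime := fun h => hp' (Finset.mem_filter.2 ⟨hp, h⟩)
      rw [dif_neg this]
  · intro p hp
    have := Nat.le_of_mem_primeFactors (by simpa using hp : p ∈ n.primeFactors)
    simp; omega
  · intro p _
    split_ifs <;> simp

lemma steinhaus_one (θ : Nat.Primes → UnitAddCircle) : steinhaus θ 1 = 1 := by
  simp [steinhaus]

lemma steinhaus_mul (θ : Nat.Primes → UnitAddCircle) {m n : ℕ} (hm : m ≠ 0) (hn : n ≠ 0) :
    steinhaus θ (m * n) = steinhaus θ m * steinhaus θ n := by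
  have h1 : m ≤ m * n := Nat.le_mul_of_pos_right _ (Nat.pos_of_ne_zero hn)
  have h2 : n ≤ m * n := Nat.le_mul_of_pos_left _ (Nat.pos_of_ne_zero hm)
  rw [steinhaus_eq_prod θ le_rfl, steinhaus_eq_prod θ h1, steinhaus_eq_prod θ h2,
    ← Finset.prod_mul_distrib]
  refine Finset.prod_congr rfl fun p _ => ?_
  rw [Nat.factorization_mul hm hn, Finsupp.add_apply, pow_add]

lemma norm_steinhaus (θ : Nat.Primes → UnitAddCircle) (n : ℕ) : ‖steinhaus θ n‖ = 1 := by
  rw [steinhaus_eq_prod θ le_rfl, norm_prod]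
  exact Finset.prod_eq_one fun p _ => by rw [norm_pow, Circle.norm_coe, one_pow]

lemma measurable_steinhaus (n : ℕ) : Measurable fun θ => steinhaus θ n := by
  simp_rw [fun θ => steinhaus_eq_prod θ (le_refl n)]
  refine Finset.measurable_prod _ fun p _ => ?_
  refine Measurable.pow_const ?_ _
  exact (continuous_subtype_val.comp (AddCircle.continuous_toCircle (T := 1))).measurable.comp
    (measurable_pi_apply p)

/-- A completely multiplicative function on the positive integers. -/
structure IsMult (f : ℕ → ℂ) : Prop where
  map_one : f 1 = 1
  map_mul : ∀ m n : ℕ, m ≠ 0 → n ≠ 0 → f (m * n) = f m * f n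

lemma isMult_steinhaus (θ : Nat.Primes → UnitAddCircle) : IsMult (steinhaus θ) :=
  ⟨steinhaus_one θ, fun _ _ => steinhaus_mul θ⟩

lemma IsMult.coprimePart {f : ℕ → ℂ} (hf : IsMult f) (r : ℕ) : IsMult (coprimePart r f) := by
  refine ⟨by simp [TwistedRatios.coprimePart, hf.map_one], fun m n hm hn => ?_⟩
  simp only [TwistedRatios.coprimePart, Nat.coprime_mul_iff_left, hf.map_mul m n hm hn]
  split_ifs <;> simp_all

lemma isMult_character {r : ℕ} (χ : DirichletCharacter ℂ r) :
    IsMult (fun n => χ (n : ZMod r)) :=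
  ⟨by simp, fun m n _ _ => by push_cast; exact map_mul _ _ _⟩

lemma integral_fourier (k : ℤ) :
    ∫ x : UnitAddCircle, fourier k x ∂AddCircle.haarAddCircle = if k = 0 then 1 else 0 := by
  have h := congrFun (fourierCoeff_fourier (T := 1) k) 0
  rw [fourierCoeff] at h
  simp only [neg_zero, fourier_zero, one_smul] at h
  rw [h]
  rcases eq_or_ne k 0 with rfl | hk
  · simp
  · rw [Pi.single_eq_of_ne' hk, if_neg hk]

/-- Orthogonality of the values of a Steinhaus random multiplicative function. -/
lemma integral_steinhaus_mul_star {m n : ℕ} (hm : m ≠ 0) (hn : n ≠ 0) :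
    ∫ θ, steinhaus θ m * star (steinhaus θ n) ∂steinhausMeasure = if m = n then 1 else 0 := by
  set N := max m n
  set s : Finset Nat.Primes := (Finset.range (N + 1)).subtype Nat.Prime with hs
  set k : Nat.Primes → ℤ := fun p => (m.factorization p : ℤ) - n.factorization p with hk
  have key : ∀ θ, steinhaus θ m * star (steinhaus θ n) =
      (fun y : s → UnitAddCircle => ∏ p : s, fourier (k p) (y p)) (s.restrict θ) := by
    intro θ
    rw [steinhaus_eq_prod θ (le_max_left m n), steinhaus_eq_prod θ (le_max_right m n), star_prod,
      ← Finset.prod_mul_distrib, ← hs]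
    change _ = ∏ p : s, (fun p : Nat.Primes => (fourier (k p) (θ p) : ℂ)) p
    rw [Finset.prod_coe_sort s (fun p : Nat.Primes => (fourier (k p) (θ p) : ℂ))]
    refine Finset.prod_congr rfl fun p _ => ?_
    have e1 : ∀ j : ℕ, (AddCircle.toCircle (θ p) : ℂ) ^ j = fourier (j : ℤ) (θ p) := by
      intro j
      rw [fourier_apply, AddCircle.toCircle_zsmul, zpow_natCast, Circle.coe_pow]
    rw [e1, e1, hk]
    simp only [sub_eq_add_neg]
    rw [fourier_add, fourier_neg]
    rfl
  rw [integral_congr_ae (Filter.Eventually.of_forall key)]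
  unfold steinhausMeasure
  refine (integral_restrict_infinitePi
    (μ := fun _ : Nat.Primes => (AddCircle.haarAddCircle : Measure UnitAddCircle)) (s := s)
    (f := fun y : s → UnitAddCircle => ∏ p : s, (fourier (k p) (y p) : ℂ)) ?_).trans ?_
  · refine Continuous.aestronglyMeasurable ?_
    refine continuous_finsetProd _ fun p _ => ?_
    exact (fourier (k p)).continuous.comp (continuous_apply p)
  · rw [integral_fintype_prod_eq_prod (fun (p : s) (x : UnitAddCircle) => (fourier (k p) x : ℂ))]
    simp_rw [integral_fourier]
    rw [Finset.prod_coe_sort s (fun p : Nat.Primes => if k p = 0 then (1 : ℂ) else 0)]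
    split_ifs with hmn
    · refine Finset.prod_eq_one fun p _ => ?_
      rw [if_pos]; simp [hk, hmn]
    · by_contra hne
      apply hmn
      refine Nat.eq_of_factorization_eq hm hn fun p => ?_
      by_cases hp : p.Prime
      · by_cases hpN : p ∈ Finset.range (N + 1)
        · have hps : (⟨p, hp⟩ : Nat.Primes) ∈ s := by
            rw [hs]; exact Finset.mem_subtype.2 hpN
          have h0 := Finset.prod_ne_zero_iff.1 hne ⟨p, hp⟩ hps
          by_contra h
          apply h0
          rw [if_neg]
          simp only [hk]
          omega
        · have h1 : N < p := by simpa using hpN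
          rw [Nat.factorization_eq_zero_of_lt (lt_of_le_of_lt (le_max_left m n) h1),
            Nat.factorization_eq_zero_of_lt (lt_of_le_of_lt (le_max_right m n) h1)]
      · rw [Nat.factorization_eq_zero_of_not_prime _ hp, Nat.factorization_eq_zero_of_not_prime _ hp]

lemma integrable_of_measurable_of_bounded {F : (Nat.Primes → UnitAddCircle) → ℂ}
    (hF : Measurable F) (B : ℝ) (hB : ∀ θ, ‖F θ‖ ≤ B) : Integrable F steinhausMeasure :=
  Integrable.of_bound hF.aestronglyMeasurable B (Filter.Eventually.of_forall hB)

lemma integrable_real_of_measurable_of_bounded {F : (Nat.Primes → UnitAddCircle) → ℝ}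
    (hF : Measurable F) (B : ℝ) (hB : ∀ θ, |F θ| ≤ B) : Integrable F steinhausMeasure :=
  Integrable.of_bound hF.aestronglyMeasurable B (Filter.Eventually.of_forall hB)

lemma integrable_steinhaus_mul_star (m n : ℕ) :
    Integrable (fun θ => steinhaus θ m * star (steinhaus θ n)) steinhausMeasure := by
  refine integrable_of_measurable_of_bounded
    ((measurable_steinhaus m).mul (continuous_star.measurable.comp (measurable_steinhaus n))) 1 fun θ => ?_
  rw [norm_mul, norm_star, norm_steinhaus, norm_steinhaus, one_mul]

/-- The twisted mean value of a product of two Dirichlet polynomials in a Steinhaus random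
multiplicative function. -/
lemma integral_twisted_sums {m₁ m₂ : ℕ} (hm₁ : m₁ ≠ 0) (hm₂ : m₂ ≠ 0) (S T : Finset ℕ)
    (hS : 0 ∉ S) (hT : 0 ∉ T) (a b : ℕ → ℂ) :
    ∫ θ, steinhaus θ m₁ * star (steinhaus θ m₂) * (∑ n ∈ S, a n * steinhaus θ n) *
        star (∑ n ∈ T, b n * steinhaus θ n) ∂steinhausMeasure =
      ∑ n ∈ S, ∑ k ∈ T, a n * star (b k) * (if m₁ * n = m₂ * k then 1 else 0) := by
  have hS' : ∀ n ∈ S, n ≠ 0 := fun n hn h => hS (h ▸ hn)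
  have hT' : ∀ n ∈ T, n ≠ 0 := fun n hn h => hT (h ▸ hn)
  have key : ∀ θ, steinhaus θ m₁ * star (steinhaus θ m₂) * (∑ n ∈ S, a n * steinhaus θ n) *
        star (∑ n ∈ T, b n * steinhaus θ n) = ∑ n ∈ S, ∑ k ∈ T, a n * star (b k) *
          (steinhaus θ (m₁ * n) * star (steinhaus θ (m₂ * k))) := by
    intro θ
    rw [star_sum, mul_assoc, Finset.sum_mul_sum, Finset.mul_sum]
    refine Finset.sum_congr rfl fun n hn => ?_
    rw [Finset.mul_sum]
    refine Finset.sum_congr rfl fun k hk => ?_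
    rw [steinhaus_mul θ hm₁ (hS' n hn), steinhaus_mul θ hm₂ (hT' k hk), star_mul', star_mul']
    ring
  simp_rw [key]
  have hint : ∀ n k : ℕ, Integrable (fun θ => a n * star (b k) *
      (steinhaus θ (m₁ * n) * star (steinhaus θ (m₂ * k)))) steinhausMeasure :=
    fun n k => (integrable_steinhaus_mul_star _ _).const_mul _
  rw [integral_finsetSum _ fun n _ => integrable_finsetSum _ fun k _ => hint n k]
  refine Finset.sum_congr rfl fun n hn => ?_
  rw [integral_finsetSum _ fun k _ => hint n k]
  refine Finset.sum_congr rfl fun k hk => ?_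
  rw [integral_const_mul, integral_steinhaus_mul_star (mul_ne_zero hm₁ (hS' n hn))
    (mul_ne_zero hm₂ (hT' k hk))]

/-- Parseval's identity for Dirichlet polynomials in a Steinhaus random multiplicative function. -/
lemma integral_norm_sq_sum (S : Finset ℕ) (hS : 0 ∉ S) (a : ℕ → ℂ) :
    ∫ θ, ‖∑ n ∈ S, a n * steinhaus θ n‖ ^ 2 ∂steinhausMeasure = ∑ n ∈ S, ‖a n‖ ^ 2 := by
  have h := integral_twisted_sums one_ne_zero one_ne_zero S S hS hS a a
  have e1 : ∀ θ, steinhaus θ 1 * star (steinhaus θ 1) * (∑ n ∈ S, a n * steinhaus θ n) *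
        star (∑ n ∈ S, a n * steinhaus θ n) = ((‖∑ n ∈ S, a n * steinhaus θ n‖ ^ 2 : ℝ) : ℂ) := by
    intro θ
    rw [steinhaus_one, star_one, one_mul, one_mul, Complex.star_def, Complex.mul_conj']
    push_cast; rfl
  have e2 : ∑ n ∈ S, ∑ k ∈ S, a n * star (a k) * (if 1 * n = 1 * k then (1 : ℂ) else 0) =
      ((∑ n ∈ S, ‖a n‖ ^ 2 : ℝ) : ℂ) := by
    push_cast
    refine Finset.sum_congr rfl fun n hn => ?_
    simp only [one_mul, mul_ite, mul_one, mul_zero]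
    rw [Finset.sum_ite_eq, if_pos hn, Complex.star_def, Complex.mul_conj']
  simp_rw [e1] at h
  rw [e2] at h
  exact Complex.ofReal_injective (integral_complex_ofReal.symm.trans h)

lemma coprimePart_eq_mul (r : ℕ) (f : ℕ → ℂ) (n : ℕ) :
    coprimePart r f n = (if n.Coprime r then 1 else 0) * f n := by
  unfold coprimePart
  split_ifs <;> simp

lemma norm_coprimePart_steinhaus_le (r : ℕ) (θ : Nat.Primes → UnitAddCircle) (n : ℕ) :
    ‖coprimePart r (steinhaus θ) n‖ ≤ 1 := by
  unfold coprimePart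
  split_ifs <;> simp [norm_steinhaus]

lemma measurable_coprimePart_steinhaus (r n : ℕ) :
    Measurable fun θ => coprimePart r (steinhaus θ) n := by
  unfold coprimePart
  split_ifs
  · exact measurable_steinhaus n
  · exact measurable_const

/-! ### From the Ratios Conjecture to twisted second moments of partial sums of `μ` -/

/-- The partial sum `∑_{n ≤ X} μ(n) f(n)`. -/
def moebiusSum (f : ℕ → ℂ) (X : ℕ) : ℂ :=
  ∑ n ∈ Finset.Icc 1 X, (ArithmeticFunction.moebius n : ℂ) * f n

lemma moebiusSum_star (f : ℕ → ℂ) (X : ℕ) :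
    moebiusSum (fun n => star (f n)) X = star (moebiusSum f X) := by
  simp [moebiusSum, star_sum]

lemma two_pi_mul_moebiusSum (hGRH : ∀ (r : ℕ) [Fact r.Prime], GRH r) {ε : ℝ} (hε : 0 < ε)
    (hε' : ε ≤ 1 / 2) (r : ℕ) [Fact r.Prime] (χ : DirichletCharacter ℂ r) (X : ℕ) :
    2 * Real.pi * moebiusSum (fun n => χ (n : ZMod r)) X =
      ∫ t : ℝ, perronKernel X ((1 / 2 + ε : ℝ) + t * Complex.I) *
        recipL χ ((1 / 2 + ε : ℝ) + t * Complex.I) := by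
  obtain ⟨C, hC, hCb⟩ := exists_recipL_bound hGRH hε
  have hr : (0:ℝ) < r := by exact_mod_cast (Fact.out : r.Prime).pos
  have h := sum_eq_perron (a := fun n => χ (n : ZMod r) * (ArithmeticFunction.moebius n : ℂ))
    (norm_char_mul_le χ norm_moebius_le_one) (F := recipL χ) (σ := 1 / 2 + ε) (C := C * (r : ℝ) ^ ε)
    (θ := ε) (by linarith) (by linarith) (by linarith)
    ((differentiableOn_recipL (hGRH r) χ).mono fun s hs => by
      simp only [Set.mem_ofPred_eq] at hs ⊢; linarith)
    (fun s hs => by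
      refine (hCb r χ s hs).trans_eq ?_
      rw [Real.mul_rpow hr.le (by positivity)]; ring)
    (fun s hs => recipL_eq_LSeries χ (by rw [hs]; norm_num)) X
  rw [← h, moebiusSum]
  simp_rw [mul_comm (χ _)]

lemma integrable_perronKernel_mul_recipL (hGRH : ∀ (r : ℕ) [Fact r.Prime], GRH r) {ε : ℝ}
    (hε : 0 < ε) (hε' : ε ≤ 1 / 2) (r : ℕ) [Fact r.Prime] (χ : DirichletCharacter ℂ r) (X : ℕ) :
    Integrable fun t : ℝ => perronKernel X ((1 / 2 + ε : ℝ) + t * Complex.I) *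
        recipL χ ((1 / 2 + ε : ℝ) + t * Complex.I) := by
  obtain ⟨C, hC, hCb⟩ := exists_recipL_bound hGRH hε
  have hr : (0:ℝ) < r := by exact_mod_cast (Fact.out : r.Prime).pos
  refine integrable_vertical (F := fun s => perronKernel X s * recipL χ s) (θ := 2 * ε - ε)
    (C := (32 * ((X : ℝ) + 1) ^ (1 / 2 + ε + 2 * ε)) * (C * (r : ℝ) ^ ε)) (by linarith) ?_ ?_
  · refine (continuous_perronKernel X (by linarith)).mul ?_
    refine continuous_vertical (differentiableOn_recipL (hGRH r) χ).continuousOn fun t => ?_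
    simp; linarith
  · intro t
    have hk := norm_perronKernel_le (X := X) (s := (1 / 2 + ε : ℝ) + t * Complex.I) (θ := 2 * ε)
      (by simp; linarith) (by linarith) (by linarith)
    have hl := hCb r χ ((1 / 2 + ε : ℝ) + t * Complex.I) (by simp)
    have e1 : ((1 / 2 + ε : ℝ) + t * Complex.I : ℂ).re = 1 / 2 + ε := by simp
    have e2 : ((1 / 2 + ε : ℝ) + t * Complex.I : ℂ).im = t := by simp
    rw [e1, e2] at hk
    rw [e2] at hl
    have ht : 0 < 1 + |t| := by positivity
    rw [norm_mul]
    refine (mul_le_mul hk hl (norm_nonneg _) (by positivity)).trans_eq ?_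
    rw [Real.mul_rpow hr.le ht.le, show -(1 + (2 * ε - ε)) = -(1 + 2 * ε) + ε by ring,
      Real.rpow_add ht]
    ring

/-- The coefficient of `n₁^{-s₁} n₂^{-s₂}` in `steinhausTwist`. -/
def twistCoeff (r m₁ m₂ : ℕ) (n : ℕ × ℕ) : ℂ :=
  ∫ θ, coprimePart r (steinhaus θ) m₁ * star (coprimePart r (steinhaus θ) m₂) *
        ((ArithmeticFunction.moebius n.1 : ℂ) * coprimePart r (steinhaus θ) n.1) *
        star ((ArithmeticFunction.moebius n.2 : ℂ) * coprimePart r (steinhaus θ) n.2)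
      ∂steinhausMeasure

lemma norm_twist_integrand_le (r m₁ m₂ : ℕ) (n : ℕ × ℕ) (θ : Nat.Primes → UnitAddCircle) :
    ‖coprimePart r (steinhaus θ) m₁ * star (coprimePart r (steinhaus θ) m₂) *
        ((ArithmeticFunction.moebius n.1 : ℂ) * coprimePart r (steinhaus θ) n.1) *
        star ((ArithmeticFunction.moebius n.2 : ℂ) * coprimePart r (steinhaus θ) n.2)‖ ≤ 1 := by
  have h := norm_coprimePart_steinhaus_le r θ
  rw [norm_mul, norm_mul, norm_mul, norm_star, norm_star, norm_mul, norm_mul]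
  have h1 := mul_le_one₀ (h m₁) (norm_nonneg _) (h m₂)
  have h2 := mul_le_one₀ (norm_moebius_le_one n.1) (norm_nonneg _) (h n.1)
  have h3 := mul_le_one₀ (norm_moebius_le_one n.2) (norm_nonneg _) (h n.2)
  exact mul_le_one₀ (mul_le_one₀ h1 (by positivity) h2) (by positivity) h3

lemma integrable_twist_integrand (r m₁ m₂ : ℕ) (n : ℕ × ℕ) :
    Integrable (fun θ => coprimePart r (steinhaus θ) m₁ * star (coprimePart r (steinhaus θ) m₂) *
        ((ArithmeticFunction.moebius n.1 : ℂ) * coprimePart r (steinhaus θ) n.1) *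
        star ((ArithmeticFunction.moebius n.2 : ℂ) * coprimePart r (steinhaus θ) n.2))
      steinhausMeasure := by
  have h := measurable_coprimePart_steinhaus r
  have hs : ∀ {g : (Nat.Primes → UnitAddCircle) → ℂ}, Measurable g →
      Measurable fun θ => star (g θ) := fun hg => continuous_star.measurable.comp hg
  exact integrable_of_measurable_of_bounded
    ((((h m₁).mul (hs (h m₂))).mul ((h n.1).const_mul _)).mul (hs ((h n.2).const_mul _))) 1
    (norm_twist_integrand_le r m₁ m₂ n)

lemma norm_twistCoeff_le (r m₁ m₂ : ℕ) (n : ℕ × ℕ) : ‖twistCoeff r m₁ m₂ n‖ ≤ 1 := by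
  have := norm_integral_le_of_norm_le_const (μ := steinhausMeasure)
    (Filter.Eventually.of_forall (norm_twist_integrand_le r m₁ m₂ n))
  simpa [twistCoeff] using this

lemma twistCoeff_support {r m₁ m₂ : ℕ} (hm₁ : m₁ ≠ 0) (hm₂ : m₂ ≠ 0) {n : ℕ × ℕ}
    (h : twistCoeff r m₁ m₂ n ≠ 0) : m₁ * n.1 = m₂ * n.2 ∧ n.1 ≠ 0 ∧ n.2 ≠ 0 := by
  have h1 : n.1 ≠ 0 := by
    intro h0; apply h; simp [twistCoeff, h0]
  have h2 : n.2 ≠ 0 := by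
    intro h0; apply h; simp [twistCoeff, h0]
  refine ⟨?_, h1, h2⟩
  by_contra hne
  apply h
  unfold twistCoeff
  have key : ∀ θ, coprimePart r (steinhaus θ) m₁ * star (coprimePart r (steinhaus θ) m₂) *
        ((ArithmeticFunction.moebius n.1 : ℂ) * coprimePart r (steinhaus θ) n.1) *
        star ((ArithmeticFunction.moebius n.2 : ℂ) * coprimePart r (steinhaus θ) n.2) =
      ((if m₁.Coprime r then 1 else 0) * star (if m₂.Coprime r then 1 else 0) *
        ((ArithmeticFunction.moebius n.1 : ℂ) * (if n.1.Coprime r then 1 else 0)) *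
        star ((ArithmeticFunction.moebius n.2 : ℂ) * (if n.2.Coprime r then 1 else 0))) *
        (steinhaus θ (m₁ * n.1) * star (steinhaus θ (m₂ * n.2))) := by
    intro θ
    rw [coprimePart_eq_mul r _ m₁, coprimePart_eq_mul r _ m₂, coprimePart_eq_mul r _ n.1,
      coprimePart_eq_mul r _ n.2, steinhaus_mul θ hm₁ h1, steinhaus_mul θ hm₂ h2]
    simp only [star_mul']
    ring
  simp_rw [key]
  rw [integral_const_mul, integral_steinhaus_mul_star (mul_ne_zero hm₁ h1) (mul_ne_zero hm₂ h2),
    if_neg hne, mul_zero]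

/-- The series defining `steinhausTwist` converges absolutely: its terms are supported on the
line `m₁ n₁ = m₂ n₂`. -/
lemma summable_twistCoeff (r : ℕ) {m₁ m₂ : ℕ} (hm₁ : m₁ ≠ 0) (hm₂ : m₂ ≠ 0) {σ : ℝ}
    (hσ : 1 / 2 < σ) :
    Summable fun n : ℕ × ℕ => ‖twistCoeff r m₁ m₂ n‖ * ((n.1 : ℝ) ^ (-σ) * (n.2 : ℝ) ^ (-σ)) := by
  have hm : (0:ℝ) < m₂ := by exact_mod_cast Nat.pos_of_ne_zero hm₂
  have hs : Summable fun k : ℕ => (m₂ : ℝ) ^ σ * (k : ℝ) ^ (-(2 * σ)) :=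
    (Real.summable_nat_rpow.2 (by linarith)).mul_left _
  set ι : ℕ → ℕ × ℕ := fun k => (k, m₁ * k / m₂) with hι
  have hinj : Function.Injective ι := fun a b hab => (Prod.ext_iff.1 hab).1
  refine (hinj.summable_iff ?_).1 ?_
  · intro n hn
    by_contra h0
    have hne : twistCoeff r m₁ m₂ n ≠ 0 := by
      intro h; apply h0; rw [h, norm_zero, zero_mul]
    obtain ⟨h1, -, -⟩ := twistCoeff_support hm₁ hm₂ hne
    refine hn ⟨n.1, ?_⟩
    rw [hι]
    refine Prod.ext rfl ?_
    simp only
    rw [h1, Nat.mul_div_cancel_left _ (Nat.pos_of_ne_zero hm₂)]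
  · refine Summable.of_nonneg_of_le (fun k => by simp only [Function.comp_apply]; positivity) (fun k => ?_) hs
    simp only [Function.comp_apply]
    by_cases hne : twistCoeff r m₁ m₂ (ι k) = 0
    · rw [hne, norm_zero, zero_mul]; positivity
    obtain ⟨h1, h2, h3⟩ := twistCoeff_support hm₁ hm₂ hne
    have hk : (0:ℝ) < (ι k).1 := by exact_mod_cast Nat.pos_of_ne_zero h2
    have hk' : (0:ℝ) < (ι k).2 := by exact_mod_cast Nat.pos_of_ne_zero h3
    have hle : ((ι k).1 : ℝ) ≤ m₂ * (ι k).2 := by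
      have : (ι k).1 ≤ m₂ * (ι k).2 := h1 ▸ Nat.le_mul_of_pos_left _ (Nat.pos_of_ne_zero hm₁)
      exact_mod_cast this
    have h4 : ((ι k).2 : ℝ) ^ (-σ) ≤ (m₂ : ℝ) ^ σ * ((ι k).1 : ℝ) ^ (-σ) := by
      have : ((m₂ : ℝ) * (ι k).2) ^ (-σ) ≤ ((ι k).1 : ℝ) ^ (-σ) :=
        Real.rpow_le_rpow_of_nonpos hk hle (by linarith)
      rw [Real.mul_rpow hm.le hk'.le, Real.rpow_neg hm.le] at this
      rw [inv_mul_le_iff₀ (Real.rpow_pos_of_pos hm σ)] at this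
      exact this
    calc ‖twistCoeff r m₁ m₂ (ι k)‖ * (((ι k).1 : ℝ) ^ (-σ) * ((ι k).2 : ℝ) ^ (-σ))
        ≤ 1 * (((ι k).1 : ℝ) ^ (-σ) * ((m₂ : ℝ) ^ σ * ((ι k).1 : ℝ) ^ (-σ))) := by
          refine mul_le_mul (norm_twistCoeff_le _ _ _ _)
            (mul_le_mul_of_nonneg_left h4 (by positivity)) (by positivity) zero_le_one
      _ = (m₂ : ℝ) ^ σ * (((ι k).1 : ℝ) ^ (-σ) * ((ι k).1 : ℝ) ^ (-σ)) := by ring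
      _ = (m₂ : ℝ) ^ σ * (k : ℝ) ^ (-(2 * σ)) := by
          rw [← Real.rpow_add hk]; congr 2; ring

/-- The twisted mean value of two partial sums of `μ f*`. -/
lemma integral_twisted_moebiusSum (r m₁ m₂ X₁ X₂ : ℕ) :
    ∫ θ, coprimePart r (steinhaus θ) m₁ * star (coprimePart r (steinhaus θ) m₂) *
        moebiusSum (coprimePart r (steinhaus θ)) X₁ *
        star (moebiusSum (coprimePart r (steinhaus θ)) X₂) ∂steinhausMeasure =
      ∑ n ∈ Finset.Icc 1 X₁ ×ˢ Finset.Icc 1 X₂, twistCoeff r m₁ m₂ n := by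
  unfold twistCoeff
  rw [← integral_finsetSum _ fun n _ => integrable_twist_integrand r m₁ m₂ n]
  refine integral_congr_ae (Filter.Eventually.of_forall fun θ => ?_)
  simp only [moebiusSum]
  rw [star_sum, mul_assoc, Finset.sum_mul_sum, Finset.mul_sum, Finset.sum_product]
  refine Finset.sum_congr rfl fun n _ => ?_
  rw [Finset.mul_sum]
  refine Finset.sum_congr rfl fun k _ => ?_
  ring

lemma norm_natCast_cpow_mul {n k : ℕ} (hn : n ≠ 0) (hk : k ≠ 0) (s₁ s₂ : ℂ) (c : ℂ) :
    ‖c / ((n : ℂ) ^ s₁ * (k : ℂ) ^ s₂)‖ = ‖c‖ * ((n : ℝ) ^ (-s₁.re) * (k : ℝ) ^ (-s₂.re)) := by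
  rw [norm_div, norm_mul, Complex.norm_natCast_cpow_of_pos (Nat.pos_of_ne_zero hn),
    Complex.norm_natCast_cpow_of_pos (Nat.pos_of_ne_zero hk), Real.rpow_neg (Nat.cast_nonneg n),
    Real.rpow_neg (Nat.cast_nonneg k), ← mul_inv, div_eq_mul_inv]

lemma norm_twist_term {r m₁ m₂ : ℕ} (hm₁ : m₁ ≠ 0) (hm₂ : m₂ ≠ 0) (σ : ℝ) (n : ℕ × ℕ) (z : ℝ × ℝ) :
    ‖twistCoeff r m₁ m₂ n / ((n.1 : ℂ) ^ (σ + z.1 * Complex.I : ℂ) *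
      (n.2 : ℂ) ^ (σ + z.2 * Complex.I : ℂ))‖ =
      ‖twistCoeff r m₁ m₂ n‖ * ((n.1 : ℝ) ^ (-σ) * (n.2 : ℝ) ^ (-σ)) := by
  by_cases h0 : twistCoeff r m₁ m₂ n = 0
  · simp [h0]
  obtain ⟨-, h1, h2⟩ := twistCoeff_support hm₁ hm₂ h0
  rw [norm_natCast_cpow_mul h1 h2]
  simp

lemma continuous_twist_term {r m₁ m₂ : ℕ} (hm₁ : m₁ ≠ 0) (hm₂ : m₂ ≠ 0) (σ : ℝ) (n : ℕ × ℕ) :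
    Continuous fun z : ℝ × ℝ => twistCoeff r m₁ m₂ n / ((n.1 : ℂ) ^ (σ + z.1 * Complex.I : ℂ) *
      (n.2 : ℂ) ^ (σ + z.2 * Complex.I : ℂ)) := by
  by_cases h0 : twistCoeff r m₁ m₂ n = 0
  · simp only [h0, zero_div]; exact continuous_const
  obtain ⟨-, h1, h2⟩ := twistCoeff_support hm₁ hm₂ h0
  have h1' : (n.1 : ℂ) ≠ 0 := by exact_mod_cast h1
  have h2' : (n.2 : ℂ) ≠ 0 := by exact_mod_cast h2
  refine continuous_const.div (Continuous.mul ?_ ?_) fun z => ?_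
  · exact Continuous.const_cpow (by fun_prop) (Or.inl h1')
  · exact Continuous.const_cpow (by fun_prop) (Or.inl h2')
  · simp [Complex.cpow_eq_zero_iff, h1', h2']

lemma integrable_kernel_mul_steinhausTwist (r : ℕ) {m₁ m₂ : ℕ} (hm₁ : m₁ ≠ 0) (hm₂ : m₂ ≠ 0)
    {σ : ℝ} (hσ : 1 / 2 < σ) (X₁ X₂ : ℕ) :
    Integrable (fun z : ℝ × ℝ => (perronKernel X₁ (σ + z.1 * Complex.I) *
      perronKernel X₂ (σ + z.2 * Complex.I)) *
      steinhausTwist r m₁ m₂ (σ + z.1 * Complex.I) (σ + z.2 * Complex.I))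
      (volume.prod volume) := by
  have hk := (integrable_perronKernel X₁ hσ.le).mul_prod (integrable_perronKernel X₂ hσ.le)
  have hs := summable_twistCoeff r hm₁ hm₂ hσ
  have hc : Continuous fun z : ℝ × ℝ =>
      steinhausTwist r m₁ m₂ (σ + z.1 * Complex.I) (σ + z.2 * Complex.I) :=
    continuous_tsum (fun n => continuous_twist_term hm₁ hm₂ σ n) hs
      fun n z => (norm_twist_term hm₁ hm₂ σ n z).le
  refine hk.mul_bdd (c := ∑' n : ℕ × ℕ,
    ‖twistCoeff r m₁ m₂ n‖ * ((n.1 : ℝ) ^ (-σ) * (n.2 : ℝ) ^ (-σ))) hc.aestronglyMeasurable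
    (Filter.Eventually.of_forall fun z => ?_)
  exact tsum_of_norm_bounded hs.hasSum fun n => (norm_twist_term hm₁ hm₂ σ n z).le

/-- Perron's formula in two variables for `steinhausTwist`. -/
lemma integral_kernel_mul_steinhausTwist (r : ℕ) {m₁ m₂ : ℕ} (hm₁ : m₁ ≠ 0) (hm₂ : m₂ ≠ 0)
    {σ : ℝ} (hσ : 1 / 2 < σ) (X₁ X₂ : ℕ) :
    ∫ z : ℝ × ℝ, (perronKernel X₁ (σ + z.1 * Complex.I) *
      perronKernel X₂ (σ + z.2 * Complex.I)) *
      steinhausTwist r m₁ m₂ (σ + z.1 * Complex.I) (σ + z.2 * Complex.I) ∂(volume.prod volume) =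
    (2 * Real.pi) * (2 * Real.pi) *
      ∑ n ∈ Finset.Icc 1 X₁ ×ˢ Finset.Icc 1 X₂, twistCoeff r m₁ m₂ n := by
  have hk := (integrable_perronKernel X₁ hσ.le).mul_prod (integrable_perronKernel X₂ hσ.le)
  set F : ℕ × ℕ → ℝ × ℝ → ℂ := fun n z => (perronKernel X₁ (σ + z.1 * Complex.I) *
      perronKernel X₂ (σ + z.2 * Complex.I)) * (twistCoeff r m₁ m₂ n /
        ((n.1 : ℂ) ^ (σ + z.1 * Complex.I : ℂ) * (n.2 : ℂ) ^ (σ + z.2 * Complex.I : ℂ))) with hF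
  have hnorm : ∀ n z, ‖F n z‖ = ‖perronKernel X₁ (σ + z.1 * Complex.I) *
      perronKernel X₂ (σ + z.2 * Complex.I)‖ *
        (‖twistCoeff r m₁ m₂ n‖ * ((n.1 : ℝ) ^ (-σ) * (n.2 : ℝ) ^ (-σ))) := by
    intro n z
    rw [hF]; simp only
    rw [norm_mul, norm_twist_term hm₁ hm₂]
  have hint : ∀ n, Integrable (F n) (volume.prod volume) := fun n =>
    hk.mul_bdd (c := ‖twistCoeff r m₁ m₂ n‖ * ((n.1 : ℝ) ^ (-σ) * (n.2 : ℝ) ^ (-σ)))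
      (continuous_twist_term hm₁ hm₂ σ n).aestronglyMeasurable
      (Filter.Eventually.of_forall fun z => (norm_twist_term hm₁ hm₂ σ n z).le)
  have hsum : Summable fun n => ∫ z, ‖F n z‖ ∂(volume.prod volume) := by
    simp_rw [hnorm, integral_mul_const]
    exact (summable_twistCoeff r hm₁ hm₂ hσ).mul_left _
  have h := integral_tsum_of_summable_integral_norm hint hsum
  have e1 : ∀ z : ℝ × ℝ, ∑' n, F n z = (perronKernel X₁ (σ + z.1 * Complex.I) *
      perronKernel X₂ (σ + z.2 * Complex.I)) *
      steinhausTwist r m₁ m₂ (σ + z.1 * Complex.I) (σ + z.2 * Complex.I) := by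
    intro z
    rw [hF]; simp only
    rw [tsum_mul_left]
    rfl
  have e2 : ∀ n, ∫ z, F n z ∂(volume.prod volume) =
      (if n ∈ Finset.Icc 1 X₁ ×ˢ Finset.Icc 1 X₂ then
        (2 * Real.pi) * (2 * Real.pi) * twistCoeff r m₁ m₂ n else 0) := by
    intro n
    by_cases h0 : twistCoeff r m₁ m₂ n = 0
    · simp [hF, h0]
    obtain ⟨-, h1, h2⟩ := twistCoeff_support hm₁ hm₂ h0
    have e3 : ∀ z, F n z = twistCoeff r m₁ m₂ n *
        ((perronKernel X₁ (σ + z.1 * Complex.I) * (1 / (n.1 : ℂ) ^ (σ + z.1 * Complex.I : ℂ))) *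
        (perronKernel X₂ (σ + z.2 * Complex.I) * (1 / (n.2 : ℂ) ^ (σ + z.2 * Complex.I : ℂ)))) := by
      intro z
      rw [hF]; simp only
      rw [div_eq_mul_inv, mul_inv, one_div, one_div]; ring
    simp_rw [e3]
    rw [integral_const_mul, integral_prod_mul
      (fun t : ℝ => perronKernel X₁ (σ + t * Complex.I) * (1 / (n.1 : ℂ) ^ (σ + t * Complex.I : ℂ)))
      (fun t : ℝ => perronKernel X₂ (σ + t * Complex.I) * (1 / (n.2 : ℂ) ^ (σ + t * Complex.I : ℂ))),
      integral_perronKernel_mul h1 (by linarith), integral_perronKernel_mul h2 (by linarith)]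
    have h1' := Nat.one_le_iff_ne_zero.2 h1
    have h2' := Nat.one_le_iff_ne_zero.2 h2
    by_cases h3 : n.1 ≤ X₁ <;> by_cases h4 : n.2 ≤ X₂ <;>
      simp [Finset.mem_product, h3, h4, h1', h2']
    ring
  simp_rw [e1] at h
  rw [← h]
  simp_rw [e2]
  rw [tsum_eq_sum (s := Finset.Icc 1 X₁ ×ˢ Finset.Icc 1 X₂) (fun n hn => if_neg hn), Finset.mul_sum]
  exact Finset.sum_congr rfl fun n hn => if_pos hn

lemma star_character_apply {r : ℕ} (χ : DirichletCharacter ℂ r) (a : ZMod r) :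
    (star χ) a = star (χ a) := MulChar.star_apply χ a

lemma star_character_ne_one {r : ℕ} {χ : DirichletCharacter ℂ r} (hχ : χ ≠ 1) : star χ ≠ 1 := by
  intro h
  apply hχ
  ext a
  have := congrArg (fun ψ : DirichletCharacter ℂ r => star (ψ a)) h
  simp only [star_character_apply, star_star] at this
  rw [this, MulChar.one_apply_coe, star_one]

lemma kernel_mul_eq (K₁ K₂ c R₁ R₂ : ℂ) :
    (K₁ * K₂) * (c / (R₁⁻¹ * R₂⁻¹)) = c * ((K₁ * R₁) * (K₂ * R₂)) := by
  rw [div_eq_mul_inv, mul_inv, inv_inv, inv_inv]; ring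

lemma kernel_mul_nonprincipalAvg (r m₁ m₂ : ℕ) [Fact r.Prime] (K₁ K₂ s₁ s₂ : ℂ) :
    (K₁ * K₂) * nonprincipalAvg r (fun χ => χ m₁ * star (χ m₂) /
          (DirichletCharacter.LFunction χ s₁ * DirichletCharacter.LFunction (star χ) s₂)) =
      nonprincipalAvg r (fun χ => χ m₁ * star (χ m₂) *
        ((K₁ * recipL χ s₁) * (K₂ * recipL (star χ) s₂))) := by
  classical
  unfold nonprincipalAvg
  rw [← mul_div_assoc, Finset.mul_sum]
  congr 1
  refine Finset.sum_congr (by congr) fun χ hχ => ?_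
  have h1 : χ ≠ 1 := (Finset.mem_erase.1 hχ).1
  simp only
  rw [← kernel_mul_eq, recipL, recipL, if_neg h1, if_neg (star_character_ne_one h1), inv_inv,
    inv_inv]

/-- The Ratios Conjecture average integrated against two Perron kernels: integrability and the
value of the integral. -/
lemma integral_kernel_mul_nonprincipalAvg (hGRH : ∀ (r : ℕ) [Fact r.Prime], GRH r) {ε : ℝ}
    (hε : 0 < ε) (hε' : ε ≤ 1 / 2) (r m₁ m₂ : ℕ) [Fact r.Prime] (X₁ X₂ : ℕ) :
    Integrable (fun z : ℝ × ℝ => (perronKernel X₁ ((1 / 2 + ε : ℝ) + z.1 * Complex.I) *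
      perronKernel X₂ ((1 / 2 + ε : ℝ) + z.2 * Complex.I)) *
      nonprincipalAvg r (fun χ => χ m₁ * star (χ m₂) /
        (DirichletCharacter.LFunction χ ((1 / 2 + ε : ℝ) + z.1 * Complex.I) *
          DirichletCharacter.LFunction (star χ) ((1 / 2 + ε : ℝ) + z.2 * Complex.I))))
      (volume.prod volume) ∧
    ∫ z : ℝ × ℝ, (perronKernel X₁ ((1 / 2 + ε : ℝ) + z.1 * Complex.I) *
      perronKernel X₂ ((1 / 2 + ε : ℝ) + z.2 * Complex.I)) *
      nonprincipalAvg r (fun χ => χ m₁ * star (χ m₂) /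
        (DirichletCharacter.LFunction χ ((1 / 2 + ε : ℝ) + z.1 * Complex.I) *
          DirichletCharacter.LFunction (star χ) ((1 / 2 + ε : ℝ) + z.2 * Complex.I)))
        ∂(volume.prod volume) =
      (2 * Real.pi) * (2 * Real.pi) * nonprincipalAvg r (fun χ => χ m₁ * star (χ m₂) *
        moebiusSum (fun n => χ (n : ZMod r)) X₁ *
        star (moebiusSum (fun n => χ (n : ZMod r)) X₂)) := by
  classical
  simp_rw [kernel_mul_nonprincipalAvg]
  have hi : ∀ χ : DirichletCharacter ℂ r, Integrable (fun z : ℝ × ℝ => χ m₁ * star (χ m₂) *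
      ((perronKernel X₁ ((1 / 2 + ε : ℝ) + z.1 * Complex.I) *
        recipL χ ((1 / 2 + ε : ℝ) + z.1 * Complex.I)) *
      (perronKernel X₂ ((1 / 2 + ε : ℝ) + z.2 * Complex.I) *
        recipL (star χ) ((1 / 2 + ε : ℝ) + z.2 * Complex.I)))) (volume.prod volume) := fun χ =>
    ((integrable_perronKernel_mul_recipL hGRH hε hε' r χ X₁).mul_prod
      (integrable_perronKernel_mul_recipL hGRH hε hε' r (star χ) X₂)).const_mul _
  unfold nonprincipalAvg
  refine ⟨(integrable_finsetSum _ fun χ _ => hi χ).div_const _, ?_⟩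
  rw [integral_div, integral_finsetSum _ fun χ _ => hi χ, ← mul_div_assoc, Finset.mul_sum]
  congr 1
  refine Finset.sum_congr rfl fun χ _ => ?_
  rw [integral_const_mul, integral_prod_mul
    (fun t : ℝ => perronKernel X₁ ((1 / 2 + ε : ℝ) + t * Complex.I) *
        recipL χ ((1 / 2 + ε : ℝ) + t * Complex.I))
    (fun t : ℝ => perronKernel X₂ ((1 / 2 + ε : ℝ) + t * Complex.I) *
        recipL (star χ) ((1 / 2 + ε : ℝ) + t * Complex.I)),
    ← two_pi_mul_moebiusSum hGRH hε hε', ← two_pi_mul_moebiusSum hGRH hε hε']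
  simp_rw [star_character_apply]
  rw [moebiusSum_star]
  ring

/-- Under GRH and the Ratios Conjecture, the twisted second moment of the sums `∑ μ(n) χ(n)` over
nonprincipal characters agrees with its Steinhaus model up to a power of `r`. -/
theorem exists_twisted_moebius_bound (hGRH : ∀ (r : ℕ) [Fact r.Prime], GRH r)
    (hRatios : TwistedRatiosConjecture) :
    ∃ w h ε₁ : ℝ, 0 < w ∧ w ≤ 1 / 2 ∧ 0 < h ∧ h ≤ 1 / 2 ∧ 0 < ε₁ ∧ ∀ ε : ℝ, 0 < ε → ε ≤ ε₁ →
      ∃ C : ℝ, 0 < C ∧ ∀ (r : ℕ) [Fact r.Prime], r ≠ 2 → ∀ m₁ m₂ : ℕ, 1 ≤ m₁ →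
        (m₁ : ℝ) ≤ (r : ℝ) ^ h → 1 ≤ m₂ → (m₂ : ℝ) ≤ (r : ℝ) ^ h → ∀ X₁ X₂ : ℕ,
        ‖nonprincipalAvg r (fun χ => χ m₁ * star (χ m₂) *
            moebiusSum (fun n => χ (n : ZMod r)) X₁ *
            star (moebiusSum (fun n => χ (n : ZMod r)) X₂)) -
          ∫ θ, coprimePart r (steinhaus θ) m₁ * star (coprimePart r (steinhaus θ) m₂) *
            moebiusSum (coprimePart r (steinhaus θ)) X₁ *
            star (moebiusSum (coprimePart r (steinhaus θ)) X₂) ∂steinhausMeasure‖ ≤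
        C * (((X₁ : ℝ) + 1) ^ (1 / 2 + 3 * ε) * ((X₂ : ℝ) + 1) ^ (1 / 2 + 3 * ε)) *
          (r : ℝ) ^ (-w) := by
  obtain ⟨w, hw, hw', ε₀, hε₀, h₀, hh₀, H⟩ := hRatios
  refine ⟨w, min h₀ (1 / 2), min ε₀ (1 / 4), hw, hw', lt_min hh₀ (by norm_num), min_le_right _ _,
    lt_min hε₀ (by norm_num), fun ε hε hε1 => ?_⟩
  have hεa : ε ≤ ε₀ := hε1.trans (min_le_left _ _)
  have hεb : ε ≤ 1 / 4 := hε1.trans (min_le_right _ _)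
  obtain ⟨C, hC⟩ := H ε hε hεa
  refine ⟨|C| * (32 * tailIntegral ε) ^ 2 + 1, by positivity, ?_⟩
  intro r _ hr2 m₁ m₂ hm₁ hm₁' hm₂ hm₂' X₁ X₂
  have hr : (0:ℝ) < r := by exact_mod_cast (Fact.out : r.Prime).pos
  have hm₁0 : m₁ ≠ 0 := Nat.one_le_iff_ne_zero.1 hm₁
  have hm₂0 : m₂ ≠ 0 := Nat.one_le_iff_ne_zero.1 hm₂
  have hmain := hC (min h₀ (1 / 2)) (lt_min hh₀ (by norm_num)) (min_le_left _ _) r hr2 m₁ m₂ hm₁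
    hm₁' hm₂ hm₂'
  obtain ⟨hi1, he1⟩ := integral_kernel_mul_nonprincipalAvg hGRH hε (by linarith) r m₁ m₂ X₁ X₂
  have hσ : (1:ℝ) / 2 < 1 / 2 + ε := by linarith
  have hi2 := integrable_kernel_mul_steinhausTwist r hm₁0 hm₂0 hσ X₁ X₂
  have he2 := integral_kernel_mul_steinhausTwist r hm₁0 hm₂0 hσ X₁ X₂
  rw [integral_twisted_moebiusSum]
  set a := nonprincipalAvg r (fun χ => χ m₁ * star (χ m₂) *
            moebiusSum (fun n => χ (n : ZMod r)) X₁ *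
            star (moebiusSum (fun n => χ (n : ZMod r)) X₂)) with ha
  set b := ∑ n ∈ Finset.Icc 1 X₁ ×ˢ Finset.Icc 1 X₂, twistCoeff r m₁ m₂ n with hb
  have hdiff := integral_sub hi1 hi2
  rw [he1, he2, ← mul_sub] at hdiff
  -- the kernels decay like `(1 + |t|)^{-1-2ε}`, which absorbs the growth of the error term
  have hk : ∀ (X : ℕ) (t : ℝ), ‖perronKernel X ((1 / 2 + ε : ℝ) + t * Complex.I)‖ * (1 + |t|) ^ ε ≤
      32 * ((X : ℝ) + 1) ^ (1 / 2 + 3 * ε) * (1 + |t|) ^ (-(1 + ε)) := by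
    intro X t
    have hk := norm_perronKernel_le (X := X) (s := (1 / 2 + ε : ℝ) + t * Complex.I) (θ := 2 * ε)
      (by simp; linarith) (by linarith) (by linarith)
    have e1 : ((1 / 2 + ε : ℝ) + t * Complex.I : ℂ).re = 1 / 2 + ε := by simp
    have e2 : ((1 / 2 + ε : ℝ) + t * Complex.I : ℂ).im = t := by simp
    rw [e1, e2] at hk
    have ht : 0 < 1 + |t| := by positivity
    refine (mul_le_mul_of_nonneg_right hk (by positivity)).trans_eq ?_
    rw [mul_assoc, ← Real.rpow_add ht]
    congr 2
    · congr 1; ring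
    · ring
  have hbound : ‖∫ z : ℝ × ℝ, ((perronKernel X₁ ((1 / 2 + ε : ℝ) + z.1 * Complex.I) *
      perronKernel X₂ ((1 / 2 + ε : ℝ) + z.2 * Complex.I)) *
      nonprincipalAvg r (fun χ => χ m₁ * star (χ m₂) /
        (DirichletCharacter.LFunction χ ((1 / 2 + ε : ℝ) + z.1 * Complex.I) *
          DirichletCharacter.LFunction (star χ) ((1 / 2 + ε : ℝ) + z.2 * Complex.I))) -
      (perronKernel X₁ ((1 / 2 + ε : ℝ) + z.1 * Complex.I) *
      perronKernel X₂ ((1 / 2 + ε : ℝ) + z.2 * Complex.I)) *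
      steinhausTwist r m₁ m₂ ((1 / 2 + ε : ℝ) + z.1 * Complex.I)
        ((1 / 2 + ε : ℝ) + z.2 * Complex.I)) ∂(volume.prod volume)‖ ≤
      ∫ z : ℝ × ℝ, (|C| * (r : ℝ) ^ (-w)) *
        ((32 * ((X₁ : ℝ) + 1) ^ (1 / 2 + 3 * ε) * (1 + |z.1|) ^ (-(1 + ε))) *
        (32 * ((X₂ : ℝ) + 1) ^ (1 / 2 + 3 * ε) * (1 + |z.2|) ^ (-(1 + ε))))
        ∂(volume.prod volume) := by
    refine norm_integral_le_of_norm_le ?_ (Filter.Eventually.of_forall fun z => ?_)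
    · exact (((integrable_one_add_abs hε).const_mul _).mul_prod
        ((integrable_one_add_abs hε).const_mul _)).const_mul _
    · have h1 := hmain ((1 / 2 + ε : ℝ) + z.1 * Complex.I) ((1 / 2 + ε : ℝ) + z.2 * Complex.I)
        (by simp) (by simp)
      have e2 : ∀ t : ℝ, ((1 / 2 + ε : ℝ) + t * Complex.I : ℂ).im = t := by intro t; simp
      rw [e2, e2] at h1
      have h2 : (1 + max |z.1| |z.2|) ^ ε ≤ (1 + |z.1|) ^ ε * (1 + |z.2|) ^ ε := by
        rw [← Real.mul_rpow (by positivity) (by positivity)]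
        refine Real.rpow_le_rpow (by positivity) ?_ hε.le
        have := abs_nonneg z.1
        have := abs_nonneg z.2
        rcases max_cases |z.1| |z.2| with h | h <;> nlinarith
      rw [← mul_sub, norm_mul, norm_mul]
      calc _ ≤ ‖perronKernel X₁ ((1 / 2 + ε : ℝ) + z.1 * Complex.I)‖ *
              ‖perronKernel X₂ ((1 / 2 + ε : ℝ) + z.2 * Complex.I)‖ *
              (|C| * ((1 + |z.1|) ^ ε * (1 + |z.2|) ^ ε) * (r : ℝ) ^ (-w)) := by
            refine mul_le_mul_of_nonneg_left (h1.trans ?_) (by positivity)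
            refine mul_le_mul_of_nonneg_right ?_ (by positivity)
            exact mul_le_mul (le_abs_self C) h2 (by positivity) (abs_nonneg _)
        _ = (|C| * (r : ℝ) ^ (-w)) *
            ((‖perronKernel X₁ ((1 / 2 + ε : ℝ) + z.1 * Complex.I)‖ * (1 + |z.1|) ^ ε) *
            (‖perronKernel X₂ ((1 / 2 + ε : ℝ) + z.2 * Complex.I)‖ * (1 + |z.2|) ^ ε)) := by ring
        _ ≤ _ := by
            refine mul_le_mul_of_nonneg_left ?_ (by positivity)
            exact mul_le_mul (hk X₁ z.1) (hk X₂ z.2) (by positivity) (by positivity)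
  rw [hdiff, integral_const_mul, integral_prod_mul
    (fun t : ℝ => 32 * ((X₁ : ℝ) + 1) ^ (1 / 2 + 3 * ε) * (1 + |t|) ^ (-(1 + ε)))
    (fun t : ℝ => 32 * ((X₂ : ℝ) + 1) ^ (1 / 2 + 3 * ε) * (1 + |t|) ^ (-(1 + ε))),
    integral_const_mul, integral_const_mul] at hbound
  change _ ≤ |C| * (r : ℝ) ^ (-w) * (32 * ((X₁ : ℝ) + 1) ^ (1 / 2 + 3 * ε) * tailIntegral ε *
    (32 * ((X₂ : ℝ) + 1) ^ (1 / 2 + 3 * ε) * tailIntegral ε)) at hbound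
  have hpi : ‖(2 * Real.pi : ℂ) * (2 * Real.pi)‖ = (2 * Real.pi) * (2 * Real.pi) := by
    rw [norm_mul, norm_mul, Complex.norm_real, Real.norm_of_nonneg Real.pi_pos.le]
    simp
  rw [norm_mul, hpi] at hbound
  have h3 : ‖a - b‖ ≤ (2 * Real.pi) * (2 * Real.pi) * ‖a - b‖ := by
    refine le_mul_of_one_le_left (norm_nonneg _) ?_
    nlinarith [Real.pi_gt_three]
  have ht := tailIntegral_nonneg ε
  have hx : 0 ≤ (((X₁ : ℝ) + 1) ^ (1 / 2 + 3 * ε) * ((X₂ : ℝ) + 1) ^ (1 / 2 + 3 * ε)) *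
          (r : ℝ) ^ (-w) := by positivity
  calc ‖a - b‖ ≤ _ := h3.trans hbound
    _ = |C| * (32 * tailIntegral ε) ^ 2 * ((((X₁ : ℝ) + 1) ^ (1 / 2 + 3 * ε) *
        ((X₂ : ℝ) + 1) ^ (1 / 2 + 3 * ε)) * (r : ℝ) ^ (-w)) := by ring
    _ ≤ (|C| * (32 * tailIntegral ε) ^ 2 + 1) * ((((X₁ : ℝ) + 1) ^ (1 / 2 + 3 * ε) *
        ((X₂ : ℝ) + 1) ^ (1 / 2 + 3 * ε)) * (r : ℝ) ^ (-w)) :=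
        mul_le_mul_of_nonneg_right (by linarith) hx
    _ = _ := by ring

/-! ### Twisted second moments of partial sums of `μ` and `λ` -/

/-- The partial sum `∑_{n ≤ X} c(n) f(n)` for the coefficients `c = sqConv κ`. -/
def sqSum (κ : ℕ → ℝ) (f : ℕ → ℂ) (X : ℕ) : ℂ :=
  ∑ n ∈ Finset.Icc 1 X, sqConv κ n * f n

lemma sqSum_eq {κ : ℕ → ℝ} {D : ℝ} (hκ : ∀ d : ℕ, D < d → κ d = 0) {f : ℕ → ℂ} (hf : IsMult f)
    (X : ℕ) : sqSum κ f X = ∑ d ∈ (Finset.Icc 1 X).filter (fun d : ℕ => (d : ℝ) ≤ D),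
      (κ d : ℂ) * f (d ^ 2) * moebiusSum f (X / d ^ 2) := by
  rw [sqSum, sum_sqConv_mul hf.map_mul κ X, Finset.sum_filter_of_ne]
  · rfl
  · intro d _ h
    by_contra hd
    apply h
    rw [hκ d (not_le.1 hd)]; simp

lemma twisted_sqSum_eq {κ : ℕ → ℝ} {D : ℝ} (hκ : ∀ d : ℕ, D < d → κ d = 0) {f : ℕ → ℂ}
    (hf : IsMult f) {m₁ m₂ : ℕ} (hm₁ : m₁ ≠ 0) (hm₂ : m₂ ≠ 0) (X : ℕ) :
    f m₁ * star (f m₂) * sqSum κ f X * star (sqSum κ f X) =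
      ∑ d ∈ (Finset.Icc 1 X).filter (fun d : ℕ => (d : ℝ) ≤ D),
      ∑ e ∈ (Finset.Icc 1 X).filter (fun d : ℕ => (d : ℝ) ≤ D),
        ((κ d : ℂ) * κ e) * (f (m₁ * d ^ 2) * star (f (m₂ * e ^ 2)) * moebiusSum f (X / d ^ 2) *
          star (moebiusSum f (X / e ^ 2))) := by
  rw [sqSum_eq hκ hf, star_sum, mul_assoc, Finset.sum_mul_sum, Finset.mul_sum]
  refine Finset.sum_congr rfl fun d hd => ?_
  rw [Finset.mul_sum]
  refine Finset.sum_congr rfl fun e he => ?_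
  have h0 : ∀ n ∈ (Finset.Icc 1 X).filter (fun d : ℕ => (d : ℝ) ≤ D), n ^ 2 ≠ 0 := fun n hn =>
    pow_ne_zero 2 (Nat.one_le_iff_ne_zero.1 (Finset.mem_Icc.1 (Finset.mem_filter.1 hn).1).1)
  rw [hf.map_mul _ _ hm₁ (h0 d hd), hf.map_mul _ _ hm₂ (h0 e he)]
  have hs : star ((κ e : ℂ)) = κ e := Complex.conj_ofReal _
  simp only [star_mul', hs]
  ring

lemma measurable_moebiusSum_coprimePart (r X : ℕ) :
    Measurable fun θ => moebiusSum (coprimePart r (steinhaus θ)) X :=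
  Finset.measurable_sum _ fun n _ => (measurable_coprimePart_steinhaus r n).const_mul _

lemma norm_sum_Icc_le {a : ℕ → ℂ} (ha : ∀ n, ‖a n‖ ≤ 1) (X : ℕ) :
    ‖∑ n ∈ Finset.Icc 1 X, a n‖ ≤ X := by
  refine (norm_sum_le_of_le _ fun n _ => ha n).trans ?_
  simp

lemma norm_moebiusSum_coprimePart_le (r X : ℕ) (θ : Nat.Primes → UnitAddCircle) :
    ‖moebiusSum (coprimePart r (steinhaus θ)) X‖ ≤ X :=
  norm_sum_Icc_le (fun n => by
    rw [norm_mul]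
    exact mul_le_one₀ (norm_moebius_le_one n) (norm_nonneg _)
      (norm_coprimePart_steinhaus_le r θ n)) X

lemma measurable_star_comp {g : (Nat.Primes → UnitAddCircle) → ℂ} (hg : Measurable g) :
    Measurable fun θ => star (g θ) := continuous_star.measurable.comp hg

lemma integrable_twisted_moebiusSum (r m₁ m₂ X₁ X₂ : ℕ) :
    Integrable (fun θ => coprimePart r (steinhaus θ) m₁ * star (coprimePart r (steinhaus θ) m₂) *
        moebiusSum (coprimePart r (steinhaus θ)) X₁ *
        star (moebiusSum (coprimePart r (steinhaus θ)) X₂)) steinhausMeasure := by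
  have h := measurable_coprimePart_steinhaus r
  refine integrable_of_measurable_of_bounded
    ((((h m₁).mul (measurable_star_comp (h m₂))).mul (measurable_moebiusSum_coprimePart r X₁)).mul
      (measurable_star_comp (measurable_moebiusSum_coprimePart r X₂))) (X₁ * X₂) fun θ => ?_
  have hb := norm_coprimePart_steinhaus_le r θ
  rw [norm_mul, norm_mul, norm_mul, norm_star, norm_star]
  refine mul_le_mul ?_ (norm_moebiusSum_coprimePart_le r X₂ θ) (norm_nonneg _) (Nat.cast_nonneg _)
  calc _ ≤ 1 * (X₁ : ℝ) := mul_le_mul (mul_le_one₀ (hb m₁) (norm_nonneg _) (hb m₂))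
        (norm_moebiusSum_coprimePart_le r X₁ θ) (norm_nonneg _) zero_le_one
    _ = X₁ := one_mul _

lemma nonprincipalAvg_sum {r : ℕ} [NeZero r] {ι : Type*} (s : Finset ι)
    (F : ι → DirichletCharacter ℂ r → ℂ) :
    nonprincipalAvg r (fun χ => ∑ i ∈ s, F i χ) = ∑ i ∈ s, nonprincipalAvg r (F i) := by
  unfold nonprincipalAvg
  rw [Finset.sum_comm, Finset.sum_div]

lemma nonprincipalAvg_const_mul {r : ℕ} [NeZero r] (c : ℂ) (F : DirichletCharacter ℂ r → ℂ) :
    nonprincipalAvg r (fun χ => c * F χ) = c * nonprincipalAvg r F := by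
  unfold nonprincipalAvg
  rw [← Finset.mul_sum, mul_div_assoc]

lemma card_filter_le {D : ℝ} (hD : 0 ≤ D) (X : ℕ) :
    (((Finset.Icc 1 X).filter (fun d : ℕ => (d : ℝ) ≤ D)).card : ℝ) ≤ D := by
  have h : (Finset.Icc 1 X).filter (fun d : ℕ => (d : ℝ) ≤ D) ⊆ Finset.Icc 1 ⌊D⌋₊ := by
    intro d hd
    rw [Finset.mem_filter, Finset.mem_Icc] at hd
    rw [Finset.mem_Icc]
    exact ⟨hd.1.1, Nat.le_floor hd.2⟩
  have h2 := Finset.card_le_card h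
  rw [Nat.card_Icc, Nat.add_sub_cancel] at h2
  exact (Nat.cast_le.2 h2).trans (Nat.floor_le hD)

/-- The twisted second moment over nonprincipal characters for coefficients `sqConv κ` with `κ`
supported on a short interval. -/
theorem exists_twisted_sqSum_nonprincipal_bound (hGRH : ∀ (r : ℕ) [Fact r.Prime], GRH r)
    (hRatios : TwistedRatiosConjecture) :
    ∃ w h ε₁ : ℝ, 0 < w ∧ w ≤ 1 / 2 ∧ 0 < h ∧ h ≤ 1 / 2 ∧ 0 < ε₁ ∧ ∀ ε : ℝ, 0 < ε → ε ≤ ε₁ →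
      ∃ C : ℝ, 0 < C ∧ ∀ (r : ℕ) [Fact r.Prime], r ≠ 2 → ∀ (D : ℝ) (κ : ℕ → ℝ), 0 ≤ D →
        (∀ d, |κ d| ≤ 1) → (∀ d : ℕ, D < d → κ d = 0) → ∀ m₁ m₂ : ℕ, 1 ≤ m₁ →
        (m₁ : ℝ) * D ^ 2 ≤ (r : ℝ) ^ h → 1 ≤ m₂ → (m₂ : ℝ) * D ^ 2 ≤ (r : ℝ) ^ h → ∀ X : ℕ,
        ‖nonprincipalAvg r (fun χ => χ m₁ * star (χ m₂) * sqSum κ (fun n => χ (n : ZMod r)) X *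
            star (sqSum κ (fun n => χ (n : ZMod r)) X)) -
          ∫ θ, coprimePart r (steinhaus θ) m₁ * star (coprimePart r (steinhaus θ) m₂) *
            sqSum κ (coprimePart r (steinhaus θ)) X *
            star (sqSum κ (coprimePart r (steinhaus θ)) X) ∂steinhausMeasure‖ ≤
        C * D ^ 2 * ((X : ℝ) + 1) ^ (1 + 6 * ε) * (r : ℝ) ^ (-w) := by
  obtain ⟨w, h, ε₁, hw, hw', hh, hh', hε₁, H⟩ := exists_twisted_moebius_bound hGRH hRatios
  refine ⟨w, h, ε₁, hw, hw', hh, hh', hε₁, fun ε hε hε' => ?_⟩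
  obtain ⟨C, hC, H⟩ := H ε hε hε'
  refine ⟨C, hC, ?_⟩
  intro r _ hr2 D κ hD hκ hκD m₁ m₂ hm₁ hm₁' hm₂ hm₂' X
  have hr : (0:ℝ) < r := by exact_mod_cast (Fact.out : r.Prime).pos
  have hm₁0 := Nat.one_le_iff_ne_zero.1 hm₁
  have hm₂0 := Nat.one_le_iff_ne_zero.1 hm₂
  set S := (Finset.Icc 1 X).filter (fun d : ℕ => (d : ℝ) ≤ D) with hS
  have e1 : nonprincipalAvg r (fun χ => χ m₁ * star (χ m₂) *
      sqSum κ (fun n => χ (n : ZMod r)) X * star (sqSum κ (fun n => χ (n : ZMod r)) X)) =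
      ∑ d ∈ S, ∑ e ∈ S, ((κ d : ℂ) * κ e) * nonprincipalAvg r (fun χ =>
        χ ((m₁ * d ^ 2 : ℕ) : ZMod r) * star (χ ((m₂ * e ^ 2 : ℕ) : ZMod r)) *
        moebiusSum (fun n => χ (n : ZMod r)) (X / d ^ 2) *
          star (moebiusSum (fun n => χ (n : ZMod r)) (X / e ^ 2))) := by
    simp_rw [← nonprincipalAvg_const_mul, ← nonprincipalAvg_sum]
    congr 1
    funext χ
    exact twisted_sqSum_eq hκD (isMult_character χ) hm₁0 hm₂0 X
  have e2 : ∫ θ, coprimePart r (steinhaus θ) m₁ * star (coprimePart r (steinhaus θ) m₂) *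
            sqSum κ (coprimePart r (steinhaus θ)) X *
            star (sqSum κ (coprimePart r (steinhaus θ)) X) ∂steinhausMeasure =
      ∑ d ∈ S, ∑ e ∈ S, ((κ d : ℂ) * κ e) * ∫ θ, coprimePart r (steinhaus θ) (m₁ * d ^ 2) *
        star (coprimePart r (steinhaus θ) (m₂ * e ^ 2)) *
        moebiusSum (coprimePart r (steinhaus θ)) (X / d ^ 2) *
        star (moebiusSum (coprimePart r (steinhaus θ)) (X / e ^ 2)) ∂steinhausMeasure := by
    have hint := fun d e => (integrable_twisted_moebiusSum r (m₁ * d ^ 2) (m₂ * e ^ 2) (X / d ^ 2)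
      (X / e ^ 2)).const_mul ((κ d : ℂ) * κ e)
    simp_rw [← integral_const_mul]
    simp_rw [fun d : ℕ => (integral_finsetSum S fun e _ => hint d e).symm]
    rw [← integral_finsetSum S fun d _ => integrable_finsetSum S fun e _ => hint d e]
    refine integral_congr_ae (Filter.Eventually.of_forall fun θ => ?_)
    exact twisted_sqSum_eq hκD ((isMult_steinhaus θ).coprimePart r) hm₁0 hm₂0 X
  rw [e1, e2, ← Finset.sum_sub_distrib]
  simp_rw [← Finset.sum_sub_distrib, ← mul_sub]
  have hterm : ∀ d ∈ S, ∀ e ∈ S, ‖((κ d : ℂ) * κ e) * (nonprincipalAvg r (fun χ =>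
        χ ((m₁ * d ^ 2 : ℕ) : ZMod r) * star (χ ((m₂ * e ^ 2 : ℕ) : ZMod r)) *
        moebiusSum (fun n => χ (n : ZMod r)) (X / d ^ 2) *
          star (moebiusSum (fun n => χ (n : ZMod r)) (X / e ^ 2))) -
        ∫ θ, coprimePart r (steinhaus θ) (m₁ * d ^ 2) *
        star (coprimePart r (steinhaus θ) (m₂ * e ^ 2)) *
        moebiusSum (coprimePart r (steinhaus θ)) (X / d ^ 2) *
        star (moebiusSum (coprimePart r (steinhaus θ)) (X / e ^ 2)) ∂steinhausMeasure)‖ ≤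
      C * ((X : ℝ) + 1) ^ (1 + 6 * ε) * (r : ℝ) ^ (-w) := by
    intro d hd e he
    have hS1 : ∀ n ∈ S, 1 ≤ n ^ 2 ∧ (n : ℝ) ^ 2 ≤ D ^ 2 := by
      intro n hn
      rw [hS, Finset.mem_filter, Finset.mem_Icc] at hn
      exact ⟨Nat.one_le_pow _ _ hn.1.1, pow_le_pow_left₀ (Nat.cast_nonneg _) hn.2 2⟩
    have hx : ∀ n : ℕ, ((X / n ^ 2 : ℕ) : ℝ) + 1 ≤ X + 1 := fun n => by
      have : X / n ^ 2 ≤ X := Nat.div_le_self _ _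
      have : ((X / n ^ 2 : ℕ) : ℝ) ≤ X := by exact_mod_cast this
      linarith
    have hb := H r hr2 (m₁ * d ^ 2) (m₂ * e ^ 2) (Nat.mul_pos hm₁ (hS1 d hd).1)
      (by push_cast; exact (mul_le_mul_of_nonneg_left (hS1 d hd).2 (Nat.cast_nonneg _)).trans hm₁')
      (Nat.mul_pos hm₂ (hS1 e he).1)
      (by push_cast; exact (mul_le_mul_of_nonneg_left (hS1 e he).2 (Nat.cast_nonneg _)).trans hm₂')
      (X / d ^ 2) (X / e ^ 2)
    rw [norm_mul, norm_mul, Complex.norm_real, Complex.norm_real]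
    refine (mul_le_mul (mul_le_one₀ (hκ d) (norm_nonneg _) (hκ e)) hb (norm_nonneg _)
      zero_le_one).trans ?_
    rw [one_mul]
    refine mul_le_mul_of_nonneg_right (mul_le_mul_of_nonneg_left ?_ hC.le) (by positivity)
    calc _ ≤ ((X : ℝ) + 1) ^ (1 / 2 + 3 * ε) * ((X : ℝ) + 1) ^ (1 / 2 + 3 * ε) :=
          mul_le_mul (Real.rpow_le_rpow (by positivity) (hx d) (by linarith))
            (Real.rpow_le_rpow (by positivity) (hx e) (by linarith)) (by positivity) (by positivity)
      _ = _ := by rw [← Real.rpow_add (by positivity)]; congr 1; ring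
  have hcard := card_filter_le hD X
  rw [← hS] at hcard
  set B := C * ((X : ℝ) + 1) ^ (1 + 6 * ε) * (r : ℝ) ^ (-w) with hB
  have hB0 : 0 ≤ B := by positivity
  calc _ ≤ ∑ d ∈ S, ∑ e ∈ S, B :=
        norm_sum_le_of_le _ fun d hd => norm_sum_le_of_le _ fun e he => hterm d hd e he
    _ = (S.card : ℝ) * S.card * B := by simp; ring
    _ ≤ D * D * B := mul_le_mul_of_nonneg_right
        (mul_le_mul hcard hcard (Nat.cast_nonneg _) hD) hB0
    _ = _ := by rw [hB]; ring

/-! ### Second moments of the tail of the convolution over squares -/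

lemma card_characters (r : ℕ) [Fact r.Prime] :
    Fintype.card (DirichletCharacter ℂ r) = r - 1 := by
  rw [← Nat.card_eq_fintype_card, DirichletCharacter.card_eq_totient_of_hasEnoughRootsOfUnity,
    Nat.totient_prime Fact.out]

open Classical in
lemma card_quadratic_characters_le (r : ℕ) [Fact r.Prime] :
    ((Finset.univ : Finset (DirichletCharacter ℂ r)).filter (fun χ => χ ^ 2 = 1)).card ≤ 2 := by
  obtain ⟨e⟩ := MulChar.mulEquiv_units (ZMod r) ℂ
  have : IsCyclic (DirichletCharacter ℂ r) := isCyclic_of_surjective e.symm e.symm.surjective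
  exact IsCyclic.card_pow_eq_one_le two_pos

lemma two_mul_sub_one_ge (r : ℕ) [Fact r.Prime] : (r : ℝ) ≤ 2 * ((r : ℝ) - 1) := by
  have : (2:ℝ) ≤ r := by exact_mod_cast (Fact.out : r.Prime).two_le
  linarith

/-- The weights `d ↦ min 1 (d / D)` and `0`, used to cut off convolutions over squares. -/
def IsTailWeight (D : ℝ) (κ : ℕ → ℝ) : Prop :=
  (κ = fun d : ℕ => min 1 ((d : ℝ) / D)) ∨ κ = fun _ : ℕ => 0

lemma IsTailWeight.abs_le_one {D : ℝ} (hD : 1 ≤ D) {κ : ℕ → ℝ} (hκ : IsTailWeight D κ) (d : ℕ) :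
    |κ d| ≤ 1 := by
  rcases hκ with rfl | rfl
  · simp only
    rw [abs_of_nonneg (le_min zero_le_one (by positivity))]
    exact min_le_left _ _
  · simp

lemma IsTailWeight.sq_le {D : ℝ} (hD : 1 ≤ D) {κ : ℕ → ℝ} (hκ : IsTailWeight D κ) (d : ℕ) :
    κ d ^ 2 ≤ D ^ (-(1 / 2) : ℝ) * (d : ℝ) ^ (1 / 2 : ℝ) := by
  have hD0 : 0 < D := by linarith
  rcases hκ with rfl | rfl
  · simp only
    have h1 : D ^ (-(1 / 2) : ℝ) * (d : ℝ) ^ (1 / 2 : ℝ) = ((d : ℝ) / D) ^ (1 / 2 : ℝ) := by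
      rw [Real.div_rpow (Nat.cast_nonneg _) hD0.le, Real.rpow_neg hD0.le]
      field_simp
    rw [h1]
    set t := (d : ℝ) / D with ht
    have ht0 : 0 ≤ t := by positivity
    rcases le_total t 1 with h | h
    · rw [min_eq_right h, ← Real.rpow_natCast]
      exact Real.rpow_le_rpow_of_exponent_ge_of_imp ht0 h (by norm_num) (by norm_num)
    · rw [min_eq_left h, one_pow]
      exact Real.one_le_rpow h (by norm_num)
  · simp only
    rw [zero_pow two_ne_zero]
    positivity

lemma sqSum_zero (f : ℕ → ℂ) (X : ℕ) : sqSum (fun _ => 0) f X = 0 := by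
  have : ∀ n, sqConv (fun _ => 0) n = 0 := fun n => by
    unfold sqConv
    refine Finset.sum_eq_zero fun p _ => ?_
    have : sqLift (fun _ => 0) p.1 = 0 := by unfold sqLift; split_ifs <;> simp
    rw [this]; simp
  simp [sqSum, this]

lemma sqSum_character_eq {r : ℕ} (κ : ℕ → ℝ) (χ : DirichletCharacter ℂ r) (X : ℕ) :
    sqSum κ (fun n => χ (n : ZMod r)) X = ∑ n ∈ Finset.Icc 1 X, χ (n : ZMod r) * sqConv κ n :=
  Finset.sum_congr rfl fun _ _ => mul_comm _ _

/-- Mean square of the tail over all characters. The at most two characters with trivial square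
are estimated individually. -/
lemma exists_tail_average_bound (hGRH : ∀ (r : ℕ) [Fact r.Prime], GRH r) {ε : ℝ} (hε : 0 < ε)
    (hε' : ε ≤ 1 / 4) :
    ∃ C : ℝ, 0 < C ∧ ∀ (r : ℕ) [Fact r.Prime] (D : ℝ) (κ : ℕ → ℝ), 1 ≤ D → IsTailWeight D κ →
      ∀ X : ℕ, (∑ χ : DirichletCharacter ℂ r, ‖sqSum κ (fun n => χ (n : ZMod r)) X‖ ^ 2) /
        ((r : ℝ) - 1) ≤ C * (D⁻¹ + (r : ℝ)⁻¹) * (r : ℝ) ^ (4 * ε) *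
          ((X : ℝ) + 1) ^ (1 + 10 * ε) := by
  classical
  obtain ⟨C₁, hC₁, H₁⟩ := exists_sqConv_tail_bound hGRH hε hε'
  obtain ⟨C₂, hC₂, H₂⟩ := exists_sqConv_sum_bound hGRH hε hε'
  refine ⟨C₁ ^ 2 + 4 * C₂ ^ 2, by positivity, ?_⟩
  intro r _ D κ hD hκ X
  have hD0 : 0 < D := by linarith
  have hr1 : (1:ℝ) < r := by exact_mod_cast (Fact.out : r.Prime).one_lt
  have hr : (0:ℝ) < r := by linarith
  have hX : (1:ℝ) ≤ (X : ℝ) + 1 := by linarith [(Nat.cast_nonneg X : (0:ℝ) ≤ X)]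
  set R := (r : ℝ) ^ (4 * ε) * ((X : ℝ) + 1) ^ (1 + 10 * ε) with hR
  have hR0 : 0 < R := by positivity
  have hb1 : ∀ χ : DirichletCharacter ℂ r, χ ^ 2 ≠ 1 →
      ‖sqSum κ (fun n => χ (n : ZMod r)) X‖ ^ 2 ≤ C₁ ^ 2 * D⁻¹ * R := by
    intro χ hχ
    rcases hκ with rfl | rfl
    · rw [sqSum_character_eq]
      refine (pow_le_pow_left₀ (norm_nonneg _) (H₁ r χ hχ D hD X) 2).trans_eq ?_
      rw [hR, mul_pow, mul_pow, mul_pow, ← Real.rpow_natCast (D ^ _), ← Real.rpow_mul hD0.le,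
        ← Real.rpow_natCast ((r : ℝ) ^ _), ← Real.rpow_mul hr.le,
        ← Real.rpow_natCast (((X : ℝ) + 1) ^ _), ← Real.rpow_mul (by positivity)]
      rw [← Real.rpow_neg_one D]
      have e1 : -(1 / 2) * ((2 : ℕ) : ℝ) = -1 := by norm_num
      have e2 : 2 * ε * ((2 : ℕ) : ℝ) = 4 * ε := by push_cast; ring
      have e3 : (1 / 2 + 5 * ε) * ((2 : ℕ) : ℝ) = 1 + 10 * ε := by push_cast; ring
      rw [e1, e2, e3]; ring
    · rw [sqSum_zero]; simp; positivity
  have hb2 : ∀ χ : DirichletCharacter ℂ r,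
      ‖sqSum κ (fun n => χ (n : ZMod r)) X‖ ^ 2 ≤ C₂ ^ 2 * R := by
    intro χ
    rw [sqSum_character_eq]
    refine (pow_le_pow_left₀ (norm_nonneg _) (H₂ r χ κ (hκ.abs_le_one hD) X) 2).trans ?_
    rw [hR, mul_pow, mul_pow, ← Real.rpow_natCast ((r : ℝ) ^ _), ← Real.rpow_mul hr.le,
        ← Real.rpow_natCast (((X : ℝ) + 1) ^ _), ← Real.rpow_mul (by positivity), mul_assoc]
    refine mul_le_mul_of_nonneg_left (mul_le_mul ?_ ?_ (by positivity) (by positivity))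
      (by positivity)
    · exact Real.rpow_le_rpow_of_exponent_le hr1.le (by push_cast; linarith)
    · exact Real.rpow_le_rpow_of_exponent_le hX (by push_cast; linarith)
  have hcard : (((Finset.univ : Finset (DirichletCharacter ℂ r)).filter
      (fun χ => ¬ χ ^ 2 = 1)).card : ℝ) ≤ (r : ℝ) - 1 := by
    have h1 := Finset.card_filter_le (Finset.univ : Finset (DirichletCharacter ℂ r))
      (fun χ => ¬ χ ^ 2 = 1)
    rw [Finset.card_univ, card_characters] at h1
    have h2 : ((r - 1 : ℕ) : ℝ) = (r : ℝ) - 1 := by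
      rw [Nat.cast_sub (Fact.out : r.Prime).one_le]; simp
    rw [← h2]
    exact_mod_cast h1
  have hcard2 : (((Finset.univ : Finset (DirichletCharacter ℂ r)).filter
      (fun χ => χ ^ 2 = 1)).card : ℝ) ≤ 2 := by
    exact_mod_cast card_quadratic_characters_le r
  rw [div_le_iff₀ (by linarith), ← Finset.sum_filter_add_sum_filter_not Finset.univ
    (fun χ : DirichletCharacter ℂ r => χ ^ 2 = 1)]
  have hs1 : ∑ χ ∈ (Finset.univ : Finset (DirichletCharacter ℂ r)).filter (fun χ => ¬ χ ^ 2 = 1),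
      ‖sqSum κ (fun n => χ (n : ZMod r)) X‖ ^ 2 ≤ ((r : ℝ) - 1) * (C₁ ^ 2 * D⁻¹ * R) := by
    refine (Finset.sum_le_card_nsmul _ _ _ fun χ hχ => hb1 χ (Finset.mem_filter.1 hχ).2).trans ?_
    rw [nsmul_eq_mul]
    exact mul_le_mul_of_nonneg_right hcard (by positivity)
  have hs2 : ∑ χ ∈ (Finset.univ : Finset (DirichletCharacter ℂ r)).filter (fun χ => χ ^ 2 = 1),
      ‖sqSum κ (fun n => χ (n : ZMod r)) X‖ ^ 2 ≤ 2 * (C₂ ^ 2 * R) := by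
    refine (Finset.sum_le_card_nsmul _ _ _ fun χ hχ => hb2 χ).trans ?_
    rw [nsmul_eq_mul]
    exact mul_le_mul_of_nonneg_right hcard2 (by positivity)
  have hinv : 1 ≤ 2 * (r : ℝ)⁻¹ * ((r : ℝ) - 1) := by
    have := two_mul_sub_one_ge r
    rw [mul_right_comm, ← div_eq_mul_inv, le_div_iff₀ hr]; linarith
  have h3 : 2 * (C₂ ^ 2 * R) ≤ (4 * C₂ ^ 2) * (r : ℝ)⁻¹ * R * ((r : ℝ) - 1) := by
    calc 2 * (C₂ ^ 2 * R) = (2 * (C₂ ^ 2 * R)) * 1 := by ring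
      _ ≤ (2 * (C₂ ^ 2 * R)) * (2 * (r : ℝ)⁻¹ * ((r : ℝ) - 1)) :=
          mul_le_mul_of_nonneg_left hinv (by positivity)
      _ = _ := by ring
  have hr0 : 0 ≤ (r : ℝ) - 1 := by linarith
  have h4 : 0 ≤ C₁ ^ 2 * (r : ℝ)⁻¹ * R * ((r : ℝ) - 1) := by positivity
  have h5 : 0 ≤ 4 * C₂ ^ 2 * D⁻¹ * R * ((r : ℝ) - 1) := by positivity
  calc _ ≤ (4 * C₂ ^ 2) * (r : ℝ)⁻¹ * R * ((r : ℝ) - 1) + ((r : ℝ) - 1) * (C₁ ^ 2 * D⁻¹ * R) :=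
        add_le_add (hs2.trans h3) hs1
    _ ≤ (C₁ ^ 2 + 4 * C₂ ^ 2) * (D⁻¹ + (r : ℝ)⁻¹) * R * ((r : ℝ) - 1) := by nlinarith
    _ = _ := by rw [hR]; ring

/-- Second moment of the Steinhaus model as a sum over squares. -/
lemma integral_norm_sq_sqSum_le (r : ℕ) (κ : ℕ → ℝ) (X : ℕ) :
    ∫ θ, ‖sqSum κ (coprimePart r (steinhaus θ)) X‖ ^ 2 ∂steinhausMeasure ≤
      ∑ n ∈ Finset.Icc 1 X, ‖sqConv κ n‖ ^ 2 := by
  have e : ∀ θ, sqSum κ (coprimePart r (steinhaus θ)) X =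
      ∑ n ∈ Finset.Icc 1 X, (sqConv κ n * (if n.Coprime r then 1 else 0)) * steinhaus θ n := by
    intro θ
    refine Finset.sum_congr rfl fun n _ => ?_
    rw [coprimePart_eq_mul, mul_assoc]
  simp_rw [e]
  rw [integral_norm_sq_sum _ (by simp)]
  refine Finset.sum_le_sum fun n _ => ?_
  split_ifs <;> simp

lemma sum_norm_sq_sqConv_le (κ : ℕ → ℝ) (X : ℕ) :
    ∑ n ∈ Finset.Icc 1 X, ‖sqConv κ n‖ ^ 2 ≤
      ∑ d ∈ Finset.Icc 1 X, κ d ^ 2 * ((X : ℝ) / (d : ℝ) ^ 2) := by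
  have h1 : ∀ n ∈ Finset.Icc 1 X, ‖sqConv κ n‖ ^ 2 ≤
      ∑ d ∈ Finset.Icc 1 X, if d ^ 2 ∣ n then κ d ^ 2 else 0 := by
    intro n hn
    rw [Finset.mem_Icc] at hn
    obtain ⟨d, m, hd, hm, rfl⟩ := exists_sq_mul_squarefree (n := n) (by omega)
    have hm0 : m ≠ 0 := hm.ne_zero
    have hdX : d ∈ Finset.Icc 1 X := by
      rw [Finset.mem_Icc]
      refine ⟨Nat.one_le_iff_ne_zero.2 hd, le_trans ?_ hn.2⟩
      calc d ≤ d ^ 2 := Nat.le_self_pow two_ne_zero d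
        _ ≤ d ^ 2 * m := Nat.le_mul_of_pos_right _ (Nat.pos_of_ne_zero hm0)
    rw [sqConv_apply κ hd hm]
    refine le_trans ?_ (Finset.single_le_sum (f := fun e => if e ^ 2 ∣ d ^ 2 * m then κ e ^ 2 else 0)
      (fun e _ => by split_ifs <;> positivity) hdX)
    rw [if_pos (Dvd.intro _ rfl), norm_mul, mul_pow, Complex.norm_real, Real.norm_eq_abs, sq_abs]
    refine mul_le_of_le_one_right (sq_nonneg _) (pow_le_one₀ (norm_nonneg _)
      (norm_moebius_le_one m))
  refine (Finset.sum_le_sum h1).trans ?_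
  rw [Finset.sum_comm]
  refine Finset.sum_le_sum fun d hd => ?_
  rw [← Finset.sum_filter, Finset.sum_const, nsmul_eq_mul, mul_comm]
  refine mul_le_mul_of_nonneg_left ?_ (sq_nonneg _)
  have h2 : ((Finset.Icc 1 X).filter (fun n => d ^ 2 ∣ n)).card = X / d ^ 2 :=
    Nat.Ioc_filter_dvd_card_eq_div X (d ^ 2)
  rw [h2]
  exact_mod_cast (Nat.cast_div_le (α := ℝ) (m := X) (n := d ^ 2))

lemma integral_norm_sq_sqSum_tail_le :
    ∃ C : ℝ, 0 < C ∧ ∀ (r : ℕ) (D : ℝ) (κ : ℕ → ℝ), 1 ≤ D → IsTailWeight D κ → ∀ X : ℕ,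
      ∫ θ, ‖sqSum κ (coprimePart r (steinhaus θ)) X‖ ^ 2 ∂steinhausMeasure ≤
        C * D ^ (-(1 / 2) : ℝ) * X := by
  have hs : Summable fun d : ℕ => (d : ℝ) ^ (-(3 / 2) : ℝ) :=
    Real.summable_nat_rpow.2 (by norm_num)
  have hs0 : 0 ≤ ∑' d : ℕ, (d : ℝ) ^ (-(3 / 2) : ℝ) := tsum_nonneg fun d => by positivity
  refine ⟨∑' d : ℕ, (d : ℝ) ^ (-(3 / 2) : ℝ) + 1, by linarith, ?_⟩
  intro r D κ hD hκ X
  have hD0 : 0 < D := by linarith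
  refine (integral_norm_sq_sqSum_le r κ X).trans ((sum_norm_sq_sqConv_le κ X).trans ?_)
  have h1 : ∀ d ∈ Finset.Icc 1 X, κ d ^ 2 * ((X : ℝ) / (d : ℝ) ^ 2) ≤
      D ^ (-(1 / 2) : ℝ) * X * (d : ℝ) ^ (-(3 / 2) : ℝ) := by
    intro d hd
    have hd0 : (0:ℝ) < d := by exact_mod_cast (Finset.mem_Icc.1 hd).1
    refine (mul_le_mul_of_nonneg_right (hκ.sq_le hD d) (by positivity)).trans_eq ?_
    have : (d : ℝ) ^ (-(3 / 2) : ℝ) = (d : ℝ) ^ (1 / 2 : ℝ) / (d : ℝ) ^ 2 := by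
      rw [← Real.rpow_natCast, ← Real.rpow_sub hd0]; congr 1; norm_num
    rw [this]; ring
  refine (Finset.sum_le_sum h1).trans ?_
  rw [← Finset.mul_sum]
  have h2 := hs.sum_le_tsum (Finset.Icc 1 X) (fun d _ => by positivity)
  calc _ ≤ D ^ (-(1 / 2) : ℝ) * X * (∑' d : ℕ, (d : ℝ) ^ (-(3 / 2) : ℝ) + 1) :=
        mul_le_mul_of_nonneg_left (by linarith) (by positivity)
    _ = _ := by ring

lemma integral_norm_sq_sqSum_le_self (r : ℕ) {κ : ℕ → ℝ} (hκ : ∀ d, |κ d| ≤ 1) (X : ℕ) :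
    ∫ θ, ‖sqSum κ (coprimePart r (steinhaus θ)) X‖ ^ 2 ∂steinhausMeasure ≤ X := by
  refine (integral_norm_sq_sqSum_le r κ X).trans ?_
  refine (Finset.sum_le_card_nsmul _ _ 1 fun n _ =>
    pow_le_one₀ (norm_nonneg _) (norm_sqConv_le hκ n)).trans ?_
  simp

/-! ### Transfer of twisted second moments to the Steinhaus model -/

lemma norm_sum_div_sub_le {r : ℕ} [Fact r.Prime] (hr2 : r ≠ 2) (F : DirichletCharacter ℂ r → ℂ)
    (E : ℂ) : ‖(∑ χ, F χ) / ((r : ℂ) - 1) - E‖ ≤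
      2 * ‖nonprincipalAvg r F - E‖ + 2 * (r : ℝ)⁻¹ * (‖F 1‖ + ‖E‖) := by
  classical
  have hr3 : (3:ℝ) ≤ r := by
    have := (Fact.out : r.Prime).two_le
    exact_mod_cast (by omega : 3 ≤ r)
  have h1 : (r : ℂ) - 1 ≠ 0 := by
    have : ((r - 1 : ℝ) : ℂ) ≠ 0 := by exact_mod_cast (by linarith : (r : ℝ) - 1 ≠ 0)
    simpa using this
  have h2 : (r : ℂ) - 2 ≠ 0 := by
    have : ((r - 2 : ℝ) : ℂ) ≠ 0 := by exact_mod_cast (by linarith : (r : ℝ) - 2 ≠ 0)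
    simpa using this
  have hN : ((r : ℂ) - 2) * nonprincipalAvg r F = ∑ χ ∈ Finset.univ.erase 1, F χ := by
    unfold nonprincipalAvg
    rw [mul_div_cancel₀ _ h2]
  have hS : ∑ χ, F χ = ((r : ℂ) - 2) * nonprincipalAvg r F + F 1 := by
    rw [hN, Finset.sum_erase_add _ _ (Finset.mem_univ _)]
  have key : (∑ χ, F χ) / ((r : ℂ) - 1) - E = (nonprincipalAvg r F - E) +
      ((r : ℂ) - 1)⁻¹ * (F 1 - E - (nonprincipalAvg r F - E)) := by
    rw [hS]; field_simp; ring
  have h3 : ‖((r : ℂ) - 1)⁻¹‖ ≤ 2 * (r : ℝ)⁻¹ := by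
    have : (r : ℂ) - 1 = ((r - 1 : ℝ) : ℂ) := by push_cast; rfl
    rw [this, norm_inv, Complex.norm_real, Real.norm_of_nonneg (by linarith)]
    rw [← div_eq_mul_inv, inv_le_comm₀ (by linarith) (by positivity), inv_div]
    linarith
  have h4 : 2 * (r : ℝ)⁻¹ ≤ 1 := by
    rw [← div_eq_mul_inv, div_le_one (by linarith)]; linarith
  rw [key]
  set N := ‖nonprincipalAvg r F - E‖ with hNdef
  calc _ ≤ N + ‖((r : ℂ) - 1)⁻¹ * (F 1 - E - (nonprincipalAvg r F - E))‖ := norm_add_le _ _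
    _ ≤ N + (2 * (r : ℝ)⁻¹) * (‖F 1‖ + ‖E‖ + N) := by
        rw [norm_mul]
        refine add_le_add le_rfl (mul_le_mul h3 ?_ (norm_nonneg _) (by positivity))
        exact (norm_sub_le _ _).trans (add_le_add (norm_sub_le _ _) le_rfl)
    _ ≤ _ := by
        have : (2 * (r : ℝ)⁻¹) * N ≤ 1 * N := mul_le_mul_of_nonneg_right h4 (norm_nonneg _)
        nlinarith

lemma norm_sub_le_of_chain {a b c d : ℂ} {x y z : ℝ} (h₁ : ‖a - b‖ ≤ x) (h₂ : ‖b - c‖ ≤ y)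
    (h₃ : ‖c - d‖ ≤ z) : ‖a - d‖ ≤ x + y + z := by
  have e : a - d = (a - b) + (b - c) + (c - d) := by ring
  rw [e]
  exact (norm_add₃_le).trans (add_le_add (add_le_add h₁ h₂) h₃)

/-- A weighted form of the comparison of `‖u + v‖²` with `‖u‖²`. -/
lemma abs_norm_add_sq_sub_le (u v : ℂ) {τ : ℝ} (hτ : 0 < τ) :
    |‖u + v‖ ^ 2 - ‖u‖ ^ 2| ≤ τ * ‖u‖ ^ 2 + (1 + τ⁻¹) * ‖v‖ ^ 2 := by
  have h1 : |‖u + v‖ - ‖u‖| ≤ ‖v‖ := by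
    have := abs_norm_sub_norm_le (u + v) u
    simpa using this
  have h2 : ‖u + v‖ ≤ ‖u‖ + ‖v‖ := norm_add_le u v
  have h3 : |‖u + v‖ ^ 2 - ‖u‖ ^ 2| ≤ ‖v‖ * (2 * ‖u‖ + ‖v‖) := by
    rw [sq_sub_sq, abs_mul, mul_comm, abs_of_nonneg (by positivity : 0 ≤ ‖u + v‖ + ‖u‖)]
    exact mul_le_mul h1 (by linarith) (by positivity) (norm_nonneg _)
  have h4 : 2 * (‖u‖ * ‖v‖) ≤ τ * ‖u‖ ^ 2 + τ⁻¹ * ‖v‖ ^ 2 := by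
    have h5 : 0 ≤ τ⁻¹ * (τ * ‖u‖ - ‖v‖) ^ 2 := by positivity
    have h6 : τ⁻¹ * (τ * ‖u‖ - ‖v‖) ^ 2 = τ * ‖u‖ ^ 2 + τ⁻¹ * ‖v‖ ^ 2 - 2 * (‖u‖ * ‖v‖) := by
      field_simp; ring
    linarith
  nlinarith

lemma norm_character_le_one {r : ℕ} [NeZero r] (χ : DirichletCharacter ℂ r) (a : ZMod r) :
    ‖χ a‖ ≤ 1 := χ.norm_le_one a

lemma mul_star_self_mul (a u : ℂ) : a * u * star u = a * ((‖u‖ ^ 2 : ℝ) : ℂ) := by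
  rw [mul_assoc, Complex.star_def, Complex.mul_conj']
  push_cast; rfl

lemma measurable_sqSum_coprimePart (κ : ℕ → ℝ) (r X : ℕ) :
    Measurable fun θ => sqSum κ (coprimePart r (steinhaus θ)) X :=
  Finset.measurable_sum _ fun n _ => (measurable_coprimePart_steinhaus r n).const_mul _

lemma norm_sqSum_coprimePart_le {κ : ℕ → ℝ} (hκ : ∀ d, |κ d| ≤ 1) (r X : ℕ)
    (θ : Nat.Primes → UnitAddCircle) : ‖sqSum κ (coprimePart r (steinhaus θ)) X‖ ≤ X :=
  norm_sum_Icc_le (fun n => by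
    rw [norm_mul]
    exact mul_le_one₀ (norm_sqConv_le hκ n) (norm_nonneg _)
      (norm_coprimePart_steinhaus_le r θ n)) X

lemma integrable_norm_sq_sqSum {κ : ℕ → ℝ} (hκ : ∀ d, |κ d| ≤ 1) (r X : ℕ) :
    Integrable (fun θ => ‖sqSum κ (coprimePart r (steinhaus θ)) X‖ ^ 2) steinhausMeasure := by
  refine integrable_real_of_measurable_of_bounded
    ((measurable_sqSum_coprimePart κ r X).norm.pow_const 2) ((X : ℝ) ^ 2) fun θ => ?_
  rw [abs_of_nonneg (by positivity)]
  exact pow_le_pow_left₀ (norm_nonneg _) (norm_sqSum_coprimePart_le hκ r X θ) 2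

lemma integrable_twisted_real {r m₁ m₂ : ℕ} {F : (Nat.Primes → UnitAddCircle) → ℝ}
    (hF : Integrable F steinhausMeasure) :
    Integrable (fun θ => coprimePart r (steinhaus θ) m₁ * star (coprimePart r (steinhaus θ) m₂) *
      (F θ : ℂ)) steinhausMeasure := by
  have h := measurable_coprimePart_steinhaus r
  refine hF.ofReal.bdd_mul (c := 1)
    ((h m₁).mul (measurable_star_comp (h m₂))).aestronglyMeasurable
    (Filter.Eventually.of_forall fun θ => ?_)
  rw [norm_mul, norm_star]
  exact mul_le_one₀ (norm_coprimePart_steinhaus_le r θ m₁) (norm_nonneg _)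
    (norm_coprimePart_steinhaus_le r θ m₂)

/-- Discarding the tail in the average over characters. -/
lemma norm_sum_twisted_sub_le {r : ℕ} [Fact r.Prime] (m₁ m₂ : ℕ)
    (u v : DirichletCharacter ℂ r → ℂ) {τ : ℝ} (hτ : 0 < τ) :
    ‖(∑ χ, χ m₁ * star (χ m₂) * ((‖u χ + v χ‖ ^ 2 : ℝ) : ℂ)) / ((r : ℂ) - 1) -
      (∑ χ, χ m₁ * star (χ m₂) * ((‖u χ‖ ^ 2 : ℝ) : ℂ)) / ((r : ℂ) - 1)‖ ≤
      τ * ((∑ χ, ‖u χ‖ ^ 2) / ((r : ℝ) - 1)) +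
        (1 + τ⁻¹) * ((∑ χ, ‖v χ‖ ^ 2) / ((r : ℝ) - 1)) := by
  have hr1 : (1:ℝ) < r := by exact_mod_cast (Fact.out : r.Prime).one_lt
  have hn : ‖(r : ℂ) - 1‖ = (r : ℝ) - 1 := by
    have : (r : ℂ) - 1 = ((r - 1 : ℝ) : ℂ) := by push_cast; rfl
    rw [this, Complex.norm_real, Real.norm_of_nonneg (by linarith)]
  rw [← sub_div, ← Finset.sum_sub_distrib, norm_div, hn, ← mul_div_assoc, ← mul_div_assoc, ← add_div]
  refine div_le_div_of_nonneg_right ?_ (by linarith)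
  rw [Finset.mul_sum, Finset.mul_sum, ← Finset.sum_add_distrib]
  refine norm_sum_le_of_le _ fun χ _ => ?_
  rw [← mul_sub, ← Complex.ofReal_sub, norm_mul, norm_mul, norm_star, Complex.norm_real,
    Real.norm_eq_abs]
  refine (mul_le_of_le_one_left (abs_nonneg _) ?_).trans (abs_norm_add_sq_sub_le _ _ hτ)
  exact mul_le_one₀ (norm_character_le_one χ _) (norm_nonneg _) (norm_character_le_one χ _)

/-- Discarding the tail in the Steinhaus average. -/
lemma norm_integral_twisted_sub_le (r m₁ m₂ X : ℕ) {κ₁ κ₂ : ℕ → ℝ} (h₁ : ∀ d, |κ₁ d| ≤ 1)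
    (h₂ : ∀ d, |κ₂ d| ≤ 1) {τ : ℝ} (hτ : 0 < τ) :
    ‖(∫ θ, coprimePart r (steinhaus θ) m₁ * star (coprimePart r (steinhaus θ) m₂) *
        ((‖sqSum κ₁ (coprimePart r (steinhaus θ)) X +
          sqSum κ₂ (coprimePart r (steinhaus θ)) X‖ ^ 2 : ℝ) : ℂ) ∂steinhausMeasure) -
      ∫ θ, coprimePart r (steinhaus θ) m₁ * star (coprimePart r (steinhaus θ) m₂) *
        ((‖sqSum κ₁ (coprimePart r (steinhaus θ)) X‖ ^ 2 : ℝ) : ℂ) ∂steinhausMeasure‖ ≤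
      τ * (∫ θ, ‖sqSum κ₁ (coprimePart r (steinhaus θ)) X‖ ^ 2 ∂steinhausMeasure) +
        (1 + τ⁻¹) * ∫ θ, ‖sqSum κ₂ (coprimePart r (steinhaus θ)) X‖ ^ 2 ∂steinhausMeasure := by
  have hi1 := integrable_norm_sq_sqSum h₁ r X
  have hi2 := integrable_norm_sq_sqSum h₂ r X
  have hi3 : Integrable (fun θ => ‖sqSum κ₁ (coprimePart r (steinhaus θ)) X +
          sqSum κ₂ (coprimePart r (steinhaus θ)) X‖ ^ 2) steinhausMeasure := by
    refine integrable_real_of_measurable_of_bounded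
      (((measurable_sqSum_coprimePart κ₁ r X).add
        (measurable_sqSum_coprimePart κ₂ r X)).norm.pow_const 2) (((X : ℝ) + X) ^ 2) fun θ => ?_
    rw [abs_of_nonneg (by positivity)]
    exact pow_le_pow_left₀ (norm_nonneg _) ((norm_add_le _ _).trans
      (add_le_add (norm_sqSum_coprimePart_le h₁ r X θ) (norm_sqSum_coprimePart_le h₂ r X θ))) 2
  rw [← integral_sub (integrable_twisted_real hi3) (integrable_twisted_real hi1),
    ← integral_const_mul, ← integral_const_mul,
    ← integral_add (hi1.const_mul _) (hi2.const_mul _)]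
  refine norm_integral_le_of_norm_le ((hi1.const_mul _).add (hi2.const_mul _))
    (Filter.Eventually.of_forall fun θ => ?_)
  rw [← mul_sub, ← Complex.ofReal_sub, norm_mul, norm_mul, norm_star, Complex.norm_real,
    Real.norm_eq_abs]
  refine (mul_le_of_le_one_left (abs_nonneg _) ?_).trans (abs_norm_add_sq_sub_le _ _ hτ)
  exact mul_le_one₀ (norm_coprimePart_steinhaus_le r θ m₁) (norm_nonneg _)
    (norm_coprimePart_steinhaus_le r θ m₂)

/-- The functions `μ` and `λ` are convolutions over squares; the weight is split into a part
supported on `[0, D]` and a tail. -/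
lemma exists_weight_split {c : ℕ → ℤ}
    (hc : (c = fun n => ArithmeticFunction.moebius n) ∨
        (c = fun n => ArithmeticFunction.liouville n)) {D : ℝ} (hD : 1 ≤ D) :
    ∃ κ₁ κ₂ : ℕ → ℝ, (∀ d, |κ₁ d| ≤ 1) ∧ (∀ d : ℕ, D < d → κ₁ d = 0) ∧ IsTailWeight D κ₂ ∧
      ∀ (f : ℕ → ℂ) (X : ℕ), ∑ n ∈ Finset.Icc 1 X, (c n : ℂ) * f n =
        sqSum κ₁ f X + sqSum κ₂ f X := by
  have hD0 : 0 < D := by linarith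
  rcases hc with rfl | rfl
  · refine ⟨fun d => if d = 1 then 1 else 0, fun _ => 0, fun d => ?_, fun d hd => ?_, Or.inr rfl,
      fun f X => ?_⟩
    · simp only; split_ifs <;> simp
    · simp only
      rw [if_neg]
      rintro rfl
      simp only [Nat.cast_one] at hd
      linarith
    · rw [sqSum_zero, add_zero]
      refine Finset.sum_congr rfl fun n hn => ?_
      rw [moebius_eq_sqConv (Nat.one_le_iff_ne_zero.1 (Finset.mem_Icc.1 hn).1)]
  · refine ⟨fun d => 1 - min 1 ((d : ℝ) / D), fun d => min 1 ((d : ℝ) / D), fun d => ?_,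
      fun d hd => ?_, Or.inl rfl, fun f X => ?_⟩
    · have h1 := min_le_left 1 ((d : ℝ) / D)
      have h2 : 0 ≤ min 1 ((d : ℝ) / D) := le_min zero_le_one (by positivity)
      rw [abs_le]; constructor <;> linarith
    · simp only
      rw [min_eq_left ((one_le_div hD0).2 hd.le)]; ring
    · rw [sqSum, sqSum, ← Finset.sum_add_distrib]
      refine Finset.sum_congr rfl fun n hn => ?_
      rw [liouville_eq_sqConv (Nat.one_le_iff_ne_zero.1 (Finset.mem_Icc.1 hn).1), ← add_mul,
        ← sqConv_add]
      congr 3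
      funext d
      ring

set_option maxHeartbeats 1600000 in
/-- Under GRH and the Ratios Conjecture, twisted second moments of `∑ c(n) χ(n)` over all characters
modulo `r` agree with the Steinhaus model up to a power of `r`, for twists by integers up to a small
power of `r`. -/
theorem exists_twisted_second_moment_bound (hGRH : ∀ (r : ℕ) [Fact r.Prime], GRH r)
    (hRatios : TwistedRatiosConjecture) {A : ℝ} (hA : 0 < A) :
    ∃ κ C : ℝ, 0 < κ ∧ κ ≤ 1 / 2 ∧ 0 < C ∧ ∀ (r : ℕ) [Fact r.Prime], r ≠ 2 → ∀ c : ℕ → ℤ,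
      ((c = fun n => ArithmeticFunction.moebius n) ∨
        (c = fun n => ArithmeticFunction.liouville n)) →
      ∀ m₁ m₂ : ℕ, 1 ≤ m₁ → (m₁ : ℝ) ≤ (r : ℝ) ^ κ → 1 ≤ m₂ → (m₂ : ℝ) ≤ (r : ℝ) ^ κ →
      ∀ X : ℕ, (X : ℝ) ≤ (r : ℝ) ^ A →
      ‖(∑ χ : DirichletCharacter ℂ r, χ m₁ * star (χ m₂) *
          ((‖∑ n ∈ Finset.Icc 1 X, (c n : ℂ) * χ (n : ZMod r)‖ ^ 2 : ℝ) : ℂ)) / ((r : ℂ) - 1) -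
        ∫ θ, coprimePart r (steinhaus θ) m₁ * star (coprimePart r (steinhaus θ) m₂) *
          ((‖∑ n ∈ Finset.Icc 1 X, (c n : ℂ) * coprimePart r (steinhaus θ) n‖ ^ 2 : ℝ) : ℂ)
          ∂steinhausMeasure‖ ≤ C * ((X : ℝ) + 1) * (r : ℝ) ^ (-κ) := by
  obtain ⟨w, h, ε₁, hw, hw', hh, hh', hε₁, H₁⟩ :=
    exists_twisted_sqSum_nonprincipal_bound hGRH hRatios
  set β := min w h / 8 with hβ
  have hβ0 : 0 < β := by have := lt_min hw hh; rw [hβ]; linarith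
  have hβw : 8 * β ≤ w := by have := min_le_left w h; rw [hβ]; linarith
  have hβh : 8 * β ≤ h := by have := min_le_right w h; rw [hβ]; linarith
  set ε := min ε₁ (min (1 / 4) (β / (40 * (A + 1)))) with hε
  have hε0 : 0 < ε := lt_min hε₁ (lt_min (by norm_num) (by positivity))
  have hε4 : ε ≤ 1 / 4 := (min_le_right _ _).trans (min_le_left _ _)
  have hεA : ε * (A + 1) ≤ β / 40 := by
    have : ε ≤ β / (40 * (A + 1)) := (min_le_right _ _).trans (min_le_right _ _)
    rw [le_div_iff₀ (by positivity)] at this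
    linarith
  have hεβ : ε ≤ β / 40 := by nlinarith
  obtain ⟨C₁, hC₁, H₁⟩ := H₁ ε hε0 (min_le_left _ _)
  obtain ⟨C₂, hC₂, H₂⟩ := exists_tail_average_bound hGRH hε0 hε4
  obtain ⟨C₃, hC₃, H₃⟩ := exists_sqConv_sum_bound hGRH hε0 hε4
  obtain ⟨C₄, hC₄, H₄⟩ := integral_norm_sq_sqSum_tail_le
  set C₅ := 2 * C₁ + 2 * (C₃ ^ 2 + 1) with hC₅
  have hC₅0 : 0 < C₅ := by positivity
  refine ⟨β / 4, (1 + C₅ + 4 * C₂) + (1 + 2 * C₄) + C₅, by positivity, by linarith, by positivity, ?_⟩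
  intro r _ hr2 c hc m₁ m₂ hm₁ hm₁' hm₂ hm₂' X hX
  have hr2' : (2:ℝ) ≤ r := by exact_mod_cast (Fact.out : r.Prime).two_le
  have hr1 : (1:ℝ) ≤ r := by linarith
  have hr0 : (0:ℝ) < r := by linarith
  set D := (r : ℝ) ^ β with hDdef
  have hD : 1 ≤ D := Real.one_le_rpow hr1 hβ0.le
  have hD0 : 0 ≤ D := by linarith
  obtain ⟨κ₁, κ₂, hκ₁, hκ₁D, hκ₂, hsplit⟩ := exists_weight_split hc hD
  have hX0 : (0:ℝ) ≤ X := Nat.cast_nonneg X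
  have hX1 : 0 < (X : ℝ) + 1 := by linarith
  -- powers of `X + 1` with small exponents are small powers of `r`
  have hXr : (X : ℝ) + 1 ≤ (r : ℝ) ^ (A + 1) := by
    have h1 : 1 ≤ (r : ℝ) ^ A := Real.one_le_rpow hr1 hA.le
    rw [Real.rpow_add hr0, Real.rpow_one]
    nlinarith
  have hXpow : ∀ k : ℝ, 0 ≤ k → ((X : ℝ) + 1) ^ (1 + k * ε) ≤ ((X : ℝ) + 1) * (r : ℝ) ^ (k * (β / 40)) := by
    intro k hk
    rw [Real.rpow_add hX1, Real.rpow_one]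
    refine mul_le_mul_of_nonneg_left ?_ hX1.le
    refine (Real.rpow_le_rpow hX1.le hXr (by positivity)).trans ?_
    rw [← Real.rpow_mul hr0.le]
    refine Real.rpow_le_rpow_of_exponent_le hr1 ?_
    nlinarith
  have hmono : ∀ {a b : ℝ}, a ≤ b → (r : ℝ) ^ a ≤ (r : ℝ) ^ b := fun hab =>
    Real.rpow_le_rpow_of_exponent_le hr1 hab
  have hrinv : (r : ℝ)⁻¹ = (r : ℝ) ^ (-1 : ℝ) := (Real.rpow_neg_one _).symm
  -- comparison for the main part of the weight
  have hmain : ∀ n₁ n₂ : ℕ, 1 ≤ n₁ → (n₁ : ℝ) ≤ (r : ℝ) ^ (β / 4) → 1 ≤ n₂ →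
      (n₂ : ℝ) ≤ (r : ℝ) ^ (β / 4) →
      ‖(∑ χ : DirichletCharacter ℂ r, χ n₁ * star (χ n₂) *
          ((‖sqSum κ₁ (fun n => χ (n : ZMod r)) X‖ ^ 2 : ℝ) : ℂ)) / ((r : ℂ) - 1) -
        ∫ θ, coprimePart r (steinhaus θ) n₁ * star (coprimePart r (steinhaus θ) n₂) *
          ((‖sqSum κ₁ (coprimePart r (steinhaus θ)) X‖ ^ 2 : ℝ) : ℂ)
          ∂steinhausMeasure‖ ≤ C₅ * ((X : ℝ) + 1) * (r : ℝ) ^ (-β) := by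
    intro n₁ n₂ hn₁ hn₁' hn₂ hn₂'
    have hlen : ∀ {n : ℕ}, (n : ℝ) ≤ (r : ℝ) ^ (β / 4) → (n : ℝ) * D ^ 2 ≤ (r : ℝ) ^ h := by
      intro n hn
      have h2 : D ^ 2 = (r : ℝ) ^ (2 * β) := by
        rw [hDdef, ← Real.rpow_natCast, ← Real.rpow_mul hr0.le]; congr 1; push_cast; ring
      rw [h2]
      calc _ ≤ (r : ℝ) ^ (β / 4) * (r : ℝ) ^ (2 * β) :=
            mul_le_mul_of_nonneg_right hn (by positivity)
        _ = (r : ℝ) ^ (β / 4 + 2 * β) := (Real.rpow_add hr0 _ _).symm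
        _ ≤ _ := hmono (by linarith)
    have h1 := H₁ r hr2 D κ₁ hD0 hκ₁ hκ₁D n₁ n₂ hn₁ (hlen hn₁') hn₂ (hlen hn₂') X
    simp_rw [mul_star_self_mul] at h1
    refine (norm_sum_div_sub_le hr2 _ _).trans ?_
    have h2 : C₁ * D ^ 2 * ((X : ℝ) + 1) ^ (1 + 6 * ε) * (r : ℝ) ^ (-w) ≤
        C₁ * ((X : ℝ) + 1) * (r : ℝ) ^ (-β) := by
      have h2 : D ^ 2 = (r : ℝ) ^ (2 * β) := by
        rw [hDdef, ← Real.rpow_natCast, ← Real.rpow_mul hr0.le]; congr 1; push_cast; ring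
      rw [h2]
      calc _ = C₁ * ((r : ℝ) ^ (2 * β) * ((X : ℝ) + 1) ^ (1 + 6 * ε) * (r : ℝ) ^ (-w)) := by ring
        _ ≤ C₁ * ((r : ℝ) ^ (2 * β) * (((X : ℝ) + 1) * (r : ℝ) ^ (6 * (β / 40))) *
            (r : ℝ) ^ (-w)) := by
            refine mul_le_mul_of_nonneg_left (mul_le_mul_of_nonneg_right
              (mul_le_mul_of_nonneg_left (hXpow 6 (by norm_num)) (by positivity))
              (by positivity)) hC₁.le
        _ = C₁ * ((X : ℝ) + 1) * (r : ℝ) ^ (2 * β + 6 * (β / 40) + -w) := by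
            rw [Real.rpow_add hr0, Real.rpow_add hr0]; ring
        _ ≤ _ := mul_le_mul_of_nonneg_left (hmono (by linarith)) (by positivity)
    have h3 : ‖(1 : DirichletCharacter ℂ r) n₁ * star ((1 : DirichletCharacter ℂ r) n₂) *
          ((‖sqSum κ₁ (fun n => (1 : DirichletCharacter ℂ r) (n : ZMod r)) X‖ ^ 2 : ℝ) : ℂ)‖ ≤
        C₃ ^ 2 * (((X : ℝ) + 1) * (r : ℝ) ^ (1 / 2 : ℝ)) := by
      rw [norm_mul, norm_mul, norm_star, Complex.norm_real, Real.norm_of_nonneg (by positivity)]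
      refine (mul_le_of_le_one_left (by positivity) (mul_le_one₀ (norm_character_le_one _ _)
        (norm_nonneg _) (norm_character_le_one _ _))).trans ?_
      rw [sqSum_character_eq]
      refine (pow_le_pow_left₀ (norm_nonneg _) (H₃ r 1 κ₁ hκ₁ X) 2).trans ?_
      rw [mul_pow, mul_pow, ← Real.rpow_natCast ((r : ℝ) ^ _), ← Real.rpow_mul hr0.le,
        ← Real.rpow_natCast (((X : ℝ) + 1) ^ _), ← Real.rpow_mul hX1.le, mul_assoc]
      refine mul_le_mul_of_nonneg_left ?_ (by positivity)
      have e : (1 / 2 + 3 * ε) * ((2 : ℕ) : ℝ) = 1 + 6 * ε := by push_cast; ring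
      rw [e]
      calc _ ≤ (r : ℝ) ^ (ε * ((2 : ℕ) : ℝ)) * (((X : ℝ) + 1) * (r : ℝ) ^ (6 * (β / 40))) :=
            mul_le_mul_of_nonneg_left (hXpow 6 (by norm_num)) (by positivity)
        _ = ((X : ℝ) + 1) * (r : ℝ) ^ (ε * ((2 : ℕ) : ℝ) + 6 * (β / 40)) := by
            rw [Real.rpow_add hr0]; ring
        _ ≤ _ := mul_le_mul_of_nonneg_left (hmono (by push_cast; linarith)) hX1.le
    have h4 : ‖∫ θ, coprimePart r (steinhaus θ) n₁ * star (coprimePart r (steinhaus θ) n₂) *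
          ((‖sqSum κ₁ (coprimePart r (steinhaus θ)) X‖ ^ 2 : ℝ) : ℂ) ∂steinhausMeasure‖ ≤
        ((X : ℝ) + 1) * (r : ℝ) ^ (1 / 2 : ℝ) := by
      refine (norm_integral_le_of_norm_le (integrable_norm_sq_sqSum hκ₁ r X)
        (Filter.Eventually.of_forall fun θ => ?_)).trans
        ((integral_norm_sq_sqSum_le_self r hκ₁ X).trans ?_)
      · rw [norm_mul, norm_mul, norm_star, Complex.norm_real, Real.norm_of_nonneg (by positivity)]
        exact mul_le_of_le_one_left (by positivity) (mul_le_one₀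
          (norm_coprimePart_steinhaus_le r θ n₁) (norm_nonneg _)
          (norm_coprimePart_steinhaus_le r θ n₂))
      · have : 1 ≤ (r : ℝ) ^ (1 / 2 : ℝ) := Real.one_le_rpow hr1 (by norm_num)
        nlinarith
    have h5 : (r : ℝ)⁻¹ * (r : ℝ) ^ (1 / 2 : ℝ) ≤ (r : ℝ) ^ (-β) := by
      rw [hrinv, ← Real.rpow_add hr0]; exact hmono (by linarith)
    calc _ ≤ 2 * (C₁ * ((X : ℝ) + 1) * (r : ℝ) ^ (-β)) + 2 * (r : ℝ)⁻¹ *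
          (C₃ ^ 2 * (((X : ℝ) + 1) * (r : ℝ) ^ (1 / 2 : ℝ)) +
            ((X : ℝ) + 1) * (r : ℝ) ^ (1 / 2 : ℝ)) :=
          add_le_add (mul_le_mul_of_nonneg_left (h1.trans h2) (by norm_num))
            (mul_le_mul_of_nonneg_left (add_le_add h3 h4) (by positivity))
      _ = 2 * C₁ * ((X : ℝ) + 1) * (r : ℝ) ^ (-β) + 2 * (C₃ ^ 2 + 1) * ((X : ℝ) + 1) *
          ((r : ℝ)⁻¹ * (r : ℝ) ^ (1 / 2 : ℝ)) := by ring
      _ ≤ 2 * C₁ * ((X : ℝ) + 1) * (r : ℝ) ^ (-β) + 2 * (C₃ ^ 2 + 1) * ((X : ℝ) + 1) *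
          (r : ℝ) ^ (-β) := add_le_add le_rfl (mul_le_mul_of_nonneg_left h5 (by positivity))
      _ = _ := by rw [hC₅]; ring
  -- mean squares of the main part and of the tail
  have hUf : ∫ θ, ‖sqSum κ₁ (coprimePart r (steinhaus θ)) X‖ ^ 2 ∂steinhausMeasure ≤ (X : ℝ) + 1 :=
    (integral_norm_sq_sqSum_le_self r hκ₁ X).trans (by linarith)
  have hU : (∑ χ : DirichletCharacter ℂ r, ‖sqSum κ₁ (fun n => χ (n : ZMod r)) X‖ ^ 2) /
      ((r : ℝ) - 1) ≤ (1 + C₅) * ((X : ℝ) + 1) := by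
    have h1 := hmain 1 1 le_rfl (by simpa using Real.one_le_rpow hr1 (by positivity)) le_rfl
      (by simpa using Real.one_le_rpow hr1 (by positivity))
    have e1 : ∀ θ, coprimePart r (steinhaus θ) 1 = 1 := fun θ =>
      ((isMult_steinhaus θ).coprimePart r).map_one
    simp only [Nat.cast_one, map_one, star_one, one_mul, e1] at h1
    rw [integral_complex_ofReal, ← Complex.ofReal_sum] at h1
    have e2 : ((∑ χ : DirichletCharacter ℂ r, ‖sqSum κ₁ (fun n => χ (n : ZMod r)) X‖ ^ 2 : ℝ) : ℂ) /
        ((r : ℂ) - 1) - ((∫ θ, ‖sqSum κ₁ (coprimePart r (steinhaus θ)) X‖ ^ 2 ∂steinhausMeasure : ℝ)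
        : ℂ) = (((∑ χ : DirichletCharacter ℂ r, ‖sqSum κ₁ (fun n => χ (n : ZMod r)) X‖ ^ 2) /
        ((r : ℝ) - 1) - ∫ θ, ‖sqSum κ₁ (coprimePart r (steinhaus θ)) X‖ ^ 2 ∂steinhausMeasure : ℝ)
        : ℂ) := by push_cast; ring
    rw [e2, Complex.norm_real, Real.norm_eq_abs] at h1
    have h2 := (le_abs_self _).trans h1
    have h3 : C₅ * ((X : ℝ) + 1) * (r : ℝ) ^ (-β) ≤ C₅ * ((X : ℝ) + 1) :=
      mul_le_of_le_one_right (by positivity) (Real.rpow_le_one_of_one_le_of_nonpos hr1 (by linarith))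
    linarith
  have hV : (∑ χ : DirichletCharacter ℂ r, ‖sqSum κ₂ (fun n => χ (n : ZMod r)) X‖ ^ 2) /
      ((r : ℝ) - 1) ≤ 2 * C₂ * ((X : ℝ) + 1) * (r : ℝ) ^ (-(β / 2)) := by
    refine (H₂ r D κ₂ hD hκ₂ X).trans ?_
    have h1 : D⁻¹ + (r : ℝ)⁻¹ ≤ 2 * (r : ℝ) ^ (-β) := by
      have h2 : (r : ℝ)⁻¹ ≤ (r : ℝ) ^ (-β) := by rw [hrinv]; exact hmono (by linarith)
      rw [hDdef, ← Real.rpow_neg hr0.le]; linarith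
    calc _ ≤ C₂ * (2 * (r : ℝ) ^ (-β)) * (r : ℝ) ^ (4 * ε) *
          (((X : ℝ) + 1) * (r : ℝ) ^ (10 * (β / 40))) :=
          mul_le_mul (mul_le_mul_of_nonneg_right (mul_le_mul_of_nonneg_left h1 hC₂.le)
            (by positivity)) (hXpow 10 (by norm_num)) (by positivity) (by positivity)
      _ = 2 * C₂ * ((X : ℝ) + 1) * (r : ℝ) ^ (-β + 4 * ε + 10 * (β / 40)) := by
          rw [Real.rpow_add hr0, Real.rpow_add hr0]; ring
      _ ≤ _ := mul_le_mul_of_nonneg_left (hmono (by linarith)) (by positivity)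
  have hVf : ∫ θ, ‖sqSum κ₂ (coprimePart r (steinhaus θ)) X‖ ^ 2 ∂steinhausMeasure ≤
      C₄ * ((X : ℝ) + 1) * (r : ℝ) ^ (-(β / 2)) := by
    refine (H₄ r D κ₂ hD hκ₂ X).trans ?_
    have e : D ^ (-(1 / 2) : ℝ) = (r : ℝ) ^ (-(β / 2)) := by
      rw [hDdef, ← Real.rpow_mul hr0.le]; congr 1; ring
    rw [e]
    have : 0 < (r : ℝ) ^ (-(β / 2)) := by positivity
    calc C₄ * (r : ℝ) ^ (-(β / 2)) * X ≤ C₄ * (r : ℝ) ^ (-(β / 2)) * (X + 1) :=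
          mul_le_mul_of_nonneg_left (by linarith) (by positivity)
      _ = _ := by ring
  set τ := (r : ℝ) ^ (-(β / 4)) with hτdef
  have hτ : 0 < τ := by positivity
  have hτ1 : τ ≤ 1 := Real.rpow_le_one_of_one_le_of_nonpos hr1 (by linarith)
  have hτ2 : (1 + τ⁻¹) * (r : ℝ) ^ (-(β / 2)) ≤ 2 * τ := by
    have h1 : (r : ℝ) ^ (-(β / 2)) = τ * τ := by
      rw [hτdef, ← Real.rpow_add hr0]; congr 1; ring
    rw [h1]
    have : (1 + τ⁻¹) * (τ * τ) = τ * τ + τ := by field_simp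
    rw [this]
    nlinarith
  have hβτ : (r : ℝ) ^ (-β) ≤ τ := hmono (by linarith)
  have t1 := norm_sum_twisted_sub_le m₁ m₂ (fun χ : DirichletCharacter ℂ r =>
    sqSum κ₁ (fun n => χ (n : ZMod r)) X) (fun χ => sqSum κ₂ (fun n => χ (n : ZMod r)) X) hτ
  have t2 := norm_integral_twisted_sub_le r m₁ m₂ X hκ₁ (hκ₂.abs_le_one hD) hτ
  have t3 := hmain m₁ m₂ hm₁ hm₁' hm₂ hm₂'
  have hs1 : ∀ χ : DirichletCharacter ℂ r, ∑ n ∈ Finset.Icc 1 X, (c n : ℂ) * χ (n : ZMod r) =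
      sqSum κ₁ (fun n => χ (n : ZMod r)) X + sqSum κ₂ (fun n => χ (n : ZMod r)) X :=
    fun χ => hsplit (fun n => χ (n : ZMod r)) X
  simp_rw [hs1, fun θ => hsplit (coprimePart r (steinhaus θ)) X]
  have b1 : τ * ((∑ χ : DirichletCharacter ℂ r, ‖sqSum κ₁ (fun n => χ (n : ZMod r)) X‖ ^ 2) /
      ((r : ℝ) - 1)) + (1 + τ⁻¹) * ((∑ χ : DirichletCharacter ℂ r,
      ‖sqSum κ₂ (fun n => χ (n : ZMod r)) X‖ ^ 2) / ((r : ℝ) - 1)) ≤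
      (1 + C₅ + 4 * C₂) * ((X : ℝ) + 1) * τ := by
    calc _ ≤ τ * ((1 + C₅) * ((X : ℝ) + 1)) +
          (1 + τ⁻¹) * (2 * C₂ * ((X : ℝ) + 1) * (r : ℝ) ^ (-(β / 2))) :=
          add_le_add (mul_le_mul_of_nonneg_left hU hτ.le)
            (mul_le_mul_of_nonneg_left hV (by positivity))
      _ = (1 + C₅) * ((X : ℝ) + 1) * τ +
          2 * C₂ * ((X : ℝ) + 1) * ((1 + τ⁻¹) * (r : ℝ) ^ (-(β / 2))) := by ring
      _ ≤ (1 + C₅) * ((X : ℝ) + 1) * τ + 2 * C₂ * ((X : ℝ) + 1) * (2 * τ) :=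
          add_le_add le_rfl (mul_le_mul_of_nonneg_left hτ2 (by positivity))
      _ = _ := by ring
  have b2 : τ * (∫ θ, ‖sqSum κ₁ (coprimePart r (steinhaus θ)) X‖ ^ 2 ∂steinhausMeasure) +
      (1 + τ⁻¹) * (∫ θ, ‖sqSum κ₂ (coprimePart r (steinhaus θ)) X‖ ^ 2 ∂steinhausMeasure) ≤
      (1 + 2 * C₄) * ((X : ℝ) + 1) * τ := by
    calc _ ≤ τ * ((X : ℝ) + 1) + (1 + τ⁻¹) * (C₄ * ((X : ℝ) + 1) * (r : ℝ) ^ (-(β / 2))) :=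
          add_le_add (mul_le_mul_of_nonneg_left hUf hτ.le)
            (mul_le_mul_of_nonneg_left hVf (by positivity))
      _ = ((X : ℝ) + 1) * τ + C₄ * ((X : ℝ) + 1) * ((1 + τ⁻¹) * (r : ℝ) ^ (-(β / 2))) := by ring
      _ ≤ ((X : ℝ) + 1) * τ + C₄ * ((X : ℝ) + 1) * (2 * τ) :=
          add_le_add le_rfl (mul_le_mul_of_nonneg_left hτ2 (by positivity))
      _ = _ := by ring
  have b3 : C₅ * ((X : ℝ) + 1) * (r : ℝ) ^ (-β) ≤ C₅ * ((X : ℝ) + 1) * τ :=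
    mul_le_mul_of_nonneg_left hβτ (by positivity)
  rw [norm_sub_rev] at t2
  refine (norm_sub_le_of_chain (t1.trans b1) (t3.trans b3) (t2.trans b2)).trans_eq ?_
  ring

/-! ### Sums over primes and moments of random prime sums -/

/-- The primes up to `P`. -/
def primesUpTo (P : ℝ) : Finset ℕ := (Finset.Icc 1 ⌊P⌋₊).filter Nat.Prime

/-- The sum of the reciprocals of the primes up to `P`. -/
def primeHarmonic (P : ℝ) : ℝ := ∑ p ∈ primesUpTo P, 1 / (p : ℝ)

lemma mem_primesUpTo {P : ℝ} {p : ℕ} : p ∈ primesUpTo P ↔ p.Prime ∧ (p : ℝ) ≤ P := by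
  rw [primesUpTo, Finset.mem_filter, Finset.mem_Icc, and_comm]
  refine and_congr_right fun hp => ?_
  rw [Nat.le_floor_iff' hp.ne_zero]
  exact ⟨fun h => h.2, fun h => ⟨hp.one_le, h⟩⟩

lemma primeHarmonic_mono {P P' : ℝ} (h : P ≤ P') : primeHarmonic P ≤ primeHarmonic P' :=
  Finset.sum_le_sum_of_subset_of_nonneg
    (fun p hp => mem_primesUpTo.2 ⟨(mem_primesUpTo.1 hp).1, (mem_primesUpTo.1 hp).2.trans h⟩)
    fun p _ _ => by positivity

/-- The sum of `1 / p` over a dyadic block, from Chebyshev's bound. -/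
lemma sum_dyadic_primes_le {k : ℕ} (hk : 1 ≤ k) :
    ∑ p ∈ (Finset.Ioc (2 ^ k) (2 ^ (k + 1))).filter Nat.Prime, 1 / (p : ℝ) ≤ 4 / k := by
  have hk0 : (0:ℝ) < k := by exact_mod_cast hk
  have hlog2 : 0 < Real.log 2 := Real.log_pos one_lt_two
  have h2k : (0:ℝ) < 2 ^ k := by positivity
  have hpt : ∀ p ∈ (Finset.Ioc (2 ^ k) (2 ^ (k + 1))).filter Nat.Prime,
      1 / (p : ℝ) ≤ Real.log p / (2 ^ k * (k * Real.log 2)) := by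
    intro p hp
    rw [Finset.mem_filter, Finset.mem_Ioc] at hp
    have hp1 : (2:ℝ) ^ k ≤ p := by exact_mod_cast hp.1.1.le
    have hl : k * Real.log 2 ≤ Real.log p := by
      rw [← Real.log_pow]; exact Real.log_le_log h2k hp1
    rw [div_le_div_iff₀ (by linarith) (by positivity), one_mul, mul_comm (Real.log _)]
    exact mul_le_mul hp1 hl (by positivity) (by linarith)
  refine (Finset.sum_le_sum hpt).trans ?_
  rw [← Finset.sum_div]
  have hθ : ∑ p ∈ (Finset.Ioc (2 ^ k) (2 ^ (k + 1))).filter Nat.Prime, Real.log p ≤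
      Real.log 4 * 2 ^ (k + 1) := by
    refine le_trans ?_ (Chebyshev.theta_le_log4_mul_x (x := 2 ^ (k + 1)) (by positivity))
    unfold Chebyshev.theta
    refine Finset.sum_le_sum_of_subset_of_nonneg ?_ fun p _ _ => Real.log_natCast_nonneg p
    intro p hp
    rw [Finset.mem_filter, Finset.mem_Ioc] at hp ⊢
    refine ⟨⟨hp.2.pos, Nat.le_floor ?_⟩, hp.2⟩
    exact_mod_cast hp.1.2
  rw [div_le_div_iff₀ (by positivity) hk0]
  have h4 : Real.log 4 = 2 * Real.log 2 := by
    rw [show (4:ℝ) = 2 ^ 2 by norm_num, Real.log_pow]; norm_num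
  calc _ ≤ Real.log 4 * 2 ^ (k + 1) * k := mul_le_mul_of_nonneg_right hθ hk0.le
    _ = _ := by rw [h4, pow_succ]; ring

lemma primeHarmonic_two_pow_le (k : ℕ) : primeHarmonic (2 ^ (k + 1)) ≤ 1 / 2 + 4 * (harmonic k : ℝ) := by
  induction k with
  | zero =>
    have : primesUpTo (2 ^ (0 + 1)) = {2} := by
      ext p
      rw [mem_primesUpTo, Finset.mem_singleton]
      constructor
      · rintro ⟨h1, h2⟩
        have : p ≤ 2 := by exact_mod_cast (by simpa using h2 : (p : ℝ) ≤ 2)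
        have := h1.two_le
        omega
      · rintro rfl
        exact ⟨Nat.prime_two, by norm_num⟩
    rw [primeHarmonic, this]
    simp
  | succ k ih =>
    have hsub : primesUpTo (2 ^ (k + 1 + 1)) = primesUpTo (2 ^ (k + 1)) ∪
        (Finset.Ioc (2 ^ (k + 1)) (2 ^ (k + 1 + 1))).filter Nat.Prime := by
      ext p
      rw [Finset.mem_union, mem_primesUpTo, mem_primesUpTo, Finset.mem_filter, Finset.mem_Ioc]
      have e1 : ((p : ℝ) ≤ 2 ^ (k + 1 + 1)) ↔ p ≤ 2 ^ (k + 1 + 1) := by norm_cast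
      have e2 : ((p : ℝ) ≤ 2 ^ (k + 1)) ↔ p ≤ 2 ^ (k + 1) := by norm_cast
      rw [e1, e2]
      have e3 : 2 ^ (k + 1) ≤ 2 ^ (k + 1 + 1) := Nat.pow_le_pow_right (by norm_num) (by omega)
      constructor
      · rintro ⟨h1, h2⟩
        by_cases h : p ≤ 2 ^ (k + 1)
        · exact Or.inl ⟨h1, h⟩
        · exact Or.inr ⟨⟨not_le.1 h, h2⟩, h1⟩
      · rintro (⟨h1, h2⟩ | ⟨⟨_, h2⟩, h1⟩)
        · exact ⟨h1, h2.trans e3⟩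
        · exact ⟨h1, h2⟩
    have hle : primeHarmonic (2 ^ (k + 1 + 1)) ≤ primeHarmonic (2 ^ (k + 1)) +
        ∑ p ∈ (Finset.Ioc (2 ^ (k + 1)) (2 ^ (k + 1 + 1))).filter Nat.Prime, 1 / (p : ℝ) := by
      unfold primeHarmonic
      rw [hsub, ← Finset.sum_union_inter]
      exact le_add_of_nonneg_right (Finset.sum_nonneg fun p _ => by positivity)
    have hb := sum_dyadic_primes_le (k := k + 1) (by omega)
    rw [harmonic_succ]
    push_cast at hb ⊢
    have : (4:ℝ) / (k + 1) = 4 * ((k : ℝ) + 1)⁻¹ := div_eq_mul_inv _ _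
    linarith

/-- An upper bound for the sum of the reciprocals of the primes, with a non-optimal constant. -/
lemma primeHarmonic_le {P : ℝ} (hP : 3 ≤ P) : primeHarmonic P ≤ 8 + 4 * Real.log (Real.log P) := by
  set k := Nat.clog 2 ⌈P⌉₊ with hk
  have hlogP : 1 < Real.log P := by
    rw [Real.lt_log_iff_exp_lt (by linarith)]
    exact Real.exp_one_lt_three.trans_le hP
  have hP1 : P ≤ 2 ^ k := by
    have h1 : ⌈P⌉₊ ≤ 2 ^ k := Nat.le_pow_clog one_lt_two _
    exact (Nat.le_ceil P).trans (by exact_mod_cast h1)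
  have hk1 : 1 < k := by
    by_contra h
    have : (2:ℝ) ^ k ≤ 2 ^ 1 := pow_le_pow_right₀ (by norm_num) (not_lt.1 h)
    linarith
  obtain ⟨j, hj⟩ : ∃ j, k = j + 1 := ⟨k - 1, by omega⟩
  have hP2 : (2:ℝ) ^ j < P := by
    have h1 : 2 ^ j < ⌈P⌉₊ := by
      have := Nat.pow_pred_clog_lt_self (b := 2) one_lt_two (x := ⌈P⌉₊)
        (Nat.lt_ceil.2 (by norm_num; linarith))
      rw [← hk, hj] at this
      exact this
    have := Nat.lt_ceil.1 h1
    exact_mod_cast this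
  have hj0 : (0:ℝ) < j := by exact_mod_cast (by omega : 0 < j)
  have h1 : primeHarmonic P ≤ 1 / 2 + 4 * (harmonic j : ℝ) :=
    (primeHarmonic_mono (by rw [← hj]; exact hP1)).trans (primeHarmonic_two_pow_le j)
  have h2 : (harmonic j : ℝ) ≤ 1 + Real.log j := harmonic_le_one_add_log j
  have h3 : (j : ℝ) ≤ 2 * Real.log P := by
    have h4 : j * Real.log 2 ≤ Real.log P := by
      rw [← Real.log_pow]; exact Real.log_le_log (by positivity) hP2.le
    have h5 : 1 / 2 ≤ Real.log 2 := by linarith [Real.log_two_gt_d9]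
    nlinarith
  have h4 : Real.log j ≤ Real.log 2 + Real.log (Real.log P) := by
    rw [← Real.log_mul (by norm_num) (by linarith)]
    exact Real.log_le_log hj0 h3
  have h5 := Real.log_two_lt_d9
  linarith

lemma primeSum_steinhaus_eq (P : ℝ) (b : ℕ → ℂ) (θ : Nat.Primes → UnitAddCircle) :
    primeSum P b (steinhaus θ) = ∑ p ∈ (Finset.Icc 1 ⌊P⌋₊).subtype Nat.Prime,
      (b p * steinhaus θ p / (√(p : ℝ) : ℂ) + b (p ^ 2) * steinhaus θ (p ^ 2) / (p : ℂ)).re := by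
  unfold primeSum
  rw [Complex.re_sum, ← Finset.sum_subtype_eq_sum_filter]

lemma steinhaus_prime (θ : Nat.Primes → UnitAddCircle) (p : Nat.Primes) :
    steinhaus θ p = (AddCircle.toCircle (θ p) : ℂ) := by
  unfold steinhaus
  rw [p.2.factorization, Finsupp.prod_single_index]
  · rw [dif_pos p.2, pow_one]; rfl
  · rw [dif_pos p.2, pow_zero]

lemma steinhaus_prime_sq (θ : Nat.Primes → UnitAddCircle) (p : Nat.Primes) :
    steinhaus θ ((p : ℕ) ^ 2) = (AddCircle.toCircle (θ p) : ℂ) ^ 2 := by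
  rw [sq, steinhaus_mul θ p.2.ne_zero p.2.ne_zero, steinhaus_prime, sq]

lemma integral_steinhaus {n : ℕ} (hn : n ≠ 0) (hn1 : n ≠ 1) :
    ∫ θ, steinhaus θ n ∂steinhausMeasure = 0 := by
  have := integral_steinhaus_mul_star hn one_ne_zero
  simpa [steinhaus_one, hn1] using this

lemma integrable_steinhaus (n : ℕ) : Integrable (fun θ => steinhaus θ n) steinhausMeasure :=
  integrable_of_measurable_of_bounded (measurable_steinhaus n) 1 fun θ => (norm_steinhaus θ n).le

lemma sqrt_le_self_of_prime {p : ℕ} (hp : p.Prime) : √(p : ℝ) ≤ p := by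
  have : (1:ℝ) ≤ p := by exact_mod_cast hp.one_le
  rw [Real.sqrt_le_left (by linarith)]
  nlinarith

/-- The random prime sums are subgaussian, by Hoeffding's lemma. -/
lemma hasSubgaussianMGF_primeSum (P : ℝ) {b : ℕ → ℂ}
    (hb : ∀ p : ℕ, p.Prime → ‖b p‖ ≤ 1 ∧ ‖b (p ^ 2)‖ ≤ 1) :
    ProbabilityTheory.HasSubgaussianMGF (fun θ => primeSum P b (steinhaus θ))
      (∑ p ∈ (Finset.Icc 1 ⌊P⌋₊).subtype Nat.Prime, 4 / ((p : ℕ) : NNReal)) steinhausMeasure := by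
  set x : Nat.Primes → UnitAddCircle → ℝ := fun p u =>
    (b p * (AddCircle.toCircle u : ℂ) / (√(p : ℝ) : ℂ) +
      b (p ^ 2) * (AddCircle.toCircle u : ℂ) ^ 2 / (p : ℂ)).re with hx
  have hxm : ∀ p, Measurable (x p) := by
    intro p
    have hc : Continuous fun u : UnitAddCircle => (AddCircle.toCircle u : ℂ) :=
      continuous_subtype_val.comp AddCircle.continuous_toCircle
    exact (Complex.continuous_re.comp (((continuous_const.mul hc).div_const _).add
      ((continuous_const.mul (hc.pow 2)).div_const _))).measurable
  have hxe : ∀ (p : Nat.Primes) θ, (b p * steinhaus θ p / (√(p : ℝ) : ℂ) +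
      b (p ^ 2) * steinhaus θ (p ^ 2) / (p : ℂ)).re = x p (θ p) := by
    intro p θ
    rw [hx, steinhaus_prime, steinhaus_prime_sq]
  have hfe : (fun θ => primeSum P b (steinhaus θ)) =
      fun θ => ∑ p ∈ (Finset.Icc 1 ⌊P⌋₊).subtype Nat.Prime, x p (θ p) := by
    funext θ
    rw [primeSum_steinhaus_eq]
    exact Finset.sum_congr rfl fun p _ => hxe p θ
  rw [hfe]
  refine ProbabilityTheory.HasSubgaussianMGF.sum_of_iIndepFun
    (X := fun (p : Nat.Primes) (θ : Nat.Primes → UnitAddCircle) => x p (θ p))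
    (ProbabilityTheory.iIndepFun_infinitePi hxm) fun p _ => ?_
  have hp0 : (0:ℝ) < (p : ℕ) := by exact_mod_cast p.2.pos
  have hs0 : 0 < √((p : ℕ) : ℝ) := Real.sqrt_pos.2 hp0
  have hsub := ProbabilityTheory.hasSubgaussianMGF_of_mem_Icc_of_integral_eq_zero
    (μ := steinhausMeasure) (X := fun θ : Nat.Primes → UnitAddCircle => x p (θ p))
    (a := -(2 / √((p : ℕ) : ℝ))) (b := 2 / √((p : ℕ) : ℝ))
    ((hxm p).comp (measurable_pi_apply p)).aemeasurable
    (Filter.Eventually.of_forall fun θ => ?_) ?_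
  · have hcst : 4 / ((p : ℕ) : NNReal) =
        (‖2 / √((p : ℕ) : ℝ) - -(2 / √((p : ℕ) : ℝ))‖₊ / 2) ^ 2 := by
      rw [← NNReal.coe_inj]
      push_cast
      rw [sub_neg_eq_add, Real.norm_of_nonneg (by positivity), div_pow]
      have : (2 / √((p : ℕ) : ℝ) + 2 / √((p : ℕ) : ℝ)) ^ 2 = 16 / (p : ℕ) := by
        rw [← add_div, div_pow, Real.sq_sqrt hp0.le]; norm_num
      rw [this]
      field_simp
      norm_num
    rw [← hcst] at hsub
    exact hsub
  · refine abs_le.1 ?_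
    refine (Complex.abs_re_le_norm _).trans ((norm_add_le _ _).trans ?_)
    rw [norm_div, norm_div, norm_mul, norm_mul, norm_pow, Circle.norm_coe, one_pow, mul_one,
      mul_one, Complex.norm_real, Real.norm_of_nonneg hs0.le, Complex.norm_natCast]
    have h1 : ‖b p‖ / √((p : ℕ) : ℝ) ≤ 1 / √((p : ℕ) : ℝ) :=
      div_le_div_of_nonneg_right (hb p p.2).1 hs0.le
    have h2 : ‖b ((p : ℕ) ^ 2)‖ / ((p : ℕ) : ℝ) ≤ 1 / √((p : ℕ) : ℝ) :=
      div_le_div₀ zero_le_one (hb p p.2).2 hs0 (sqrt_le_self_of_prime p.2)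
    calc _ ≤ 1 / √((p : ℕ) : ℝ) + 1 / √((p : ℕ) : ℝ) := add_le_add h1 h2
      _ = _ := by ring
  · simp_rw [← hxe]
    have hi : Integrable (fun θ => b p * steinhaus θ p / (√(p : ℝ) : ℂ) +
      b (p ^ 2) * steinhaus θ (p ^ 2) / (p : ℂ)) steinhausMeasure :=
      (((integrable_steinhaus _).const_mul _).div_const _).add
        (((integrable_steinhaus _).const_mul _).div_const _)
    have h1 := integral_re hi
    simp only [RCLike.re_eq_complex_re] at h1
    rw [h1, integral_add (((integrable_steinhaus _).const_mul _).div_const _)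
      (((integrable_steinhaus _).const_mul _).div_const _), integral_div, integral_div,
      integral_const_mul, integral_const_mul, integral_steinhaus p.2.ne_zero p.2.ne_one,
      integral_steinhaus (pow_ne_zero 2 p.2.ne_zero)]
    · simp
    · intro h
      exact p.2.ne_one (Nat.pow_eq_one.1 h |>.resolve_right two_ne_zero)

lemma measurable_primeSum_steinhaus (P : ℝ) (b : ℕ → ℂ) :
    Measurable fun θ => primeSum P b (steinhaus θ) :=
  Complex.measurable_re.comp (Finset.measurable_sum _ fun p _ =>
    (((measurable_steinhaus p).const_mul _).div_const _).add
      (((measurable_steinhaus (p ^ 2)).const_mul _).div_const _))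

/-- Trivial bound for a prime sum at a function bounded by one. -/
lemma abs_primeSum_le {P : ℝ} {b f : ℕ → ℂ} (hb : ∀ p : ℕ, p.Prime → ‖b p‖ ≤ 1 ∧ ‖b (p ^ 2)‖ ≤ 1)
    (hf : ∀ n, ‖f n‖ ≤ 1) : |primeSum P b f| ≤ 2 * ⌊P⌋₊ := by
  unfold primeSum
  refine (Complex.abs_re_le_norm _).trans ?_
  refine (norm_sum_le_of_le (f := fun p : ℕ => (b p * f p / (√(p : ℝ) : ℂ) + b (p ^ 2) * f (p ^ 2) / (p : ℂ)))
    (n := fun _ => (2:ℝ)) _ fun p hp => ?_).trans ?_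
  · have hp := (Finset.mem_filter.1 hp).2
    have hp1 : (1:ℝ) ≤ p := by exact_mod_cast hp.one_le
    refine (norm_add_le _ _).trans ?_
    rw [norm_div, norm_div, norm_mul, norm_mul, Complex.norm_real,
      Real.norm_of_nonneg (Real.sqrt_nonneg _), Complex.norm_natCast]
    have h1 : ‖b p‖ * ‖f p‖ / √(p : ℝ) ≤ 1 :=
      (div_le_one_of_le₀ ((mul_le_one₀ (hb p hp).1 (norm_nonneg _) (hf p)).trans
        (Real.one_le_sqrt.2 hp1)) (Real.sqrt_nonneg _))
    have h2 : ‖b (p ^ 2)‖ * ‖f (p ^ 2)‖ / (p : ℝ) ≤ 1 :=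
      (div_le_one_of_le₀ ((mul_le_one₀ (hb p hp).2 (norm_nonneg _) (hf _)).trans hp1) (by linarith))
    linarith
  · rw [Finset.sum_const, nsmul_eq_mul, mul_comm]
    refine mul_le_mul_of_nonneg_left ?_ (by norm_num)
    have := Finset.card_filter_le (Finset.Icc 1 ⌊P⌋₊) Nat.Prime
    rw [Nat.card_Icc, Nat.add_sub_cancel] at this
    exact_mod_cast this

/-- The even moments of the random prime sums are bounded by Gaussian moments. -/
lemma integral_primeSum_pow_le {P v : ℝ} {b : ℕ → ℂ}
    (hb : ∀ p : ℕ, p.Prime → ‖b p‖ ≤ 1 ∧ ‖b (p ^ 2)‖ ≤ 1) (hv : 4 * primeHarmonic P ≤ v)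
    (hv0 : 0 < v) {k : ℕ} (hk : 1 ≤ k) :
    ∫ θ, primeSum P b (steinhaus θ) ^ (2 * k) ∂steinhausMeasure ≤
      2 * (2 * k * Real.exp 1 * v) ^ k := by
  have hsub := hasSubgaussianMGF_primeSum P hb
  set S : (Nat.Primes → UnitAddCircle) → ℝ := fun θ => primeSum P b (steinhaus θ) with hS
  have hk0 : (0:ℝ) < k := by exact_mod_cast hk
  have hc : ((∑ p ∈ (Finset.Icc 1 ⌊P⌋₊).subtype Nat.Prime, 4 / ((p : ℕ) : NNReal) : NNReal) : ℝ)
      = 4 * primeHarmonic P := by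
    push_cast
    rw [Finset.sum_subtype_eq_sum_filter (f := fun p : ℕ => 4 / (p : ℝ)), primeHarmonic,
      Finset.mul_sum]
    exact Finset.sum_congr rfl fun p _ => by ring
  set t := √(2 * k / v) with ht
  have ht0 : 0 < t := Real.sqrt_pos.2 (by positivity)
  have ht2 : t ^ 2 = 2 * k / v := Real.sq_sqrt (by positivity)
  have hmgf : ∀ s : ℝ, s ^ 2 = t ^ 2 → ∫ θ, Real.exp (s * S θ) ∂steinhausMeasure ≤ Real.exp k := by
    intro s hs
    refine (hsub.mgf_le s).trans (Real.exp_le_exp.2 ?_)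
    rw [hc, hs, ht2]
    calc 4 * primeHarmonic P * (2 * k / v) / 2 ≤ v * (2 * k / v) / 2 := by
          refine div_le_div_of_nonneg_right (mul_le_mul_of_nonneg_right hv (by positivity))
            (by norm_num)
      _ = k := by field_simp
  have hpt : ∀ θ, S θ ^ (2 * k) ≤ ((2 * k).factorial : ℝ) * (t ^ (2 * k))⁻¹ *
      (Real.exp (t * S θ) + Real.exp (-t * S θ)) := by
    intro θ
    have h1 := Real.pow_div_factorial_le_exp (|t * S θ|) (abs_nonneg _) (2 * k)
    have h2 : |t * S θ| ^ (2 * k) = t ^ (2 * k) * S θ ^ (2 * k) := by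
      rw [pow_mul, sq_abs, ← pow_mul, mul_pow]
    have h3 : Real.exp |t * S θ| ≤ Real.exp (t * S θ) + Real.exp (-t * S θ) := by
      rcases abs_cases (t * S θ) with ⟨h, _⟩ | ⟨h, _⟩
      · rw [h]; linarith [Real.exp_pos (-t * S θ)]
      · rw [h, neg_mul]; linarith [Real.exp_pos (t * S θ)]
    rw [h2, div_le_iff₀ (by positivity)] at h1
    have h4 : t ^ (2 * k) * S θ ^ (2 * k) ≤
        (Real.exp (t * S θ) + Real.exp (-t * S θ)) * (2 * k).factorial :=
      h1.trans (mul_le_mul_of_nonneg_right h3 (by positivity))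
    rw [← div_eq_mul_inv, div_mul_eq_mul_div, le_div_iff₀ (by positivity)]
    linarith
  have hi1 := hsub.integrable_exp_mul t
  have hi2 := hsub.integrable_exp_mul (-t)
  have hint : Integrable (fun θ => S θ ^ (2 * k)) steinhausMeasure := by
    refine integrable_real_of_measurable_of_bounded
      ((measurable_primeSum_steinhaus P b).pow_const _) ((2 * ⌊P⌋₊) ^ (2 * k)) fun θ => ?_
    rw [abs_pow]
    exact pow_le_pow_left₀ (abs_nonneg _)
      (abs_primeSum_le hb fun n => (norm_steinhaus θ n).le) _
  have h1 := integral_mono hint ((hi1.add hi2).const_mul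
    (((2 * k).factorial : ℝ) * (t ^ (2 * k))⁻¹)) hpt
  simp only [Pi.add_apply] at h1
  rw [integral_const_mul, integral_add hi1 hi2] at h1
  refine h1.trans ?_
  have h2 : ((2 * k).factorial : ℝ) ≤ (2 * k : ℝ) ^ (2 * k) := by
    exact_mod_cast Nat.factorial_le_pow (2 * k)
  have h3 : (t ^ (2 * k))⁻¹ = (v / (2 * k)) ^ k := by
    rw [pow_mul, ht2, ← inv_pow, inv_div]
  rw [h3]
  have h4 : Real.exp k = Real.exp 1 ^ k := by rw [← Real.exp_nat_mul, mul_one]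
  calc _ ≤ (2 * k : ℝ) ^ (2 * k) * (v / (2 * k)) ^ k * (Real.exp k + Real.exp k) := by
        refine mul_le_mul (mul_le_mul_of_nonneg_right h2 (by positivity))
          (add_le_add (hmgf t rfl) (hmgf (-t) (neg_sq t))) (by positivity) (by positivity)
    _ = 2 * (((2 * k : ℝ) ^ 2 * (v / (2 * k)) * Real.exp 1) ^ k) := by
        generalize (2 * k : ℝ) = a
        rw [h4, pow_mul, mul_pow, mul_pow]; ring
    _ = _ := by
        congr 2
        field_simp

/-! ### Smooth numbers -/

/-- The positive integers all of whose prime factors are at most `P`. -/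
def smooth (P : ℝ) : Set ℕ := Nat.smoothNumbers (⌊P⌋₊ + 1)

/-- The part of `n` composed of the primes at most `P`. -/
def smoothPart (P : ℝ) (n : ℕ) : ℕ := (n.primeFactorsList.filter (· < ⌊P⌋₊ + 1)).prod

/-- The part of `n` composed of the primes greater than `P`. -/
def roughPart (P : ℝ) (n : ℕ) : ℕ := (n.primeFactorsList.filter (fun p => ¬ p < ⌊P⌋₊ + 1)).prod

lemma smoothPart_mem (P : ℝ) (n : ℕ) : smoothPart P n ∈ smooth P :=
  Nat.prod_mem_smoothNumbers n _

lemma smoothPart_mul_roughPart (P : ℝ) {n : ℕ} (hn : n ≠ 0) :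
    smoothPart P n * roughPart P n = n := by
  unfold smoothPart roughPart
  rw [← List.prod_append]
  conv_rhs => rw [← Nat.prod_primeFactorsList hn]
  refine List.Perm.prod_eq ?_
  have := List.filter_append_perm (fun p => decide (p < ⌊P⌋₊ + 1)) n.primeFactorsList
  simpa only [decide_not] using this

lemma ne_zero_of_smooth {P : ℝ} {n : ℕ} (hn : n ∈ smooth P) : n ≠ 0 :=
  Nat.ne_zero_of_mem_smoothNumbers hn

lemma one_mem_smooth (P : ℝ) : 1 ∈ smooth P := by
  rw [smooth, Nat.mem_smoothNumbers]; simp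

lemma mul_mem_smooth {P : ℝ} {m n : ℕ} (hm : m ∈ smooth P) (hn : n ∈ smooth P) :
    m * n ∈ smooth P := Nat.mul_mem_smoothNumbers hm hn

lemma prime_mem_smooth {P : ℝ} {p : ℕ} (hp : p.Prime) (h : (p : ℝ) ≤ P) : p ∈ smooth P := by
  refine Nat.mem_smoothNumbers_of_lt hp.pos (Nat.lt_succ_of_le (Nat.le_floor h))

lemma smooth_coprime {P : ℝ} {n r : ℕ} (hn : n ∈ smooth P) (hr : r.Prime) (hrP : P < r) :
    n.Coprime r := by
  rw [Nat.coprime_comm, hr.coprime_iff_not_dvd]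
  intro h
  have := Nat.mem_smoothNumbers'.1 hn r hr h
  by_cases hP : 0 ≤ P
  · have h2 : ⌊P⌋₊ < r := (Nat.floor_lt hP).2 hrP
    omega
  · rw [Nat.floor_of_nonpos (not_le.1 hP).le] at this
    have := hr.two_le
    omega

/-- Multiplication by a smooth number does not change the rough part. -/
lemma roughPart_mul {P : ℝ} {m n : ℕ} (hm : m ∈ smooth P) (hn : n ≠ 0) :
    roughPart P (m * n) = roughPart P n := by
  unfold roughPart
  have h := (Nat.perm_primeFactorsList_mul (ne_zero_of_smooth hm) hn).filter
    (fun p => decide (¬ p < ⌊P⌋₊ + 1))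
  rw [h.prod_eq, List.filter_append, List.prod_append]
  have h0 : m.primeFactorsList.filter (fun p => decide (¬ p < ⌊P⌋₊ + 1)) = [] := by
    rw [List.filter_eq_nil_iff]
    intro p hp
    simpa using (Nat.mem_smoothNumbers.1 hm).2 p hp
  rw [h0, List.prod_nil, one_mul]

lemma one_sub_inv_le_exp {t : ℝ} (ht0 : 0 ≤ t) (ht : t ≤ 3 / 4) : (1 - t)⁻¹ ≤ Real.exp (4 * t) := by
  have h1 : 0 < 1 - t := by linarith
  have h2 : t * (1 - t)⁻¹ ≤ 4 * t := by
    rw [← div_eq_mul_inv, div_le_iff₀ h1]; nlinarith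
  have h3 : (1 - t)⁻¹ = t * (1 - t)⁻¹ + 1 := by field_simp; ring
  rw [h3]
  exact (Real.add_one_le_exp _).trans (Real.exp_le_exp.2 h2)

/-- Rankin's bound for the sum of `q^{-(1-α)}` over smooth numbers. -/
lemma sum_smooth_rpow_le {P α : ℝ} (hP : 1 ≤ P) (hα0 : 0 ≤ α) (hα : α ≤ 1 / 2)
    (hPα : P ^ α ≤ 3) (Q : Finset ℕ) (hQ : ∀ q ∈ Q, q ∈ smooth P) :
    ∑ q ∈ Q, (q : ℝ) ^ (-(1 - α)) ≤ Real.exp (12 * primeHarmonic P) := by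
  set f : ℕ →* ℝ :=
    { toFun := fun n => (n : ℝ) ^ (-(1 - α))
      map_one' := by simp
      map_mul' := fun m n => by
        push_cast
        rw [Real.mul_rpow (Nat.cast_nonneg _) (Nat.cast_nonneg _)] } with hf
  have hfe : ∀ n, f n = (n : ℝ) ^ (-(1 - α)) := fun n => rfl
  have hf0 : ∀ n, 0 ≤ f n := fun n => by rw [hfe]; positivity
  have hfp : ∀ {p : ℕ}, p.Prime → f p ≤ 3 / 4 := by
    intro p hp
    have hp2 : (2:ℝ) ≤ p := by exact_mod_cast hp.two_le
    rw [hfe]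
    calc (p : ℝ) ^ (-(1 - α)) ≤ (2:ℝ) ^ (-(1 - α)) :=
          Real.rpow_le_rpow_of_nonpos (by norm_num) hp2 (by linarith)
      _ ≤ (2:ℝ) ^ (-(1 / 2) : ℝ) := Real.rpow_le_rpow_of_exponent_le one_le_two (by linarith)
      _ ≤ 3 / 4 := by
          rw [Real.rpow_neg (by norm_num), ← Real.sqrt_eq_rpow]
          rw [inv_le_comm₀ (by positivity) (by norm_num)]
          exact Real.le_sqrt_of_sq_le (by norm_num)
  classical
  obtain ⟨hs, hsum⟩ := EulerProduct.summable_and_hasSum_smoothNumbers_prod_primesBelow_geometric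
    (f := f) (fun {p} hp => by
      rw [Real.norm_of_nonneg (hf0 p)]; linarith [hfp hp]) (⌊P⌋₊ + 1)
  have h1 : ∑ q ∈ Q, (q : ℝ) ^ (-(1 - α)) ≤ ∏ p ∈ (⌊P⌋₊ + 1).primesBelow, (1 - f p)⁻¹ := by
    have h2 : ∑ q ∈ Q, (q : ℝ) ^ (-(1 - α)) =
        ∑ q ∈ Q.subtype (· ∈ Nat.smoothNumbers (⌊P⌋₊ + 1)), f q := by
      exact (Finset.sum_subtype_of_mem (p := (· ∈ Nat.smoothNumbers (⌊P⌋₊ + 1))) f hQ).symm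
    rw [h2]
    exact sum_le_hasSum _ (fun q _ => hf0 q) hsum
  refine h1.trans ?_
  have h3 : ∏ p ∈ (⌊P⌋₊ + 1).primesBelow, (1 - f p)⁻¹ ≤
      ∏ p ∈ (⌊P⌋₊ + 1).primesBelow, Real.exp (4 * f p) := by
    refine Finset.prod_le_prod (fun p hp => ?_) fun p hp => ?_
    · have := hfp (Nat.prime_of_mem_primesBelow hp)
      rw [inv_nonneg]; linarith
    · exact one_sub_inv_le_exp (hf0 p) (hfp (Nat.prime_of_mem_primesBelow hp))
  refine h3.trans ?_
  rw [← Real.exp_sum]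
  refine Real.exp_le_exp.2 ?_
  rw [primeHarmonic, Finset.mul_sum]
  have hset : (⌊P⌋₊ + 1).primesBelow = primesUpTo P := by
    ext p
    rw [Nat.mem_primesBelow, mem_primesUpTo, and_comm]
    refine and_congr_right fun hp => ?_
    rw [Nat.lt_succ_iff, Nat.le_floor_iff (by linarith)]
  rw [hset]
  refine Finset.sum_le_sum fun p hp => ?_
  obtain ⟨hpp, hpP⟩ := mem_primesUpTo.1 hp
  have hp0 : (0:ℝ) < p := by exact_mod_cast hpp.pos
  rw [hfe, show -(1 - α) = -1 + α by ring, Real.rpow_add hp0, Real.rpow_neg_one]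
  have : (p : ℝ) ^ α ≤ 3 := (Real.rpow_le_rpow hp0.le hpP hα0).trans hPα
  have h5 : 0 < (p : ℝ)⁻¹ := by positivity
  rw [one_div]
  nlinarith

/-- Every solution of `a b = c d` in smooth numbers up to `Y` factors as `a = g u`, `b = v h`,
`c = g v`, `d = u h`; Rankin's trick then bounds their number. -/
lemma card_smooth_quadruples_le {P α : ℝ} (hP : 1 ≤ P) (hα0 : 0 ≤ α) (hα : α ≤ 1 / 2)
    (hPα : P ^ α ≤ 3) (Y : ℕ) (Q : Finset ℕ) (hQ : ∀ q ∈ Q, q ∈ smooth P ∧ q ≤ Y) :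
    ((((Q ×ˢ Q) ×ˢ (Q ×ˢ Q)).filter
      (fun z : (ℕ × ℕ) × (ℕ × ℕ) => z.1.1 * z.1.2 = z.2.1 * z.2.2)).card : ℝ) ≤
      ((Y : ℝ) ^ (1 - α)) ^ 2 * Real.exp (12 * primeHarmonic P) ^ 4 := by
  classical
  -- all smooth numbers up to `Y`
  set R : Finset ℕ := (Finset.Icc 1 Y).filter (fun q => q ∈ smooth P) with hR
  have hRm : ∀ q, q ∈ R ↔ (1 ≤ q ∧ q ≤ Y) ∧ q ∈ smooth P := by
    intro q; rw [hR, Finset.mem_filter, Finset.mem_Icc]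
  set T : Finset ((ℕ × ℕ) × (ℕ × ℕ)) := ((R ×ˢ R) ×ˢ (R ×ˢ R)).filter
    (fun z => z.1.1 * z.1.2 * (z.2.1 * z.2.2) ≤ Y ^ 2) with hT
  set φ : (ℕ × ℕ) × (ℕ × ℕ) → (ℕ × ℕ) × (ℕ × ℕ) := fun z =>
    ((z.1.1 * z.1.2, z.2.1 * z.2.2), (z.1.1 * z.2.1, z.1.2 * z.2.2)) with hφ
  have hsub : ((Q ×ˢ Q) ×ˢ (Q ×ˢ Q)).filter
      (fun z : (ℕ × ℕ) × (ℕ × ℕ) => z.1.1 * z.1.2 = z.2.1 * z.2.2) ⊆ T.image φ := by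
    rintro ⟨⟨a, b⟩, ⟨c, d⟩⟩ hz
    rw [Finset.mem_filter, Finset.mem_product, Finset.mem_product, Finset.mem_product] at hz
    obtain ⟨⟨⟨ha, hb⟩, ⟨hc, hd⟩⟩, heq⟩ := hz
    simp only at ha hb hc hd heq
    obtain ⟨ha1, ha2⟩ := hQ a ha
    obtain ⟨hb1, hb2⟩ := hQ b hb
    obtain ⟨hc1, hc2⟩ := hQ c hc
    obtain ⟨hd1, hd2⟩ := hQ d hd
    have ha0 := Nat.pos_of_ne_zero (ne_zero_of_smooth ha1)
    have hb0 := Nat.pos_of_ne_zero (ne_zero_of_smooth hb1)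
    have hg : 0 < Nat.gcd a c := Nat.gcd_pos_of_pos_left _ ha0
    obtain ⟨u, v, huv, hu, hv⟩ := Nat.exists_coprime a c
    set g := Nat.gcd a c with hgdef
    have h1 : u * b = v * d := by
      refine Nat.eq_of_mul_eq_mul_left hg ?_
      calc g * (u * b) = (u * g) * b := by ring
        _ = a * b := by rw [← hu]
        _ = c * d := heq
        _ = (v * g) * d := by rw [← hv]
        _ = g * (v * d) := by ring
    have h2 : v ∣ b := huv.symm.dvd_of_dvd_mul_left (Dvd.intro _ h1.symm)
    obtain ⟨h, rfl⟩ := h2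
    have hv0 : 0 < v := Nat.pos_of_ne_zero fun h0 => by simp [h0] at hb0
    have h3 : d = u * h := by
      refine Nat.eq_of_mul_eq_mul_left hv0 ?_
      rw [← h1]; ring
    have hmem : ∀ q x : ℕ, q ∣ x → x ∈ smooth P → x ≤ Y → q ∈ R := by
      intro q x hqx hx hxY
      have hx0 := Nat.pos_of_ne_zero (ne_zero_of_smooth hx)
      have hq0 := Nat.pos_of_dvd_of_pos hqx hx0
      exact (hRm q).2 ⟨⟨hq0, (Nat.le_of_dvd hx0 hqx).trans hxY⟩,
        Nat.mem_smoothNumbers_of_dvd hx hqx⟩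
    rw [Finset.mem_image]
    refine ⟨((g, u), (v, h)), ?_, ?_⟩
    · rw [hT, Finset.mem_filter, Finset.mem_product, Finset.mem_product, Finset.mem_product]
      refine ⟨⟨⟨hmem g a (Nat.gcd_dvd_left a c) ha1 ha2, hmem u a (Dvd.intro _ hu.symm) ha1 ha2⟩,
        ⟨hmem v c (Dvd.intro _ hv.symm) hc1 hc2, hmem h (v * h) (Dvd.intro_left _ rfl) hb1 hb2⟩⟩, ?_⟩
      simp only
      rw [mul_comm g u, ← hu, sq]
      exact Nat.mul_le_mul ha2 hb2
    · rw [hφ]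
      simp only
      rw [mul_comm g u, ← hu, mul_comm g v, ← hv, h3]
  have hcard : ((((Q ×ˢ Q) ×ˢ (Q ×ˢ Q)).filter
      (fun z : (ℕ × ℕ) × (ℕ × ℕ) => z.1.1 * z.1.2 = z.2.1 * z.2.2)).card : ℝ) ≤ T.card := by
    exact_mod_cast (Finset.card_le_card hsub).trans Finset.card_image_le
  refine hcard.trans ?_
  have hR1 : ∀ q ∈ R, (1:ℝ) ≤ q := fun q hq => by exact_mod_cast ((hRm q).1 hq).1.1
  have hpt : ∀ z ∈ T, (1:ℝ) ≤ ((Y : ℝ) ^ (1 - α)) ^ 2 *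
      (((z.1.1 : ℝ) ^ (-(1 - α)) * (z.1.2 : ℝ) ^ (-(1 - α))) *
      ((z.2.1 : ℝ) ^ (-(1 - α)) * (z.2.2 : ℝ) ^ (-(1 - α)))) := by
    intro z hz
    rw [hT, Finset.mem_filter, Finset.mem_product, Finset.mem_product, Finset.mem_product] at hz
    obtain ⟨⟨⟨h1, h2⟩, ⟨h3, h4⟩⟩, h5⟩ := hz
    have h1 := hR1 _ h1
    have h2 := hR1 _ h2
    have h3 := hR1 _ h3
    have h4 := hR1 _ h4
    have h5' : (z.1.1 : ℝ) * z.1.2 * (z.2.1 * z.2.2) ≤ (Y : ℝ) ^ 2 := by exact_mod_cast h5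
    rw [← Real.mul_rpow (by positivity) (by positivity), ← Real.mul_rpow (by positivity)
      (by positivity), ← Real.mul_rpow (by positivity) (by positivity), ← Real.rpow_natCast,
      ← Real.rpow_mul (Nat.cast_nonneg _), mul_comm (1 - α), Real.rpow_mul (Nat.cast_nonneg _),
      Real.rpow_natCast, Real.rpow_neg (by positivity), ← div_eq_mul_inv, one_le_div (by positivity)]
    exact Real.rpow_le_rpow (by positivity) h5' (by linarith)
  have hsum : (T.card : ℝ) ≤ ∑ z ∈ (R ×ˢ R) ×ˢ (R ×ˢ R), ((Y : ℝ) ^ (1 - α)) ^ 2 *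
      (((z.1.1 : ℝ) ^ (-(1 - α)) * (z.1.2 : ℝ) ^ (-(1 - α))) *
      ((z.2.1 : ℝ) ^ (-(1 - α)) * (z.2.2 : ℝ) ^ (-(1 - α)))) := by
    calc (T.card : ℝ) = ∑ z ∈ T, (1:ℝ) := by simp
      _ ≤ _ := Finset.sum_le_sum hpt
      _ ≤ _ := Finset.sum_le_sum_of_subset_of_nonneg (Finset.filter_subset _ _)
        fun z _ _ => by positivity
  refine hsum.trans ?_
  rw [← Finset.mul_sum, Finset.sum_product]
  simp_rw [← Finset.mul_sum]
  rw [← Finset.sum_mul]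
  refine mul_le_mul_of_nonneg_left ?_ (by positivity)
  have hZ := sum_smooth_rpow_le hP hα0 hα hPα R fun q hq => ((hRm q).1 hq).2
  have hZ0 : 0 ≤ ∑ q ∈ R, (q : ℝ) ^ (-(1 - α)) := Finset.sum_nonneg fun q _ => by positivity
  have hpair : ∑ z ∈ R ×ˢ R, ((z.1 : ℝ) ^ (-(1 - α)) * (z.2 : ℝ) ^ (-(1 - α))) =
      (∑ q ∈ R, (q : ℝ) ^ (-(1 - α))) ^ 2 := by
    rw [sq, Finset.sum_mul_sum, Finset.sum_product]
  rw [hpair]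
  calc _ = (∑ q ∈ R, (q : ℝ) ^ (-(1 - α))) ^ 4 := by ring
    _ ≤ _ := pow_le_pow_left₀ hZ0 hZ 4

lemma sum_rpow_le {α : ℝ} (hα0 : 0 < α) (hα : α ≤ 1) (X : ℕ) :
    ∑ t ∈ Finset.Icc 1 X, (t : ℝ) ^ (α - 1) ≤ (X : ℝ) ^ α / α := by
  induction X with
  | zero => simp [Real.zero_rpow hα0.ne']
  | succ X ih =>
    rw [Finset.sum_Icc_succ_top (by omega)]
    have hX : (0:ℝ) < (X + 1 : ℕ) := by positivity
    have h1 := rpow_one_add_le_one_add_mul_self (s := -1 / ((X + 1 : ℕ) : ℝ)) (p := α)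
      (by rw [le_div_iff₀ hX]; push_cast; linarith [(Nat.cast_nonneg X : (0:ℝ) ≤ X)]) hα0.le hα
    have h2 : 1 + -1 / ((X + 1 : ℕ) : ℝ) = X / ((X + 1 : ℕ) : ℝ) := by
      field_simp; push_cast; ring
    rw [h2, Real.div_rpow (Nat.cast_nonneg _) hX.le, div_le_iff₀ (by positivity)] at h1
    have h3 : ((X + 1 : ℕ) : ℝ) ^ (α - 1) = ((X + 1 : ℕ) : ℝ) ^ α / ((X + 1 : ℕ) : ℝ) :=
      Real.rpow_sub_one hX.ne' α
    have h4 : (X : ℝ) ^ α / α + ((X + 1 : ℕ) : ℝ) ^ (α - 1) ≤ ((X + 1 : ℕ) : ℝ) ^ α / α := by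
      rw [h3, ← sub_nonneg]
      have : ((X + 1 : ℕ) : ℝ) ^ α / α - ((X : ℝ) ^ α / α + ((X + 1 : ℕ) : ℝ) ^ α / ((X + 1 : ℕ) : ℝ))
          = ((1 + α * (-1 / ((X + 1 : ℕ) : ℝ))) * ((X + 1 : ℕ) : ℝ) ^ α - (X : ℝ) ^ α) / α := by
        field_simp
        ring
      rw [this]
      exact div_nonneg (by linarith) hα0.le
    linarith

/-! ### Weighted second moments of the Steinhaus model -/

/-- A trigonometric polynomial in the values of a multiplicative function at `P`-smooth numbers: a
function of the form `∑ b f(m₁) conj(f(m₂))` with `m₁, m₂` smooth of size at most `H` and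
`∑ |b| ≤ B`. -/
def IsTrigPoly (P H B : ℝ) (F : (ℕ → ℂ) → ℝ) : Prop :=
  ∃ (ι : Type) (_ : Fintype ι) (b : ι → ℂ) (m₁ m₂ : ι → ℕ),
    (∀ i, m₁ i ∈ smooth P ∧ m₂ i ∈ smooth P ∧ (m₁ i : ℝ) ≤ H ∧ (m₂ i : ℝ) ≤ H) ∧
    ∑ i, ‖b i‖ ≤ B ∧ ∀ f : ℕ → ℂ, IsMult f → (F f : ℂ) = ∑ i, b i * (f (m₁ i) * star (f (m₂ i)))

lemma IsTrigPoly.measurable {P H B : ℝ} {F : (ℕ → ℂ) → ℝ} (hF : IsTrigPoly P H B F) :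
    Measurable fun θ => F (steinhaus θ) := by
  obtain ⟨ι, _, b, m₁, m₂, -, -, h⟩ := hF
  have e : ∀ θ, F (steinhaus θ) =
      (∑ i, b i * (steinhaus θ (m₁ i) * star (steinhaus θ (m₂ i)))).re := fun θ => by
    rw [← h _ (isMult_steinhaus θ), Complex.ofReal_re]
  simp_rw [e]
  exact Complex.measurable_re.comp (Finset.measurable_sum _ fun i _ =>
    ((measurable_steinhaus _).mul (measurable_star_comp (measurable_steinhaus _))).const_mul _)

lemma IsTrigPoly.abs_le {P H B : ℝ} {F : (ℕ → ℂ) → ℝ} (hF : IsTrigPoly P H B F) {f : ℕ → ℂ}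
    (hf : IsMult f) (hf1 : ∀ n, ‖f n‖ ≤ 1) : |F f| ≤ B := by
  obtain ⟨ι, _, b, m₁, m₂, -, hB, h⟩ := hF
  rw [← Real.norm_eq_abs, ← Complex.norm_real, h f hf]
  refine (norm_sum_le_of_le _ fun i _ => ?_).trans hB
  rw [norm_mul, norm_mul, norm_star]
  exact mul_le_of_le_one_right (norm_nonneg _) (mul_le_one₀ (hf1 _) (norm_nonneg _) (hf1 _))

lemma norm_steinhaus_sum_le {c : ℕ → ℂ} (hc : ∀ n, ‖c n‖ ≤ 1) (S : Finset ℕ)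
    (θ : Nat.Primes → UnitAddCircle) : ‖∑ n ∈ S, c n * steinhaus θ n‖ ≤ S.card := by
  refine (norm_sum_le_of_le (n := fun _ => (1:ℝ)) _ fun n _ => ?_).trans (by simp)
  rw [norm_mul, norm_steinhaus, mul_one]; exact hc n

lemma measurable_steinhaus_sum (c : ℕ → ℂ) (S : Finset ℕ) :
    Measurable fun θ => ∑ n ∈ S, c n * steinhaus θ n :=
  Finset.measurable_sum _ fun n _ => (measurable_steinhaus n).const_mul _

lemma IsTrigPoly.integrable_mul_sum {P H B : ℝ} {F : (ℕ → ℂ) → ℝ} (hF : IsTrigPoly P H B F)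
    {c : ℕ → ℂ} (hc : ∀ n, ‖c n‖ ≤ 1) (S S' : Finset ℕ) :
    Integrable (fun θ => (F (steinhaus θ) : ℂ) * ((∑ n ∈ S, c n * steinhaus θ n) *
      star (∑ n ∈ S', c n * steinhaus θ n))) steinhausMeasure := by
  refine integrable_of_measurable_of_bounded
    ((Complex.measurable_ofReal.comp hF.measurable).mul ((measurable_steinhaus_sum c S).mul
      (measurable_star_comp (measurable_steinhaus_sum c S')))) (B * (S.card * S'.card)) fun θ => ?_
  have hB := hF.abs_le (isMult_steinhaus θ) fun n => (norm_steinhaus θ n).le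
  rw [norm_mul, norm_mul, norm_star, Complex.norm_real]
  exact mul_le_mul hB (mul_le_mul (norm_steinhaus_sum_le hc S θ) (norm_steinhaus_sum_le hc S' θ)
    (norm_nonneg _) (Nat.cast_nonneg _)) (by positivity) ((abs_nonneg _).trans hB)

/-- Sums over integers with different rough parts are orthogonal, even in the presence of a weight
depending only on smooth numbers. -/
lemma IsTrigPoly.integral_mul_eq_zero {P H B : ℝ} {F : (ℕ → ℂ) → ℝ} (hF : IsTrigPoly P H B F)
    {c : ℕ → ℂ} {S S' : Finset ℕ} (hS : 0 ∉ S) (hS' : 0 ∉ S')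
    (hne : ∀ n ∈ S, ∀ k ∈ S', roughPart P n ≠ roughPart P k) :
    ∫ θ, (F (steinhaus θ) : ℂ) * ((∑ n ∈ S, c n * steinhaus θ n) *
      star (∑ n ∈ S', c n * steinhaus θ n)) ∂steinhausMeasure = 0 := by
  obtain ⟨ι, _, b, m₁, m₂, hm, -, h⟩ := hF
  have e : ∀ θ, (F (steinhaus θ) : ℂ) * ((∑ n ∈ S, c n * steinhaus θ n) *
      star (∑ n ∈ S', c n * steinhaus θ n)) = ∑ i, b i * (steinhaus θ (m₁ i) *
      star (steinhaus θ (m₂ i)) * (∑ n ∈ S, c n * steinhaus θ n) *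
      star (∑ n ∈ S', c n * steinhaus θ n)) := by
    intro θ
    rw [h _ (isMult_steinhaus θ), Finset.sum_mul]
    exact Finset.sum_congr rfl fun i _ => by ring
  simp_rw [e]
  have hint : ∀ i, Integrable (fun θ => b i * (steinhaus θ (m₁ i) *
      star (steinhaus θ (m₂ i)) * (∑ n ∈ S, c n * steinhaus θ n) *
      star (∑ n ∈ S', c n * steinhaus θ n))) steinhausMeasure := by
    intro i
    refine Integrable.const_mul ?_ _
    refine integrable_of_measurable_of_bounded
      ((((measurable_steinhaus _).mul (measurable_star_comp (measurable_steinhaus _))).mul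
      (measurable_steinhaus_sum c S)).mul (measurable_star_comp (measurable_steinhaus_sum c S')))
      ((∑ n ∈ S, ‖c n‖) * (∑ n ∈ S', ‖c n‖)) fun θ => ?_
    have hb : ∀ U : Finset ℕ, ‖∑ n ∈ U, c n * steinhaus θ n‖ ≤ ∑ n ∈ U, ‖c n‖ := fun U =>
      norm_sum_le_of_le _ fun n _ => by rw [norm_mul, norm_steinhaus, mul_one]
    rw [norm_mul, norm_mul, norm_mul, norm_star, norm_star, norm_steinhaus, norm_steinhaus, one_mul,
      one_mul]
    exact mul_le_mul (hb S) (hb S') (norm_nonneg _) (Finset.sum_nonneg fun _ _ => norm_nonneg _)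
  rw [integral_finsetSum _ fun i _ => hint i]
  refine Finset.sum_eq_zero fun i _ => ?_
  rw [integral_const_mul, integral_twisted_sums (ne_zero_of_smooth (hm i).1)
    (ne_zero_of_smooth (hm i).2.1) S S' hS hS' c c]
  rw [Finset.sum_eq_zero, mul_zero]
  intro n hn
  refine Finset.sum_eq_zero fun k hk => ?_
  rw [if_neg, mul_zero]
  intro heq
  apply hne n hn k hk
  rw [← roughPart_mul (hm i).1 (fun h0 => hS (h0 ▸ hn)), heq,
    roughPart_mul (hm i).2.1 (fun h0 => hS' (h0 ▸ hk))]

/-- The fourth moment of a Dirichlet polynomial counts the solutions of `a b = c d`. -/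
lemma integral_norm_pow_four_le {a : ℕ → ℂ} (ha : ∀ n, ‖a n‖ ≤ 1) (Q : Finset ℕ) (hQ : 0 ∉ Q) :
    ∫ θ, ‖∑ q ∈ Q, a q * steinhaus θ q‖ ^ 4 ∂steinhausMeasure ≤
      (((Q ×ˢ Q) ×ˢ (Q ×ˢ Q)).filter
        (fun z : (ℕ × ℕ) × (ℕ × ℕ) => z.1.1 * z.1.2 = z.2.1 * z.2.2)).card := by
  have hQ' : ∀ q ∈ Q, q ≠ 0 := fun q hq h => hQ (h ▸ hq)
  have e : ∀ θ, ((‖∑ q ∈ Q, a q * steinhaus θ q‖ ^ 4 : ℝ) : ℂ) =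
      ∑ z ∈ (Q ×ˢ Q) ×ˢ (Q ×ˢ Q), (a z.1.1 * a z.1.2 * star (a z.2.1 * a z.2.2)) *
        (steinhaus θ (z.1.1 * z.1.2) * star (steinhaus θ (z.2.1 * z.2.2))) := by
    intro θ
    set M := ∑ q ∈ Q, a q * steinhaus θ q with hM
    have h1 : ((‖M‖ ^ 4 : ℝ) : ℂ) = (M * M) * star (M * M) := by
      rw [Complex.star_def, Complex.mul_conj', norm_mul]; push_cast; ring
    have h2 : M * M = ∑ z ∈ Q ×ˢ Q, (a z.1 * a z.2) * steinhaus θ (z.1 * z.2) := by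
      rw [hM, Finset.sum_mul_sum, Finset.sum_product]
      refine Finset.sum_congr rfl fun x hx => ?_
      refine Finset.sum_congr rfl fun y hy => ?_
      rw [steinhaus_mul θ (hQ' x hx) (hQ' y hy)]; ring
    rw [h1, h2, star_sum, Finset.sum_mul_sum, Finset.sum_product (Q ×ˢ Q) (Q ×ˢ Q)]
    refine Finset.sum_congr rfl fun x _ => ?_
    refine Finset.sum_congr rfl fun y _ => ?_
    rw [star_mul' (a y.1 * a y.2)]
    ring
  have hC : ∫ θ, ((‖∑ q ∈ Q, a q * steinhaus θ q‖ ^ 4 : ℝ) : ℂ) ∂steinhausMeasure =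
      ∑ z ∈ (Q ×ˢ Q) ×ˢ (Q ×ˢ Q), (a z.1.1 * a z.1.2 * star (a z.2.1 * a z.2.2)) *
        (if z.1.1 * z.1.2 = z.2.1 * z.2.2 then 1 else 0) := by
    simp_rw [e]
    rw [integral_finsetSum _ fun z _ => (integrable_steinhaus_mul_star _ _).const_mul _]
    refine Finset.sum_congr rfl fun z hz => ?_
    rw [Finset.mem_product, Finset.mem_product, Finset.mem_product] at hz
    rw [integral_const_mul, integral_steinhaus_mul_star
      (mul_ne_zero (hQ' _ hz.1.1) (hQ' _ hz.1.2)) (mul_ne_zero (hQ' _ hz.2.1) (hQ' _ hz.2.2))]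
  rw [integral_complex_ofReal] at hC
  have hle := congrArg norm hC
  rw [Complex.norm_real, Real.norm_of_nonneg (integral_nonneg fun θ => by positivity)] at hle
  rw [hle]
  refine (norm_sum_le_of_le (n := fun z => if z.1.1 * z.1.2 = z.2.1 * z.2.2 then (1:ℝ) else 0) _
    fun z _ => ?_).trans_eq ?_
  · split_ifs
    · rw [mul_one, norm_mul, norm_star, norm_mul, norm_mul]
      exact mul_le_one₀ (mul_le_one₀ (ha _) (norm_nonneg _) (ha _)) (by positivity)
        (mul_le_one₀ (ha _) (norm_nonneg _) (ha _))
    · simp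
  · rw [Finset.sum_boole]

/-- The fourth moment of the sum over the integers with a given rough part. -/
lemma integral_rough_fibre_pow_four_le {P α : ℝ} (hP : 1 ≤ P) (hα0 : 0 ≤ α) (hα : α ≤ 1 / 2)
    (hPα : P ^ α ≤ 3) {c : ℕ → ℂ} (hc : ∀ n, ‖c n‖ ≤ 1) (X t : ℕ) (ht : t ≠ 0) :
    ∫ θ, ‖∑ n ∈ (Finset.Icc 1 X).filter (fun n => roughPart P n = t), c n * steinhaus θ n‖ ^ 4
      ∂steinhausMeasure ≤
      (((X : ℝ) / t) ^ (1 - α)) ^ 2 * Real.exp (12 * primeHarmonic P) ^ 4 := by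
  classical
  set S := (Finset.Icc 1 X).filter (fun n => roughPart P n = t) with hS
  have hSm : ∀ n ∈ S, n ≠ 0 ∧ n ≤ X ∧ smoothPart P n * t = n := by
    intro n hn
    rw [hS, Finset.mem_filter, Finset.mem_Icc] at hn
    have h0 : n ≠ 0 := by omega
    refine ⟨h0, hn.1.2, ?_⟩
    rw [← hn.2]; exact smoothPart_mul_roughPart P h0
  set Q := S.image (smoothPart P) with hQ
  have hinj : Set.InjOn (smoothPart P) S := by
    intro n hn k hk h
    rw [← (hSm n hn).2.2, ← (hSm k hk).2.2, h]
  have hQm : ∀ q ∈ Q, q ∈ smooth P ∧ q ≤ X / t := by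
    intro q hq
    obtain ⟨n, hn, rfl⟩ := Finset.mem_image.1 hq
    refine ⟨smoothPart_mem P n, ?_⟩
    rw [Nat.le_div_iff_mul_le (Nat.pos_of_ne_zero ht), (hSm n hn).2.2]
    exact (hSm n hn).2.1
  have hQ0 : 0 ∉ Q := fun h => ne_zero_of_smooth (hQm 0 h).1 rfl
  have e : ∀ θ, ‖∑ n ∈ S, c n * steinhaus θ n‖ = ‖∑ q ∈ Q, c (q * t) * steinhaus θ q‖ := by
    intro θ
    have h1 : ∑ n ∈ S, c n * steinhaus θ n = (∑ q ∈ Q, c (q * t) * steinhaus θ q) * steinhaus θ t := by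
      rw [hQ, Finset.sum_image hinj, Finset.sum_mul]
      refine Finset.sum_congr rfl fun n hn => ?_
      rw [mul_assoc, ← steinhaus_mul θ (ne_zero_of_smooth (smoothPart_mem P n)) ht,
        (hSm n hn).2.2]
    rw [h1, norm_mul, norm_steinhaus, mul_one]
  simp_rw [e]
  refine (integral_norm_pow_four_le (fun q => hc (q * t)) Q hQ0).trans
    ((card_smooth_quadruples_le hP hα0 hα hPα (X / t) Q hQm).trans ?_)
  refine mul_le_mul_of_nonneg_right (pow_le_pow_left₀ (by positivity)
    (Real.rpow_le_rpow (by positivity) Nat.cast_div_le (by linarith)) 2) (by positivity)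

/-- The weighted second moment of a Steinhaus sum is controlled by the second moment of the weight.
Splitting by rough parts makes the sum over rough parts diagonal; each diagonal term is estimated by
the fourth moment of a sum over smooth numbers. -/
lemma IsTrigPoly.integral_mul_norm_sq_le {P H B α : ℝ} {F : (ℕ → ℂ) → ℝ} (hF : IsTrigPoly P H B F)
    (hP : 1 ≤ P) (hα0 : 0 < α) (hα : α ≤ 1 / 2) (hPα : P ^ α ≤ 3)
    {c : ℕ → ℂ} (hc : ∀ n, ‖c n‖ ≤ 1) (X : ℕ) {η : ℝ} (hη : 0 < η) :
    ∫ θ, F (steinhaus θ) * ‖∑ n ∈ Finset.Icc 1 X, c n * steinhaus θ n‖ ^ 2 ∂steinhausMeasure ≤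
      X / α * (η * (∫ θ, F (steinhaus θ) ^ 2 ∂steinhausMeasure) +
        η⁻¹ * Real.exp (12 * primeHarmonic P) ^ 4) := by
  classical
  set T := (Finset.Icc 1 X).image (roughPart P) with hT
  set S : ℕ → Finset ℕ := fun t => (Finset.Icc 1 X).filter (fun n => roughPart P n = t) with hS
  set A : ℕ → (Nat.Primes → UnitAddCircle) → ℂ := fun t θ => ∑ n ∈ S t, c n * steinhaus θ n with hA
  have hS0 : ∀ t, 0 ∉ S t := by
    intro t h
    rw [hS, Finset.mem_filter, Finset.mem_Icc] at h
    omega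
  have hTm : ∀ t ∈ T, t ∈ Finset.Icc 1 X := by
    intro t ht
    obtain ⟨n, hn, rfl⟩ := Finset.mem_image.1 ht
    rw [Finset.mem_Icc] at hn ⊢
    have h := smoothPart_mul_roughPart P (n := n) (by omega)
    have hd : roughPart P n ∣ n := Dvd.intro_left _ h
    exact ⟨Nat.pos_of_dvd_of_pos hd (by omega), (Nat.le_of_dvd (by omega) hd).trans hn.2⟩
  have hsum : ∀ θ, ∑ n ∈ Finset.Icc 1 X, c n * steinhaus θ n = ∑ t ∈ T, A t θ := fun θ =>
    (Finset.sum_fiberwise_of_maps_to (fun n hn => Finset.mem_image_of_mem _ hn) _).symm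
  have hdiag : ∫ θ, F (steinhaus θ) * ‖∑ n ∈ Finset.Icc 1 X, c n * steinhaus θ n‖ ^ 2
      ∂steinhausMeasure = ∑ t ∈ T, ∫ θ, F (steinhaus θ) * ‖A t θ‖ ^ 2 ∂steinhausMeasure := by
    have hsq : ∀ (u : ℝ) (z : ℂ), ((u * ‖z‖ ^ 2 : ℝ) : ℂ) = u * (z * star z) := by
      intro u z
      rw [Complex.star_def, Complex.mul_conj']; push_cast; ring
    have h1 : ∫ θ, (((F (steinhaus θ) * ‖∑ n ∈ Finset.Icc 1 X, c n * steinhaus θ n‖ ^ 2 : ℝ)) : ℂ)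
        ∂steinhausMeasure = ∑ t ∈ T, ∫ θ, ((F (steinhaus θ) * ‖A t θ‖ ^ 2 : ℝ) : ℂ)
        ∂steinhausMeasure := by
      have e1 : ∀ θ, (((F (steinhaus θ) * ‖∑ n ∈ Finset.Icc 1 X, c n * steinhaus θ n‖ ^ 2 : ℝ)) : ℂ)
          = ∑ t ∈ T, ∑ t' ∈ T, (F (steinhaus θ) : ℂ) * (A t θ * star (A t' θ)) := by
        intro θ
        rw [hsum, hsq, star_sum, Finset.sum_mul_sum, Finset.mul_sum]
        exact Finset.sum_congr rfl fun t _ => Finset.mul_sum _ _ _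
      simp_rw [e1]
      have hint : ∀ t t', Integrable (fun θ => (F (steinhaus θ) : ℂ) * (A t θ * star (A t' θ)))
          steinhausMeasure := fun t t' => hF.integrable_mul_sum hc (S t) (S t')
      rw [integral_finsetSum _ fun t _ => integrable_finsetSum _ fun t' _ => hint t t']
      refine Finset.sum_congr rfl fun t ht => ?_
      rw [integral_finsetSum _ fun t' _ => hint t t', Finset.sum_eq_single t]
      · simp_rw [hsq]
      · intro t' _ hne
        refine hF.integral_mul_eq_zero (hS0 t) (hS0 t') fun n hn k hk => ?_
        rw [(Finset.mem_filter.1 hn).2, (Finset.mem_filter.1 hk).2]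
        exact hne.symm
      · exact fun h => absurd ht h
    simp_rw [integral_complex_ofReal] at h1
    exact_mod_cast h1
  set E4 := Real.exp (12 * primeHarmonic P) ^ 4 with hE4
  set I2 := ∫ θ, F (steinhaus θ) ^ 2 ∂steinhausMeasure with hI2
  have hI2' : 0 ≤ I2 := integral_nonneg fun θ => sq_nonneg _
  have hint2 : Integrable (fun θ => F (steinhaus θ) ^ 2) steinhausMeasure := by
    refine integrable_real_of_measurable_of_bounded (hF.measurable.pow_const 2) (B ^ 2) fun θ => ?_
    rw [abs_pow]
    exact pow_le_pow_left₀ (abs_nonneg _)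
      (hF.abs_le (isMult_steinhaus θ) fun n => (norm_steinhaus θ n).le) 2
  have hint4 : ∀ t, Integrable (fun θ => ‖A t θ‖ ^ 4) steinhausMeasure := by
    intro t
    refine integrable_real_of_measurable_of_bounded
      ((measurable_steinhaus_sum c (S t)).norm.pow_const 4) ((S t).card ^ 4) fun θ => ?_
    rw [abs_of_nonneg (by positivity)]
    exact pow_le_pow_left₀ (norm_nonneg _) (norm_steinhaus_sum_le hc (S t) θ) 4
  have hint3 : ∀ t, Integrable (fun θ => F (steinhaus θ) * ‖A t θ‖ ^ 2) steinhausMeasure := by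
    intro t
    refine integrable_real_of_measurable_of_bounded (hF.measurable.mul
      ((measurable_steinhaus_sum c (S t)).norm.pow_const 2)) (B * (S t).card ^ 2) fun θ => ?_
    have hB := hF.abs_le (isMult_steinhaus θ) fun n => (norm_steinhaus θ n).le
    rw [abs_mul, abs_of_nonneg (by positivity : 0 ≤ ‖A t θ‖ ^ 2)]
    exact mul_le_mul hB (pow_le_pow_left₀ (norm_nonneg _) (norm_steinhaus_sum_le hc (S t) θ) 2)
      (by positivity) ((abs_nonneg _).trans hB)
  have hterm : ∀ t ∈ T, ∫ θ, F (steinhaus θ) * ‖A t θ‖ ^ 2 ∂steinhausMeasure ≤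
      ((X : ℝ) / t) ^ (1 - α) * (η * I2 + η⁻¹ * E4) := by
    intro t ht
    have ht1 := Finset.mem_Icc.1 (hTm t ht)
    have ht0 : (0:ℝ) < t := by exact_mod_cast ht1.1
    have hX0 : (0:ℝ) < X := by exact_mod_cast ht1.1.trans ht1.2
    set y := ((X : ℝ) / t) ^ (1 - α) with hy
    have hy0 : 0 < y := Real.rpow_pos_of_pos (by positivity) _
    have h4 := integral_rough_fibre_pow_four_le hP hα0.le hα hPα hc X t (by omega)
    have hpt : ∀ θ, F (steinhaus θ) * ‖A t θ‖ ^ 2 ≤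
        (y * η) * F (steinhaus θ) ^ 2 + (y * η)⁻¹ * ‖A t θ‖ ^ 4 := by
      intro θ
      set u := F (steinhaus θ)
      set v := ‖A t θ‖ ^ 2 with hv
      have hv4 : ‖A t θ‖ ^ 4 = v ^ 2 := by rw [hv]; ring
      rw [hv4]
      have h1 : 0 ≤ (y * η)⁻¹ * ((y * η) * u - v) ^ 2 := by positivity
      have h2 : (y * η)⁻¹ * ((y * η) * u - v) ^ 2 =
          (y * η) * u ^ 2 + (y * η)⁻¹ * v ^ 2 - 2 * (u * v) := by field_simp; ring
      have h3 : 0 ≤ (y * η) * u ^ 2 + (y * η)⁻¹ * v ^ 2 := by positivity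
      by_cases huv : 0 ≤ u * v <;> linarith
    have h5 := integral_mono (hint3 t) ((hint2.const_mul _).add ((hint4 t).const_mul _)) hpt
    simp only [Pi.add_apply] at h5
    rw [integral_add (hint2.const_mul _) ((hint4 t).const_mul _), integral_const_mul,
      integral_const_mul] at h5
    refine h5.trans ?_
    calc _ ≤ y * η * I2 + (y * η)⁻¹ * (y ^ 2 * E4) :=
          add_le_add le_rfl (mul_le_mul_of_nonneg_left h4 (by positivity))
      _ = _ := by field_simp
  rw [hdiag]
  refine (Finset.sum_le_sum hterm).trans ?_
  rw [← Finset.sum_mul]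
  refine mul_le_mul_of_nonneg_right ?_ (by positivity)
  calc ∑ t ∈ T, ((X : ℝ) / t) ^ (1 - α) ≤ ∑ t ∈ Finset.Icc 1 X, ((X : ℝ) / t) ^ (1 - α) :=
        Finset.sum_le_sum_of_subset_of_nonneg hTm fun t _ _ => by positivity
    _ = (X : ℝ) ^ (1 - α) * ∑ t ∈ Finset.Icc 1 X, (t : ℝ) ^ (α - 1) := by
        rw [Finset.mul_sum]
        refine Finset.sum_congr rfl fun t _ => ?_
        rw [Real.div_rpow (Nat.cast_nonneg _) (Nat.cast_nonneg _), div_eq_mul_inv,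
          ← Real.rpow_neg (Nat.cast_nonneg _), neg_sub]
    _ ≤ (X : ℝ) ^ (1 - α) * ((X : ℝ) ^ α / α) :=
        mul_le_mul_of_nonneg_left (sum_rpow_le hα0 (by linarith) X) (by positivity)
    _ = (X : ℝ) / α := by
        rcases Nat.eq_zero_or_pos X with rfl | hX
        · simp [Real.zero_rpow hα0.ne']
        · have hX0 : (0:ℝ) < X := by exact_mod_cast hX
          rw [← mul_div_assoc, ← Real.rpow_add hX0, sub_add_cancel, Real.rpow_one]

/-- Rankin's bound for the number of integers without large prime divisors. -/
lemma card_smooth_le {Q α : ℝ} (hQ : 1 ≤ Q) (hα0 : 0 ≤ α) (hα : α ≤ 1 / 2) (hQα : Q ^ α ≤ 3)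
    (X : ℕ) : (((Finset.Icc 1 X).filter (fun n => ¬ Q < (maxPrimeDivisor n : ℝ))).card : ℝ) ≤
      (X : ℝ) ^ (1 - α) * Real.exp (12 * primeHarmonic Q) := by
  set R := (Finset.Icc 1 X).filter (fun n => ¬ Q < (maxPrimeDivisor n : ℝ)) with hR
  have hRm : ∀ n ∈ R, 1 ≤ n ∧ n ≤ X ∧ n ∈ smooth Q := by
    intro n hn
    rw [hR, Finset.mem_filter, Finset.mem_Icc] at hn
    refine ⟨hn.1.1, hn.1.2, ?_⟩
    refine Nat.mem_smoothNumbers'.2 fun p hp hpn => ?_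
    have h1 : p ≤ maxPrimeDivisor n :=
      Finset.le_sup (f := id) (Nat.mem_primeFactors.2 ⟨hp, hpn, by omega⟩)
    have h2 : (p : ℝ) ≤ Q := (Nat.cast_le.2 h1).trans (not_lt.1 hn.2)
    exact Nat.lt_succ_of_le (Nat.le_floor h2)
  have hpt : ∀ n ∈ R, (1:ℝ) ≤ (X : ℝ) ^ (1 - α) * (n : ℝ) ^ (-(1 - α)) := by
    intro n hn
    obtain ⟨h1, h2, -⟩ := hRm n hn
    have hn0 : (0:ℝ) < n := by exact_mod_cast h1
    rw [Real.rpow_neg hn0.le, ← div_eq_mul_inv, one_le_div (by positivity)]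
    exact Real.rpow_le_rpow hn0.le (by exact_mod_cast h2) (by linarith)
  calc (R.card : ℝ) = ∑ n ∈ R, (1:ℝ) := by simp
    _ ≤ ∑ n ∈ R, (X : ℝ) ^ (1 - α) * (n : ℝ) ^ (-(1 - α)) := Finset.sum_le_sum hpt
    _ = (X : ℝ) ^ (1 - α) * ∑ n ∈ R, (n : ℝ) ^ (-(1 - α)) := (Finset.mul_sum _ _ _).symm
    _ ≤ _ := mul_le_mul_of_nonneg_left
        (sum_smooth_rpow_le hQ hα0 hα hQα R fun n hn => (hRm n hn).2.2) (by positivity)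

/-! ### Operations on trigonometric polynomials -/

lemma IsTrigPoly.mono {P H H' B B' : ℝ} {F : (ℕ → ℂ) → ℝ} (hF : IsTrigPoly P H B F) (hH : H ≤ H')
    (hB : B ≤ B') : IsTrigPoly P H' B' F := by
  obtain ⟨ι, hι, b, m₁, m₂, hm, hb, h⟩ := hF
  exact ⟨ι, hι, b, m₁, m₂, fun i => ⟨(hm i).1, (hm i).2.1, (hm i).2.2.1.trans hH,
    (hm i).2.2.2.trans hH⟩, hb.trans hB, h⟩

lemma isTrigPoly_const (P : ℝ) {H : ℝ} (hH : 1 ≤ H) (a : ℝ) : IsTrigPoly P H |a| fun _ => a :=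
  ⟨Unit, inferInstance, fun _ => a, fun _ => 1, fun _ => 1,
    fun _ => ⟨one_mem_smooth P, one_mem_smooth P, by simpa using hH, by simpa using hH⟩,
    by simp, fun f hf => by simp [hf.map_one]⟩

lemma IsTrigPoly.add {P H B B' : ℝ} {F G : (ℕ → ℂ) → ℝ} (hF : IsTrigPoly P H B F)
    (hG : IsTrigPoly P H B' G) : IsTrigPoly P H (B + B') fun f => F f + G f := by
  obtain ⟨ι, _, b, m₁, m₂, hm, hb, h⟩ := hF
  obtain ⟨ι', _, b', m₁', m₂', hm', hb', h'⟩ := hG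
  refine ⟨ι ⊕ ι', inferInstance, Sum.elim b b', Sum.elim m₁ m₁', Sum.elim m₂ m₂', ?_, ?_, ?_⟩
  · rintro (i | i)
    · exact hm i
    · exact hm' i
  · simpa using add_le_add hb hb'
  · intro f hf
    simp [h f hf, h' f hf]

lemma IsTrigPoly.mul {P H H' B B' : ℝ} {F G : (ℕ → ℂ) → ℝ} (hF : IsTrigPoly P H B F)
    (hG : IsTrigPoly P H' B' G) : IsTrigPoly P (H * H') (B * B') fun f => F f * G f := by
  obtain ⟨ι, _, b, m₁, m₂, hm, hb, h⟩ := hF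
  obtain ⟨ι', _, b', m₁', m₂', hm', hb', h'⟩ := hG
  refine ⟨ι × ι', inferInstance, fun z => b z.1 * b' z.2, fun z => m₁ z.1 * m₁' z.2,
    fun z => m₂ z.1 * m₂' z.2, ?_, ?_, ?_⟩
  · rintro ⟨i, i'⟩
    obtain ⟨h1, h2, h3, h4⟩ := hm i
    obtain ⟨h1', h2', h3', h4'⟩ := hm' i'
    refine ⟨mul_mem_smooth h1 h1', mul_mem_smooth h2 h2', ?_, ?_⟩
    · push_cast
      exact mul_le_mul h3 h3' (Nat.cast_nonneg _) ((Nat.cast_nonneg _).trans h3)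
    · push_cast
      exact mul_le_mul h4 h4' (Nat.cast_nonneg _) ((Nat.cast_nonneg _).trans h4)
  · simp only [norm_mul, Fintype.sum_prod_type]
    rw [← Fintype.sum_mul_sum]
    exact mul_le_mul hb hb' (Finset.sum_nonneg fun _ _ => norm_nonneg _)
      ((Finset.sum_nonneg fun _ _ => norm_nonneg _).trans hb)
  · intro f hf
    rw [Complex.ofReal_mul, h f hf, h' f hf, Fintype.sum_mul_sum, Fintype.sum_prod_type]
    refine Finset.sum_congr rfl fun i _ => Finset.sum_congr rfl fun i' _ => ?_
    rw [hf.map_mul _ _ (ne_zero_of_smooth (hm i).1) (ne_zero_of_smooth (hm' i').1),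
      hf.map_mul _ _ (ne_zero_of_smooth (hm i).2.1) (ne_zero_of_smooth (hm' i').2.1), star_mul']
    ring

lemma IsTrigPoly.sum {P H B : ℝ} {κ : Type*} (s : Finset κ) {F : κ → (ℕ → ℂ) → ℝ} (hH : 1 ≤ H)
    (hF : ∀ i ∈ s, IsTrigPoly P H B (F i)) :
    IsTrigPoly P H (s.card * B) fun f => ∑ i ∈ s, F i f := by
  classical
  induction s using Finset.induction_on with
  | empty => simpa using isTrigPoly_const P hH 0
  | insert i s hi ih =>
    have := (hF i (Finset.mem_insert_self _ _)).add
      (ih fun k hk => hF k (Finset.mem_insert_of_mem hk))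
    simp only [Finset.sum_insert hi]
    refine this.mono le_rfl ?_
    rw [Finset.card_insert_of_notMem hi]; push_cast; linarith

lemma IsTrigPoly.prod {P H B : ℝ} {κ : Type*} (s : Finset κ) {F : κ → (ℕ → ℂ) → ℝ}
    (hF : ∀ i ∈ s, IsTrigPoly P H B (F i)) :
    IsTrigPoly P (H ^ s.card) (B ^ s.card) fun f => ∏ i ∈ s, F i f := by
  classical
  induction s using Finset.induction_on with
  | empty => simpa using isTrigPoly_const P (le_refl 1) 1
  | insert i s hi ih =>
    have := (hF i (Finset.mem_insert_self _ _)).mul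
      (ih fun k hk => hF k (Finset.mem_insert_of_mem hk))
    simp only [Finset.prod_insert hi]
    rw [Finset.card_insert_of_notMem hi, pow_succ', pow_succ']
    exact this

lemma IsTrigPoly.pow {P H B : ℝ} {F : (ℕ → ℂ) → ℝ} (hF : IsTrigPoly P H B F) (k : ℕ) :
    IsTrigPoly P (H ^ k) (B ^ k) fun f => F f ^ k := by
  simpa using IsTrigPoly.prod (Finset.range k) (F := fun _ => F) fun _ _ => hF

lemma IsTrigPoly.const_mul {P H B : ℝ} {F : (ℕ → ℂ) → ℝ} (hF : IsTrigPoly P H B F) (a : ℝ) :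
    IsTrigPoly P H (|a| * B) fun f => a * F f := by
  simpa using (isTrigPoly_const P (le_refl 1) a).mul hF

lemma isTrigPoly_re_mul {P H : ℝ} {w : ℂ} {n : ℕ} (hn : n ∈ smooth P) (hnH : (n : ℝ) ≤ H)
    (hw : ‖w‖ ≤ 1) : IsTrigPoly P H 1 fun f => (w * f n).re := by
  have hH : (1 : ℝ) ≤ H := le_trans
    (by exact_mod_cast Nat.one_le_iff_ne_zero.2 (ne_zero_of_smooth hn)) hnH
  refine ⟨Fin 2, inferInstance, ![w / 2, star w / 2], ![n, 1], ![1, n], ?_, ?_, ?_⟩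
  · intro i
    fin_cases i
    · exact ⟨hn, one_mem_smooth P, hnH, by simpa using hH⟩
    · exact ⟨one_mem_smooth P, hn, by simpa using hH, hnH⟩
  · simp only [Fin.sum_univ_two, Matrix.cons_val_zero, Matrix.cons_val_one, norm_div, norm_star]
    norm_num; linarith
  · intro f hf
    simp only [Fin.sum_univ_two, Matrix.cons_val_zero, Matrix.cons_val_one, hf.map_one, star_one,
      one_mul, mul_one]
    rw [Complex.re_eq_add_conj, map_mul, Complex.star_def]
    ring

lemma isTrigPoly_primeSum {P : ℝ} (hP : 1 ≤ P) {b : ℕ → ℂ}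
    (hb : ∀ p : ℕ, p.Prime → ‖b p‖ ≤ 1 ∧ ‖b (p ^ 2)‖ ≤ 1) :
    IsTrigPoly P (P ^ 2) (2 * P) (primeSum P b) := by
  have e : primeSum P b = fun f => ∑ p ∈ primesUpTo P,
      ((b p / (√(p : ℝ) : ℂ) * f p).re + (b (p ^ 2) / (p : ℂ) * f (p ^ 2)).re) := by
    funext f
    rw [primeSum, primesUpTo, Complex.re_sum]
    refine Finset.sum_congr rfl fun p _ => ?_
    rw [Complex.add_re, div_mul_eq_mul_div, div_mul_eq_mul_div]
  rw [e]
  have hterm : ∀ p ∈ primesUpTo P, IsTrigPoly P (P ^ 2) (1 + 1) fun f =>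
      (b p / (√(p : ℝ) : ℂ) * f p).re + (b (p ^ 2) / (p : ℂ) * f (p ^ 2)).re := by
    intro p hp
    obtain ⟨hpp, hpP⟩ := mem_primesUpTo.1 hp
    have h1 : (1 : ℝ) ≤ p := by exact_mod_cast hpp.one_le
    have hs := prime_mem_smooth hpp hpP
    refine (isTrigPoly_re_mul hs (hpP.trans (by nlinarith)) ?_).add
      (isTrigPoly_re_mul (by rw [pow_two]; exact mul_mem_smooth hs hs) ?_ ?_)
    · rw [norm_div, Complex.norm_real, Real.norm_of_nonneg (Real.sqrt_nonneg _)]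
      exact div_le_one_of_le₀ ((hb p hpp).1.trans (Real.one_le_sqrt.2 h1)) (Real.sqrt_nonneg _)
    · push_cast; gcongr
    · rw [norm_div, Complex.norm_natCast]
      exact div_le_one_of_le₀ ((hb p hpp).2.trans h1) (by positivity)
  refine (IsTrigPoly.sum _ (by nlinarith) hterm).mono le_rfl ?_
  have hc : ((primesUpTo P).card : ℝ) ≤ P := by
    refine le_trans ?_ (Nat.floor_le (zero_le_one.trans hP))
    have := Finset.card_filter_le (Finset.Icc 1 ⌊P⌋₊) Nat.Prime
    rw [Nat.card_Icc] at this
    exact_mod_cast this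
  linarith

/-! ### Taylor approximation of the weights -/

/-- The Taylor polynomial of degree less than `L` at the origin. -/
def taylorPoly (G : ℝ → ℝ) (L : ℕ) (y : ℝ) : ℝ :=
  ∑ k ∈ Finset.range L, iteratedDeriv k G 0 / k.factorial * y ^ k

lemma abs_sub_taylorPoly_le {G : ℝ → ℝ} (hG : ContDiff ℝ ∞ G) {L : ℕ} (hL : 1 ≤ L) {D : ℝ}
    (hD : ∀ y, |iteratedDeriv L G y| ≤ D) (y : ℝ) :
    |taylorPoly G L y - G y| ≤ D * |y| ^ L / L.factorial := by
  obtain ⟨n, rfl⟩ := Nat.exists_eq_add_of_le' hL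
  rcases eq_or_ne y 0 with rfl | hy
  · have : taylorPoly G (n + 1) 0 = G 0 := by
      rw [taylorPoly, Finset.sum_range_succ', Finset.sum_eq_zero fun k _ => by simp]
      simp
    rw [this]; simp
  · obtain ⟨x', -, hx⟩ := taylor_mean_remainder_lagrange_iteratedDeriv (n := n) (Ne.symm hy)
      ((hG.of_le (by exact_mod_cast le_top)).contDiffOn (s := Set.uIcc 0 y))
    have e : taylorWithinEval G n (Set.uIcc 0 y) 0 y = taylorPoly G (n + 1) y := by
      rw [taylor_within_apply, taylorPoly]
      refine Finset.sum_congr rfl fun k _ => ?_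
      rw [iteratedDerivWithin_eq_iteratedDeriv (uniqueDiffOn_uIcc (Ne.symm hy))
        (hG.contDiffAt.of_le (by exact_mod_cast le_top)) Set.left_mem_uIcc, smul_eq_mul, sub_zero]
      ring
    rw [e] at hx
    rw [abs_sub_comm, hx, sub_zero, abs_div, abs_mul, abs_pow, Nat.abs_cast]
    gcongr
    exact hD x'

lemma IsTrigPoly.taylorPoly_comp {P H B : ℝ} {S : (ℕ → ℂ) → ℝ} (hS : IsTrigPoly P H B S)
    (hH : 1 ≤ H) (hB : 1 ≤ B) {G : ℝ → ℝ} {L : ℕ} {D : ℝ}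
    (hD : ∀ k < L, |iteratedDeriv k G 0| ≤ D) :
    IsTrigPoly P (H ^ L) (L * (D * B ^ L)) fun f => taylorPoly G L (S f) := by
  have := IsTrigPoly.sum (P := P) (H := H ^ L) (B := D * B ^ L) (Finset.range L)
    (F := fun k f => iteratedDeriv k G 0 / k.factorial * S f ^ k) (one_le_pow₀ hH) fun k hk => by
      have hkL := Finset.mem_range.1 hk
      refine ((hS.pow k).const_mul _).mono (pow_le_pow_right₀ hH hkL.le) ?_
      refine mul_le_mul ?_ (pow_le_pow_right₀ hB hkL.le) (by positivity)
        ((abs_nonneg _).trans (hD k hkL))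
      rw [abs_div, Nat.abs_cast]
      exact (div_le_self (abs_nonneg _) (by exact_mod_cast Nat.factorial_pos k)).trans (hD k hkL)
  simpa [taylorPoly] using this

/-! ### The partition of unity -/

lemma IsPartition.tail_eq {N : ℕ} {δ : ℝ} {g gTail : ℝ → ℝ} (h : IsPartition N δ g gTail) :
    gTail = fun x => 1 - ∑ j ∈ Finset.Icc (-(N : ℤ)) N, g (x - j) := by
  funext x; linarith [h.sum_eq_one x]

lemma IsPartition.contDiff_partFn {N : ℕ} {δ : ℝ} {g gTail : ℝ → ℝ} (h : IsPartition N δ g gTail)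
    (j : ℤ) : ContDiff ℝ ∞ (partFn N g gTail j) := by
  have hs : ∀ i : ℤ, ContDiff ℝ ∞ fun x : ℝ => g (x - i) := fun i =>
    h.smooth.comp (contDiff_id.sub contDiff_const)
  by_cases hj : j = N + 1
  · have e : partFn N g gTail j = gTail := by funext x; simp [partFn, hj]
    rw [e, h.tail_eq]
    exact contDiff_const.sub (ContDiff.sum fun i _ => hs i)
  · have e : partFn N g gTail j = fun x => g (x - j) := by funext x; simp [partFn, hj]
    rw [e]; exact hs j

lemma IsPartition.partFn_nonneg {N : ℕ} {δ : ℝ} {g gTail : ℝ → ℝ} (h : IsPartition N δ g gTail)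
    (j : ℤ) (x : ℝ) : 0 ≤ partFn N g gTail j x := by
  rw [partFn]; split_ifs
  exacts [h.tail_nonneg x, h.nonneg _]

lemma IsPartition.partFn_le_one {N : ℕ} {δ : ℝ} {g gTail : ℝ → ℝ} (h : IsPartition N δ g gTail)
    {j : ℤ} (hj : -(N : ℤ) ≤ j ∧ j ≤ (N : ℤ) + 1) (x : ℝ) : partFn N g gTail j x ≤ 1 := by
  have h1 := h.sum_eq_one x
  rw [partFn]; split_ifs with hjN
  · have := Finset.sum_nonneg (s := Finset.Icc (-(N : ℤ)) N) fun i _ => h.nonneg (x - i)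
    linarith
  · have := Finset.single_le_sum (f := fun i : ℤ => g (x - i)) (fun i _ => h.nonneg (x - i))
      (Finset.mem_Icc.2 ⟨hj.1, by lia⟩ : j ∈ Finset.Icc (-(N : ℤ)) N)
    have h2 := h.tail_nonneg x
    linarith

lemma IsPartition.abs_iteratedDeriv_partFn_le {N : ℕ} {δ : ℝ} {g gTail : ℝ → ℝ}
    (h : IsPartition N δ g gTail) (hN : 1 ≤ N) (hδ : 0 < δ) {l : ℕ} (hl : 1 ≤ l) (j : ℤ) (x : ℝ) :
    |iteratedDeriv l (partFn N g gTail j) x| ≤ 3 * N * (2 * Real.pi / δ) ^ (l + 1) := by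
  have hN' : (1 : ℝ) ≤ N := by exact_mod_cast hN
  have hpos : (0 : ℝ) ≤ (2 * Real.pi / δ) ^ (l + 1) := by positivity
  have hg : ∀ y, |iteratedDeriv l g y| ≤ (2 * Real.pi / δ) ^ (l + 1) := by
    intro y
    refine (h.deriv_bound l hl y).trans (mul_le_of_le_one_left hpos ?_)
    rw [div_le_one (by positivity)]
    have := Real.pi_gt_three
    have : (0 : ℝ) ≤ l := Nat.cast_nonneg l
    nlinarith
  have hshift : ∀ i : ℤ, iteratedDeriv l (fun z : ℝ => g (z - i)) x = iteratedDeriv l g (x - i) :=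
    fun i => by rw [iteratedDeriv_comp_sub_const]
  by_cases hj : j = N + 1
  · have e : partFn N g gTail j = fun x => 1 - ∑ i ∈ Finset.Icc (-(N : ℤ)) N, g (x - i) := by
      rw [← h.tail_eq]; funext x; simp [partFn, hj]
    have hs : ∀ i ∈ Finset.Icc (-(N : ℤ)) N, ContDiffAt ℝ l (fun z : ℝ => g (z - i)) x := fun i _ =>
      (h.smooth.comp (contDiff_id.sub contDiff_const)).contDiffAt.of_le (by exact_mod_cast le_top)
    rw [e, iteratedDeriv_const_sub (by lia) (1 : ℝ)]
    rw [iteratedDeriv_neg, abs_neg, iteratedDeriv_fun_sum hs]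
    refine (Finset.abs_sum_le_sum_abs _ _).trans ((Finset.sum_le_card_nsmul _ _
      ((2 * Real.pi / δ) ^ (l + 1)) fun i _ => ?_).trans ?_)
    · rw [hshift]; exact hg _
    · rw [nsmul_eq_mul, Int.card_Icc]
      refine mul_le_mul_of_nonneg_right ?_ hpos
      have : ((N : ℤ) + 1 - -(N : ℤ)).toNat = 2 * N + 1 := by lia
      rw [this]; push_cast; linarith
  · have e : partFn N g gTail j = fun x => g (x - j) := by funext x; simp [partFn, hj]
    rw [e, hshift]
    exact (hg _).trans (le_mul_of_one_le_left hpos (by linarith))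

/-! ### Comparison of products -/

lemma abs_prod_sub_prod_le {κ : Type*} (s : Finset κ) {G p e : κ → ℝ} (hG : ∀ i ∈ s, |G i| ≤ 1)
    (he : ∀ i ∈ s, |p i - G i| ≤ e i) :
    |∏ i ∈ s, p i - ∏ i ∈ s, G i| ≤ ∏ i ∈ s, (1 + e i) - 1 := by
  classical
  induction s using Finset.induction_on with
  | empty => simp
  | insert i s hi ih =>
    have ih' := ih (fun k hk => hG k (Finset.mem_insert_of_mem hk))
      fun k hk => he k (Finset.mem_insert_of_mem hk)
    have hGi := hG i (Finset.mem_insert_self _ _)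
    have hei := he i (Finset.mem_insert_self _ _)
    have hprod : |∏ k ∈ s, G k| ≤ 1 := by
      rw [Finset.abs_prod]
      exact Finset.prod_le_one (fun _ _ => abs_nonneg _)
        fun k hk => hG k (Finset.mem_insert_of_mem hk)
    have hpi : |p i| ≤ 1 + e i := by
      have := abs_add_le (p i - G i) (G i)
      rw [sub_add_cancel] at this; linarith
    rw [Finset.prod_insert hi, Finset.prod_insert hi, Finset.prod_insert hi]
    have e1 : p i * ∏ k ∈ s, p k - G i * ∏ k ∈ s, G k =
        p i * (∏ k ∈ s, p k - ∏ k ∈ s, G k) + (p i - G i) * ∏ k ∈ s, G k := by ring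
    rw [e1]
    refine (abs_add_le _ _).trans ?_
    rw [abs_mul, abs_mul]
    have h1 : |p i| * |∏ k ∈ s, p k - ∏ k ∈ s, G k| ≤ (1 + e i) * (∏ k ∈ s, (1 + e k) - 1) :=
      mul_le_mul hpi ih' (abs_nonneg _) ((abs_nonneg _).trans hpi)
    have h2 : |p i - G i| * |∏ k ∈ s, G k| ≤ e i * 1 :=
      mul_le_mul hei hprod (abs_nonneg _) ((abs_nonneg _).trans hei)
    linarith

lemma one_add_pow_sub_one_le {E : ℝ} (hE : 0 ≤ E) (n : ℕ) :
    (1 + E) ^ n - 1 ≤ 2 ^ n * (E + E ^ n) := by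
  rcases le_total E 1 with h1 | h1
  · have : ∀ k : ℕ, (1 + E) ^ k ≤ 1 + (2 ^ k - 1) * E := by
      intro k
      induction k with
      | zero => simp
      | succ k ih =>
        have h2 : (1:ℝ) ≤ 2 ^ k := one_le_pow₀ (by norm_num)
        rw [pow_succ, pow_succ]
        nlinarith [mul_nonneg (sub_nonneg.2 h2) (mul_nonneg hE (sub_nonneg.2 h1))]
    have h3 := this n
    have : (0:ℝ) ≤ 2 ^ n * E ^ n := by positivity
    nlinarith
  · have h2 : (1 + E) ^ n ≤ (2 * E) ^ n := pow_le_pow_left₀ (by linarith) (by linarith) n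
    rw [mul_pow] at h2
    have : (0:ℝ) ≤ 2 ^ n * E := by positivity
    nlinarith

lemma prod_one_add_sub_one_le {Y : ℕ} (hY : 1 ≤ Y) {e : Fin Y → ℝ} (he : ∀ i, 0 ≤ e i) :
    ∏ i, (1 + e i) - 1 ≤ 2 ^ Y * ∑ i, (e i + e i ^ Y) := by
  have : Nonempty (Fin Y) := ⟨⟨0, hY⟩⟩
  obtain ⟨k, -, hk⟩ := Finset.exists_max_image Finset.univ e Finset.univ_nonempty
  have h1 : ∏ i, (1 + e i) ≤ (1 + e k) ^ Y := by
    refine (Finset.prod_le_prod (g := fun _ => 1 + e k) (fun i _ => ?_)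
      fun i hi => ?_).trans_eq (by simp)
    · linarith [he i]
    · linarith [hk i hi]
  have h2 := one_add_pow_sub_one_le (he k) Y
  have h3 : e k + e k ^ Y ≤ ∑ i, (e i + e i ^ Y) :=
    Finset.single_le_sum (f := fun i => e i + e i ^ Y)
      (fun i _ => add_nonneg (he i) (pow_nonneg (he i) _)) (Finset.mem_univ k)
  have h4 : (0:ℝ) ≤ 2 ^ Y := by positivity
  nlinarith

/-! ### Trigonometric polynomial approximation of the weight -/

/-- Moments of the Taylor remainder. The main point is that they are small as soon as `L` is a large
multiple of `m v`. -/
lemma integral_remainder_pow_le {P v : ℝ} (D : ℝ) {b : ℕ → ℂ}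
    (hb : ∀ p : ℕ, p.Prime → ‖b p‖ ≤ 1 ∧ ‖b (p ^ 2)‖ ≤ 1) (hv : 4 * primeHarmonic P ≤ v)
    (hv0 : 0 < v) {L m : ℕ} (hL : 1 ≤ L) (hm : 1 ≤ m) :
    ∫ θ, (D / L.factorial * primeSum P b (steinhaus θ) ^ L) ^ (2 * m) ∂steinhausMeasure ≤
      2 * (D ^ 2 * (2 * m * Real.exp 1 ^ 3 * v / L) ^ L) ^ m := by
  have hL0 : (0 : ℝ) < L := by exact_mod_cast hL
  have hf0 : (0 : ℝ) < L.factorial := by exact_mod_cast L.factorial_pos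
  have e : ∀ θ, (D / L.factorial * primeSum P b (steinhaus θ) ^ L) ^ (2 * m) =
      (D / L.factorial) ^ (2 * m) * primeSum P b (steinhaus θ) ^ (2 * (L * m)) := fun θ => by
    rw [mul_pow, ← pow_mul, mul_left_comm]
  simp_rw [e]
  rw [integral_const_mul]
  have h1 := integral_primeSum_pow_le hb hv hv0 (Nat.mul_pos hL hm : 1 ≤ L * m)
  have h2 : (0 : ℝ) ≤ (D / L.factorial) ^ (2 * m) := by rw [pow_mul]; positivity
  refine (mul_le_mul_of_nonneg_left h1 h2).trans ?_
  have h3 : (D / L.factorial) ^ (2 * m) * (2 * (2 * ((L * m : ℕ) : ℝ) * Real.exp 1 * v) ^ (L * m)) =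
      2 * (D ^ 2 * ((2 * ((L * m : ℕ) : ℝ) * Real.exp 1 * v) ^ L * ((L.factorial : ℝ)⁻¹) ^ 2)) ^ m := by
    rw [pow_mul, pow_mul, div_eq_mul_inv, mul_pow D, mul_pow _ _ m, mul_pow _ _ m, mul_pow _ _ m]
    ring
  rw [h3]
  have h4 : (L.factorial : ℝ)⁻¹ ≤ (Real.exp 1 / L) ^ L := by
    have := Real.pow_div_factorial_le_exp (L : ℝ) hL0.le L
    rw [div_pow, ← Real.exp_nat_mul, mul_one, le_div_iff₀ (by positivity)]
    rwa [div_eq_mul_inv, mul_comm] at this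
  have h5 : ((L.factorial : ℝ)⁻¹) ^ 2 ≤ ((Real.exp 1 / L) ^ L) ^ 2 :=
    pow_le_pow_left₀ (by positivity) h4 2
  have h6 : (2 * ((L * m : ℕ) : ℝ) * Real.exp 1 * v) ^ L * ((L.factorial : ℝ)⁻¹) ^ 2 ≤
      (2 * m * Real.exp 1 ^ 3 * v / L) ^ L := by
    refine (mul_le_mul_of_nonneg_left h5 (by positivity)).trans_eq ?_
    rw [← pow_mul, mul_comm L 2, pow_mul, ← mul_pow]
    congr 1
    push_cast
    field_simp
  refine mul_le_mul_of_nonneg_left (pow_le_pow_left₀ (by positivity) ?_ m) (by norm_num)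
  exact mul_le_mul_of_nonneg_left h6 (sq_nonneg D)

/-- With `L ≥ 4·10⁵ Y δ⁻² ℓ`, the moments of the Taylor remainder are smaller than any fixed power
of `e^{-Yℓ}`. The factor `δ⁻²` compensates for the size `(2π/δ)^L` of the derivatives. -/
lemma integral_remainder_pow_le_exp {P δ l : ℝ} {N Y L m : ℕ} {b : ℕ → ℂ}
    (hb : ∀ p : ℕ, p.Prime → ‖b p‖ ≤ 1 ∧ ‖b (p ^ 2)‖ ≤ 1) (hl : 8 ≤ l)
    (hPl : primeHarmonic P ≤ 5 * l) (hN : 1 ≤ N) (hNl : Real.log N ≤ l) (hδ : 0 < δ) (hδ1 : 8 ≤ δ⁻¹)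
    (hL : 400000 * (Y * l * δ⁻¹ ^ 2) ≤ L) (hm : 1 ≤ m) (hmY : m ≤ Y) :
    ∫ θ, (3 * N * (2 * Real.pi / δ) ^ (L + 1) / L.factorial *
      primeSum P b (steinhaus θ) ^ L) ^ (2 * m) ∂steinhausMeasure ≤
      2 * Real.exp (-(200000 * (Y * l))) := by
  have hY : (1 : ℝ) ≤ Y := by exact_mod_cast hm.trans hmY
  have hN0 : (0 : ℝ) < N := by exact_mod_cast hN
  have hmY' : (m : ℝ) ≤ Y := by exact_mod_cast hmY
  have hYl : l ≤ Y * l := le_mul_of_one_le_left (by linarith) hY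
  have hd2 : (64 : ℝ) ≤ δ⁻¹ ^ 2 := by nlinarith
  have hYld : Y * l * 64 ≤ Y * l * δ⁻¹ ^ 2 := mul_le_mul_of_nonneg_left hd2 (by linarith)
  have hdYl : δ⁻¹ ^ 2 ≤ Y * l * δ⁻¹ ^ 2 := le_mul_of_one_le_left (by positivity) (by linarith)
  have hL0 : (0 : ℝ) < L := by nlinarith
  have hL1 : 1 ≤ L := by exact_mod_cast hL0
  refine (integral_remainder_pow_le _ hb (v := 20 * l) (by linarith) (by linarith) hL1 hm).trans ?_
  refine mul_le_mul_of_nonneg_left ?_ (by norm_num)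
  have hpi : Real.pi ^ 2 ≤ 10 := by nlinarith [Real.pi_lt_d2, Real.pi_gt_three]
  have hexp : Real.exp 1 ^ 3 ≤ 21 := by
    have h := Real.exp_one_lt_d9
    calc Real.exp 1 ^ 3 ≤ (2.72 : ℝ) ^ 3 := pow_le_pow_left₀ (Real.exp_pos _).le (by linarith) 3
      _ ≤ 21 := by norm_num
  have h1 : (2 * Real.pi / δ) ^ 2 * (2 * m * Real.exp 1 ^ 3 * (20 * l) / L) ≤ Real.exp (-2) := by
    have h2 : (2 * Real.pi / δ) ^ 2 ≤ 40 * δ⁻¹ ^ 2 := by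
      rw [div_eq_mul_inv, mul_pow, mul_pow]
      have : (0:ℝ) ≤ δ⁻¹ ^ 2 := by positivity
      nlinarith
    have h3 : 2 * m * Real.exp 1 ^ 3 * (20 * l) / L ≤ 840 * (Y * l) / L := by
      refine div_le_div_of_nonneg_right ?_ hL0.le
      have : (m : ℝ) * Real.exp 1 ^ 3 ≤ Y * 21 := mul_le_mul hmY' hexp (by positivity) (by linarith)
      nlinarith
    have h4 : Real.exp (-2) ≥ 1 / 10 := by
      rw [Real.exp_neg, ← one_div]
      refine one_div_le_one_div_of_le (Real.exp_pos _) ?_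
      have h := Real.exp_one_lt_d9
      have : Real.exp 2 = Real.exp 1 ^ 2 := by rw [← Real.exp_nat_mul]; norm_num
      rw [this]
      nlinarith [Real.exp_pos 1]
    refine (mul_le_mul h2 h3 (by positivity) (by positivity)).trans (le_trans ?_ h4)
    rw [mul_div_assoc', div_le_iff₀ hL0]
    linarith
  have h2 : (3 * N * (2 * Real.pi / δ) ^ (L + 1)) ^ 2 *
      (2 * m * Real.exp 1 ^ 3 * (20 * l) / L) ^ L ≤
      9 * N ^ 2 * (40 * δ⁻¹ ^ 2) * Real.exp (-2) ^ L := by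
    have e : (3 * N * (2 * Real.pi / δ) ^ (L + 1)) ^ 2 *
      (2 * m * Real.exp 1 ^ 3 * (20 * l) / L) ^ L = 9 * N ^ 2 * (2 * Real.pi / δ) ^ 2 *
        ((2 * Real.pi / δ) ^ 2 * (2 * m * Real.exp 1 ^ 3 * (20 * l) / L)) ^ L := by
      rw [mul_pow ((2 * Real.pi / δ) ^ 2), ← pow_mul]; ring
    rw [e]
    have hs : (2 * Real.pi / δ) ^ 2 ≤ 40 * δ⁻¹ ^ 2 := by
      rw [div_eq_mul_inv, mul_pow, mul_pow]
      have : (0:ℝ) ≤ δ⁻¹ ^ 2 := by positivity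
      nlinarith
    have hl0 : 0 ≤ l := by linarith
    gcongr
  have h3 : 9 * (N : ℝ) ^ 2 * (40 * δ⁻¹ ^ 2) ≤ Real.exp L := by
    have hN2 : (N : ℝ) ^ 2 ≤ Real.exp (2 * l) := by
      rw [← Real.exp_log hN0, ← Real.exp_nat_mul]
      exact Real.exp_le_exp.2 (by push_cast; linarith)
    have hd : δ⁻¹ ^ 2 ≤ Real.exp (δ⁻¹ ^ 2) := by linarith [Real.add_one_le_exp (δ⁻¹ ^ 2)]
    have h360 : (360 : ℝ) ≤ Real.exp 360 := by linarith [Real.add_one_le_exp (360 : ℝ)]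
    calc 9 * (N : ℝ) ^ 2 * (40 * δ⁻¹ ^ 2) = 360 * (N ^ 2 * δ⁻¹ ^ 2) := by ring
      _ ≤ Real.exp 360 * (Real.exp (2 * l) * Real.exp (δ⁻¹ ^ 2)) := by gcongr
      _ = Real.exp (360 + (2 * l + δ⁻¹ ^ 2)) := by rw [Real.exp_add, Real.exp_add]
      _ ≤ Real.exp L := Real.exp_le_exp.2 (by nlinarith)
  have h4 : (3 * N * (2 * Real.pi / δ) ^ (L + 1)) ^ 2 *
      (2 * m * Real.exp 1 ^ 3 * (20 * l) / L) ^ L ≤ Real.exp (-L) := by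
    refine h2.trans ((mul_le_mul_of_nonneg_right h3 (by positivity)).trans_eq ?_)
    rw [← Real.exp_nat_mul, ← Real.exp_add]; congr 1; ring
  have hl0 : 0 ≤ l := by linarith
  refine (pow_le_pow_left₀ (by positivity) h4 m).trans ?_
  rw [← Real.exp_nat_mul]
  refine Real.exp_le_exp.2 ?_
  have : (1 : ℝ) ≤ m := by exact_mod_cast hm
  nlinarith

/-- A common bound for the `ℓ¹` norms of the Taylor polynomials and their remainders. -/
lemma taylor_coefficients_le {P δ Z : ℝ} {N L : ℕ} (hδ : 0 < δ) (hZ : 8 ≤ Z) (hP0 : 0 ≤ P)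
    (hP : P ≤ Z) (hδZ : δ⁻¹ ≤ Z) (hN : (N : ℝ) ≤ Z) (hL : 4 ≤ L) :
    L * (3 * N * (2 * Real.pi / δ) ^ (L + 1) * (2 * P) ^ L) ≤ Z ^ (6 * L) := by
  have h1 : (L : ℝ) ≤ Z ^ L := by
    have : (L : ℝ) ≤ 2 ^ L := by exact_mod_cast Nat.lt_two_pow_self.le
    exact this.trans (pow_le_pow_left₀ (by norm_num) (by linarith) L)
  have h2 : 3 * (N : ℝ) ≤ Z ^ 2 := by nlinarith
  have h3 : 2 * Real.pi / δ ≤ Z ^ 2 := by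
    rw [div_eq_mul_inv]
    have := Real.pi_lt_d2
    have hd : 0 < δ⁻¹ := by positivity
    nlinarith
  have h4 : 2 * P ≤ Z ^ 2 := by nlinarith
  have hpi := Real.pi_pos
  calc L * (3 * N * (2 * Real.pi / δ) ^ (L + 1) * (2 * P) ^ L)
      ≤ Z ^ L * (Z ^ 2 * (Z ^ 2) ^ (L + 1) * (Z ^ 2) ^ L) := by gcongr
    _ = Z ^ (5 * L + 4) := by ring
    _ ≤ Z ^ (6 * L) := pow_le_pow_right₀ (by linarith) (by lia)

lemma sq_two_pow_mul_sum_le {Y : ℕ} (e : Fin Y → ℝ) :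
    (2 ^ Y * ∑ i, (e i + e i ^ Y)) ^ 2 ≤
      2 * Y * 4 ^ Y * ∑ i, (e i ^ (2 * 1) + e i ^ (2 * Y)) := by
  have h1 := sq_sum_le_card_mul_sum_sq (s := Finset.univ) (f := fun i => e i + e i ^ Y)
  rw [Finset.card_univ, Fintype.card_fin] at h1
  have h2 : ∑ i, (e i + e i ^ Y) ^ 2 ≤ 2 * ∑ i, (e i ^ (2 * 1) + e i ^ (2 * Y)) := by
    rw [Finset.mul_sum]
    refine Finset.sum_le_sum fun i _ => ?_
    rw [mul_one, mul_comm 2 Y, pow_mul]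
    nlinarith [sq_nonneg (e i - e i ^ Y)]
  have e4 : ((2 : ℝ) ^ Y) ^ 2 = 4 ^ Y := by rw [← pow_mul, mul_comm, pow_mul]; norm_num
  rw [mul_pow, e4]
  have h3 : (∑ i, (e i + e i ^ Y)) ^ 2 ≤ Y * (2 * ∑ i, (e i ^ (2 * 1) + e i ^ (2 * Y))) :=
    h1.trans (mul_le_mul_of_nonneg_left h2 (Nat.cast_nonneg _))
  refine (mul_le_mul_of_nonneg_left h3 (by positivity)).trans_eq ?_
  ring

lemma card_factor_le_exp {Y : ℕ} {l : ℝ} (hY : 1 ≤ Y) (hl : 8 ≤ l) :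
    (2 * Y * 4 ^ Y * (Y * 4) : ℝ) ≤ Real.exp (6 * (Y * l)) := by
  have hY' : (1 : ℝ) ≤ Y := by exact_mod_cast hY
  have h4 : (Y : ℝ) ≤ 2 ^ Y := by exact_mod_cast Nat.lt_two_pow_self.le
  have h8 : (8 : ℝ) ≤ 8 ^ Y := le_self_pow₀ (by norm_num) (by lia)
  have h128 : (128 : ℝ) ≤ Real.exp 48 := by
    have h := Real.add_one_le_exp (24 : ℝ)
    have : Real.exp 48 = Real.exp 24 * Real.exp 24 := by rw [← Real.exp_add]; norm_num
    nlinarith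
  calc (2 * Y * 4 ^ Y * (Y * 4) : ℝ) = 8 * (Y * Y * 4 ^ Y) := by ring
    _ ≤ 8 ^ Y * (2 ^ Y * 2 ^ Y * 4 ^ Y) := by gcongr
    _ = 128 ^ Y := by rw [← mul_pow, ← mul_pow, ← mul_pow]; norm_num
    _ ≤ Real.exp 48 ^ Y := by gcongr
    _ = Real.exp (Y * 48) := by rw [← Real.exp_nat_mul]
    _ ≤ Real.exp (6 * (Y * l)) := Real.exp_le_exp.2 (by nlinarith)

/-- The weight is well approximated by a trigonometric polynomial `p`, and the error is dominated by
another trigonometric polynomial `D`, small in mean square. -/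
lemma exists_trigPoly_approx {P δ Z l : ℝ} {N Y L : ℕ} {g gTail : ℝ → ℝ}
    (h : IsPartition N δ g gTail) (hδ : 0 < δ) (hP : 1 ≤ P) (hPZ : P ≤ Z) (hδZ : δ⁻¹ ≤ Z)
    (hNZ : (N : ℝ) ≤ Z) (hl : 8 ≤ l) (hPl : primeHarmonic P ≤ 5 * l) (hN : 1 ≤ N)
    (hNl : Real.log N ≤ l) (hδ1 : 8 ≤ δ⁻¹) (hY : 1 ≤ Y) (hLe : Even L)
    (hL : 400000 * (Y * l * δ⁻¹ ^ 2) ≤ L) {j : Fin Y → ℤ}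
    (hj : ∀ i, -(N : ℤ) ≤ j i ∧ j i ≤ (N : ℤ) + 1) {a : Fin Y → ℕ → ℂ}
    (ha : ∀ i, ∀ p : ℕ, p.Prime → ‖a i p‖ ≤ 1 ∧ ‖a i (p ^ 2)‖ ≤ 1) :
    ∃ p D : (ℕ → ℂ) → ℝ, IsTrigPoly P (Z ^ (2 * L * Y)) (Z ^ (7 * L * Y)) p ∧
      IsTrigPoly P (Z ^ (2 * L * Y)) (Z ^ (7 * L * Y)) D ∧
      (∀ f, |p f - weightG N g gTail P j a f| ≤ D f) ∧
      ∫ θ, D (steinhaus θ) ^ 2 ∂steinhausMeasure ≤ Real.exp (-(199994 * (Y * l))) := by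
  have hY' : (1 : ℝ) ≤ Y := by exact_mod_cast hY
  have hN' : (1 : ℝ) ≤ N := by exact_mod_cast hN
  have hZ : 8 ≤ Z := hδ1.trans hδZ
  have hYl : l ≤ Y * l := le_mul_of_one_le_left (by linarith) hY'
  have hL4 : 4 ≤ L := by
    have h1 : (1:ℝ) ≤ δ⁻¹ ^ 2 := by nlinarith
    have : (4 : ℝ) ≤ L := by
      have := le_mul_of_one_le_right (a := (Y * l : ℝ)) (by linarith) h1
      linarith
    exact_mod_cast this
  set D₀ : ℝ := 3 * N * (2 * Real.pi / δ) ^ (L + 1) with hD₀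
  set U : ℝ := L * (D₀ * (2 * P) ^ L) with hU
  have hUZ : U ≤ Z ^ (6 * L) := taylor_coefficients_le hδ hZ (by linarith) hPZ hδZ hNZ hL4
  have hpi1 : 1 ≤ 2 * Real.pi / δ := by
    rw [div_eq_mul_inv]; nlinarith [Real.pi_gt_three]
  have hD₀1 : 1 ≤ D₀ := by
    have : (1 : ℝ) ≤ (2 * Real.pi / δ) ^ (L + 1) := one_le_pow₀ hpi1
    rw [hD₀]; nlinarith
  have hL1 : (1 : ℝ) ≤ L := by exact_mod_cast (by lia : 1 ≤ L)
  have h2P : (1 : ℝ) ≤ (2 * P) ^ L := one_le_pow₀ (by linarith)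
  have hU0 : D₀ * (2 * P) ^ L ≤ U := le_mul_of_one_le_left (by positivity) hL1
  have hU1 : 1 ≤ U := le_trans (by nlinarith) hU0
  have hP2 : (1:ℝ) ≤ P ^ 2 := by nlinarith
  have hHle : (P ^ 2) ^ L ≤ Z ^ (2 * L) := by rw [← pow_mul]; gcongr
  have hH1 : (1:ℝ) ≤ Z ^ (2 * L) := one_le_pow₀ (by linarith)
  set G : Fin Y → ℝ → ℝ := fun i => partFn N g gTail (j i) with hG
  set q : Fin Y → (ℕ → ℂ) → ℝ := fun i f => taylorPoly (G i) L (primeSum P (a i) f) with hq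
  set e : Fin Y → (ℕ → ℂ) → ℝ := fun i f => D₀ / L.factorial * primeSum P (a i) f ^ L with he
  have he0 : ∀ i f, 0 ≤ e i f := fun i f =>
    mul_nonneg (by positivity) (hLe.pow_nonneg _)
  have hqe : ∀ i f, |q i f - G i (primeSum P (a i) f)| ≤ e i f := by
    intro i f
    refine (abs_sub_taylorPoly_le (h.contDiff_partFn (j i)) (by lia)
      (fun y => h.abs_iteratedDeriv_partFn_le hN hδ (by lia) (j i) y) _).trans_eq ?_
    rw [hLe.pow_abs, he, hD₀]; ring
  have hqT : ∀ i, IsTrigPoly P (Z ^ (2 * L)) U (q i) := fun i => by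
    refine ((isTrigPoly_primeSum hP (ha i)).taylorPoly_comp hP2 (by linarith)
      (D := D₀) fun k hk => ?_).mono hHle le_rfl
    rcases Nat.eq_zero_or_pos k with rfl | hk0
    · rw [iteratedDeriv_zero, abs_of_nonneg (h.partFn_nonneg _ _)]
      exact (h.partFn_le_one (hj i) _).trans hD₀1
    · refine (h.abs_iteratedDeriv_partFn_le hN hδ hk0 (j i) 0).trans ?_
      rw [hD₀]
      exact mul_le_mul_of_nonneg_left (pow_le_pow_right₀ hpi1 (by lia)) (by positivity)
  have heT : ∀ i, IsTrigPoly P (Z ^ (2 * L)) U (e i) := fun i => by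
    refine (((isTrigPoly_primeSum hP (ha i)).pow L).const_mul _).mono hHle (le_trans ?_ hU0)
    refine mul_le_mul_of_nonneg_right ?_ (by positivity)
    rw [abs_of_nonneg (by positivity)]
    exact div_le_self (by positivity) (by exact_mod_cast L.factorial_pos)
  have hZ67 : U ^ Y ≤ Z ^ (6 * L * Y) := by
    rw [pow_mul]; exact pow_le_pow_left₀ (by linarith) hUZ Y
  have hHY : Z ^ (2 * L) ≤ (Z ^ (2 * L)) ^ Y := le_self_pow₀ hH1 (by lia)
  refine ⟨fun f => ∏ i, q i f, fun f => 2 ^ Y * ∑ i, (e i f + e i f ^ Y), ?_, ?_, ?_, ?_⟩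
  · have := IsTrigPoly.prod Finset.univ fun i _ => hqT i
    rw [Finset.card_univ, Fintype.card_fin, ← pow_mul] at this
    exact this.mono le_rfl (hZ67.trans (pow_le_pow_right₀ (by linarith) (by gcongr; norm_num)))
  · have h1 : ∀ i, IsTrigPoly P ((Z ^ (2 * L)) ^ Y) (U + U ^ Y) fun f => e i f + e i f ^ Y :=
      fun i => ((heT i).mono hHY le_rfl).add ((heT i).pow Y)
    have h2 := (IsTrigPoly.sum Finset.univ (one_le_pow₀ hH1) fun i _ => h1 i).const_mul (2 ^ Y)
    rw [Finset.card_univ, Fintype.card_fin, ← pow_mul] at h2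
    refine h2.mono le_rfl ?_
    rw [abs_of_nonneg (by positivity)]
    have h3 : U ≤ U ^ Y := le_self_pow₀ hU1 (by lia)
    have h4 : (Y : ℝ) ≤ 2 ^ Y := by exact_mod_cast Nat.lt_two_pow_self.le
    have h5 : (2 : ℝ) ≤ 2 ^ Y := le_self_pow₀ (by norm_num) (by lia)
    calc 2 ^ Y * (Y * (U + U ^ Y)) ≤ 2 ^ Y * (2 ^ Y * (U ^ Y + U ^ Y)) := by gcongr
      _ = 2 ^ Y * (2 ^ Y * 2) * U ^ Y := by ring
      _ ≤ 2 ^ Y * (2 ^ Y * 2 ^ Y) * Z ^ (6 * L * Y) := by gcongr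
      _ = 8 ^ Y * Z ^ (6 * L * Y) := by
        rw [← mul_pow, ← mul_pow]; norm_num
      _ ≤ Z ^ Y * Z ^ (6 * L * Y) := by gcongr
      _ = Z ^ (Y + 6 * L * Y) := by rw [pow_add]
      _ ≤ Z ^ (7 * L * Y) := pow_le_pow_right₀ (by linarith) (by nlinarith)
  · intro f
    refine (abs_prod_sub_prod_le Finset.univ (e := fun i => e i f) (fun i _ => ?_)
      fun i _ => hqe i f).trans (prod_one_add_sub_one_le hY fun i => he0 i f)
    rw [abs_of_nonneg (h.partFn_nonneg _ _)]
    exact h.partFn_le_one (hj i) _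
  · have hpt : ∀ θ, (2 ^ Y * ∑ i, (e i (steinhaus θ) + e i (steinhaus θ) ^ Y)) ^ 2 ≤
        2 * Y * 4 ^ Y * ∑ i, (e i (steinhaus θ) ^ (2 * 1) + e i (steinhaus θ) ^ (2 * Y))  :=
      fun θ => sq_two_pow_mul_sum_le fun i => e i (steinhaus θ)
    have hint : ∀ i (k : ℕ), Integrable (fun θ => e i (steinhaus θ) ^ k) steinhausMeasure :=
      fun i k => integrable_real_of_measurable_of_bounded ((heT i).pow k).measurable (U ^ k)
        fun θ => ((heT i).pow k).abs_le (isMult_steinhaus θ) fun n => (norm_steinhaus θ n).le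
    have hadd : ∀ i ∈ Finset.univ, Integrable (fun θ => e i (steinhaus θ) ^ (2 * 1) +
        e i (steinhaus θ) ^ (2 * Y)) steinhausMeasure := fun i _ => (hint i _).add (hint i _)
    have hsum : Integrable (fun θ => ∑ i, (e i (steinhaus θ) ^ (2 * 1) +
        e i (steinhaus θ) ^ (2 * Y))) steinhausMeasure := integrable_finsetSum _ hadd
    refine (integral_mono_of_nonneg (Filter.Eventually.of_forall fun θ => sq_nonneg _)
      (hsum.const_mul _) (Filter.Eventually.of_forall hpt)).trans ?_
    rw [integral_const_mul, integral_finsetSum _ hadd]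
    have hi : ∀ i, ∫ θ, (e i (steinhaus θ) ^ (2 * 1) + e i (steinhaus θ) ^ (2 * Y))
        ∂steinhausMeasure ≤ 4 * Real.exp (-(200000 * (Y * l))) := by
      intro i
      rw [integral_add (hint i _) (hint i _)]
      have h1 := integral_remainder_pow_le_exp (ha i) hl hPl hN hNl hδ hδ1 hL le_rfl hY
      have h2 := integral_remainder_pow_le_exp (ha i) hl hPl hN hNl hδ hδ1 hL hY le_rfl
      linarith
    refine (mul_le_mul_of_nonneg_left (Finset.sum_le_sum fun i _ => hi i) (by positivity)).trans ?_
    rw [Finset.sum_const, Finset.card_univ, Fintype.card_fin, nsmul_eq_mul]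
    have h16 := card_factor_le_exp hY hl
    calc 2 * Y * 4 ^ Y * (Y * (4 * Real.exp (-(200000 * (Y * l)))))
        = (2 * Y * 4 ^ Y * (Y * 4)) * Real.exp (-(200000 * (Y * l))) := by ring
      _ ≤ Real.exp (6 * (Y * l)) * Real.exp (-(200000 * (Y * l))) := by gcongr
      _ = Real.exp (-(199994 * (Y * l))) := by rw [← Real.exp_add]; congr 1; ring

/-! ### From characters to the Steinhaus model -/

lemma norm_coefficient_le_one {c : ℕ → ℤ} (hc : (c = fun n => ArithmeticFunction.moebius n) ∨
    (c = fun n => ArithmeticFunction.liouville n)) (n : ℕ) : ‖(c n : ℂ)‖ ≤ 1 := by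
  rcases hc with rfl | rfl
  · exact norm_moebius_le_one n
  · rcases eq_or_ne n 0 with rfl | hn
    · simp
    · simp [ArithmeticFunction.liouville_apply hn]

lemma abs_charAvg_sub_le {r : ℕ} [Fact r.Prime] {F G K : DirichletCharacter ℂ r → ℝ}
    (h : ∀ χ, |F χ - G χ| ≤ K χ) : |charAvg r F - charAvg r G| ≤ charAvg r K := by
  have : (1 : ℝ) ≤ r := by exact_mod_cast (Fact.out : r.Prime).one_le
  rw [charAvg, charAvg, ← sub_div, ← Finset.sum_sub_distrib, abs_div,
    abs_of_nonneg (by linarith : (0:ℝ) ≤ r - 1)]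
  exact div_le_div_of_nonneg_right
    ((Finset.abs_sum_le_sum_abs _ _).trans (Finset.sum_le_sum fun χ _ => h χ)) (by linarith)

/-- A bound for the twisted second moments, uniform in the twists, transfers to second moments
weighted by a trigonometric polynomial. -/
lemma IsTrigPoly.abs_charAvg_sub_integral_le {r : ℕ} [Fact r.Prime] {P H B E κ : ℝ}
    {F : (ℕ → ℂ) → ℝ} (hF : IsTrigPoly P H B F) (hPr : P < r) (hH : H ≤ (r : ℝ) ^ κ) {c : ℕ → ℂ}
    (hc : ∀ n, ‖c n‖ ≤ 1) {X : ℕ} (hE0 : 0 ≤ E)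
    (hE : ∀ m₁ m₂ : ℕ, 1 ≤ m₁ → (m₁ : ℝ) ≤ (r : ℝ) ^ κ → 1 ≤ m₂ → (m₂ : ℝ) ≤ (r : ℝ) ^ κ →
      ‖(∑ χ : DirichletCharacter ℂ r, χ m₁ * star (χ m₂) *
          ((‖∑ n ∈ Finset.Icc 1 X, c n * χ (n : ZMod r)‖ ^ 2 : ℝ) : ℂ)) / ((r : ℂ) - 1) -
        ∫ θ, coprimePart r (steinhaus θ) m₁ * star (coprimePart r (steinhaus θ) m₂) *
          ((‖∑ n ∈ Finset.Icc 1 X, c n * coprimePart r (steinhaus θ) n‖ ^ 2 : ℝ) : ℂ)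
          ∂steinhausMeasure‖ ≤ E) :
    |charAvg r (fun χ => F (fun n => χ (n : ZMod r)) *
        ‖∑ n ∈ Finset.Icc 1 X, c n * χ (n : ZMod r)‖ ^ 2) -
      ∫ θ, F (steinhaus θ) * ‖∑ n ∈ Finset.Icc 1 X, c n * coprimePart r (steinhaus θ) n‖ ^ 2
        ∂steinhausMeasure| ≤ B * E := by
  have hr : r.Prime := Fact.out
  obtain ⟨ι, _, b, m₁, m₂, hm, hb, h⟩ := hF
  have hE' := fun i => hE (m₁ i) (m₂ i) (Nat.one_le_iff_ne_zero.2 (ne_zero_of_smooth (hm i).1))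
    ((hm i).2.2.1.trans hH) (Nat.one_le_iff_ne_zero.2 (ne_zero_of_smooth (hm i).2.1))
    ((hm i).2.2.2.trans hH)
  set M : (Nat.Primes → UnitAddCircle) → ℝ := fun θ =>
    ‖∑ n ∈ Finset.Icc 1 X, c n * coprimePart r (steinhaus θ) n‖ ^ 2 with hM
  have hMmeas : Measurable M := (Finset.measurable_sum _ fun n _ =>
    (measurable_coprimePart_steinhaus r n).const_mul _).norm.pow_const 2
  have hMint : Integrable M steinhausMeasure := by
    refine integrable_real_of_measurable_of_bounded hMmeas ((X : ℝ) ^ 2) fun θ => ?_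
    rw [abs_of_nonneg (sq_nonneg _)]
    refine pow_le_pow_left₀ (norm_nonneg _) (norm_sum_Icc_le (fun n => ?_) X) 2
    rw [norm_mul]
    exact mul_le_one₀ (hc n) (norm_nonneg _) (norm_coprimePart_steinhaus_le r θ n)
  have hchar : ((charAvg r (fun χ => F (fun n => χ (n : ZMod r)) *
      ‖∑ n ∈ Finset.Icc 1 X, c n * χ (n : ZMod r)‖ ^ 2) : ℝ) : ℂ) =
      ∑ i, b i * ((∑ χ : DirichletCharacter ℂ r, χ (m₁ i) * star (χ (m₂ i)) *
          ((‖∑ n ∈ Finset.Icc 1 X, c n * χ (n : ZMod r)‖ ^ 2 : ℝ) : ℂ)) / ((r : ℂ) - 1)) := by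
    rw [charAvg]
    push_cast
    simp_rw [mul_div_assoc', ← Finset.sum_div]
    congr 1
    simp_rw [Finset.mul_sum]
    rw [Finset.sum_comm]
    refine Finset.sum_congr rfl fun χ _ => ?_
    rw [h _ (isMult_character χ), Finset.sum_mul]
    exact Finset.sum_congr rfl fun i _ => by ring
  have hst : ((∫ θ, F (steinhaus θ) * M θ ∂steinhausMeasure : ℝ) : ℂ) =
      ∑ i, b i * ∫ θ, coprimePart r (steinhaus θ) (m₁ i) *
        star (coprimePart r (steinhaus θ) (m₂ i)) * ((M θ : ℝ) : ℂ) ∂steinhausMeasure := by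
    rw [← integral_complex_ofReal]
    simp_rw [← integral_const_mul]
    rw [← integral_finsetSum _ fun i _ => (integrable_twisted_real hMint).const_mul _]
    refine integral_congr_ae (Filter.Eventually.of_forall fun θ => ?_)
    simp only
    rw [Complex.ofReal_mul, h _ (isMult_steinhaus θ), Finset.sum_mul]
    refine Finset.sum_congr rfl fun i _ => ?_
    rw [coprimePart, coprimePart, if_pos (smooth_coprime (hm i).1 hr hPr),
      if_pos (smooth_coprime (hm i).2.1 hr hPr)]
    ring
  rw [← Real.norm_eq_abs, ← Complex.norm_real, Complex.ofReal_sub, hchar, hst,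
    ← Finset.sum_sub_distrib]
  simp_rw [← mul_sub]
  refine (norm_sum_le_of_le (n := fun i => ‖b i‖ * E) _ fun i _ => ?_).trans ?_
  · rw [norm_mul]
    exact mul_le_mul_of_nonneg_left (hE' i) (norm_nonneg _)
  · rw [← Finset.sum_mul]
    exact mul_le_mul_of_nonneg_right hb hE0

/-- Replacing the characters by the Steinhaus model, for a weight which is within `D` of `p`, where
`p` and `D` are trigonometric polynomials. -/
lemma abs_charAvg_weight_sub_le {r : ℕ} [Fact r.Prime] {P H B E κ : ℝ} {W p D : (ℕ → ℂ) → ℝ}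
    (hp : IsTrigPoly P H B p) (hD : IsTrigPoly P H B D) (hpW : ∀ f, |p f - W f| ≤ D f)
    (hWm : Measurable fun θ => W (steinhaus θ)) (hPr : P < r) (hH : H ≤ (r : ℝ) ^ κ) {c : ℕ → ℂ}
    (hc : ∀ n, ‖c n‖ ≤ 1) {X : ℕ} (hE0 : 0 ≤ E)
    (hE : ∀ m₁ m₂ : ℕ, 1 ≤ m₁ → (m₁ : ℝ) ≤ (r : ℝ) ^ κ → 1 ≤ m₂ → (m₂ : ℝ) ≤ (r : ℝ) ^ κ →
      ‖(∑ χ : DirichletCharacter ℂ r, χ m₁ * star (χ m₂) *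
          ((‖∑ n ∈ Finset.Icc 1 X, c n * χ (n : ZMod r)‖ ^ 2 : ℝ) : ℂ)) / ((r : ℂ) - 1) -
        ∫ θ, coprimePart r (steinhaus θ) m₁ * star (coprimePart r (steinhaus θ) m₂) *
          ((‖∑ n ∈ Finset.Icc 1 X, c n * coprimePart r (steinhaus θ) n‖ ^ 2 : ℝ) : ℂ)
          ∂steinhausMeasure‖ ≤ E) :
    |charAvg r (fun χ => W (fun n => χ (n : ZMod r)) *
        ‖∑ n ∈ Finset.Icc 1 X, c n * χ (n : ZMod r)‖ ^ 2) -
      ∫ θ, W (steinhaus θ) * ‖∑ n ∈ Finset.Icc 1 X, c n * coprimePart r (steinhaus θ) n‖ ^ 2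
        ∂steinhausMeasure| ≤
      2 * (B * E) + 2 * ∫ θ, D (steinhaus θ) *
        ‖∑ n ∈ Finset.Icc 1 X, c n * coprimePart r (steinhaus θ) n‖ ^ 2 ∂steinhausMeasure := by
  have h1 := hp.abs_charAvg_sub_integral_le hPr hH hc hE0 hE
  have h2 := hD.abs_charAvg_sub_integral_le hPr hH hc hE0 hE
  set M : (Nat.Primes → UnitAddCircle) → ℝ := fun θ =>
    ‖∑ n ∈ Finset.Icc 1 X, c n * coprimePart r (steinhaus θ) n‖ ^ 2 with hM
  have hMmeas : Measurable M := (Finset.measurable_sum _ fun n _ =>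
    (measurable_coprimePart_steinhaus r n).const_mul _).norm.pow_const 2
  have hM0 : ∀ θ, 0 ≤ M θ := fun θ => sq_nonneg _
  have hMX : ∀ θ, M θ ≤ (X : ℝ) ^ 2 := by
    intro θ
    refine pow_le_pow_left₀ (norm_nonneg _) (norm_sum_Icc_le (fun n => ?_) X) 2
    rw [norm_mul]
    exact mul_le_one₀ (hc n) (norm_nonneg _) (norm_coprimePart_steinhaus_le r θ n)
  have hint : ∀ {F : (Nat.Primes → UnitAddCircle) → ℝ} (_ : Measurable F) (B' : ℝ)
      (_ : ∀ θ, |F θ| ≤ B'), Integrable (fun θ => F θ * M θ) steinhausMeasure := by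
    intro F hF B' hB'
    refine integrable_real_of_measurable_of_bounded (hF.mul hMmeas) (B' * (X : ℝ) ^ 2) fun θ => ?_
    rw [abs_mul, abs_of_nonneg (hM0 θ)]
    exact mul_le_mul (hB' θ) (hMX θ) (hM0 θ) ((abs_nonneg _).trans (hB' θ))
  have hpB := fun θ => hp.abs_le (isMult_steinhaus θ) fun n => (norm_steinhaus θ n).le
  have hDB := fun θ => hD.abs_le (isMult_steinhaus θ) fun n => (norm_steinhaus θ n).le
  have hWB : ∀ θ, |W (steinhaus θ)| ≤ B + B := fun θ => by
    have e : W (steinhaus θ) = p (steinhaus θ) - (p (steinhaus θ) - W (steinhaus θ)) := by ring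
    rw [e]
    exact (abs_sub _ _).trans (add_le_add (hpB θ)
      ((hpW _).trans ((le_abs_self _).trans (hDB θ))))
  have h3 : |charAvg r (fun χ => p (fun n => χ (n : ZMod r)) *
        ‖∑ n ∈ Finset.Icc 1 X, c n * χ (n : ZMod r)‖ ^ 2) -
      charAvg r (fun χ => W (fun n => χ (n : ZMod r)) *
        ‖∑ n ∈ Finset.Icc 1 X, c n * χ (n : ZMod r)‖ ^ 2)| ≤
      charAvg r (fun χ => D (fun n => χ (n : ZMod r)) *
        ‖∑ n ∈ Finset.Icc 1 X, c n * χ (n : ZMod r)‖ ^ 2) := by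
    refine abs_charAvg_sub_le fun χ => ?_
    rw [← sub_mul, abs_mul, abs_of_nonneg (sq_nonneg ‖_‖)]
    exact mul_le_mul_of_nonneg_right (hpW _) (sq_nonneg _)
  have h4 : |∫ θ, p (steinhaus θ) * M θ ∂steinhausMeasure -
      ∫ θ, W (steinhaus θ) * M θ ∂steinhausMeasure| ≤
      ∫ θ, D (steinhaus θ) * M θ ∂steinhausMeasure := by
    rw [← integral_sub (hint hp.measurable B hpB) (hint hWm _ hWB)]
    refine abs_integral_le_integral_abs.trans (integral_mono_of_nonneg
      (Filter.Eventually.of_forall fun θ => abs_nonneg _) (hint hD.measurable B hDB)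
      (Filter.Eventually.of_forall fun θ => ?_))
    simp only
    rw [← sub_mul, abs_mul, abs_of_nonneg (hM0 θ)]
    exact mul_le_mul_of_nonneg_right (hpW _) (hM0 θ)
  rw [abs_le] at h1 h2 h3 h4 ⊢
  constructor <;> linarith [h1.1, h1.2, h2.1, h2.2, h3.1, h3.2, h4.1, h4.2]

/-! ### Restricting to integers with a large prime factor -/

lemma card_multiples_le {r : ℕ} (hr : r.Prime) (X : ℕ) :
    (((Finset.Icc 1 X).filter fun n => ¬ n.Coprime r).card : ℝ) ≤ X / r := by
  have hsub : (Finset.Icc 1 X).filter (fun n => ¬ n.Coprime r) ⊆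
      (Finset.Ioc 0 X).filter (fun n => r ∣ n) := by
    intro n hn
    simp only [Finset.mem_filter, Finset.mem_Icc, Finset.mem_Ioc] at hn ⊢
    refine ⟨⟨hn.1.1, hn.1.2⟩, ?_⟩
    by_contra h
    exact hn.2 ((Nat.coprime_comm.1 ((Nat.Prime.coprime_iff_not_dvd hr).2 h)))
  have h := Finset.card_le_card hsub
  rw [Nat.Ioc_filter_dvd_card_eq_div] at h
  exact (Nat.cast_le.2 h).trans Nat.cast_div_le

/-- In the Steinhaus model, discarding the multiples of `r` or the `Q`-smooth numbers changes the
weighted second moment by little. -/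
lemma abs_integral_sub_rough_le {r : ℕ} (hr : r.Prime) {W : (ℕ → ℂ) → ℝ} (hW : ∀ f, |W f| ≤ 1)
    (hWm : Measurable fun θ => W (steinhaus θ)) {c : ℕ → ℂ} (hc : ∀ n, ‖c n‖ ≤ 1) (X : ℕ) (Q : ℝ)
    {τ : ℝ} (hτ : 0 < τ) :
    |(∫ θ, W (steinhaus θ) * ‖∑ n ∈ Finset.Icc 1 X, c n * coprimePart r (steinhaus θ) n‖ ^ 2
        ∂steinhausMeasure) -
      ∫ θ, W (steinhaus θ) * ‖∑ n ∈ (Finset.Icc 1 X).filter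
        (fun n => Q < (maxPrimeDivisor n : ℝ)), c n * steinhaus θ n‖ ^ 2 ∂steinhausMeasure| ≤
      τ * X + (1 + τ⁻¹) * (X / r +
        ((Finset.Icc 1 X).filter (fun n => ¬ Q < (maxPrimeDivisor n : ℝ))).card) := by
  classical
  have h0 : (0 : ℕ) ∉ Finset.Icc 1 X := by simp
  set c₁ : ℕ → ℂ := fun n => if Q < (maxPrimeDivisor n : ℝ) then c n else 0 with hc₁
  set d : ℕ → ℂ := fun n => (if n.Coprime r then c n else 0) - c₁ n with hd
  set u : (Nat.Primes → UnitAddCircle) → ℂ := fun θ =>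
    ∑ n ∈ Finset.Icc 1 X, c₁ n * steinhaus θ n with hu
  set v : (Nat.Primes → UnitAddCircle) → ℂ := fun θ =>
    ∑ n ∈ Finset.Icc 1 X, d n * steinhaus θ n with hv
  have e1 : ∀ θ, ∑ n ∈ Finset.Icc 1 X, c n * coprimePart r (steinhaus θ) n = u θ + v θ := by
    intro θ
    rw [hu, hv]
    simp only
    rw [← Finset.sum_add_distrib]
    refine Finset.sum_congr rfl fun n _ => ?_
    rw [hd, coprimePart]
    simp only
    split_ifs <;> ring
  have e2 : ∀ θ, ∑ n ∈ (Finset.Icc 1 X).filter (fun n => Q < (maxPrimeDivisor n : ℝ)),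
      c n * steinhaus θ n = u θ := by
    intro θ
    rw [hu, Finset.sum_filter]
    refine Finset.sum_congr rfl fun n _ => ?_
    rw [hc₁]; simp only
    split_ifs <;> simp
  simp_rw [e1, e2]
  have hum : Measurable u := measurable_steinhaus_sum c₁ _
  have hvm : Measurable v := measurable_steinhaus_sum d _
  have hc₁1 : ∀ n, ‖c₁ n‖ ≤ 1 := fun n => by
    rw [hc₁]; simp only
    split_ifs
    exacts [hc n, by simp]
  have hbound : ∀ (a : ℕ → ℂ) θ, ‖∑ n ∈ Finset.Icc 1 X, a n * steinhaus θ n‖ ^ 2 ≤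
      (∑ n ∈ Finset.Icc 1 X, ‖a n‖) ^ 2 := fun a θ =>
    pow_le_pow_left₀ (norm_nonneg _) (norm_sum_le_of_le _ fun n _ => by
      rw [norm_mul, norm_steinhaus, mul_one]) 2
  have hiu : Integrable (fun θ => ‖u θ‖ ^ 2) steinhausMeasure :=
    integrable_real_of_measurable_of_bounded (hum.norm.pow_const 2) _ fun θ => by
      rw [abs_of_nonneg (sq_nonneg _)]; exact hbound c₁ θ
  have hiv : Integrable (fun θ => ‖v θ‖ ^ 2) steinhausMeasure :=
    integrable_real_of_measurable_of_bounded (hvm.norm.pow_const 2) _ fun θ => by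
      rw [abs_of_nonneg (sq_nonneg _)]; exact hbound d θ
  have hiuv : Integrable (fun θ => ‖u θ + v θ‖ ^ 2) steinhausMeasure := by
    have : ∀ θ, u θ + v θ = ∑ n ∈ Finset.Icc 1 X, (c₁ n + d n) * steinhaus θ n := fun θ => by
      rw [hu, hv]; simp only
      rw [← Finset.sum_add_distrib]
      exact Finset.sum_congr rfl fun n _ => by ring
    refine integrable_real_of_measurable_of_bounded ((hum.add hvm).norm.pow_const 2)
      ((∑ n ∈ Finset.Icc 1 X, ‖c₁ n + d n‖) ^ 2) fun θ => ?_
    rw [abs_of_nonneg (sq_nonneg _), this θ]; exact hbound _ θ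
  have hWae : ∀ᵐ θ ∂steinhausMeasure, ‖W (steinhaus θ)‖ ≤ 1 :=
    Filter.Eventually.of_forall fun θ => hW _
  rw [← integral_sub (hiuv.bdd_mul (c := 1) hWm.aestronglyMeasurable hWae)
    (hiu.bdd_mul (c := 1) hWm.aestronglyMeasurable hWae)]
  have hpt : ∀ θ, |W (steinhaus θ) * ‖u θ + v θ‖ ^ 2 - W (steinhaus θ) * ‖u θ‖ ^ 2| ≤
      τ * ‖u θ‖ ^ 2 + (1 + τ⁻¹) * ‖v θ‖ ^ 2 := by
    intro θ
    rw [← mul_sub, abs_mul]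
    exact (mul_le_of_le_one_left (abs_nonneg _) (hW _)).trans (abs_norm_add_sq_sub_le _ _ hτ)
  have hsum : Integrable (fun θ => τ * ‖u θ‖ ^ 2 + (1 + τ⁻¹) * ‖v θ‖ ^ 2) steinhausMeasure :=
    (hiu.const_mul τ).add (hiv.const_mul (1 + τ⁻¹))
  refine (abs_integral_le_integral_abs.trans (integral_mono_of_nonneg
    (Filter.Eventually.of_forall fun θ => abs_nonneg _) hsum
    (Filter.Eventually.of_forall hpt))).trans ?_
  rw [integral_add (hiu.const_mul τ) (hiv.const_mul (1 + τ⁻¹)), integral_const_mul,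
    integral_const_mul]
  have hU : ∫ θ, ‖u θ‖ ^ 2 ∂steinhausMeasure ≤ X := by
    rw [hu, integral_norm_sq_sum _ h0]
    refine (Finset.sum_le_card_nsmul _ _ 1 fun n _ => pow_le_one₀ (norm_nonneg _) (hc₁1 n)).trans ?_
    simp
  have hV : ∫ θ, ‖v θ‖ ^ 2 ∂steinhausMeasure ≤ X / r +
      ((Finset.Icc 1 X).filter (fun n => ¬ Q < (maxPrimeDivisor n : ℝ))).card := by
    rw [hv, integral_norm_sq_sum _ h0]
    refine le_trans (Finset.sum_le_sum (g := fun n => (if ¬ n.Coprime r then (1:ℝ) else 0) +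
      (if ¬ Q < (maxPrimeDivisor n : ℝ) then (1:ℝ) else 0)) fun n _ => ?_) ?_
    · have h1 : ‖c n‖ ^ 2 ≤ 1 := pow_le_one₀ (norm_nonneg _) (hc n)
      rw [hd, hc₁]; simp only
      split_ifs <;> simp_all
    · rw [Finset.sum_add_distrib, Finset.sum_boole, Finset.sum_boole]
      exact add_le_add_left (card_multiples_le hr X) _
  have hτ' : 0 ≤ 1 + τ⁻¹ := by positivity
  exact add_le_add (mul_le_mul_of_nonneg_left hU hτ.le) (mul_le_mul_of_nonneg_left hV hτ')

/-! ### Numerical estimates -/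

lemma IsPartition.measurable_weightG {N Y : ℕ} {δ : ℝ} {g gTail : ℝ → ℝ}
    (h : IsPartition N δ g gTail) (P : ℝ) (j : Fin Y → ℤ) (a : Fin Y → ℕ → ℂ) :
    Measurable fun θ => weightG N g gTail P j a (steinhaus θ) :=
  Finset.measurable_prod _ fun i _ =>
    (h.contDiff_partFn (j i)).continuous.measurable.comp (measurable_primeSum_steinhaus P (a i))

lemma IsPartition.abs_weightG_le_one {N Y : ℕ} {δ : ℝ} {g gTail : ℝ → ℝ}
    (h : IsPartition N δ g gTail) (P : ℝ) {j : Fin Y → ℤ}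
    (hj : ∀ i, -(N : ℤ) ≤ j i ∧ j i ≤ (N : ℤ) + 1) (a : Fin Y → ℕ → ℂ) (f : ℕ → ℂ) :
    |weightG N g gTail P j a f| ≤ 1 := by
  rw [weightG, Finset.abs_prod]
  refine Finset.prod_le_one (fun _ _ => abs_nonneg _) fun i _ => ?_
  rw [abs_of_nonneg (h.partFn_nonneg _ _)]
  exact h.partFn_le_one (hj i) _

/-- Consequences of the growth condition on `Z = max(P, δ⁻¹, N)`. The number `3.5·10⁶ = 400·8750`
is a bound for `7 L Y / ((Y/δ)² ℓ)`. -/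
lemma growth_bounds {Z δ l ε κ : ℝ} {r Y L : ℕ} (hr : 2 ≤ r) (hδ1 : 8 ≤ δ⁻¹)
    (hZ : Real.exp 8 ≤ Z) (hl : 8 ≤ l) (hY : 1 ≤ Y) (hL : (L : ℝ) ≤ 500000 * (Y * l * δ⁻¹ ^ 2))
    (hκ : κ ≤ 1) (hε : ε ≤ κ / 35000) (h : Z ^ (400 * ((Y : ℝ) / δ) ^ 2 * l) ≤ (r : ℝ) ^ ε) :
    Z ^ (7 * L * Y) ≤ (r : ℝ) ^ (κ / 4) ∧ Real.exp (40 * (Y * l)) ≤ (r : ℝ) ^ (κ / 4) ∧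
      Real.exp (40 * (Y * l)) ≤ r ∧ Z < r := by
  have hr1 : (2 : ℝ) ≤ r := by exact_mod_cast hr
  have hr0 : (0 : ℝ) < r := by linarith
  have hZ0 : 0 < Z := (Real.exp_pos _).trans_le hZ
  have hY1 : (1 : ℝ) ≤ Y := by exact_mod_cast hY
  set R := Real.log r with hR
  have hR0 : 0 < R := Real.log_pos (by linarith)
  set z := Real.log Z with hz
  have hz8 : 8 ≤ z := (Real.le_log_iff_exp_le hZ0).2 hZ
  set q : ℝ := Y * (Y * l * δ⁻¹ ^ 2) with hq
  have hq' : 400 * ((Y : ℝ) / δ) ^ 2 * l = 400 * q := by rw [hq, div_eq_mul_inv]; ring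
  rw [hq'] at h
  have h1 : 400 * q * z ≤ ε * R := by
    have := Real.log_le_log (by positivity) h
    rwa [Real.log_rpow hZ0, Real.log_rpow hr0] at this
  have hYl : 8 ≤ Y * l := by nlinarith
  have hd : (64 : ℝ) ≤ δ⁻¹ ^ 2 := by nlinarith
  have hYld : 64 * (Y * l) ≤ Y * l * δ⁻¹ ^ 2 := by nlinarith
  have hqYl : Y * l * δ⁻¹ ^ 2 ≤ q := le_mul_of_one_le_left (by linarith) hY1
  have hq0 : 0 < q := by linarith
  have hqz : 8 * q ≤ q * z := by nlinarith
  have hεR : ε * R ≤ κ / 35000 * R := mul_le_mul_of_nonneg_right hε hR0.le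
  have hκR : κ * R ≤ R := mul_le_of_le_one_left hR0.le hκ
  have e1 : ∀ t : ℝ, (r : ℝ) ^ t = Real.exp (t * R) := fun t => by
    rw [Real.rpow_def_of_pos hr0, mul_comm]
  refine ⟨?_, ?_, ?_, ?_⟩
  · rw [e1, ← Real.exp_log hZ0, ← Real.exp_nat_mul, ← hz]
    refine Real.exp_le_exp.2 ?_
    push_cast
    have h2 : (L : ℝ) * Y * z ≤ 500000 * (q * z) := by
      have : (L : ℝ) * Y ≤ 500000 * q := by
        rw [hq]; nlinarith
      nlinarith
    linarith
  · rw [e1]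
    exact Real.exp_le_exp.2 (by linarith)
  · rw [← Real.exp_log hr0]
    exact Real.exp_le_exp.2 (by linarith)
  · rw [← Real.exp_log hr0, ← Real.exp_log hZ0]
    refine Real.exp_lt_exp.2 ?_
    have : z * 1 < z * (400 * q) := mul_lt_mul_of_pos_left (by linarith) (by linarith)
    have e : z * (400 * q) = 400 * q * z := by ring
    change z < R
    linarith

/-- Rankin's bound for the integers up to `x` without prime factor above `exp((log x)^{1/3})`. -/
lemma card_smooth_le_exp {x Q : ℝ} (hx : Real.exp 8 ≤ x) (hQ : 1 ≤ Q)
    (hQx : Q ≤ Real.exp ((Real.log x) ^ (1 / 3 : ℝ))) :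
    (((Finset.Icc 1 ⌊x⌋₊).filter (fun n => ¬ Q < (maxPrimeDivisor n : ℝ))).card : ℝ) ≤
      x * (Real.exp 900 * Real.exp (-(Real.log x) ^ (1 / 2 : ℝ))) := by
  have hx0 : 0 < x := (Real.exp_pos _).trans_le hx
  set u := Real.log x with hu
  have hu8 : 8 ≤ u := (Real.le_log_iff_exp_le hx0).2 hx
  have hu0 : 0 < u := by linarith
  -- in terms of the sixth root of `log x` every exponent is a polynomial
  set y := u ^ (1 / 6 : ℝ) with hy
  have hy0 : 0 < y := Real.rpow_pos_of_pos hu0 _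
  have hpow : ∀ k : ℕ, y ^ k = u ^ ((k : ℝ) / 6) := fun k => by
    rw [hy, ← Real.rpow_natCast, ← Real.rpow_mul hu0.le]; congr 1; ring
  have h3 : u ^ (1 / 3 : ℝ) = y ^ 2 := by rw [hpow]; norm_num
  have h2 : u ^ (1 / 2 : ℝ) = y ^ 3 := by rw [hpow]; norm_num
  have h6 : y ^ 6 = u := by rw [hpow]; norm_num
  have hy2 : 2 ≤ y ^ 2 := by
    by_contra hlt
    push Not at hlt
    have : y ^ 6 < 2 ^ 3 := by
      have e : y ^ 6 = (y ^ 2) ^ 3 := by ring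
      rw [e]; exact pow_lt_pow_left₀ hlt (by positivity) (by norm_num)
    linarith
  set α : ℝ := (y ^ 2)⁻¹ with hα
  have hα0 : 0 < α := by positivity
  have hα2 : α ≤ 1 / 2 := by
    rw [hα, ← one_div]; exact one_div_le_one_div_of_le (by norm_num) hy2
  have hQα : Q ^ α ≤ 3 := by
    calc Q ^ α ≤ (Real.exp (u ^ (1 / 3 : ℝ))) ^ α :=
          Real.rpow_le_rpow (by linarith) hQx hα0.le
      _ = Real.exp 1 := by
          rw [← Real.exp_mul, h3, hα, mul_inv_cancel₀ (by positivity)]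
      _ ≤ 3 := Real.exp_one_lt_three.le
  have hph : primeHarmonic Q ≤ 8 + 8 * y := by
    refine (primeHarmonic_mono hQx).trans ((primeHarmonic_le ?_).trans ?_)
    · rw [h3]; linarith [Real.add_one_le_exp (y ^ 2)]
    · rw [Real.log_exp, h3, Real.log_pow]
      push_cast
      linarith [Real.log_le_sub_one_of_pos hy0]
  refine (card_smooth_le hQ hα0.le hα2 hQα _).trans ?_
  have hX : ((⌊x⌋₊ : ℕ) : ℝ) ^ (1 - α) ≤ x * Real.exp (-y ^ 4) := by
    refine (Real.rpow_le_rpow (Nat.cast_nonneg _) (Nat.floor_le hx0.le) (by linarith)).trans_eq ?_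
    rw [Real.rpow_sub hx0, Real.rpow_one, div_eq_mul_inv, ← Real.rpow_neg hx0.le,
      Real.rpow_def_of_pos hx0, ← hu, ← h6, hα]
    congr 2
    field_simp
  refine (mul_le_mul hX (Real.exp_le_exp.2 (mul_le_mul_of_nonneg_left hph (by norm_num)))
    (Real.exp_pos _).le (by positivity)).trans ?_
  rw [mul_assoc, ← Real.exp_add, ← Real.exp_add, h2]
  refine mul_le_mul_of_nonneg_left (Real.exp_le_exp.2 ?_) hx0.le
  -- `12 (8 + 8 y) - y⁴ ≤ 900 - y³`
  nlinarith [sq_nonneg (y ^ 2 - y / 2 - 10), sq_nonneg (y - 3)]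

/-- The contribution of the approximation error of the weight. -/
lemma IsTrigPoly.integral_mul_coprime_norm_sq_le {P H B l : ℝ} {D : (ℕ → ℂ) → ℝ}
    (hD : IsTrigPoly P H B D) {Y : ℕ} (hY : 1 ≤ Y) (hl : 8 ≤ l) (hP : Real.exp 8 ≤ P)
    (hPl : primeHarmonic P ≤ 5 * l) (hlogP : Real.log P ≤ Real.exp l)
    (hD2 : ∫ θ, D (steinhaus θ) ^ 2 ∂steinhausMeasure ≤ Real.exp (-(199994 * (Y * l))))
    {c : ℕ → ℂ} (hc : ∀ n, ‖c n‖ ≤ 1) (r X : ℕ) :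
    ∫ θ, D (steinhaus θ) * ‖∑ n ∈ Finset.Icc 1 X, c n * coprimePart r (steinhaus θ) n‖ ^ 2
      ∂steinhausMeasure ≤ X * Real.exp (-(10 * (Y * l))) := by
  have hY1 : (1 : ℝ) ≤ Y := by exact_mod_cast hY
  have hYl : l ≤ Y * l := le_mul_of_one_le_left (by linarith) hY1
  have hP0 : 0 < P := (Real.exp_pos _).trans_le hP
  have hlog : 8 ≤ Real.log P := (Real.le_log_iff_exp_le hP0).2 hP
  have hP1 : 1 ≤ P := le_trans (Real.one_le_exp (by norm_num)) hP
  have hPα : P ^ (Real.log P)⁻¹ ≤ 3 := by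
    rw [Real.rpow_def_of_pos hP0, mul_inv_cancel₀ (by linarith)]
    exact Real.exp_one_lt_three.le
  have hα : (Real.log P)⁻¹ ≤ 1 / 2 := by
    rw [← one_div]; exact one_div_le_one_div_of_le (by norm_num) (by linarith)
  have e : ∀ θ, ∑ n ∈ Finset.Icc 1 X, c n * coprimePart r (steinhaus θ) n =
      ∑ n ∈ Finset.Icc 1 X, (c n * (if n.Coprime r then 1 else 0)) * steinhaus θ n := fun θ =>
    Finset.sum_congr rfl fun n _ => by rw [coprimePart_eq_mul]; ring
  simp_rw [e]
  -- `η = exp (10⁵ Y l)` balances the two terms, as `𝔼 D²` is about `η⁻²`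
  refine (hD.integral_mul_norm_sq_le hP1 (inv_pos.2 (by linarith)) hα hPα (fun n => ?_) X
    (Real.exp_pos (100000 * (Y * l)))).trans ?_
  · split_ifs
    · simpa using hc n
    · simp
  rw [div_inv_eq_mul, mul_assoc]
  refine mul_le_mul_of_nonneg_left ?_ (Nat.cast_nonneg _)
  have h1 : Real.exp (100000 * (Y * l)) * ∫ θ, D (steinhaus θ) ^ 2 ∂steinhausMeasure ≤
      Real.exp (-(90000 * (Y * l))) := by
    refine (mul_le_mul_of_nonneg_left hD2 (Real.exp_pos _).le).trans ?_
    rw [← Real.exp_add]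
    exact Real.exp_le_exp.2 (by linarith)
  have h2 : (Real.exp (100000 * (Y * l)))⁻¹ * Real.exp (12 * primeHarmonic P) ^ 4 ≤
      Real.exp (-(90000 * (Y * l))) := by
    rw [← Real.exp_neg, ← Real.exp_nat_mul, ← Real.exp_add]
    refine Real.exp_le_exp.2 ?_
    push_cast
    linarith
  have h3 : (2 : ℝ) ≤ Real.exp l := by linarith [Real.add_one_le_exp l]
  calc Real.log P * (Real.exp (100000 * (Y * l)) * (∫ θ, D (steinhaus θ) ^ 2 ∂steinhausMeasure) +
        (Real.exp (100000 * (Y * l)))⁻¹ * Real.exp (12 * primeHarmonic P) ^ 4)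
      ≤ Real.log P * (2 * Real.exp (-(90000 * (Y * l)))) :=
        mul_le_mul_of_nonneg_left (by linarith) (by linarith)
    _ ≤ Real.exp l * (Real.exp l * Real.exp (-(90000 * (Y * l)))) := by gcongr
    _ = Real.exp (l + (l + -(90000 * (Y * l)))) := by rw [Real.exp_add, Real.exp_add]
    _ ≤ Real.exp (-(10 * (Y * l))) := Real.exp_le_exp.2 (by linarith)

lemma transfer_error_le {x B C κ T : ℝ} {r X : ℕ} (hx : 1 ≤ x) (hXx : (X : ℝ) ≤ x) (hC : 0 < C)
    (hκ : 0 < κ) (hr : (1 : ℝ) ≤ r) (hB0 : 0 ≤ B) (hB : B ≤ (r : ℝ) ^ (κ / 4))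
    (hT : ((r : ℝ) ^ (κ / 4))⁻¹ ≤ T) :
    B * (C * ((X : ℝ) + 1) * (r : ℝ) ^ (-κ)) ≤ 2 * C * (x * T) := by
  have hr0 : (0 : ℝ) < r := by linarith
  have h1 : B * (r : ℝ) ^ (-κ) ≤ T := by
    calc B * (r : ℝ) ^ (-κ) ≤ (r : ℝ) ^ (κ / 4) * (r : ℝ) ^ (-κ) := by gcongr
      _ = (r : ℝ) ^ (-(3 * κ / 4)) := by rw [← Real.rpow_add hr0]; congr 1; ring
      _ ≤ (r : ℝ) ^ (-(κ / 4)) := Real.rpow_le_rpow_of_exponent_le hr (by linarith)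
      _ ≤ T := by rwa [Real.rpow_neg hr0.le]
  have hT0 : 0 ≤ T := le_trans (by positivity) hT
  calc B * (C * ((X : ℝ) + 1) * (r : ℝ) ^ (-κ)) = C * (X + 1) * (B * (r : ℝ) ^ (-κ)) := by ring
    _ ≤ C * (x + x) * T := by gcongr
    _ = 2 * C * (x * T) := by ring

lemma rough_error_le {x l S M : ℝ} {r X : ℕ} (hx : 0 ≤ x) (hl : 0 ≤ l) (hXx : (X : ℝ) ≤ x)
    (hr : Real.exp (20 * l) ≤ r) (hS : S ≤ x * (Real.exp M * Real.exp (-(20 * l)))) :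
    Real.exp (-(10 * l)) * X + (1 + (Real.exp (-(10 * l)))⁻¹) * (X / r + S) ≤
      (3 + 2 * Real.exp M) * (x * Real.exp (-(10 * l))) := by
  have h1 : 1 + (Real.exp (-(10 * l)))⁻¹ ≤ 2 * Real.exp (10 * l) := by
    rw [Real.exp_neg, inv_inv]; linarith [Real.one_le_exp (by linarith : 0 ≤ 10 * l)]
  have h20 : Real.exp (10 * l) * Real.exp (-(20 * l)) = Real.exp (-(10 * l)) := by
    rw [← Real.exp_add]; congr 1; ring
  have h2 : (X : ℝ) / r ≤ x * Real.exp (-(20 * l)) := by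
    rw [div_eq_mul_inv, Real.exp_neg]
    exact mul_le_mul hXx (inv_anti₀ (Real.exp_pos _) hr) (by positivity) hx
  have h3 : (1 + (Real.exp (-(10 * l)))⁻¹) * (X / r + S) ≤ 2 * Real.exp (10 * l) *
      (x * Real.exp (-(20 * l)) + x * (Real.exp M * Real.exp (-(20 * l)))) := by
    refine (mul_le_mul_of_nonneg_left (add_le_add h2 hS) (by positivity)).trans ?_
    exact mul_le_mul_of_nonneg_right h1 (by positivity)
  have h4 : 2 * Real.exp (10 * l) * (x * Real.exp (-(20 * l)) +
      x * (Real.exp M * Real.exp (-(20 * l)))) =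
      2 * x * (1 + Real.exp M) * Real.exp (-(10 * l)) := by rw [← h20]; ring
  have h5 : Real.exp (-(10 * l)) * X ≤ Real.exp (-(10 * l)) * x :=
    mul_le_mul_of_nonneg_left hXx (Real.exp_pos _).le
  linarith

end TwistedRatios

end

theorem proposition2p8
    (hGRH : ∀ (r : ℕ) [Fact r.Prime], TwistedRatios.GRH r)
    (hRatios : TwistedRatios.TwistedRatiosConjecture) :
    ∃ K : ℝ, 0 < K ∧
    ∀ A : ℝ, 0 < A →
    ∃ ε₀ : ℝ, 0 < ε₀ ∧ ∃ C : ℝ, 0 < C ∧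
    ∀ ε : ℝ, 0 < ε → ε ≤ ε₀ →
    ∀ (r : ℕ) [Fact r.Prime] (x P δ Q : ℝ) (N Y : ℕ),
      K ≤ x → K ≤ P → K ≤ N → 0 < δ → K ≤ δ⁻¹ → 1 ≤ Y →
      x ≤ (r : ℝ) ^ A →
      1 ≤ Q → Q ≤ Real.exp ((Real.log x) ^ (1 / 3 : ℝ)) →
      (max P (max δ⁻¹ (N : ℝ))) ^ (400 * ((Y : ℝ) / δ) ^ 2 * Real.log (N * Real.log P))
        ≤ (r : ℝ) ^ ε →
      20 * (Y : ℝ) * Real.log (N * Real.log P) ≤ (Real.log x) ^ (1 / 2 : ℝ) →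
    ∀ c : ℕ → ℤ,
      (c = fun n => ArithmeticFunction.moebius n) ∨
        (c = fun n => ArithmeticFunction.liouville n) →
    ∀ g gTail : ℝ → ℝ, TwistedRatios.IsPartition N δ g gTail →
    ∀ j : Fin Y → ℤ, (∀ i, -(N : ℤ) ≤ j i ∧ j i ≤ (N : ℤ) + 1) →
    ∀ a : Fin Y → ℕ → ℂ,
      (∀ i, ∀ p : ℕ, p.Prime → ‖a i p‖ ≤ 1 ∧ ‖a i (p ^ 2)‖ ≤ 1) →
      |TwistedRatios.charAvg r (fun χ =>
            TwistedRatios.weightG N g gTail P j a (fun n => χ (n : ZMod r)) *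
              ‖TwistedRatios.partialSum c (fun n => χ (n : ZMod r)) x‖ ^ 2)
          - ∫ θ, TwistedRatios.weightG N g gTail P j a (TwistedRatios.steinhaus θ) *
              ‖TwistedRatios.roughPartialSum c (TwistedRatios.steinhaus θ) x Q‖ ^ 2
            ∂TwistedRatios.steinhausMeasure|
        ≤ C * (x / ((N : ℝ) * Real.log P) ^ (10 * Y)) := by
  -- `K = e⁸` makes `log (N log P)` exceed the absolute constants in the bounds for `∑ 1 / p`
  refine ⟨Real.exp 8, Real.exp_pos 8, fun A hA => ?_⟩
  obtain ⟨κ, C, hκ, hκ2, hC, hbound⟩ := TwistedRatios.exists_twisted_second_moment_bound hGRH hRatios hA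
  -- `ε₀` is such that `Z^{7LY} ≤ r^{8750 ε} ≤ r^{κ/4}`, which leaves room in the saving `r^{-κ}`
  refine ⟨κ / 35000, by positivity, 4 * C + 5 + 2 * Real.exp 900, by positivity, ?_⟩
  intro ε hε hεκ r hrp x P δ Q N Y hx hP hN hδ hδK hY hxA hQ hQx hZr hYx c hc g gTail hpart j hj a ha
  have hr : r.Prime := hrp.out
  have h9 : (9 : ℝ) ≤ Real.exp 8 := by linarith [Real.add_one_le_exp (8 : ℝ)]
  have hY1 : (1 : ℝ) ≤ Y := by exact_mod_cast hY
  have hx0 : 0 < x := by linarith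
  have hP0 : 0 < P := by linarith
  have hN0 : (0 : ℝ) < N := by linarith
  have hN1 : 1 ≤ N := by exact_mod_cast (by linarith : (1 : ℝ) ≤ N)
  have hlogP : 8 ≤ Real.log P := (Real.le_log_iff_exp_le hP0).2 hP
  have hlogN : 8 ≤ Real.log N := (Real.le_log_iff_exp_le hN0).2 hN
  set l := Real.log (N * Real.log P) with hl
  have hlsum : l = Real.log N + Real.log (Real.log P) := Real.log_mul hN0.ne' (by linarith)
  have hloglog : 0 ≤ Real.log (Real.log P) := Real.log_nonneg (by linarith)
  have hl8 : 8 ≤ l := by linarith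
  have hexpl : Real.exp l = N * Real.log P := Real.exp_log (mul_pos hN0 (by linarith))
  have hlogPl : Real.log P ≤ Real.exp l := by
    rw [hexpl]; exact le_mul_of_one_le_left (by linarith) (by linarith)
  have hPl : TwistedRatios.primeHarmonic P ≤ 5 * l := (TwistedRatios.primeHarmonic_le (by linarith)).trans (by linarith)
  set Z := max P (max δ⁻¹ (N : ℝ)) with hZ
  have hPZ : P ≤ Z := le_max_left _ _
  have hδZ : δ⁻¹ ≤ Z := (le_max_left _ _).trans (le_max_right _ _)
  have hNZ : (N : ℝ) ≤ Z := (le_max_right _ _).trans (le_max_right _ _)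
  set b : ℝ := Y * l * δ⁻¹ ^ 2 with hb
  have hYl : 8 ≤ Y * l := by nlinarith
  have hb1 : 1 ≤ b := by
    have : (1 : ℝ) ≤ δ⁻¹ ^ 2 := one_le_pow₀ (by linarith)
    rw [hb]; nlinarith
  -- an even degree, so that the Taylor remainders are polynomials rather than powers of `|S|`
  set L : ℕ := 2 * ⌈200000 * b⌉₊ with hL
  have hLlow : 400000 * b ≤ L := by
    have := Nat.le_ceil (200000 * b)
    rw [hL]; push_cast; linarith
  have hLup : (L : ℝ) ≤ 500000 * b := by
    have := Nat.ceil_lt_add_one (by linarith : 0 ≤ 200000 * b)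
    rw [hL]; push_cast; linarith
  obtain ⟨hZκ, hYκ, hYr, hZltr⟩ := TwistedRatios.growth_bounds hr.two_le (by linarith : 8 ≤ δ⁻¹)
    (hP.trans hPZ) hl8 hY hLup (by linarith) hεκ hZr
  -- for `r = 2` the growth condition has no solutions
  have hr2 : r ≠ 2 := by
    rintro rfl
    have : P ≤ ((2 : ℕ) : ℝ) := hPZ.trans hZltr.le
    push_cast at this
    linarith
  have hr0 : (0 : ℝ) < r := by exact_mod_cast hr.pos
  have hr1 : (1 : ℝ) ≤ r := by exact_mod_cast hr.one_le
  set X := ⌊x⌋₊ with hX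
  have hXx : (X : ℝ) ≤ x := Nat.floor_le hx0.le
  have hc1 := TwistedRatios.norm_coefficient_le_one hc
  obtain ⟨p, D, hp, hD, hpW, hD2⟩ := TwistedRatios.exists_trigPoly_approx hpart hδ (by linarith) hPZ hδZ hNZ hl8 hPl
    hN1 (by linarith) (by linarith) hY ⟨_, two_mul _⟩ hLlow hj ha
  have hH : Z ^ (2 * L * Y) ≤ (r : ℝ) ^ κ := by
    refine le_trans (pow_le_pow_right₀ (by linarith) (by gcongr; norm_num)) (hZκ.trans ?_)
    exact Real.rpow_le_rpow_of_exponent_le hr1 (by linarith)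
  have hmain := TwistedRatios.abs_charAvg_weight_sub_le hp hD hpW (hpart.measurable_weightG P j a)
    (hPZ.trans_lt hZltr) hH (c := fun n => (c n : ℂ)) hc1 (X := X)
    (E := C * ((X : ℝ) + 1) * (r : ℝ) ^ (-κ)) (by positivity)
    fun m₁ m₂ h₁ h₁' h₂ h₂' => hbound r hr2 c hc m₁ m₂ h₁ h₁' h₂ h₂' X (hXx.trans hxA)
  have hDint := hD.integral_mul_coprime_norm_sq_le hY hl8 hP hPl hlogPl hD2
    (c := fun n => (c n : ℂ)) hc1 r X
  have hrough := TwistedRatios.abs_integral_sub_rough_le hr (hpart.abs_weightG_le_one P hj a)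
    (hpart.measurable_weightG P j a) (c := fun n => (c n : ℂ)) hc1 X Q
    (Real.exp_pos (-(10 * (Y * l))))
  have hsmooth := TwistedRatios.card_smooth_le_exp hx hQ hQx
  set T := Real.exp (-(10 * (Y * l))) with hT
  have hT0 : 0 < T := Real.exp_pos _
  have hT40 : Real.exp (-(40 * (Y * l))) ≤ T := Real.exp_le_exp.2 (by linarith)
  have hgoal : x / ((N : ℝ) * Real.log P) ^ (10 * Y) = x * T := by
    rw [hT, Real.exp_neg, div_eq_mul_inv, ← hexpl, ← Real.exp_nat_mul]
    push_cast
    ring_nf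
  rw [hgoal]
  -- the error from the twisted second moments
  have hE := TwistedRatios.transfer_error_le (by linarith) hXx hC hκ hr1
    (pow_nonneg (by linarith) _) hZκ
    (T := T) ((inv_anti₀ (Real.exp_pos _) hYκ).trans ((Real.exp_neg _).symm.trans_le hT40))
  -- the error from the multiples of `r` and the smooth numbers
  have hR := TwistedRatios.rough_error_le (l := Y * l) hx0.le (by linarith) hXx
    (hYr.trans' (Real.exp_le_exp.2 (by linarith))) (hsmooth.trans (mul_le_mul_of_nonneg_left
      (mul_le_mul_of_nonneg_left (Real.exp_le_exp.2 (by linarith)) (Real.exp_pos _).le) hx0.le))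
  have hDx : (X : ℝ) * T ≤ x * T := mul_le_mul_of_nonneg_right hXx hT0.le
  refine (abs_sub_le _ _ _).trans ((add_le_add hmain hrough).trans ?_)
  linarith
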